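/- Let $n\ge 2$ and let $(f_1,f_2)$ be a complete intersection at $0\in\mathbb C^n$: $f_1,f_2$ are holomorphic near $0$, $f_1(0)=f_2(0)=0$, and $\{f_1=f_2=0\}$ has dimension $n-2$ at $0$. Write $z=(z_1,z')$, $z'=(z_2,z'')$. Call the coordinates adapted to $(f_1,f_2)$ if $f_1$ and $f_2$ have Weierstrass polynomials $P_1^{f_1},P_1^{f_2}$ with respect to $z_1$ (that is, near $0$ each $f_i$ is a nowhere vanishing holomorphic function times a monic polynomial in $z_1$ whose other coefficients are holomorphic in $z'$ and vanish at $z'=0$), and if their resultant in $z_1$, $R_1(z')$, has a Weierstrass polynomial $P_2^{R_1}$ with respect to $z_2$. Let $N_1=\deg P_1^{f_1}$ and $N_2=\deg P_2^{R_1}$. For a form $\phi=\sum_J\phi_J\,dz_1\wedge\dots\wedge dz_n\wedge d\bar z_J$ put $\bar\partial_l\phi=\sum_J\frac{\partial\phi_J}{\partial\bar z_l}\,dz_1\wedge\dots\wedge dz_n\wedge d\bar z_J$. (i) There is a linear change of coordinates of $\mathbb C^n$ after which the coordinates are adapted to $(f_1,f_2)$. (ii) Suppose that the coordinates are adapted to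 $(f_1,f_2)$. Then there is a holomorphic matrix $A=\begin{pmatrix}1&0\\a_1&a_2\end{pmatrix}$ near $0$ with $A\binom{f_1}{f_2}=\binom{f_1}{R_1}$. Moreover there is an open neighbourhood $U$ of $0$ such that the following holds. (a) For every integer $\Gamma\ge1$, the integral $$\langle X_1^\Gamma,\phi\rangle=\int_{\mathbb C^n}\frac{(\overline{P_1^{f_1}})^\Gamma}{f_1}\,\bar\partial_1^{\Gamma N_1}\phi$$ over $(n,n)$ test forms $\phi$ on $U$ converges absolutely and defines a current on $U$, and $f_1X_1^\Gamma=(-1)^{\Gamma N_1}(\Gamma N_1)!$. (b) For every integer $\Gamma\ge N_2+1$, the integral $$\langle X_2^\Gamma,\phi\rangle=\int_{\mathbb C^n}\frac{\overline{P_2^{R_1}}}{R_1}\,\bar\partial_2^{N_2}\Big(\frac{\bar\partial(\overline{P_1^{f_1}})^\Gamma}{f_1}\wedge\bar\partial_1^{\Gamma N_1}\phi\Big)$$ over $(n,n-1)$ test forms $\phi$ on $U$ converges absolutely and defines a current on $U$, and $$R_1X_2^\Gamma=(-1)^{N_2}N_2!\,\bar\partial X_1^\Gamma,\qquad f_1X_2^\Gamma=0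 .$$ (c) For every $\Gamma\ge N_2+1$, every $2\times2$ matrix $A$ of holomorphic functions near $0$ with $A\binom{f_1}{f_2}=\binom{f_1}{R_1}$, and every $g$ holomorphic near $0$: $g$ belongs to the ideal generated by $f_1,f_2$ in the ring of germs of holomorphic functions at $0$ if and only if the current $g\,\det(A)\,\bar\partial X_2^\Gamma$ vanishes in a neighbourhood of $0$. -/

import Mathlib

open scoped Topology ContDiff ComplexConjugate

noncomputable section

namespace ResidueCurrents

/-! ### Germs at the origin of `ℂⁿ` -/

/-- `g` belongs to the ideal generated by `f₁, f₂` in the ring of germs at `0` of holomorphic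
functions on `ℂⁿ`. -/
def MemLocalIdeal {n : ℕ} (f₁ f₂ g : (Fin n → ℂ) → ℂ) : Prop :=
  ∃ h₁ h₂ : (Fin n → ℂ) → ℂ, AnalyticAt ℂ h₁ 0 ∧ AnalyticAt ℂ h₂ 0 ∧
    ∀ᶠ z in 𝓝 0, g z = h₁ z * f₁ z + h₂ z * f₂ z

/-- The analytic set `Z` has dimension `d` at `a`: `d` is the largest integer `e` such that every
neighbourhood of `a` contains an immersed `e`-dimensional complex manifold lying in `Z`. -/
def HasLocalDim {n : ℕ} (Z : Set (Fin n → ℂ)) (a : Fin n → ℂ) (d : ℕ) : Prop :=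
  IsGreatest {e : ℕ | ∀ U ∈ 𝓝 a, ∃ (W : Set (Fin e → ℂ)) (ψ : (Fin e → ℂ) → (Fin n → ℂ)),
    IsOpen W ∧ W.Nonempty ∧ DifferentiableOn ℂ ψ W ∧
    (∀ w ∈ W, Function.Injective (fderiv ℂ ψ w)) ∧ Set.MapsTo ψ W (Z ∩ U)} d

/-- `(f₁, f₂)` is a complete intersection at `0` in `ℂ^(m+2)`: both functions are holomorphic near
`0`, vanish at `0`, and their common zero set has codimension `2` at `0`. -/
structure IsCompleteIntersection {m : ℕ} (f₁ f₂ : (Fin (m + 2) → ℂ) → ℂ) : Prop where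
  analytic₁ : AnalyticAt ℂ f₁ 0
  analytic₂ : AnalyticAt ℂ f₂ 0
  zero₁ : f₁ 0 = 0
  zero₂ : f₂ 0 = 0
  dim : HasLocalDim {z | f₁ z = 0 ∧ f₂ z = 0} 0 m

/-! ### Weierstrass polynomials -/

/-- The value at `z = (z₁, z')` of a family of polynomials in `z₁` depending on `z'`. -/
def evalFamily {k : ℕ} (P : (Fin k → ℂ) → Polynomial ℂ) (z : Fin (k + 1) → ℂ) : ℂ :=
  (P (Fin.tail z)).eval (z 0)

/-- `P` is a Weierstrass polynomial of degree `N` in the first variable: it is monic of degree `N`,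
its coefficients are holomorphic functions of the other variables near `0`, and the non-leading
ones vanish at `0`. -/
structure IsWeierstrassPoly {k : ℕ} (P : (Fin k → ℂ) → Polynomial ℂ) (N : ℕ) : Prop where
  monic : ∀ w, (P w).Monic
  natDegree : ∀ w, (P w).natDegree = N
  analytic : ∀ i, AnalyticAt ℂ (fun w => (P w).coeff i) 0
  at_zero : P 0 = Polynomial.X ^ N

/-- `P` is the Weierstrass polynomial, of degree `N`, of `f` with respect to the first variable:
`f` is the product of `P` and of a holomorphic unit near `0`. -/
def IsWeierstrassPolyOf {k : ℕ} (f : (Fin (k + 1) → ℂ) → ℂ) (P : (Fin k → ℂ) → Polynomial ℂ)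
    (N : ℕ) : Prop :=
  IsWeierstrassPoly P N ∧ ∃ u : (Fin (k + 1) → ℂ) → ℂ, AnalyticAt ℂ u 0 ∧ u 0 ≠ 0 ∧
    ∀ᶠ z in 𝓝 0, f z = u z * evalFamily P z

/-- The resultant of two families of polynomials in `z₁`, a function of `z' = (z₂, …, zₙ)`. -/
def res {k : ℕ} (P₁ P₂ : (Fin k → ℂ) → Polynomial ℂ) (w : Fin k → ℂ) : ℂ :=
  Polynomial.resultant (P₁ w) (P₂ w)

/-- The resultant, as a function of `z = (z₁, z')` that does not depend on `z₁`. -/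
def resLift {k : ℕ} (P₁ P₂ : (Fin k → ℂ) → Polynomial ℂ) (z : Fin (k + 1) → ℂ) : ℂ :=
  res P₁ P₂ (Fin.tail z)

/-- The coordinates are adapted to `(f₁, f₂)`: `P₁` and `P₂` are the Weierstrass polynomials of
`f₁` and `f₂` with respect to `z₁`, and `Q` is the Weierstrass polynomial with respect to `z₂` of
the resultant of `P₁` and `P₂`; their degrees are `N₁`, `M` and `N₂`. -/
structure IsAdapted {m : ℕ} (f₁ f₂ : (Fin (m + 2) → ℂ) → ℂ)
    (P₁ P₂ : (Fin (m + 1) → ℂ) → Polynomial ℂ) (Q : (Fin m → ℂ) → Polynomial ℂ)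
    (N₁ M N₂ : ℕ) : Prop where
  first : IsWeierstrassPolyOf f₁ P₁ N₁
  second : IsWeierstrassPolyOf f₂ P₂ M
  resultant : IsWeierstrassPolyOf (res P₁ P₂) Q N₂

/-- `A` is a holomorphic transition matrix from `(f₁, f₂)` to `(f₁, R)` near `0`. -/
def IsTransitionMatrix {n : ℕ} (f₁ f₂ R : (Fin n → ℂ) → ℂ)
    (A : (Fin n → ℂ) → Matrix (Fin 2) (Fin 2) ℂ) : Prop :=
  (∀ i j, AnalyticAt ℂ (fun z => A z i j) 0) ∧
    ∀ᶠ z in 𝓝 0, (A z).mulVec ![f₁ z, f₂ z] = ![f₁ z, R z]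

/-! ### Forms of bidegree `(n, q)` -/

/-- A form `∑_J φ_J dz₁ ∧ ⋯ ∧ dzₙ ∧ dz̄_J` on `ℂⁿ`, given by its coefficients; here
`dz̄_J = dz̄_{j₁} ∧ ⋯ ∧ dz̄_{j_q}` for `J = {j₁ < ⋯ < j_q}`. -/
abbrev Form (n : ℕ) : Type := Finset (Fin n) → (Fin n → ℂ) → ℂ

/-- The Wirtinger derivative `∂h/∂z̄_l`. -/
def dbarCoord {n : ℕ} (l : Fin n) (h : (Fin n → ℂ) → ℂ) : (Fin n → ℂ) → ℂ := fun z =>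
  (1 / 2) * (fderiv ℝ h z (Pi.single l 1) + Complex.I * fderiv ℝ h z (Pi.single l Complex.I))

/-- The iterate `∂̄_l^N φ`, where `∂̄_l` differentiates the coefficients with respect to `z̄_l`. -/
def dbarIter {n : ℕ} (l : Fin n) (N : ℕ) (φ : Form n) : Form n :=
  fun J => (dbarCoord l)^[N] (φ J)

/-- The sign such that
`dz̄_l ∧ (dz₁ ∧ ⋯ ∧ dzₙ ∧ dz̄_{K \ l}) = wedgeSign l K • dz₁ ∧ ⋯ ∧ dzₙ ∧ dz̄_K` for `l ∈ K`. -/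
def wedgeSign {n : ℕ} (l : Fin n) (K : Finset (Fin n)) : ℂ :=
  (-1) ^ n * (-1) ^ (K.filter (fun k => k < l)).card

/-- The form `∂̄φ`. -/
def dbar {n : ℕ} (φ : Form n) : Form n := fun K z =>
  ∑ l ∈ K, wedgeSign l K * dbarCoord l (φ (K.erase l)) z

/-- The form `∂̄h ∧ φ`, for a function `h`. -/
def dbarWedge {n : ℕ} (h : (Fin n → ℂ) → ℂ) (φ : Form n) : Form n := fun K z =>
  ∑ l ∈ K, wedgeSign l K * (dbarCoord l h z * φ (K.erase l) z)

/-- The product `h φ` of a function and a form. -/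
def mulForm {n : ℕ} (h : (Fin n → ℂ) → ℂ) (φ : Form n) : Form n := fun J z => h z * φ J z

/-- The integral over `ℂⁿ` of the component of bidegree `(n, n)`; here
`dz₁ ∧ ⋯ ∧ dzₙ ∧ dz̄₁ ∧ ⋯ ∧ dz̄ₙ = (-1)^(n(n-1)/2) (-2i)ⁿ dλ` with `λ` the Lebesgue measure. -/
def formIntegral {n : ℕ} (φ : Form n) : ℂ :=
  (-1) ^ (n * (n - 1) / 2) * (-2 * Complex.I) ^ n * ∫ z : Fin n → ℂ, φ Finset.univ z

/-- `φ` is a test form of bidegree `(n, q)` on the open set `U`. -/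
structure IsTestForm {n : ℕ} (U : Set (Fin n → ℂ)) (q : ℕ) (φ : Form n) : Prop where
  degree : ∀ J : Finset (Fin n), J.card ≠ q → φ J = 0
  smooth : ∀ J, ContDiff ℝ ∞ (φ J)
  compact : ∀ J, HasCompactSupport (φ J)
  support : ∀ J, tsupport (φ J) ⊆ U

/-! ### Currents -/

/-- `T` is a current on `U`, acting on test forms of bidegree `(n, q)`: it is linear and, on the
forms supported in a given compact set, bounded by finitely many derivatives. -/
structure IsCurrent {n : ℕ} (U : Set (Fin n → ℂ)) (q : ℕ) (T : Form n → ℂ) : Prop where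
  map_add : ∀ φ ψ, IsTestForm U q φ → IsTestForm U q ψ → T (φ + ψ) = T φ + T ψ
  map_smul : ∀ (c : ℂ) φ, IsTestForm U q φ → T (c • φ) = c * T φ
  bounded : ∀ K : Set (Fin n → ℂ), IsCompact K → K ⊆ U → ∃ (C : ℝ) (r : ℕ),
    ∀ φ, IsTestForm U q φ → (∀ J, tsupport (φ J) ⊆ K) →
      ∀ B : ℝ, (∀ J, ∀ i ≤ r, ∀ z, ‖iteratedFDeriv ℝ i (φ J) z‖ ≤ B) → ‖T φ‖ ≤ C * B

/-- The currents `S` and `T`, acting on forms of bidegree `(n, q)`, agree on `U`. -/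
def CurrentEq {n : ℕ} (U : Set (Fin n → ℂ)) (q : ℕ) (S T : Form n → ℂ) : Prop :=
  ∀ φ, IsTestForm U q φ → S φ = T φ

/-- The product of a function and a current. -/
def mulCurrent {n : ℕ} (h : (Fin n → ℂ) → ℂ) (T : Form n → ℂ) : Form n → ℂ :=
  fun φ => T (mulForm h φ)

/-- `∂̄T` for a current `T` of bidegree `(0, q)`: `⟨∂̄T, φ⟩ = (-1)^(q+1) ⟨T, ∂̄φ⟩`. -/
def dbarCurrent {n : ℕ} (q : ℕ) (T : Form n → ℂ) : Form n → ℂ :=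
  fun φ => (-1) ^ (q + 1) * T (dbar φ)

/-! ### The currents `X₁^Γ` and `X₂^Γ` -/

/-- The function `(conj P)^Γ`. -/
def conjPow {k : ℕ} (P : (Fin k → ℂ) → Polynomial ℂ) (Γ : ℕ) : (Fin (k + 1) → ℂ) → ℂ :=
  fun z => conj (evalFamily P z) ^ Γ

/-- The integrand `(conj P₁)^Γ / f₁ · ∂̄₁^(Γ N₁) φ`. -/
def integrand₁ {m : ℕ} (f₁ : (Fin (m + 2) → ℂ) → ℂ) (P₁ : (Fin (m + 1) → ℂ) → Polynomial ℂ)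
    (N₁ Γ : ℕ) (φ : Form (m + 2)) : Form (m + 2) :=
  mulForm (fun z => conjPow P₁ Γ z / f₁ z) (dbarIter 0 (Γ * N₁) φ)

/-- The integrand `(conj Q) / R · ∂̄₂^N₂ (∂̄(conj P₁)^Γ / f₁ ∧ ∂̄₁^(Γ N₁) φ)`, where `R` and `Q` do
not depend on `z₁`. -/
def integrand₂ {m : ℕ} (f₁ : (Fin (m + 2) → ℂ) → ℂ) (P₁ : (Fin (m + 1) → ℂ) → Polynomial ℂ)
    (R : (Fin (m + 1) → ℂ) → ℂ) (Q : (Fin m → ℂ) → Polynomial ℂ)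
    (N₁ N₂ Γ : ℕ) (φ : Form (m + 2)) : Form (m + 2) :=
  mulForm (fun z => conj (evalFamily Q (Fin.tail z)) / R (Fin.tail z))
    (dbarIter 1 N₂ (mulForm (fun z => (f₁ z)⁻¹)
      (dbarWedge (conjPow P₁ Γ) (dbarIter 0 (Γ * N₁) φ))))

/-- The current `X₁^Γ`, acting on test forms of bidegree `(n, n)`. -/
def X₁ {m : ℕ} (f₁ : (Fin (m + 2) → ℂ) → ℂ) (P₁ : (Fin (m + 1) → ℂ) → Polynomial ℂ)
    (N₁ Γ : ℕ) : Form (m + 2) → ℂ :=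
  fun φ => formIntegral (integrand₁ f₁ P₁ N₁ Γ φ)

/-- The current `X₂^Γ`, acting on test forms of bidegree `(n, n - 1)`. -/
def X₂ {m : ℕ} (f₁ : (Fin (m + 2) → ℂ) → ℂ) (P₁ : (Fin (m + 1) → ℂ) → Polynomial ℂ)
    (R : (Fin (m + 1) → ℂ) → ℂ) (Q : (Fin m → ℂ) → Polynomial ℂ)
    (N₁ N₂ Γ : ℕ) : Form (m + 2) → ℂ :=
  fun φ => formIntegral (integrand₂ f₁ P₁ R Q N₁ N₂ Γ φ)

end ResidueCurrents

end

/-! Near `0` write `f₁ = u p` and `R = v q`, with holomorphic units `u`, `v` and Weierstrass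
polynomials `p` in `z₁` and `q` in `z₂`; this is what `Chart` records. The analytic input is that
integration by parts against `conj p / p` has no contribution from the zeros of `p`
(`IsDivisor.integral_conj_div`). The quotient is regularized by `conj p ^ 2 / (|p| ^ 2 + ε)`, and
the limit is dominated by the logarithmic derivatives of `p`. These are integrable: in the direction
`z₁` they are sums of `1 / (t - a)` over the roots, and the other directions follow by a small shear
and the preparation theorem (`exists_integrableOn_logDeriv`).

The identities for `X₁` and `X₂` come from degrees. Since `p ^ Γ` is monic of degree `Γ N₁` in `z₁`,
applying `∂̄₁` to `conj p ^ Γ` that many times gives the constant `(Γ N₁)!`. Moving the derivatives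
off the test form yields `f₁ X₁`, and the same with `conj q` and `∂̄₂ ^ N₂` yields `R X₂`. Because
that derivative is constant, `∂̄₁ ^ (Γ N₁)` kills every `∂̄_l (conj p ^ Γ)`. Hence `f₁ X₂` is the
integral of a `∂̄₁`-derivative against a function of `z'`, which is zero. The `N₂` derivatives in
`X₂` consume `N₂` of the `Γ - 1` available powers of `conj p`, whence `Γ ≥ N₂ + 1`.

For duality, the two identities and `∂̄∂̄ = 0` show that `f₁` and `R` annihilate `∂̄X₂`
(`Chart.annihilates`). Conversely, two Weierstrass divisions reduce any germ modulo `(f₁, R)` to `∑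
r_il(z'') z₁^i z₂^l` with `i < N₁`, `l < N₂`. On products of cutoff functions `∂̄X₂` is a nonzero
constant times an iterated residue integral with denominator `p q` (`Chart.exists_residue_formula`).
In one variable the residue of `t ^ s / T`, with `T` monic of degree `N` and `s < N`, is nonzero
only for `s = N - 1` (`integral_pow_div_cutoff`), so the `r_il` can be read off one after the other
from the top (`Chart.coeff_eq_zero`). This is duality for `(f₁, R)`, `Chart.memLocalIdeal_iff`. The
passage to `(f₁, f₂)` is algebraic: `g ∈ (f₁, f₂)` if and only if `g det A ∈ (f₁, R)`, because `R`
is not a zero divisor modulo `f₁` (`memLocalIdeal_of_mul_det`).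

Adapted coordinates exist because the resultant cannot vanish identically. Otherwise the two
Weierstrass polynomials would have a common root over every `z'`, and choosing roots of the largest
multiplicity that still occurs over an open set would produce an immersed hypersurface in the common
zero set (`IsWeierstrassPoly.exists_immersion`), against codimension `2`.

Weierstrass division itself is proved by functional calculus. Multiplication by `f(·, z')` acts on
bounded sequences of Taylor coefficients by an operator depending analytically on `z'`. The map
sending `(q, r)` to `f q + r` is invertible at `z' = 0`, hence nearby. -/

noncomputable section

namespace ResidueCurrents

section

open MeasureTheory

variable {n : ℕ}

/-! ### Calculus of the Wirtinger derivatives -/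

/-- The functional on real differentials that computes `∂/∂z̄_l`. -/
def wirtinger (l : Fin n) : ((Fin n → ℂ) →L[ℝ] ℂ) →L[ℝ] ℂ :=
  ((1 / 2 : ℝ) • (ContinuousLinearMap.apply ℝ ℂ (Pi.single l 1) +
    (ContinuousLinearMap.mul ℝ ℂ Complex.I).comp
      (ContinuousLinearMap.apply ℝ ℂ (Pi.single l Complex.I))))

/-- Composing `fderiv` with a fixed continuous functional lets smoothness, support and norm bounds
pass from the real differential to the Wirtinger derivative. -/
theorem dbarCoord_eq_wirtinger (l : Fin n) (h : (Fin n → ℂ) → ℂ) :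
    dbarCoord l h = fun z => wirtinger l (fderiv ℝ h z) := by
  funext z
  simp [dbarCoord, wirtinger, mul_add]

/-- Cauchy–Riemann: complex linearity pulls `I` out of `L`, and `I * I = -1` makes the two halves
cancel. -/
theorem wirtinger_restrictScalars (l : Fin n) (L : (Fin n → ℂ) →L[ℂ] ℂ) :
    wirtinger l (L.restrictScalars ℝ) = 0 := by
  have : (Pi.single l Complex.I : Fin n → ℂ) = Complex.I • Pi.single l 1 := by
    rw [← Pi.single_smul]; simp
  simp only [wirtinger, _root_.smul_apply, _root_.add_apply,
    ContinuousLinearMap.apply_apply, ContinuousLinearMap.comp_apply,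
    ContinuousLinearMap.mul_apply', ContinuousLinearMap.coe_restrictScalars', this, map_smul]
  rw [smul_eq_mul, ← mul_assoc, Complex.I_mul_I]
  simp

/-- Conjugation turns the factor `I` into `-I`, so the two halves agree and add up instead of
cancelling. -/
theorem wirtinger_conj (l : Fin n) (L : (Fin n → ℂ) →L[ℂ] ℂ) :
    wirtinger l ((Complex.conjCLE : ℂ →L[ℝ] ℂ).comp (L.restrictScalars ℝ)) =
      conj (L (Pi.single l 1)) := by
  have : (Pi.single l Complex.I : Fin n → ℂ) = Complex.I • Pi.single l 1 := by
    rw [← Pi.single_smul]; simp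
  simp only [wirtinger, _root_.smul_apply, _root_.add_apply,
    ContinuousLinearMap.apply_apply, ContinuousLinearMap.comp_apply,
    ContinuousLinearMap.mul_apply', ContinuousLinearMap.coe_restrictScalars', this, map_smul]
  simp only [ContinuousLinearEquiv.coe_coe, Complex.conjCLE_apply, smul_eq_mul, map_mul,
    Complex.conj_I]
  rw [← mul_assoc, mul_neg, Complex.I_mul_I, neg_neg, one_mul, Complex.real_smul]
  push_cast; ring

/-- The holomorphic derivative `∂h/∂z_l`. -/
def dCoord (l : Fin n) (h : (Fin n → ℂ) → ℂ) : (Fin n → ℂ) → ℂ := fun z =>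
  fderiv ℂ h z (Pi.single l 1)

theorem dbarCoord_of_differentiableAt {l : Fin n} {h : (Fin n → ℂ) → ℂ} {z : Fin n → ℂ}
    (hh : DifferentiableAt ℂ h z) : dbarCoord l h z = 0 := by
  rw [dbarCoord_eq_wirtinger]
  beta_reduce
  rw [hh.fderiv_restrictScalars ℝ]
  exact wirtinger_restrictScalars l _

theorem dbarCoord_conj {l : Fin n} {h : (Fin n → ℂ) → ℂ} {z : Fin n → ℂ}
    (hh : DifferentiableAt ℂ h z) :
    dbarCoord l (fun z => conj (h z)) z = conj (dCoord l h z) := by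
  rw [dbarCoord_eq_wirtinger]
  have : HasFDerivAt (fun z => conj (h z))
      ((Complex.conjCLE : ℂ →L[ℝ] ℂ).comp ((fderiv ℂ h z).restrictScalars ℝ)) z :=
    (Complex.conjCLE : ℂ →L[ℝ] ℂ).hasFDerivAt.comp z (hh.hasFDerivAt.restrictScalars ℝ)
  simp only [this.fderiv]
  exact wirtinger_conj l _

theorem dbarCoord_mul {l : Fin n} {g h : (Fin n → ℂ) → ℂ} {z : Fin n → ℂ}
    (hg : DifferentiableAt ℝ g z) (hh : DifferentiableAt ℝ h z) :
    dbarCoord l (fun z => g z * h z) z = dbarCoord l g z * h z + g z * dbarCoord l h z := by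
  simp only [dbarCoord, fderiv_fun_mul hg hh, _root_.add_apply,
    _root_.smul_apply, smul_eq_mul]
  ring

theorem dbarCoord_add {l : Fin n} {g h : (Fin n → ℂ) → ℂ} {z : Fin n → ℂ}
    (hg : DifferentiableAt ℝ g z) (hh : DifferentiableAt ℝ h z) :
    dbarCoord l (fun z => g z + h z) z = dbarCoord l g z + dbarCoord l h z := by
  simp only [dbarCoord, fderiv_fun_add hg hh, _root_.add_apply]
  ring

theorem dbarCoord_sum {ι : Type*} (s : Finset ι) {l : Fin n} {g : ι → (Fin n → ℂ) → ℂ}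
    {z : Fin n → ℂ} (hg : ∀ i ∈ s, DifferentiableAt ℝ (g i) z) :
    dbarCoord l (fun z => ∑ i ∈ s, g i z) z = ∑ i ∈ s, dbarCoord l (g i) z := by
  rw [dbarCoord_eq_wirtinger]
  simp only [fderiv_fun_sum hg, map_sum, dbarCoord_eq_wirtinger]

theorem dbarCoord_const_mul {l : Fin n} (c : ℂ) {h : (Fin n → ℂ) → ℂ} {z : Fin n → ℂ}
    (hh : DifferentiableAt ℝ h z) :
    dbarCoord l (fun z => c * h z) z = c * dbarCoord l h z := by
  have h0 : dbarCoord l (fun _ : Fin n → ℂ => c) z = 0 :=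
    dbarCoord_of_differentiableAt (differentiableAt_const c)
  rw [dbarCoord_mul (differentiableAt_const c) hh, h0]; ring

/-- A holomorphic factor passes through `∂/∂z̄_l`. -/
theorem dbarCoord_holo_mul {l : Fin n} {g h : (Fin n → ℂ) → ℂ} {z : Fin n → ℂ}
    (hg : DifferentiableAt ℂ g z) (hh : DifferentiableAt ℝ h z) :
    dbarCoord l (fun z => g z * h z) z = g z * dbarCoord l h z := by
  rw [dbarCoord_mul (hg.restrictScalars ℝ) hh, dbarCoord_of_differentiableAt hg]; ring

theorem dbarCoord_eventuallyEq {l : Fin n} {g h : (Fin n → ℂ) → ℂ} {z : Fin n → ℂ}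
    (hgh : g =ᶠ[𝓝 z] h) : dbarCoord l g =ᶠ[𝓝 z] dbarCoord l h := by
  filter_upwards [hgh.fderiv (𝕜 := ℝ)] with y hy
  simp [dbarCoord, hy]

theorem dbarCoord_iterate_eventuallyEq {l : Fin n} {g h : (Fin n → ℂ) → ℂ} {z : Fin n → ℂ}
    (hgh : g =ᶠ[𝓝 z] h) (k : ℕ) : (dbarCoord l)^[k] g =ᶠ[𝓝 z] (dbarCoord l)^[k] h := by
  induction k with
  | zero => exact hgh
  | succ k ih =>
    simp only [Function.iterate_succ_apply']
    exact dbarCoord_eventuallyEq ih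

theorem dbarCoord_congr_on {l : Fin n} {U : Set (Fin n → ℂ)} (hU : IsOpen U)
    {g h : (Fin n → ℂ) → ℂ} (hgh : ∀ z ∈ U, g z = h z) (k : ℕ) :
    ∀ z ∈ U, (dbarCoord l)^[k] g z = (dbarCoord l)^[k] h z := fun z hz =>
  (dbarCoord_iterate_eventuallyEq (Filter.eventuallyEq_of_mem (hU.mem_nhds hz) hgh) k).eq_of_nhds

theorem dbarCoord_zero (l : Fin n) : dbarCoord l (0 : (Fin n → ℂ) → ℂ) = 0 := by
  funext z; exact dbarCoord_of_differentiableAt (differentiableAt_const 0)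

theorem dbarCoord_iterate_zero (l : Fin n) (k : ℕ) :
    (dbarCoord l)^[k] (0 : (Fin n → ℂ) → ℂ) = 0 :=
  Function.iterate_fixed (dbarCoord_zero l) k

theorem tsupport_dbarCoord_subset (l : Fin n) (h : (Fin n → ℂ) → ℂ) :
    tsupport (dbarCoord l h) ⊆ tsupport h := by
  rw [dbarCoord_eq_wirtinger]
  exact (tsupport_comp_subset (map_zero _) _).trans (tsupport_fderiv_subset ℝ)

/-- Smooth functions on an open set. -/
abbrev SmoothOn (U : Set (Fin n → ℂ)) (w : (Fin n → ℂ) → ℂ) : Prop := ContDiffOn ℝ ∞ w U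

theorem SmoothOn.contDiffAt {U : Set (Fin n → ℂ)} {w : (Fin n → ℂ) → ℂ} (hw : SmoothOn U w)
    (hU : IsOpen U) {z : Fin n → ℂ} (hz : z ∈ U) : ContDiffAt ℝ ∞ w z :=
  ContDiffOn.contDiffAt hw (hU.mem_nhds hz)

theorem SmoothOn.differentiableAt {U : Set (Fin n → ℂ)} {w : (Fin n → ℂ) → ℂ} (hw : SmoothOn U w)
    (hU : IsOpen U) {z : Fin n → ℂ} (hz : z ∈ U) : DifferentiableAt ℝ w z :=
  (hw.contDiffAt hU hz).differentiableAt (by simp)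

theorem contDiffAt_dbarCoord {l : Fin n} {h : (Fin n → ℂ) → ℂ} {z : Fin n → ℂ}
    (hh : ContDiffAt ℝ ∞ h z) : ContDiffAt ℝ ∞ (dbarCoord l h) z := by
  rw [dbarCoord_eq_wirtinger]
  exact (wirtinger l).contDiff.contDiffAt.comp z (hh.fderiv_right (m := ∞) (by simp))

theorem SmoothOn.dbarCoord {U : Set (Fin n → ℂ)} {w : (Fin n → ℂ) → ℂ} (hw : SmoothOn U w)
    (hU : IsOpen U) (l : Fin n) : SmoothOn U (dbarCoord l w) := fun _ hz =>
  (contDiffAt_dbarCoord (hw.contDiffAt hU hz)).contDiffWithinAt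

theorem SmoothOn.dbarCoord_iterate {U : Set (Fin n → ℂ)} {w : (Fin n → ℂ) → ℂ}
    (hw : SmoothOn U w) (hU : IsOpen U) (l : Fin n) (k : ℕ) :
    SmoothOn U ((ResidueCurrents.dbarCoord l)^[k] w) := by
  induction k with
  | zero => exact hw
  | succ k ih => rw [Function.iterate_succ_apply']; exact ih.dbarCoord hU l

theorem dbarCoord_comm {l k : Fin n} {h : (Fin n → ℂ) → ℂ} {z : Fin n → ℂ}
    (hh : ContDiffAt ℝ ∞ h z) :
    dbarCoord l (dbarCoord k h) z = dbarCoord k (dbarCoord l h) z := by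
  have hs : IsSymmSndFDerivAt ℝ h z := hh.isSymmSndFDerivAt (by
    simpa using WithTop.coe_le_coe.2 (le_top : (2 : ℕ∞) ≤ ⊤))
  have hd : DifferentiableAt ℝ (fderiv ℝ h) z :=
    (hh.fderiv_right (m := ∞) (by simp)).differentiableAt (by simp)
  have key : ∀ k : Fin n, ∀ v, fderiv ℝ (dbarCoord k h) z v =
      wirtinger k (fderiv ℝ (fderiv ℝ h) z v) := by
    intro k v
    have : HasFDerivAt (dbarCoord k h) ((wirtinger k).comp (fderiv ℝ (fderiv ℝ h) z)) z := by
      rw [dbarCoord_eq_wirtinger]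
      exact (wirtinger k).hasFDerivAt.comp z hd.hasFDerivAt
    rw [this.fderiv]; rfl
  simp only [dbarCoord_eq_wirtinger l, dbarCoord_eq_wirtinger k]
  rw [← dbarCoord_eq_wirtinger, ← dbarCoord_eq_wirtinger]
  have e1 : ∀ (l : Fin n) (L : (Fin n → ℂ) →L[ℝ] ℂ), wirtinger l L =
      (1 / 2) * (L (Pi.single l 1) + Complex.I * L (Pi.single l Complex.I)) := by
    intro l L; simp [wirtinger, mul_add]
  rw [e1 l, e1 k, key k, key k, key l, key l, e1, e1, e1, e1,
    hs (Pi.single l 1) (Pi.single k 1), hs (Pi.single l 1) (Pi.single k Complex.I),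
    hs (Pi.single l Complex.I) (Pi.single k 1), hs (Pi.single l Complex.I) (Pi.single k Complex.I)]
  ring

/-- Test functions on an open set. -/
structure IsTest (U : Set (Fin n → ℂ)) (χ : (Fin n → ℂ) → ℂ) : Prop where
  smooth : ContDiff ℝ ∞ χ
  compact : HasCompactSupport χ
  support : tsupport χ ⊆ U

namespace IsTest

variable {U V : Set (Fin n → ℂ)} {χ ψ : (Fin n → ℂ) → ℂ}

theorem mono (h : IsTest U χ) (hUV : U ⊆ V) : IsTest V χ :=
  ⟨h.smooth, h.compact, h.support.trans hUV⟩

theorem differentiableAt (h : IsTest U χ) (z : Fin n → ℂ) : DifferentiableAt ℝ χ z :=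
  h.smooth.contDiffAt.differentiableAt (by simp)

theorem smoothOn (h : IsTest U χ) (V : Set (Fin n → ℂ)) : SmoothOn V χ := h.smooth.contDiffOn

theorem zero : IsTest U (fun _ => 0 : (Fin n → ℂ) → ℂ) :=
  ⟨contDiff_const, HasCompactSupport.zero, by
    simp [tsupport, Function.support_fun_zero]⟩

theorem add (h : IsTest U χ) (h' : IsTest U ψ) : IsTest U (fun z => χ z + ψ z) :=
  ⟨h.smooth.add h'.smooth, h.compact.add h'.compact,
    (tsupport_add χ ψ).trans (Set.union_subset h.support h'.support)⟩

theorem const_mul (h : IsTest U χ) (c : ℂ) : IsTest U (fun z => c * χ z) :=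
  ⟨contDiff_const.mul h.smooth, h.compact.mul_left,
    (tsupport_mul_subset_right (f := fun _ => c) (g := χ)).trans h.support⟩

theorem sum {ι : Type*} (s : Finset ι) {g : ι → (Fin n → ℂ) → ℂ}
    (hg : ∀ i ∈ s, IsTest U (g i)) : IsTest U (fun z => ∑ i ∈ s, g i z) := by
  classical
  induction s using Finset.induction_on with
  | empty => simpa using zero
  | insert a s ha ih =>
    simp only [Finset.sum_insert ha]
    exact (hg a (Finset.mem_insert_self a s)).add
      (ih fun i hi => hg i (Finset.mem_insert_of_mem hi))

/-- The factor `w` is controlled on `U` only. A point outside `U` is outside the closed support of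
`χ`, so the product is zero near it, and values of `w` off `U` never matter. -/
theorem mul (h : IsTest U χ) (hU : IsOpen U) {w : (Fin n → ℂ) → ℂ} (hw : SmoothOn U w) :
    IsTest U (fun z => w z * χ z) := by
  have hs : tsupport (fun z => w z * χ z) ⊆ tsupport χ := tsupport_mul_subset_right
  refine ⟨contDiff_iff_contDiffAt.2 fun z => ?_, h.compact.mul_left, hs.trans h.support⟩
  by_cases hz : z ∈ U
  · exact (hw.contDiffAt hU hz).mul h.smooth.contDiffAt
  · have : (fun z => w z * χ z) =ᶠ[𝓝 z] fun _ => 0 :=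
      notMem_tsupport_iff_eventuallyEq.1 fun h' => hz (h.support (hs h'))
    exact contDiffAt_const.congr_of_eventuallyEq this

theorem dbar (h : IsTest U χ) (l : Fin n) : IsTest U (dbarCoord l χ) :=
  ⟨contDiff_iff_contDiffAt.2 fun _ => contDiffAt_dbarCoord h.smooth.contDiffAt,
    h.compact.of_isClosed_subset (isClosed_tsupport _) (tsupport_dbarCoord_subset l χ),
    (tsupport_dbarCoord_subset l χ).trans h.support⟩

theorem dbar_iterate (h : IsTest U χ) (l : Fin n) (k : ℕ) : IsTest U ((dbarCoord l)^[k] χ) := by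
  induction k with
  | zero => exact h
  | succ k ih => rw [Function.iterate_succ_apply']; exact ih.dbar l

theorem continuous (h : IsTest U χ) : Continuous χ := h.smooth.continuous

theorem integrable (h : IsTest U χ) : Integrable χ :=
  h.continuous.integrable_of_hasCompactSupport h.compact

theorem eq_zero (h : IsTest U χ) {z : Fin n → ℂ} (hz : z ∉ U) : χ z = 0 :=
  image_eq_zero_of_notMem_tsupport fun h' => hz (h.support h')

theorem eventually_eq_zero (h : IsTest U χ) {z : Fin n → ℂ} (hz : z ∉ U) :
    χ =ᶠ[𝓝 z] fun _ => 0 :=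
  notMem_tsupport_iff_eventuallyEq.1 fun h' => hz (h.support h')

/-- Integration by parts against the constant function `1`. -/
theorem integral_fderiv (h : IsTest U χ) (v : Fin n → ℂ) : ∫ z, fderiv ℝ χ z v = 0 := by
  have hi : Integrable fun z => fderiv ℝ χ z v := by
    refine Continuous.integrable_of_hasCompactSupport ?_ ?_
    · exact (h.smooth.continuous_fderiv (by simp)).clm_apply continuous_const
    · exact h.compact.fderiv_apply ℝ v
  have := integral_mul_fderiv_eq_neg_fderiv_mul_of_integrable (𝕜 := ℂ) (μ := volume)
    (f := fun _ : Fin n → ℂ => (1 : ℂ)) (g := χ) (v := v) (by simp) (by simpa using hi)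
    (by simpa using h.integrable)
    (fun _ _ => differentiableAt_const _) (fun z _ => h.differentiableAt z)
  simpa using this

theorem integral_dbarCoord (h : IsTest U χ) (l : Fin n) : ∫ z, dbarCoord l χ z = 0 := by
  have hi : ∀ v, Integrable fun z => fderiv ℝ χ z v := fun v => by
    refine Continuous.integrable_of_hasCompactSupport ?_ ?_
    · exact (h.smooth.continuous_fderiv (by simp)).clm_apply continuous_const
    · exact h.compact.fderiv_apply ℝ v
  simp only [ResidueCurrents.dbarCoord]
  rw [integral_const_mul, integral_add (hi _) ((hi _).const_mul _), integral_const_mul,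
    h.integral_fderiv, h.integral_fderiv]
  simp

theorem dbarCoord_comm_iterate (h : IsTest U χ) (k l : Fin n) (N : ℕ) :
    (dbarCoord l)^[N] (dbarCoord k χ) = dbarCoord k ((dbarCoord l)^[N] χ) := by
  induction N with
  | zero => rfl
  | succ N ih =>
    rw [Function.iterate_succ_apply', ih, Function.iterate_succ_apply']
    funext z
    exact dbarCoord_comm (h.dbar_iterate l N).smooth.contDiffAt

end IsTest

theorem dbarCoord_iterate_holo_mul {U : Set (Fin n → ℂ)} (hU : IsOpen U) {l : Fin n}
    {g h : (Fin n → ℂ) → ℂ} (hg : ∀ z ∈ U, DifferentiableAt ℂ g z) (hh : SmoothOn U h) (k : ℕ) :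
    ∀ z ∈ U, (dbarCoord l)^[k] (fun z => g z * h z) z = g z * (dbarCoord l)^[k] h z := by
  induction k with
  | zero => intro z _; rfl
  | succ k ih =>
    intro z hz
    rw [Function.iterate_succ_apply', Function.iterate_succ_apply']
    rw [(dbarCoord_eventuallyEq (Filter.eventuallyEq_of_mem (hU.mem_nhds hz) ih)).eq_of_nhds]
    exact dbarCoord_holo_mul (hg z hz) ((hh.dbarCoord_iterate hU l k).differentiableAt hU hz)

theorem dbarCoord_iterate_sum {ι : Type*} (s : Finset ι) {U : Set (Fin n → ℂ)} (hU : IsOpen U)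
    {l : Fin n} {g : ι → (Fin n → ℂ) → ℂ} (hg : ∀ i ∈ s, SmoothOn U (g i)) (k : ℕ) :
    ∀ z ∈ U, (dbarCoord l)^[k] (fun z => ∑ i ∈ s, g i z) z =
      ∑ i ∈ s, (dbarCoord l)^[k] (g i) z := by
  induction k with
  | zero => intro z _; rfl
  | succ k ih =>
    intro z hz
    simp only [Function.iterate_succ_apply']
    rw [(dbarCoord_eventuallyEq (Filter.eventuallyEq_of_mem (hU.mem_nhds hz) ih)).eq_of_nhds]
    exact dbarCoord_sum s fun i hi => ((hg i hi).dbarCoord_iterate hU l k).differentiableAt hU hz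

theorem dbarCoord_iterate_add {U : Set (Fin n → ℂ)} (hU : IsOpen U)
    {l : Fin n} {g h : (Fin n → ℂ) → ℂ} (hg : SmoothOn U g) (hh : SmoothOn U h) (k : ℕ) :
    ∀ z ∈ U, (dbarCoord l)^[k] (fun z => g z + h z) z =
      (dbarCoord l)^[k] g z + (dbarCoord l)^[k] h z := by
  induction k with
  | zero => intro z _; rfl
  | succ k ih =>
    intro z hz
    simp only [Function.iterate_succ_apply']
    rw [(dbarCoord_eventuallyEq (Filter.eventuallyEq_of_mem (hU.mem_nhds hz) ih)).eq_of_nhds]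
    exact dbarCoord_add ((hg.dbarCoord_iterate hU l k).differentiableAt hU hz)
      ((hh.dbarCoord_iterate hU l k).differentiableAt hU hz)

theorem _root_.AnalyticOnNhd.smoothOn {U : Set (Fin n → ℂ)} {h : (Fin n → ℂ) → ℂ}
    (hh : AnalyticOnNhd ℂ h U) : SmoothOn U h := fun z hz =>
  ((hh z hz).contDiffAt (n := ∞)).restrict_scalars ℝ |>.contDiffWithinAt

theorem SmoothOn.conj {U : Set (Fin n → ℂ)} {h : (Fin n → ℂ) → ℂ}
    (hh : SmoothOn U h) : SmoothOn U (fun z => conj (h z)) :=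
  Complex.conjCLE.contDiff.comp_contDiffOn hh

theorem analyticOnNhd_dCoord {U : Set (Fin n → ℂ)} {h : (Fin n → ℂ) → ℂ}
    (hh : AnalyticOnNhd ℂ h U) (l : Fin n) : AnalyticOnNhd ℂ (dCoord l h) U := fun z hz =>
  ((ContinuousLinearMap.apply ℂ ℂ (Pi.single l (1 : ℂ) : Fin n → ℂ)).analyticAt _).comp
    ((hh z hz).fderiv)

theorem analyticOnNhd_dCoord_iterate {U : Set (Fin n → ℂ)} {h : (Fin n → ℂ) → ℂ}
    (hh : AnalyticOnNhd ℂ h U) (l : Fin n) (k : ℕ) : AnalyticOnNhd ℂ ((dCoord l)^[k] h) U := by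
  induction k with
  | zero => exact hh
  | succ k ih => rw [Function.iterate_succ_apply']; exact analyticOnNhd_dCoord ih l

/-- Antiholomorphic derivatives of `conj h` become holomorphic derivatives of `h`, to which the
algebra of polynomial derivatives applies. -/
theorem dbarCoord_iterate_conj {U : Set (Fin n → ℂ)} (hU : IsOpen U) {l : Fin n}
    {h : (Fin n → ℂ) → ℂ} (hh : AnalyticOnNhd ℂ h U) (k : ℕ) :
    ∀ z ∈ U, (dbarCoord l)^[k] (fun z => conj (h z)) z = conj ((dCoord l)^[k] h z) := by
  induction k with
  | zero => intro z _; rfl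
  | succ k ih =>
    intro z hz
    rw [Function.iterate_succ_apply', Function.iterate_succ_apply',
      (dbarCoord_eventuallyEq (Filter.eventuallyEq_of_mem (hU.mem_nhds hz) ih)).eq_of_nhds]
    exact dbarCoord_conj (analyticOnNhd_dCoord_iterate hh l k z hz).differentiableAt

theorem dCoord_comm {l k : Fin n} {h : (Fin n → ℂ) → ℂ} {z : Fin n → ℂ}
    (hh : AnalyticAt ℂ h z) : dCoord l (dCoord k h) z = dCoord k (dCoord l h) z := by
  have hs : IsSymmSndFDerivAt ℂ h z := (hh.contDiffAt (n := ω)).isSymmSndFDerivAt_of_omega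
  have hd : DifferentiableAt ℂ (fderiv ℂ h) z := hh.fderiv.differentiableAt
  have key : ∀ k : Fin n, ∀ v, fderiv ℂ (dCoord k h) z v =
      fderiv ℂ (fderiv ℂ h) z v (Pi.single k 1) := by
    intro k v
    have : HasFDerivAt (dCoord k h) ((ContinuousLinearMap.apply ℂ ℂ
      (Pi.single k (1 : ℂ) : Fin n → ℂ)).comp (fderiv ℂ (fderiv ℂ h) z)) z :=
      (ContinuousLinearMap.apply ℂ ℂ (Pi.single k (1 : ℂ) : Fin n → ℂ)).hasFDerivAt.comp z
        hd.hasFDerivAt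
    rw [this.fderiv]; rfl
  rw [dCoord, key, dCoord, key]
  exact hs _ _

theorem dCoord_congr {l : Fin n} {g h : (Fin n → ℂ) → ℂ} {z : Fin n → ℂ}
    (hgh : g =ᶠ[𝓝 z] h) : dCoord l g =ᶠ[𝓝 z] dCoord l h := by
  filter_upwards [hgh.fderiv (𝕜 := ℂ)] with y hy
  simp [dCoord, hy]

theorem dCoord_comm_iterate {U : Set (Fin n → ℂ)} (hU : IsOpen U) {l k : Fin n}
    {h : (Fin n → ℂ) → ℂ} (hh : AnalyticOnNhd ℂ h U) (N : ℕ) :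
    ∀ z ∈ U, (dCoord l)^[N] (dCoord k h) z = dCoord k ((dCoord l)^[N] h) z := by
  induction N with
  | zero => intro z _; rfl
  | succ N ih =>
    intro z hz
    rw [Function.iterate_succ_apply', Function.iterate_succ_apply',
      (dCoord_congr (Filter.eventuallyEq_of_mem (hU.mem_nhds hz) ih)).eq_of_nhds]
    exact dCoord_comm (analyticOnNhd_dCoord_iterate hh l N z hz)

/-- The iterates of `∂/∂z̄_l` are controlled by the total derivatives. -/
theorem exists_norm_iteratedFDeriv_dbarCoord_le (l : Fin n) (k : ℕ) : ∃ C : ℝ, 0 ≤ C ∧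
    ∀ (χ : (Fin n → ℂ) → ℂ), ContDiff ℝ ∞ χ → ∀ (i : ℕ) (z : Fin n → ℂ),
      ‖iteratedFDeriv ℝ i ((dbarCoord l)^[k] χ) z‖ ≤ C * ‖iteratedFDeriv ℝ (i + k) χ z‖ := by
  induction k with
  | zero => exact ⟨1, zero_le_one, fun χ _ i z => by simp⟩
  | succ k ih =>
    obtain ⟨C, hC, h⟩ := ih
    refine ⟨C * ‖wirtinger l‖, by positivity, fun χ hχ i z => ?_⟩
    rw [Function.iterate_succ_apply]
    have hs : ContDiff ℝ ∞ (dbarCoord l χ) :=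
      contDiff_iff_contDiffAt.2 fun _ => contDiffAt_dbarCoord hχ.contDiffAt
    refine (h _ hs i z).trans ?_
    rw [mul_assoc]
    refine mul_le_mul_of_nonneg_left ?_ hC
    rw [dbarCoord_eq_wirtinger]
    refine ((wirtinger l).norm_iteratedFDeriv_comp_left (f := fderiv ℝ χ) (N := ∞)
      (hχ.fderiv_right (m := ∞) (by simp)).contDiffAt (by exact_mod_cast le_top)).trans ?_
    rw [norm_iteratedFDeriv_fderiv]
    rfl

end

section

/-! ### Analytic functions of elements of a Banach algebra -/

section FunctionalCalculus

variable {k : ℕ} (A : Type*) [NormedRing A] [NormedAlgebra ℂ A] [NormOneClass A]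

/-- The extension of a power series in `k` complex variables to elements of a Banach algebra. -/
def algebraSeries (p : FormalMultilinearSeries ℂ (Fin k → ℂ) ℂ) :
    FormalMultilinearSeries ℂ (Fin k → A) A := fun n =>
  ∑ i : Fin n → Fin k, p n (fun j => Pi.single (i j) 1) •
    (ContinuousMultilinearMap.mkPiAlgebraFin ℂ n A).compContinuousLinearMap
      (fun j => ContinuousLinearMap.proj (R := ℂ) (φ := fun _ : Fin k => A) (i j))

/-- There are `k ^ n` words of length `n` in the variables, each contributing at most `‖p n‖`. The
base `k + 1` instead of `k` allows division by it also when `k = 0`. -/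
theorem norm_algebraSeries_le (p : FormalMultilinearSeries ℂ (Fin k → ℂ) ℂ) (n : ℕ) :
    ‖algebraSeries A p n‖ ≤ (k + 1 : ℝ) ^ n * ‖p n‖ := by
  refine ContinuousMultilinearMap.opNorm_le_bound (by positivity) fun x => ?_
  simp only [algebraSeries, sum_apply, smul_apply,
    ContinuousMultilinearMap.compContinuousLinearMap_apply, ContinuousLinearMap.proj_apply]
  have h1 : ∀ i : Fin n → Fin k, ‖p n (fun j => Pi.single (i j) 1) •
      ContinuousMultilinearMap.mkPiAlgebraFin ℂ n A (fun j => x j (i j))‖ ≤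
        ‖p n‖ * ∏ j, ‖x j‖ := by
    intro i
    rw [norm_smul]
    have e1 : ‖p n (fun j => Pi.single (i j) 1)‖ ≤ ‖p n‖ := by
      refine ((p n).le_opNorm _).trans ?_
      refine mul_le_of_le_one_right (norm_nonneg _) (Finset.prod_le_one (fun _ _ => norm_nonneg _)
        fun j _ => ?_)
      rw [Pi.norm_single]; simp
    have e2 : ‖ContinuousMultilinearMap.mkPiAlgebraFin ℂ n A (fun j => x j (i j))‖ ≤
        ∏ j, ‖x j‖ := by
      refine (ContinuousMultilinearMap.le_opNorm _ _).trans ?_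
      rw [ContinuousMultilinearMap.norm_mkPiAlgebraFin, one_mul]
      exact Finset.prod_le_prod (fun _ _ => norm_nonneg _) fun j _ => norm_le_pi_norm (x j) (i j)
    exact mul_le_mul e1 e2 (norm_nonneg _) (norm_nonneg _)
  refine (norm_sum_le_of_le _ fun i _ => h1 i).trans ?_
  rw [Finset.sum_const, nsmul_eq_mul, Finset.card_univ, Fintype.card_fun, mul_assoc]
  simp only [Fintype.card_fin]
  push_cast
  gcongr
  linarith

theorem algebraSeries_radius_pos (p : FormalMultilinearSeries ℂ (Fin k → ℂ) ℂ)
    (hp : 0 < p.radius) : 0 < (algebraSeries A p).radius := by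
  obtain ⟨r, hr0, hr⟩ := ENNReal.lt_iff_exists_nnreal_btwn.1 hp
  obtain ⟨C, hC, h⟩ := p.norm_mul_pow_le_of_lt_radius hr
  have hr0' : 0 < r := by exact_mod_cast hr0
  have : ((r / (k + 1) : NNReal) : ENNReal) ≤ (algebraSeries A p).radius := by
    refine FormalMultilinearSeries.le_radius_of_bound _ C fun n => ?_
    refine le_trans ?_ (h n)
    push_cast
    rw [div_pow]
    calc _ ≤ ((k + 1 : ℝ) ^ n * ‖p n‖) * ((r : ℝ) ^ n / (k + 1 : ℝ) ^ n) := by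
          gcongr; exact norm_algebraSeries_le A p n
      _ = _ := by
        have : (k + 1 : ℝ) ^ n ≠ 0 := by positivity
        field_simp
  refine lt_of_lt_of_le ?_ this
  have : 0 < r / (k + 1) := by positivity
  exact_mod_cast this

variable {A}
variable {F : Type*} [NormedAddCommGroup F] [NormedSpace ℂ F]

/-- Under `T`, left multiplication by `γ i` becomes the scalar `c i`, so each noncommutative
monomial in `γ` becomes the corresponding scalar monomial. Multilinearity reassembles these into `p
n` at `c`. The `γ i` need not commute. -/
theorem map_algebraSeries (p : FormalMultilinearSeries ℂ (Fin k → ℂ) ℂ) (T : A →L[ℂ] F)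
    {γ : Fin k → A} {c : Fin k → ℂ} (hT : ∀ i a, T (γ i * a) = c i • T a) (n : ℕ) :
    T (algebraSeries A p n fun _ => γ) = (p n fun _ => c) • T 1 := by
  have hl : ∀ l : List (Fin k), T (l.map γ).prod = (l.map c).prod • T 1 := by
    intro l
    induction l with
    | nil => simp
    | cons a l ih => rw [List.map_cons, List.prod_cons, hT, ih, List.map_cons, List.prod_cons,
        mul_smul]
  have hc : (fun _ : Fin n => c) = fun _ => ∑ i, c i • (Pi.single i 1 : Fin k → ℂ) := by
    funext _ ; rw [pi_eq_sum_univ' c]; simp [Pi.single_apply]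
  rw [hc, ContinuousMultilinearMap.map_sum]
  simp only [algebraSeries, sum_apply, map_sum, Finset.sum_smul,
    smul_apply, map_smul,
    ContinuousMultilinearMap.compContinuousLinearMap_apply,
    ContinuousMultilinearMap.mkPiAlgebraFin_apply, ContinuousLinearMap.proj_apply,
    ContinuousMultilinearMap.map_smul_univ]
  refine Finset.sum_congr rfl fun i _ => ?_
  have := hl (List.ofFn i)
  rw [List.map_ofFn, List.map_ofFn, List.prod_ofFn (f := c ∘ i)] at this
  simp only [Function.comp_def] at this
  rw [this, smul_smul, mul_comm]
  rfl

variable [CompleteSpace A]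

/-- Functional calculus for a germ of analytic function. -/
theorem exists_analytic_calculus (A : Type*) [NormedRing A] [NormedAlgebra ℂ A] [NormOneClass A]
    [CompleteSpace A] {f : (Fin k → ℂ) → ℂ} (hf : AnalyticAt ℂ f 0) :
    ∃ (F : (Fin k → A) → A) (δ : ℝ), 0 < δ ∧ AnalyticOnNhd ℂ F (Metric.ball 0 δ) ∧
      ∀ (E : Type) [NormedAddCommGroup E] [NormedSpace ℂ E] (T : A →L[ℂ] E) (γ : Fin k → A)
        (c : Fin k → ℂ), γ ∈ Metric.ball 0 δ → c ∈ Metric.ball 0 δ →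
        (∀ i a, T (γ i * a) = c i • T a) → T (F γ) = f c • T 1 := by
  obtain ⟨p, r, hp⟩ := hf
  have hpos := algebraSeries_radius_pos A p (hp.r_pos.trans_le hp.r_le)
  have hF := (algebraSeries A p).hasFPowerSeriesOnBall hpos
  obtain ⟨δ, hδ0, hδ⟩ := ENNReal.lt_iff_exists_nnreal_btwn.1 (lt_min hpos hp.r_pos)
  have hb1 : Metric.ball (0 : Fin k → A) δ ⊆ Metric.eball 0 (algebraSeries A p).radius := by
    rw [← Metric.eball_coe]
    exact Metric.eball_subset_eball (hδ.le.trans (min_le_left _ _))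
  have hb2 : Metric.ball (0 : Fin k → ℂ) δ ⊆ Metric.eball 0 r := by
    rw [← Metric.eball_coe]
    exact Metric.eball_subset_eball (hδ.le.trans (min_le_right _ _))
  refine ⟨(algebraSeries A p).sum, δ, by exact_mod_cast hδ0,
    hF.analyticOnNhd.mono hb1, fun E _ _ T γ c hγ hc hT => ?_⟩
  -- Term by term, the image under `T` of the series at `γ` is the scalar series of `f` at `c` times
  -- `T 1`; uniqueness of sums concludes.
  have h1 := (hF.hasSum (hb1 hγ)).mapL T
  have h2 := (hp.hasSum (hb2 hc)).smul_const (T 1)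
  rw [zero_add] at h1 h2
  simp only [map_algebraSeries p T hT] at h1
  exact h1.unique h2

end FunctionalCalculus

end

section

/-! ### Weierstrass division -/

open scoped BoundedContinuousFunction

/-- Bounded sequences, regarded as sequences of Taylor coefficients. -/
abbrev CoeffSeq : Type := ℕ →ᵇ ℂ

/-- Multiplication by the variable, on sequences of Taylor coefficients. -/
def shiftRight : CoeffSeq →L[ℂ] CoeffSeq :=
  LinearMap.mkContinuous
    { toFun := fun a => BoundedContinuousFunction.ofNormedAddCommGroupDiscrete
        (fun i => Nat.casesOn i 0 a) ‖a‖ (by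
          rintro (_ | i)
          · simp
          · exact a.norm_coe_le_norm i)
      map_add' := fun a b => by ext i; cases i <;> simp
      map_smul' := fun c a => by ext i; cases i <;> simp } 1 (fun a => by
    rw [one_mul]
    refine (BoundedContinuousFunction.norm_le (norm_nonneg _)).2 ?_
    rintro (_ | i)
    · simp
    · exact a.norm_coe_le_norm i)

/-- The left inverse of `shiftRight`. -/
def shiftLeft : CoeffSeq →L[ℂ] CoeffSeq :=
  LinearMap.mkContinuous
    { toFun := fun a => a.compContinuous ⟨Nat.succ, continuous_of_discreteTopology⟩
      map_add' := fun a b => rfl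
      map_smul' := fun c a => rfl } 1 (fun a => by
    rw [one_mul]
    exact (BoundedContinuousFunction.norm_le (norm_nonneg _)).2 fun i => a.norm_coe_le_norm _)

/-- The constant coefficient. -/
def coeffZero : CoeffSeq →L[ℂ] ℂ := BoundedContinuousFunction.evalCLM ℂ 0

/-- The Taylor coefficients of the constant `1`. -/
def oneSeq : CoeffSeq :=
  BoundedContinuousFunction.ofNormedAddCommGroupDiscrete (fun i => if i = 0 then 1 else 0) 1
    (fun i => by split_ifs <;> simp)

@[simp] theorem shiftRight_zero (a : CoeffSeq) : shiftRight a 0 = 0 := rfl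
@[simp] theorem shiftRight_succ (a : CoeffSeq) (i : ℕ) : shiftRight a (i + 1) = a i := rfl
@[simp] theorem shiftLeft_apply (a : CoeffSeq) (i : ℕ) : shiftLeft a i = a (i + 1) := rfl
@[simp] theorem coeffZero_apply (a : CoeffSeq) : coeffZero a = a 0 := rfl
theorem oneSeq_apply (i : ℕ) : oneSeq i = if i = 0 then 1 else 0 := rfl

theorem norm_shiftRight_le : ‖shiftRight‖ ≤ 1 := LinearMap.mkContinuous_norm_le _ zero_le_one _
theorem norm_shiftLeft_le : ‖shiftLeft‖ ≤ 1 := LinearMap.mkContinuous_norm_le _ zero_le_one _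

theorem shiftLeft_shiftRight (a : CoeffSeq) : shiftLeft (shiftRight a) = a := by
  ext i; simp

theorem shiftRight_shiftLeft (a : CoeffSeq) : shiftRight (shiftLeft a) + a 0 • oneSeq = a := by
  ext i; cases i <;> simp [oneSeq_apply]

theorem shiftLeft_iterate_apply (j : ℕ) (a : CoeffSeq) (i : ℕ) :
    (shiftLeft ^ j) a i = a (i + j) := by
  induction j generalizing a with
  | zero => simp
  | succ j ih => rw [pow_succ, mul_apply_eq_comp, ih]; rfl

/-- The sum at `t` of the power series with the given coefficients, for `|t| < 1`. -/
def evalSeq (t : ℂ) : CoeffSeq →L[ℂ] ℂ :=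
  -- By the Neumann series, the zeroth entry of `(1 - t • shiftLeft)⁻¹ a` is `∑ a k * t ^ k`. In
  -- this form analyticity in `t` is that of inversion in a Banach algebra.
  coeffZero.comp (Ring.inverse (1 - t • shiftLeft))

theorem isUnit_one_sub_shiftLeft {t : ℂ} (ht : ‖t‖ < 1) : IsUnit (1 - t • shiftLeft) := by
  refine isUnit_one_sub_of_norm_lt_one (R := CoeffSeq →L[ℂ] CoeffSeq) ?_
  rw [norm_smul]
  exact (mul_le_of_le_one_right (norm_nonneg _) norm_shiftLeft_le).trans_lt ht

theorem evalSeq_apply_sub {t : ℂ} (ht : ‖t‖ < 1) (a : CoeffSeq) :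
    evalSeq t (a - t • shiftLeft a) = a 0 := by
  have := congrArg (fun B : CoeffSeq →L[ℂ] CoeffSeq => B a)
    (Ring.inverse_mul_cancel _ (isUnit_one_sub_shiftLeft ht))
  simp only [mul_apply_eq_comp, one_apply_eq_self, sub_apply,
    smul_apply] at this
  simp [evalSeq, this]

theorem evalSeq_shiftRight {t : ℂ} (ht : ‖t‖ < 1) (a : CoeffSeq) :
    evalSeq t (shiftRight a) = t * evalSeq t a := by
  have := evalSeq_apply_sub ht (shiftRight a)
  rw [shiftLeft_shiftRight, map_sub, map_smul, shiftRight_zero, sub_eq_zero] at this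
  exact this

theorem evalSeq_oneSeq {t : ℂ} (ht : ‖t‖ < 1) : evalSeq t oneSeq = 1 := by
  have h : shiftLeft oneSeq = 0 := by ext i; simp [oneSeq_apply]
  have := evalSeq_apply_sub ht oneSeq
  rw [h, smul_zero, sub_zero] at this
  rw [this]; rfl

theorem analyticAt_evalSeq : AnalyticAt ℂ evalSeq 0 := by
  have h1 : AnalyticAt ℂ (fun t : ℂ => (1 : CoeffSeq →L[ℂ] CoeffSeq) - t • shiftLeft) 0 :=
    analyticAt_const.sub (analyticAt_id.smul analyticAt_const)
  have h2 : AnalyticAt ℂ Ring.inverse ((1 : CoeffSeq →L[ℂ] CoeffSeq) - (0 : ℂ) • shiftLeft) := by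
    have := analyticAt_inverse (𝕜 := ℂ) (A := CoeffSeq →L[ℂ] CoeffSeq) 1
    rwa [Units.val_one, show (1 : CoeffSeq →L[ℂ] CoeffSeq) = 1 - (0 : ℂ) • shiftLeft by
      ext a i; simp] at this
  have h3 : AnalyticAt ℂ (fun t : ℂ =>
      Ring.inverse ((1 : CoeffSeq →L[ℂ] CoeffSeq) - t • shiftLeft)) 0 :=
    AnalyticAt.comp (f := fun t : ℂ => (1 : CoeffSeq →L[ℂ] CoeffSeq) - t • shiftLeft) h2 h1
  exact ((ContinuousLinearMap.compL ℂ CoeffSeq CoeffSeq ℂ coeffZero).analyticAt _).comp h3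

/-- Identity theorem for power series. The value at `t = 0` is the constant coefficient; once it is
zero, the series may be divided by `t`, which is `shiftLeft`, and the argument repeats. -/
theorem eq_zero_of_evalSeq {a : CoeffSeq} (h : ∀ᶠ t in 𝓝 (0 : ℂ), evalSeq t a = 0) : a = 0 := by
  have hc : ∀ b : CoeffSeq, (∀ᶠ t in 𝓝 (0 : ℂ), evalSeq t b = 0) → b 0 = 0 := by
    intro b hb
    have := hb.self_of_nhds
    have e := evalSeq_apply_sub (t := 0) (by simp) b
    rw [zero_smul, sub_zero, this] at e
    exact e.symm
  have hs : ∀ b : CoeffSeq, (∀ᶠ t in 𝓝 (0 : ℂ), evalSeq t b = 0) →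
      ∀ᶠ t in 𝓝 (0 : ℂ), evalSeq t (shiftLeft b) = 0 := by
    intro b hb
    have hcont : ContinuousAt (fun t => evalSeq t (shiftLeft b)) 0 :=
      (analyticAt_evalSeq.continuousAt).clm_apply continuousAt_const
    have h1 : ∀ᶠ t in 𝓝[≠] (0 : ℂ), evalSeq t (shiftLeft b) = 0 := by
      have hb1 : ∀ᶠ t in 𝓝 (0 : ℂ), ‖t‖ < 1 := by
        filter_upwards [Metric.ball_mem_nhds (0 : ℂ) one_pos] with t ht using by simpa using ht
      filter_upwards [hb.filter_mono nhdsWithin_le_nhds, self_mem_nhdsWithin,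
        hb1.filter_mono nhdsWithin_le_nhds] with t ht ht0 ht1
      have e := shiftRight_shiftLeft b
      rw [hc b hb, zero_smul, add_zero] at e
      rw [← e, evalSeq_shiftRight ht1] at ht
      exact (mul_eq_zero.1 ht).resolve_left ht0
    have h0 : evalSeq 0 (shiftLeft b) = 0 := by
      refine tendsto_nhds_unique (hcont.tendsto.mono_left nhdsWithin_le_nhds) ?_ (l := 𝓝[≠] 0)
      exact tendsto_const_nhds.congr' (h1.mono fun _ h => h.symm)
    rw [eventually_nhdsWithin_iff] at h1
    filter_upwards [h1] with t ht
    by_cases h : t = 0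
    · rw [h]; exact h0
    · exact ht h
  have hk : ∀ k, ∀ᶠ t in 𝓝 (0 : ℂ), evalSeq t ((shiftLeft ^ k) a) = 0 := by
    intro k
    induction k with
    | zero => simpa using h
    | succ k ih =>
      rw [pow_succ', ContinuousLinearMap.mul_def]
      exact hs _ ih
  ext k
  have := hc _ (hk k)
  rw [shiftLeft_iterate_apply, zero_add] at this
  simpa using this

theorem evalSeq_shiftRight_pow {t : ℂ} (ht : ‖t‖ < 1) (j : ℕ) (a : CoeffSeq) :
    evalSeq t ((shiftRight ^ j) a) = t ^ j * evalSeq t a := by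
  induction j with
  | zero => simp
  | succ j ih =>
    rw [pow_succ', mul_apply_eq_comp, evalSeq_shiftRight ht, ih]; ring

/-- Polynomials of degree less than `N`, as sequences of Taylor coefficients. -/
def polySeq (N : ℕ) : (Fin N → ℂ) →L[ℂ] CoeffSeq :=
  ∑ j : Fin N, (ContinuousLinearMap.proj (R := ℂ) (φ := fun _ : Fin N => ℂ) j).smulRight
    ((shiftRight ^ (j : ℕ)) oneSeq)

theorem evalSeq_polySeq {t : ℂ} (ht : ‖t‖ < 1) (N : ℕ) (r : Fin N → ℂ) :
    evalSeq t (polySeq N r) = ∑ j : Fin N, r j * t ^ (j : ℕ) := by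
  simp only [polySeq, sum_apply, map_sum, ContinuousLinearMap.smulRight_apply, map_smul,
    ContinuousLinearMap.proj_apply, evalSeq_shiftRight_pow ht, evalSeq_oneSeq ht, mul_one,
    smul_eq_mul]

/-- Division by `t ^ N` on coefficient sequences, with the first `N` coefficients as remainder; this
is half of the invertibility of `divPow`. -/
theorem shiftRight_pow_shiftLeft_pow (N : ℕ) (a : CoeffSeq) :
    (shiftRight ^ N) ((shiftLeft ^ N) a) + polySeq N (fun j => a j) = a := by
  induction N with
  | zero => simp [polySeq]
  | succ N ih =>
    have e : polySeq (N + 1) (fun j => a j) =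
        polySeq N (fun j => a j) + a N • (shiftRight ^ N) oneSeq := by
      simp [polySeq, sum_apply, Fin.sum_univ_castSucc]
    have e2 := shiftRight_shiftLeft ((shiftLeft ^ N) a)
    rw [shiftLeft_iterate_apply, zero_add] at e2
    rw [e, pow_succ shiftRight, pow_succ' shiftLeft, mul_apply_eq_comp,
      mul_apply_eq_comp]
    conv_rhs => rw [← ih, ← e2, map_add, map_smul]
    abel

theorem shiftRight_pow_apply (N : ℕ) (a : CoeffSeq) (i : ℕ) :
    (shiftRight ^ N) a i = if i < N then 0 else a (i - N) := by
  induction N generalizing i with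
  | zero => simp
  | succ N ih =>
    rw [pow_succ', mul_apply_eq_comp]
    cases i with
    | zero => simp
    | succ i =>
      rw [shiftRight_succ, ih]
      simp only [Nat.add_lt_add_iff_right, Nat.add_sub_add_right]

theorem polySeq_apply (N : ℕ) (r : Fin N → ℂ) (i : ℕ) :
    polySeq N r i = if h : i < N then r ⟨i, h⟩ else 0 := by
  have : polySeq N r i = ∑ j : Fin N, r j * (if i = j then 1 else 0) := by
    simp only [polySeq, sum_apply, ContinuousLinearMap.smulRight_apply,
      ContinuousLinearMap.proj_apply]
    rw [BoundedContinuousFunction.coe_sum, Finset.sum_apply]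
    refine Finset.sum_congr rfl fun j _ => ?_
    rw [BoundedContinuousFunction.smul_apply, shiftRight_pow_apply, smul_eq_mul]
    congr 1
    rw [oneSeq_apply]
    split_ifs <;> first | rfl | omega
  rw [this]
  split_ifs with h
  · rw [Finset.sum_eq_single ⟨i, h⟩] <;> simp
    intro b hb hb'
    exact absurd (Fin.ext hb'.symm) hb
  · refine Finset.sum_eq_zero fun j _ => ?_
    rw [if_neg (by omega), mul_zero]

/-- Division by the `N`-th power of the variable. -/
def divPow (N : ℕ) (ρ : ℂ) (hρ : ρ ≠ 0) : (CoeffSeq × (Fin N → ℂ)) ≃L[ℂ] CoeffSeq :=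
  ContinuousLinearEquiv.equivOfInverse
    ((ρ • shiftRight ^ N).coprod (polySeq N))
    (ContinuousLinearMap.prod (ρ⁻¹ • shiftLeft ^ N)
      (ContinuousLinearMap.pi fun j => BoundedContinuousFunction.evalCLM ℂ (j : ℕ)))
    (by
      rintro ⟨a, r⟩
      refine Prod.ext ?_ ?_
      · ext i
        simp only [ContinuousLinearMap.coprod_apply, ContinuousLinearMap.prod_apply, smul_apply,
          BoundedContinuousFunction.coe_smul, shiftLeft_iterate_apply,
          BoundedContinuousFunction.coe_add, Pi.add_apply, shiftRight_pow_apply, polySeq_apply]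
        simp [hρ]
      · ext j
        simp only [ContinuousLinearMap.coprod_apply, ContinuousLinearMap.prod_apply, smul_apply,
          ContinuousLinearMap.pi_apply, BoundedContinuousFunction.evalCLM_apply,
          BoundedContinuousFunction.coe_smul,
          BoundedContinuousFunction.coe_add, Pi.add_apply, shiftRight_pow_apply, polySeq_apply]
        simp [j.2])
    (by
      intro a
      have := shiftRight_pow_shiftLeft_pow N a
      simp only [ContinuousLinearMap.coprod_apply, ContinuousLinearMap.prod_apply, smul_apply,
        map_smul, smul_smul, inv_mul_cancel₀ hρ, one_smul]
      exact this)

end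

/-! ### Operator calculus on coefficient sequences and Weierstrass division -/

/-- The point `(z₁, z')`. -/
abbrev consPoint {k : ℕ} (t : ℂ) (w : Fin k → ℂ) : Fin (k + 1) → ℂ :=
  Fin.cons (α := fun _ => ℂ) t w

/-- Ensures that the identity operator has norm one, as the functional calculus on operators
requires. -/
instance : Nontrivial CoeffSeq :=
  ⟨oneSeq, 0, fun h => by simpa [oneSeq_apply] using congrArg (fun a : CoeffSeq => a 0) h⟩

theorem analyticAt_clm_apply {E F G : Type*} [NormedAddCommGroup E] [NormedSpace ℂ E]
    [NormedAddCommGroup F] [NormedSpace ℂ F] [NormedAddCommGroup G] [NormedSpace ℂ G]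
    {B : E → F →L[ℂ] G} {b : E → F} {x : E} (hB : AnalyticAt ℂ B x) (hb : AnalyticAt ℂ b x) :
    AnalyticAt ℂ (fun y => B y (b y)) x :=
  ((ContinuousLinearMap.apply ℂ G).flip.analyticAt_bilinear (B x, b x)).comp₂ hB hb

/-- The affine family `(ρ S, z' • 1)` of operators. -/
def operatorPoint (k : ℕ) (ρ : ℂ) (w : Fin k → ℂ) : Fin (k + 1) → (CoeffSeq →L[ℂ] CoeffSeq) :=
  Fin.cons (α := fun _ => CoeffSeq →L[ℂ] CoeffSeq) (ρ • shiftRight) (fun i => w i • 1)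

theorem analyticAt_operatorPoint (k : ℕ) (ρ : ℂ) (w : Fin k → ℂ) :
    AnalyticAt ℂ (operatorPoint k ρ) w := by
  refine AnalyticAt.pi (f := fun i w => operatorPoint k ρ w i) fun i => ?_
  refine Fin.cases ?_ (fun i => ?_) i
  · exact analyticAt_const
  · exact ((ContinuousLinearMap.proj (R := ℂ) (φ := fun _ : Fin k => ℂ) i).analyticAt w).smul
      analyticAt_const

theorem operatorPoint_mem_ball {k : ℕ} {ρ : ℂ} {w : Fin k → ℂ} {δ : ℝ} (hρ : ‖ρ‖ < δ)
    (hw : ‖w‖ < δ) : operatorPoint k ρ w ∈ Metric.ball 0 δ := by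
  have hδ : 0 < δ := (norm_nonneg _).trans_lt hρ
  rw [mem_ball_zero_iff, pi_norm_lt_iff hδ]
  refine Fin.cases ?_ (fun i => ?_)
  · simp only [operatorPoint, Fin.cons_zero, norm_smul]
    exact (mul_le_of_le_one_right (norm_nonneg _) norm_shiftRight_le).trans_lt hρ
  · simp only [operatorPoint, Fin.cons_succ, norm_smul]
    exact (mul_le_of_le_one_right (norm_nonneg _) ContinuousLinearMap.norm_id_le).trans_lt
      ((norm_le_pi_norm w i).trans_lt hw)

/-- The operator `G w` is the functional calculus of `f` at the shift scaled by `ρ` and the scalars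
`w i`, and `evalSeq t` plays the role of `T` in `exists_analytic_calculus`. The factor `ρ` moves the
shift, whose norm is at most one, into the ball of convergence while `t` still ranges over the whole
unit disc. -/
theorem exists_operator_calculus {k : ℕ} {f : (Fin (k + 1) → ℂ) → ℂ} (hf : AnalyticAt ℂ f 0) :
    ∃ δ : ℝ, 0 < δ ∧ ∀ ρ : ℂ, ‖ρ‖ < δ → ∃ G : (Fin k → ℂ) → (CoeffSeq →L[ℂ] CoeffSeq),
      AnalyticAt ℂ G 0 ∧ ∀ᶠ w in 𝓝 (0 : Fin k → ℂ), ∀ t : ℂ, ‖t‖ < 1 → ∀ a,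
        evalSeq t (G w a) = f (consPoint (ρ * t) w) * evalSeq t a := by
  obtain ⟨F, δ, hδ, hF, h⟩ := exists_analytic_calculus (CoeffSeq →L[ℂ] CoeffSeq) hf
  refine ⟨δ, hδ, fun ρ hρ => ⟨fun w => F (operatorPoint k ρ w), ?_, ?_⟩⟩
  · exact (hF _ (operatorPoint_mem_ball hρ (by simpa using hδ))).comp
      (analyticAt_operatorPoint k ρ 0)
  · filter_upwards [Metric.ball_mem_nhds (0 : Fin k → ℂ) hδ] with w hw t ht a
    rw [mem_ball_zero_iff] at hw
    have hT := h (CoeffSeq →L[ℂ] ℂ) (ContinuousLinearMap.compL ℂ CoeffSeq CoeffSeq ℂ (evalSeq t))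
      (operatorPoint k ρ w) (consPoint (ρ * t) w) (operatorPoint_mem_ball hρ hw) (by
        rw [mem_ball_zero_iff, pi_norm_lt_iff hδ]
        refine Fin.cases ?_ (fun i => ?_)
        · simp only [Fin.cons_zero, norm_mul]
          exact (mul_le_of_le_one_right (norm_nonneg _) ht.le).trans_lt hρ
        · exact (norm_le_pi_norm w i).trans_lt hw) (by
        refine Fin.cases (fun B => ?_) (fun i B => ?_)
        · ext a
          simp [operatorPoint, evalSeq_shiftRight ht, mul_assoc]
        · ext a
          simp [operatorPoint])
    have := congrArg (fun B : CoeffSeq →L[ℂ] ℂ => B a) hT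
    simpa using this

theorem analyticAt_tail {k : ℕ} (z : Fin (k + 1) → ℂ) :
    AnalyticAt ℂ (fun z : Fin (k + 1) → ℂ => Fin.tail z) z :=
  (ContinuousLinearMap.pi (R := ℂ) (φ := fun _ : Fin k => ℂ)
    fun i => ContinuousLinearMap.proj (R := ℂ) (φ := fun _ : Fin (k + 1) => ℂ) i.succ).analyticAt z

theorem analyticAt_coord {k : ℕ} (i : Fin k) (z : Fin k → ℂ) :
    AnalyticAt ℂ (fun z : Fin k → ℂ => z i) z :=
  (ContinuousLinearMap.proj (R := ℂ) (φ := fun _ : Fin k => ℂ) i).analyticAt z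

theorem tail_zero {k : ℕ} : Fin.tail (0 : Fin (k + 1) → ℂ) = 0 := rfl

theorem tendsto_tail {k : ℕ} :
    Filter.Tendsto (fun z : Fin (k + 1) → ℂ => Fin.tail z) (𝓝 0) (𝓝 (0 : Fin k → ℂ)) :=
  (analyticAt_tail (0 : Fin (k + 1) → ℂ)).continuousAt.tendsto

/-- **Weierstrass division theorem**, for a divisor whose restriction to the first axis is
a power of the variable. -/
theorem weierstrass_division {k N : ℕ} {f g : (Fin (k + 1) → ℂ) → ℂ} (hf : AnalyticAt ℂ f 0)
    (hg : AnalyticAt ℂ g 0) (h0 : ∀ᶠ t in 𝓝 (0 : ℂ), f (consPoint t 0) = t ^ N) :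
    ∃ (q : (Fin (k + 1) → ℂ) → ℂ) (r : Fin N → (Fin k → ℂ) → ℂ), AnalyticAt ℂ q 0 ∧
      (∀ j, AnalyticAt ℂ (r j) 0) ∧
      ∀ᶠ z in 𝓝 0, g z = q z * f z + ∑ j, r j (Fin.tail z) * z 0 ^ (j : ℕ) := by
  obtain ⟨δ₁, hδ₁, H₁⟩ := exists_operator_calculus hf
  obtain ⟨δ₂, hδ₂, H₂⟩ := exists_operator_calculus hg
  -- Half of the smaller radius, so that one scale serves both the divisor and the dividend.
  set ρ : ℂ := ((min δ₁ δ₂ / 2 : ℝ) : ℂ) with hρdef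
  have hm : 0 < min δ₁ δ₂ := lt_min hδ₁ hδ₂
  have hρn : ‖ρ‖ = min δ₁ δ₂ / 2 := by
    rw [hρdef, Complex.norm_real, Real.norm_of_nonneg (by positivity)]
  have hρ0 : ρ ≠ 0 := by
    rw [← norm_pos_iff, hρn]; positivity
  obtain ⟨F, hF, hFe⟩ := H₁ ρ (by rw [hρn]; linarith [min_le_left δ₁ δ₂])
  obtain ⟨G, hG, hGe⟩ := H₂ ρ (by rw [hρn]; linarith [min_le_right δ₁ δ₂])
  have hlt : ∀ᶠ t in 𝓝 (0 : ℂ), ‖t‖ < 1 := by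
    filter_upwards [Metric.ball_mem_nhds (0 : ℂ) one_pos] with t ht using by simpa using ht
  -- the divisor acts as a multiple of a power of the shift on the axis
  have hF0 : F 0 = ρ ^ N • shiftRight ^ N := by
    ext1 a
    rw [← sub_eq_zero]
    refine eq_zero_of_evalSeq ?_
    have hmul : Filter.Tendsto (fun t : ℂ => ρ * t) (𝓝 0) (𝓝 0) := by
      have : Continuous fun t : ℂ => ρ * t := by fun_prop
      simpa using this.tendsto 0
    filter_upwards [hlt, hmul.eventually h0] with t ht ht'
    rw [map_sub, hFe.self_of_nhds t ht a, ht', smul_apply, map_smul,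
      evalSeq_shiftRight_pow ht, smul_eq_mul]
    ring
  -- The division map `(q, r) ↦ f q + r` over the parameter `w`. At `w = 0` it is `divPow`, an
  -- isomorphism; invertibility is an open condition and inversion is analytic, so quotient and
  -- remainder depend analytically on `w`.
  let Lw : (Fin k → ℂ) → ((CoeffSeq × (Fin N → ℂ)) →L[ℂ] CoeffSeq) :=
    fun w => (F w).coprod (polySeq N)
  have hLw : AnalyticAt ℂ Lw 0 := by
    have h1 : Lw = fun w => (ContinuousLinearMap.compL ℂ (CoeffSeq × (Fin N → ℂ)) CoeffSeq
        CoeffSeq).flip (ContinuousLinearMap.fst ℂ CoeffSeq (Fin N → ℂ)) (F w) +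
        (polySeq N).comp (ContinuousLinearMap.snd ℂ CoeffSeq (Fin N → ℂ)) := by
      funext w
      ext <;> simp [Lw]
    rw [h1]
    exact ((ContinuousLinearMap.analyticAt _ _).comp hF).add analyticAt_const
  have hL0 : Lw 0 = (divPow N (ρ ^ N) (pow_ne_zero _ hρ0) :
      (CoeffSeq × (Fin N → ℂ)) →L[ℂ] CoeffSeq) := by
    ext1 <;> simp only [Lw, hF0] <;> rfl
  have hinv : AnalyticAt ℂ ContinuousLinearMap.inverse (Lw 0) := by
    rw [hL0]
    exact (contDiffAt_map_inverse (n := ω) _).analyticAt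
  let qr : (Fin k → ℂ) → CoeffSeq × (Fin N → ℂ) := fun w =>
    (ContinuousLinearMap.inverse (Lw w)) (G w oneSeq)
  have hqr : AnalyticAt ℂ qr 0 :=
    analyticAt_clm_apply (hinv.comp hLw) (analyticAt_clm_apply hG analyticAt_const)
  have hsol : ∀ᶠ w in 𝓝 (0 : Fin k → ℂ), Lw w (qr w) = G w oneSeq := by
    have hnhds := ContinuousLinearEquiv.nhds (divPow N (ρ ^ N) (pow_ne_zero _ hρ0))
    rw [← hL0] at hnhds
    filter_upwards [hLw.continuousAt.eventually_mem hnhds] with w ⟨e, he⟩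
    simp only [qr, ← he, ContinuousLinearMap.inverse_equiv]
    exact e.apply_symm_apply _
  have hdiv0 : AnalyticAt ℂ (fun z : Fin (k + 1) → ℂ => z 0 / ρ) 0 :=
    (analyticAt_coord 0 0).div analyticAt_const hρ0
  have hqt : AnalyticAt ℂ (fun z : Fin (k + 1) → ℂ => qr (Fin.tail z)) 0 :=
    AnalyticAt.comp (g := qr) (f := fun z : Fin (k + 1) → ℂ => Fin.tail z) hqr (analyticAt_tail 0)
  have hev : AnalyticAt ℂ (fun z : Fin (k + 1) → ℂ => evalSeq (z 0 / ρ)) 0 := by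
    refine AnalyticAt.fun_comp (g := evalSeq) (f := fun z : Fin (k + 1) → ℂ => z 0 / ρ) ?_ hdiv0
    simpa using analyticAt_evalSeq
  -- The power series variable is `z 0 / ρ`, so the `j`-th remainder coefficient acquires the factor
  -- `ρ⁻¹ ^ j`.
  refine ⟨fun z => evalSeq (z 0 / ρ) (qr (Fin.tail z)).1,
    fun j w => (qr w).2 j * (ρ⁻¹) ^ (j : ℕ), analyticAt_clm_apply hev (analyticAt_fst.comp hqt),
    fun j => ?_, ?_⟩
  · exact (((ContinuousLinearMap.proj (R := ℂ) (φ := fun _ : Fin N => ℂ) j).comp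
      (ContinuousLinearMap.snd ℂ CoeffSeq (Fin N → ℂ))).analyticAt _).comp hqr |>.mul
      analyticAt_const
  · have ht1 : ∀ᶠ z in 𝓝 (0 : Fin (k + 1) → ℂ), ‖z 0 / ρ‖ < 1 := by
      have := hdiv0.continuousAt.tendsto.eventually (p := fun t => ‖t‖ < 1) (by simpa using hlt)
      simpa using this
    filter_upwards [tendsto_tail.eventually hFe, tendsto_tail.eventually hGe,
      tendsto_tail.eventually hsol, ht1] with z hz1 hz2 hz3 hz4
    have e1 := hz1 (z 0 / ρ) hz4 (qr (Fin.tail z)).1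
    have e2 := hz2 (z 0 / ρ) hz4 oneSeq
    have hz : consPoint (ρ * (z 0 / ρ)) (Fin.tail z) = z := by
      rw [mul_div_cancel₀ _ hρ0]; exact Fin.cons_self_tail z
    rw [hz] at e1 e2
    have e3 := congrArg (evalSeq (z 0 / ρ)) hz3
    simp only [Lw, ContinuousLinearMap.coprod_apply, map_add] at e3
    rw [e1, e2, evalSeq_oneSeq hz4, evalSeq_polySeq hz4, mul_one] at e3
    rw [← e3, mul_comm]
    congr 1
    refine Finset.sum_congr rfl fun j _ => ?_
    rw [div_pow, inv_pow]
    ring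

section

open Polynomial

/-! ### Weierstrass polynomials and preparation -/

/-- A polynomial that is divisible by `P` near all roots of `P`, and of smaller degree, vanishes. -/
theorem eq_zero_of_eval_eq_mul {D : Set ℂ} (hD : IsOpen D) {k : ℂ → ℂ} (hk : ContinuousOn k D) :
    ∀ (d : ℕ) (P A : ℂ[X]), P.Monic → P.natDegree = d → A.degree < P.degree →
      (∀ a, P.IsRoot a → a ∈ D) → (∀ z ∈ D, A.eval z = P.eval z * k z) → A = 0 := by
  intro d
  induction d with
  | zero =>
    intro P A hP hd hA _ _
    rw [hP.natDegree_eq_zero.1 hd, degree_one] at hA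
    by_contra h
    have := zero_le_degree_iff.2 h
    exact absurd hA (not_lt.2 this)
  | succ d ih =>
    intro P A hP hd hA hroot heq
    obtain ⟨a, ha⟩ := Complex.exists_root (f := P) (natDegree_pos_iff_degree_pos.1 (by omega))
    have haD := hroot a ha
    obtain ⟨P', rfl⟩ := dvd_iff_isRoot.2 ha
    have hAa : A.IsRoot a := by
      rw [IsRoot, heq a haD]; simp
    obtain ⟨A', rfl⟩ := dvd_iff_isRoot.2 hAa
    have hP' : P'.Monic := (monic_X_sub_C a).of_mul_monic_left hP
    have hd' : P'.natDegree = d := by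
      rw [(monic_X_sub_C a).natDegree_mul hP', natDegree_X_sub_C] at hd; omega
    have hA' : A'.degree < P'.degree := by
      rw [degree_mul, degree_mul, degree_X_sub_C] at hA
      exact lt_of_add_lt_add_left hA
    have hne : ∀ z ∈ D, z ≠ a → A'.eval z = P'.eval z * k z := by
      intro z hz hza
      have := heq z hz
      simp only [eval_mul, eval_sub, eval_X, eval_C] at this
      rw [mul_assoc] at this
      exact mul_left_cancel₀ (sub_ne_zero.2 hza) this
    -- Cancelling `z - a` gives the factorization off `a`; continuity extends it to `a` itself, so
    -- that the induction also handles repeated roots.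
    have hka : ContinuousAt k a := hk.continuousAt (hD.mem_nhds haD)
    have hlim : A'.eval a = P'.eval a * k a := by
      refine tendsto_nhds_unique (f := fun z => A'.eval z) (l := 𝓝[≠] a)
        (A'.continuous.continuousAt.tendsto.mono_left nhdsWithin_le_nhds) ?_
      refine Filter.Tendsto.congr' (f₁ := fun z => P'.eval z * k z) ?_
        ((P'.continuous.continuousAt.mul hka).tendsto.mono_left nhdsWithin_le_nhds)
      filter_upwards [self_mem_nhdsWithin, nhdsWithin_le_nhds (hD.mem_nhds haD)] with z hz hzD
      exact (hne z hzD hz).symm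
    have := ih P' A' hP' hd' hA' (fun b hb => hroot b (by simp [IsRoot, hb.eq_zero]))
      (fun z hz => by
        by_cases h : z = a
        · rw [h]; exact hlim
        · exact hne z hz h)
    rw [this, mul_zero]

/-- The polynomial with prescribed lower coefficients. -/
def lowPoly {N : ℕ} (c : Fin N → ℂ) : ℂ[X] := ∑ j : Fin N, C (c j) * X ^ (j : ℕ)

theorem eval_lowPoly {N : ℕ} (c : Fin N → ℂ) (t : ℂ) :
    (lowPoly c).eval t = ∑ j : Fin N, c j * t ^ (j : ℕ) := by
  simp [lowPoly, eval_finsetSum]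

theorem degree_lowPoly_lt {N : ℕ} (c : Fin N → ℂ) : (lowPoly c).degree < N := by
  exact degree_sum_fin_lt c

theorem coeff_lowPoly {N : ℕ} (c : Fin N → ℂ) (i : ℕ) :
    (lowPoly c).coeff i = if h : i < N then c ⟨i, h⟩ else 0 := by
  simp only [lowPoly, finsetSum_coeff, coeff_C_mul, coeff_X_pow]
  split_ifs with h
  · rw [Finset.sum_eq_single ⟨i, h⟩] <;> simp
    intro b hb hb'
    exact absurd (Fin.ext hb'.symm) hb
  · refine Finset.sum_eq_zero fun j _ => ?_
    rw [if_neg (by omega), mul_zero]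

theorem lowPoly_eq_zero {N : ℕ} {c : Fin N → ℂ} (h : lowPoly c = 0) (j : Fin N) : c j = 0 := by
  have := coeff_lowPoly c j
  simpa [h, j.2] using this.symm

namespace IsWeierstrassPoly

variable {k N : ℕ} {P : (Fin k → ℂ) → ℂ[X]}

theorem evalFamily_eq (hP : IsWeierstrassPoly P N) (z : Fin (k + 1) → ℂ) :
    evalFamily P z = ∑ i ∈ Finset.range (N + 1), (P (Fin.tail z)).coeff i * z 0 ^ i := by
  rw [evalFamily, eval_eq_sum_range, hP.natDegree]

/-- The coefficients are simultaneously analytic on a neighbourhood of the origin. -/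
theorem eventually_analyticAt (hP : IsWeierstrassPoly P N) :
    ∀ᶠ w in 𝓝 (0 : Fin k → ℂ), ∀ i, AnalyticAt ℂ (fun w => (P w).coeff i) w := by
  have h1 : ∀ᶠ w in 𝓝 (0 : Fin k → ℂ), ∀ i ∈ Finset.range (N + 1),
      AnalyticAt ℂ (fun w => (P w).coeff i) w :=
    (Filter.eventually_all_finset _).2 fun i _ => (hP.analytic i).eventually_analyticAt
  filter_upwards [h1] with w hw i
  by_cases hi : i ∈ Finset.range (N + 1)
  · exact hw i hi
  · have : (fun w => (P w).coeff i) = fun _ => 0 := by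
      funext w
      refine coeff_eq_zero_of_natDegree_lt ?_
      rw [hP.natDegree]
      simpa using hi
    rw [this]
    exact analyticAt_const

theorem analyticAt_evalFamily_of (hP : IsWeierstrassPoly P N) {z : Fin (k + 1) → ℂ}
    (hz : ∀ i, AnalyticAt ℂ (fun w => (P w).coeff i) (Fin.tail z)) :
    AnalyticAt ℂ (evalFamily P) z := by
  have : evalFamily P = fun z => ∑ i ∈ Finset.range (N + 1),
      (P (Fin.tail z)).coeff i * z 0 ^ i := funext hP.evalFamily_eq
  rw [this]
  refine Finset.analyticAt_fun_sum _ fun i _ => ?_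
  exact (AnalyticAt.comp (g := fun w => (P w).coeff i)
    (f := fun z : Fin (k + 1) → ℂ => Fin.tail z) (hz i) (analyticAt_tail z)).mul
    ((analyticAt_coord 0 z).pow i)

theorem analyticAt_evalFamily (hP : IsWeierstrassPoly P N) : AnalyticAt ℂ (evalFamily P) 0 :=
  hP.analyticAt_evalFamily_of hP.analytic

theorem evalFamily_cons_zero (hP : IsWeierstrassPoly P N) (t : ℂ) :
    evalFamily P (consPoint t 0) = t ^ N := by
  simp [evalFamily, hP.at_zero]

/-- **Weierstrass division** by a Weierstrass polynomial. -/
theorem division (hP : IsWeierstrassPoly P N) {g : (Fin (k + 1) → ℂ) → ℂ}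
    (hg : AnalyticAt ℂ g 0) :
    ∃ (q : (Fin (k + 1) → ℂ) → ℂ) (r : Fin N → (Fin k → ℂ) → ℂ), AnalyticAt ℂ q 0 ∧
      (∀ j, AnalyticAt ℂ (r j) 0) ∧
      ∀ᶠ z in 𝓝 0, g z = q z * evalFamily P z + ∑ j, r j (Fin.tail z) * z 0 ^ (j : ℕ) :=
  weierstrass_division hP.analyticAt_evalFamily hg
    (Filter.Eventually.of_forall hP.evalFamily_cons_zero)

/-- The roots of a Weierstrass polynomial are small for small parameters. -/
theorem eventually_roots_small (hP : IsWeierstrassPoly P N) {ε : ℝ} (hε : 0 < ε) :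
    ∀ᶠ w in 𝓝 (0 : Fin k → ℂ), ∀ a, (P w).IsRoot a → ‖a‖ < ε := by
  -- If `‖a‖ ≥ ε`, then `‖a‖ ^ j ≤ ‖a‖ ^ N / ε ^ (N - j)`. The equation for a root then bounds `‖a‖
  -- ^ N` by this sum times `‖a‖ ^ N`, which is absurd once the sum is below `1`. At `w = 0` the sum
  -- is zero.
  have hcont : ContinuousAt (fun w => ∑ j ∈ Finset.range N, ‖(P w).coeff j‖ * (ε ^ (N - j))⁻¹) 0 := by
    refine tendsto_finsetSum _ fun j _ => ?_
    exact ((hP.analytic j).continuousAt.norm.mul continuousAt_const)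
  have h0 : (∑ j ∈ Finset.range N, ‖(P 0).coeff j‖ * (ε ^ (N - j))⁻¹) < 1 := by
    rw [Finset.sum_eq_zero]
    · exact one_pos
    · intro j hj
      rw [hP.at_zero, coeff_X_pow, if_neg (by simpa using (Finset.mem_range.1 hj).ne)]
      simp
  filter_upwards [hcont.eventually_lt_const h0] with w hw a ha
  by_contra! hle
  have ha0 : 0 < ‖a‖ := hε.trans_le hle
  have e : a ^ N = -∑ j ∈ Finset.range N, (P w).coeff j * a ^ j := by
    have h1 := ha.eq_zero
    have h2 : (P w).coeff N = 1 := by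
      have := hP.monic w
      rwa [Monic, leadingCoeff, hP.natDegree] at this
    rw [eval_eq_sum_range, hP.natDegree, Finset.sum_range_succ, h2, one_mul] at h1
    linear_combination h1
  have h3 : ‖a‖ ^ N ≤ ∑ j ∈ Finset.range N, ‖(P w).coeff j‖ * ‖a‖ ^ j := by
    rw [← norm_pow, e, norm_neg]
    refine (norm_sum_le _ _).trans (le_of_eq ?_)
    simp
  have h4 : ∑ j ∈ Finset.range N, ‖(P w).coeff j‖ * ‖a‖ ^ j ≤
      (∑ j ∈ Finset.range N, ‖(P w).coeff j‖ * (ε ^ (N - j))⁻¹) * ‖a‖ ^ N := by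
    rw [Finset.sum_mul]
    refine Finset.sum_le_sum fun j hj => ?_
    rw [mul_assoc]
    refine mul_le_mul_of_nonneg_left ?_ (norm_nonneg _)
    have hj' := (Finset.mem_range.1 hj).le
    rw [← Nat.sub_add_cancel hj', pow_add, Nat.sub_add_cancel hj', ← mul_assoc]
    refine le_mul_of_one_le_left (by positivity) ?_
    rw [inv_mul_eq_div, one_le_div (by positivity)]
    gcongr
  have h5 := h3.trans h4
  have h6 : 0 < ‖a‖ ^ N := by positivity
  nlinarith

end IsWeierstrassPoly

/-- **Weierstrass preparation theorem.** -/
theorem weierstrass_preparation {k : ℕ} {f : (Fin (k + 1) → ℂ) → ℂ} (hf : AnalyticAt ℂ f 0)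
    (h0 : ¬ ∀ᶠ t in 𝓝 (0 : ℂ), f (consPoint t 0) = 0) :
    ∃ (P : (Fin k → ℂ) → ℂ[X]) (N : ℕ), IsWeierstrassPolyOf f P N := by
  have hcons : AnalyticAt ℂ (fun t : ℂ => consPoint t (0 : Fin k → ℂ)) 0 := by
    refine AnalyticAt.pi (f := fun i (t : ℂ) => consPoint t (0 : Fin k → ℂ) i) fun i => ?_
    refine Fin.cases ?_ (fun i => ?_) i
    · exact analyticAt_id
    · exact analyticAt_const
  have hc0 : consPoint (0 : ℂ) (0 : Fin k → ℂ) = 0 := by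
    funext i; refine Fin.cases rfl (fun _ => rfl) i
  have hf1 : AnalyticAt ℂ (fun t : ℂ => f (consPoint t 0)) 0 :=
    AnalyticAt.comp (g := f) (f := fun t : ℂ => consPoint t (0 : Fin k → ℂ)) (by rwa [hc0]) hcons
  obtain ⟨N, v, hv, hv0, hfv⟩ := hf1.exists_eventuallyEq_pow_smul_nonzero_iff.2 h0
  have hvz : AnalyticAt ℂ (fun z : Fin (k + 1) → ℂ => v (z 0)) 0 :=
    AnalyticAt.comp (g := v) (f := fun z : Fin (k + 1) → ℂ => z 0) hv (analyticAt_coord 0 0)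
  have hft : AnalyticAt ℂ (fun z : Fin (k + 1) → ℂ => f z / v (z 0)) 0 := hf.div hvz hv0
  have hvne : ∀ᶠ t in 𝓝 (0 : ℂ), v t ≠ 0 := hv.continuousAt.eventually_ne hv0
  have hcoord : Filter.Tendsto (fun z : Fin (k + 1) → ℂ => z 0) (𝓝 0) (𝓝 0) :=
    (analyticAt_coord 0 (0 : Fin (k + 1) → ℂ)).continuousAt.tendsto
  -- After division by the unit `v` the divisor is exactly `t ^ N` on the axis. Dividing `z₁ ^ N` by
  -- it, the remainder supplies the lower coefficients of the Weierstrass polynomial and the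
  -- quotient supplies the unit.
  obtain ⟨q, r, hq, hr, hqr⟩ := weierstrass_division (N := N) hft ((analyticAt_coord 0 0).pow N) (by
    filter_upwards [hfv, hvne] with t h1 h2
    simp only [Fin.cons_zero]
    rw [h1, sub_zero, smul_eq_mul, mul_div_assoc, div_self h2, mul_one])
  -- on the axis the remainder vanishes
  have hqc : AnalyticAt ℂ (fun t : ℂ => q (consPoint t 0)) 0 :=
    AnalyticAt.comp (g := q) (f := fun t : ℂ => consPoint t (0 : Fin k → ℂ)) (by rwa [hc0]) hcons
  have haxis : ∀ᶠ t in 𝓝 (0 : ℂ), (lowPoly fun j => r j 0).eval t =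
      t ^ N * (1 - q (consPoint t 0)) := by
    have ht : Filter.Tendsto (fun t : ℂ => consPoint t (0 : Fin k → ℂ)) (𝓝 0) (𝓝 0) := by
      have := hcons.continuousAt.tendsto
      rwa [hc0] at this
    filter_upwards [ht.eventually hqr, hfv, hvne] with t h1 h2 h3
    rw [eval_lowPoly]
    simp only [Fin.cons_zero, Fin.tail_cons, Pi.pow_apply] at h1
    rw [h2, sub_zero, smul_eq_mul, mul_div_assoc, div_self h3] at h1
    linear_combination -h1
  have hr0 : ∀ j, r j 0 = 0 := by
    obtain ⟨ε, hε, hb⟩ := Metric.eventually_nhds_iff_ball.1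
      (haxis.and hqc.eventually_analyticAt)
    -- On the axis the remainder has degree below `N` and is `t ^ N` times a continuous function,
    -- hence vanishes.
    refine lowPoly_eq_zero (eq_zero_of_eval_eq_mul (D := Metric.ball 0 ε) Metric.isOpen_ball
      (k := fun t => 1 - q (consPoint t 0)) ?_ N (X ^ N) _ (monic_X_pow N)
      (natDegree_X_pow N) ?_ ?_ ?_)
    · exact fun t ht => (continuousAt_const.sub (hb t ht).2.continuousAt).continuousWithinAt
    · rw [degree_X_pow]; exact degree_lowPoly_lt _
    · intro a ha
      have : a = 0 := by
        have := ha.eq_zero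
        rw [eval_pow, eval_X] at this
        exact eq_zero_of_pow_eq_zero this
      rw [this]; exact Metric.mem_ball_self hε
    · intro t ht
      rw [(hb t ht).1, eval_pow, eval_X]
  -- With zero remainder the axis identity forces `q = 1` away from the origin, and continuity
  -- excludes `q 0 = 0`.
  have hq0 : q 0 ≠ 0 := by
    intro hq0
    have hlow : (lowPoly fun j => r j 0) = 0 := by
      simp [lowPoly, hr0]
    have h1 : ∀ᶠ t in 𝓝[≠] (0 : ℂ), q (consPoint t 0) = 1 := by
      filter_upwards [haxis.filter_mono nhdsWithin_le_nhds, self_mem_nhdsWithin] with t ht ht0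
      rw [hlow, eval_zero] at ht
      have := (mul_eq_zero.1 ht.symm).resolve_left (pow_ne_zero _ ht0)
      linear_combination -this
    have h2 : Filter.Tendsto (fun t : ℂ => q (consPoint t 0)) (𝓝[≠] 0) (𝓝 0) := by
      have := hqc.continuousAt.tendsto.mono_left (nhdsWithin_le_nhds (s := {0}ᶜ))
      rwa [hc0, hq0] at this
    exact zero_ne_one (tendsto_nhds_unique h2
      (tendsto_const_nhds.congr' (h1.mono fun _ h => h.symm)))
  refine ⟨fun w => X ^ N - lowPoly fun j => r j w, N, ⟨?_, ?_, ?_, ?_⟩, fun z => v (z 0) / q z,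
    hvz.div hq hq0, div_ne_zero hv0 hq0, ?_⟩
  · intro w; exact monic_X_pow_sub (degree_lowPoly_lt _)
  · intro w
    refine natDegree_eq_of_degree_eq_some ?_
    rw [degree_sub_eq_left_of_degree_lt, degree_X_pow]
    rw [degree_X_pow]; exact degree_lowPoly_lt _
  · intro i
    simp only [coeff_sub, coeff_lowPoly]
    refine analyticAt_const.sub ?_
    by_cases h : i < N
    · simp only [h, dif_pos]; exact hr _
    · simp only [h, dif_neg, not_false_eq_true]; exact analyticAt_const
  · simp [lowPoly, hr0]
  · filter_upwards [hqr, hq.continuousAt.eventually_ne hq0, hcoord.eventually hvne] with z h1 h2 h3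
    simp only [evalFamily, eval_sub, eval_pow, eval_X, eval_lowPoly]
    simp only [Pi.pow_apply] at h1
    rw [h1]
    field_simp
    ring

end

section

open MeasureTheory Polynomial

/-! ### Integration in the first variable and logarithmic derivatives -/

theorem measurePreserving_cons (k : ℕ) :
    MeasurePreserving (fun x : ℂ × (Fin k → ℂ) => consPoint x.1 x.2) := by
  have h := (volume_preserving_piFinSuccAbove (fun _ : Fin (k + 1) => ℂ) 0).symm
  have e : (fun x : ℂ × (Fin k → ℂ) => consPoint x.1 x.2) =
      (MeasurableEquiv.piFinSuccAbove (fun _ : Fin (k + 1) => ℂ) 0).symm := by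
    funext x
    simp [MeasurableEquiv.piFinSuccAbove, consPoint, Fin.consEquiv]
  rw [e]; exact h

theorem measurableEmbedding_cons (k : ℕ) :
    MeasurableEmbedding (fun x : ℂ × (Fin k → ℂ) => consPoint x.1 x.2) := by
  have e : (fun x : ℂ × (Fin k → ℂ) => consPoint x.1 x.2) =
      (MeasurableEquiv.piFinSuccAbove (fun _ : Fin (k + 1) => ℂ) 0).symm := by
    funext x
    simp [MeasurableEquiv.piFinSuccAbove, consPoint, Fin.consEquiv]
  rw [e]; exact MeasurableEquiv.measurableEmbedding _

theorem lintegral_cons {k : ℕ} {F : (Fin (k + 1) → ℂ) → ENNReal} (hF : AEMeasurable F) :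
    ∫⁻ z, F z = ∫⁻ w : Fin k → ℂ, ∫⁻ t : ℂ, F (consPoint t w) := by
  rw [← (measurePreserving_cons k).lintegral_comp_emb (measurableEmbedding_cons k),
    Measure.volume_eq_prod, lintegral_prod_symm]
  rw [← Measure.volume_eq_prod]
  exact hF.comp_quasiMeasurePreserving (measurePreserving_cons k).quasiMeasurePreserving

theorem integral_cons {k : ℕ} {F : (Fin (k + 1) → ℂ) → ℂ} (hF : Integrable F) :
    ∫ z, F z = ∫ w : Fin k → ℂ, ∫ t : ℂ, F (consPoint t w) := by
  rw [← (measurePreserving_cons k).integral_comp (measurableEmbedding_cons k),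
    Measure.volume_eq_prod, integral_prod_symm]
  rw [← Measure.volume_eq_prod]
  exact (measurePreserving_cons k).integrable_comp_of_integrable hF

/-- The integrals of `1 / |z - a|` over the unit disc are uniformly bounded. -/
theorem exists_lintegral_inv_le : ∃ C : ENNReal, C < ⊤ ∧
    ∀ a : ℂ, ∫⁻ z in Metric.ball (0 : ℂ) 1, ‖z - a‖ₑ⁻¹ ≤ C := by
  have h0 : ∫⁻ z in Metric.ball (0 : ℂ) 1, ‖z‖ₑ⁻¹ < ⊤ := by
    -- In polar coordinates the Jacobian `r` cancels the singularity `1 / r`.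
    rw [← lintegral_indicator measurableSet_ball, ← Complex.lintegral_comp_polarCoord_symm]
    calc _ ≤ ∫⁻ p in polarCoord.target, (Set.Ioo (0 : ℝ) 1 ×ˢ Set.Ioo (-Real.pi) Real.pi).indicator
          (fun _ => 1) p := by
          refine setLIntegral_mono' polarCoord.open_target.measurableSet fun p hp => ?_
          rw [polarCoord_target] at hp
          have hp1 : 0 < p.1 := hp.1
          have hn : ‖Complex.polarCoord.symm p‖ = p.1 := by
            rw [Complex.norm_polarCoord_symm, abs_of_pos hp1]
          by_cases h : Complex.polarCoord.symm p ∈ Metric.ball (0 : ℂ) 1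
          · rw [Set.indicator_of_mem h, Set.indicator_of_mem, ← ofReal_norm, hn, smul_eq_mul,
              ENNReal.mul_inv_cancel]
            · simpa using hp1
            · simp
            · refine ⟨⟨hp1, ?_⟩, hp.2⟩
              rw [mem_ball_zero_iff, hn] at h
              exact h
          · rw [Set.indicator_of_notMem h]; simp
      _ ≤ ∫⁻ p : ℝ × ℝ, (Set.Ioo (0 : ℝ) 1 ×ˢ Set.Ioo (-Real.pi) Real.pi).indicator
          (fun _ => 1) p := setLIntegral_le_lintegral _ _
      _ < ⊤ := by
        rw [lintegral_indicator (measurableSet_Ioo.prod measurableSet_Ioo), setLIntegral_const,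
          one_mul, Measure.volume_eq_prod, Measure.prod_prod]
        exact ENNReal.mul_lt_top (by simp) (by simp)
  -- Within distance `1` of `a` the translate of the integral at the origin is a bound; elsewhere
  -- the integrand is at most `1`, which costs the area of the disc.
  refine ⟨(∫⁻ z in Metric.ball (0 : ℂ) 1, ‖z‖ₑ⁻¹) + volume (Metric.ball (0 : ℂ) 1),
    ENNReal.add_lt_top.2 ⟨h0, measure_ball_lt_top⟩, fun a => ?_⟩
  have h1 : ∫⁻ z in Metric.ball (0 : ℂ) 1, ‖z‖ₑ⁻¹ =
      ∫⁻ z, (Metric.ball (0 : ℂ) 1).indicator (fun z => ‖z‖ₑ⁻¹) (z - a) := by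
    rw [lintegral_sub_right_eq_self, lintegral_indicator measurableSet_ball]
  have h2 : volume (Metric.ball (0 : ℂ) 1) =
      ∫⁻ z, (Metric.ball (0 : ℂ) 1).indicator (fun _ => 1) z := by
    rw [lintegral_indicator measurableSet_ball, setLIntegral_const, one_mul]
  rw [h1, h2, ← lintegral_indicator measurableSet_ball, ← lintegral_add_right]
  · refine lintegral_mono fun z => ?_
    by_cases hz : z ∈ Metric.ball (0 : ℂ) 1
    · rw [Set.indicator_of_mem hz, Set.indicator_of_mem hz]
      by_cases hza : z - a ∈ Metric.ball (0 : ℂ) 1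
      · rw [Set.indicator_of_mem hza]; exact le_self_add
      · refine le_trans ?_ le_add_self
        rw [ENNReal.inv_le_one, ← ofReal_norm]
        rw [mem_ball_zero_iff, not_lt] at hza
        exact ENNReal.one_le_ofReal.2 hza
    · rw [Set.indicator_of_notMem hz]; exact bot_le
  · exact measurable_const.indicator measurableSet_ball

theorem dCoord_mul {n : ℕ} {l : Fin n} {g h : (Fin n → ℂ) → ℂ} {z : Fin n → ℂ}
    (hg : DifferentiableAt ℂ g z) (hh : DifferentiableAt ℂ h z) :
    dCoord l (fun z => g z * h z) z = dCoord l g z * h z + g z * dCoord l h z := by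
  simp only [dCoord, fderiv_fun_mul hg hh, _root_.add_apply, _root_.smul_apply, smul_eq_mul]
  ring

/-- The derivative along a coordinate line of a function that is polynomial on that line. -/
theorem dCoord_of_eval {n : ℕ} {l : Fin n} {h : (Fin n → ℂ) → ℂ} {z : Fin n → ℂ} {p : ℂ[X]}
    (hh : DifferentiableAt ℂ h z) (hp : ∀ t : ℂ, h (z + t • Pi.single l 1) = p.eval (z l + t)) :
    dCoord l h z = p.derivative.eval (z l) := by
  have h1 : HasDerivAt (fun t : ℂ => h (z + t • (Pi.single l 1 : Fin n → ℂ))) (dCoord l h z) 0 := by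
    have := hh.hasFDerivAt.hasLineDerivAt (Pi.single l 1)
    exact this
  have h2 : HasDerivAt (fun t : ℂ => p.eval (z l + t)) (p.derivative.eval (z l)) 0 := by
    have := (p.hasDerivAt (z l + 0)).comp_const_add (z l) 0
    simpa using this
  have h3 : (fun t : ℂ => h (z + t • (Pi.single l 1 : Fin n → ℂ))) =
      fun t : ℂ => p.eval (z l + t) := funext hp
  rw [h3] at h1
  exact h1.unique h2

theorem dCoord_zero_evalFamily {k : ℕ} {P : (Fin k → ℂ) → ℂ[X]} {z : Fin (k + 1) → ℂ}
    (hh : DifferentiableAt ℂ (evalFamily P) z) :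
    dCoord 0 (evalFamily P) z = evalFamily (fun w => (P w).derivative) z := by
  refine dCoord_of_eval (p := P (Fin.tail z)) hh fun t => ?_
  have e : Fin.tail (z + t • Pi.single 0 1) = Fin.tail z := by
    funext i; simp [Fin.tail]
  rw [evalFamily, e]
  simp

/-- The logarithmic derivative of `f` in a direction in which `f` is regular is integrable. -/
theorem exists_integrableOn_logDeriv_zero {k N : ℕ} {f : (Fin (k + 1) → ℂ) → ℂ}
    {P : (Fin k → ℂ) → ℂ[X]} (hf : AnalyticAt ℂ f 0) (hP : IsWeierstrassPolyOf f P N) :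
    ∃ ε > 0, IntegrableOn (fun z => dCoord 0 f z / f z) (Metric.ball 0 ε) := by
  obtain ⟨hW, u, hu, hu0, hfu⟩ := hP
  have hlu : ContinuousAt (fun z => dCoord 0 u z / u z) 0 := by
    refine ContinuousAt.div ?_ hu.continuousAt hu0
    exact (hu.fderiv.continuousAt).clm_apply continuousAt_const
  have hbd : ∀ᶠ z in 𝓝 (0 : Fin (k + 1) → ℂ), ‖dCoord 0 u z / u z‖ < ‖dCoord 0 u 0 / u 0‖ + 1 :=
    hlu.norm.eventually_lt_const (lt_add_one _)
  obtain ⟨ε, hε, hb⟩ := Metric.eventually_nhds_iff_ball.1 (hbd.and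
    (hf.eventually_analyticAt.and (hu.eventually_analyticAt.and
      (hW.analyticAt_evalFamily.eventually_analyticAt.and
        ((hu.continuousAt.eventually_ne hu0).and hfu.eventually_nhds)))))
  refine ⟨min ε 1, lt_min hε one_pos, ?_⟩
  set B := Metric.ball (0 : Fin (k + 1) → ℂ) (min ε 1) with hB
  have hBε : B ⊆ Metric.ball 0 ε := Metric.ball_subset_ball (min_le_left _ _)
  have hfB : AnalyticOnNhd ℂ f B := fun z hz => (hb z (hBε hz)).2.1
  have hmeas : AEStronglyMeasurable (fun z => dCoord 0 f z / f z) (volume.restrict B) :=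
    ((analyticOnNhd_dCoord hfB 0).continuousOn.aemeasurable
      measurableSet_ball).div
      (hfB.continuousOn.aemeasurable measurableSet_ball) |>.aestronglyMeasurable
  refine ⟨hmeas, ?_⟩
  rw [hasFiniteIntegral_iff_enorm, ← lintegral_indicator measurableSet_ball, lintegral_cons
    ((aemeasurable_indicator_iff measurableSet_ball).2 hmeas.enorm)]
  obtain ⟨C, hC, hCa⟩ := exists_lintegral_inv_le
  set c := ‖dCoord 0 u 0 / u 0‖ + 1
  -- On a line parallel to the first axis, the logarithmic derivative of `f` is that of `u`, which
  -- is bounded, plus `∑ 1 / (t - a)` over the at most `N` roots. The resulting bound for the slice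
  -- integral does not depend on `w`.
  have hptw : ∀ (w : Fin k → ℂ) (t : ℂ),
      B.indicator (fun z => ‖dCoord 0 f z / f z‖ₑ) (consPoint t w) ≤
      (Metric.ball (0 : Fin k → ℂ) 1).indicator (fun _ => (Metric.ball (0 : ℂ) 1).indicator
        (fun t => ENNReal.ofReal c + ((P w).roots.map fun a => ‖t - a‖ₑ⁻¹).sum) t) w := by
    intro w t
    by_cases hz : consPoint t w ∈ B
    · have hz1 : ‖consPoint t w‖ < 1 := by
        have := mem_ball_zero_iff.1 hz
        exact this.trans_le (min_le_right _ _)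
      have hw : w ∈ Metric.ball (0 : Fin k → ℂ) 1 := by
        rw [mem_ball_zero_iff, pi_norm_lt_iff one_pos]
        exact fun i => (norm_le_pi_norm (consPoint t w) i.succ).trans_lt hz1
      have ht : t ∈ Metric.ball (0 : ℂ) 1 := by
        rw [mem_ball_zero_iff]
        exact (norm_le_pi_norm (consPoint t w) 0).trans_lt hz1
      rw [Set.indicator_of_mem hz, Set.indicator_of_mem hw, Set.indicator_of_mem ht]
      obtain ⟨h1, h2, h3, h4, h5, h6⟩ := hb _ (hBε hz)
      -- At zeros of `f` the quotient is `0` by the convention for division, so nothing has to be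
      -- shown there.
      by_cases hp : (P w).eval t = 0
      · have : f (consPoint t w) = 0 := by
          rw [h6.self_of_nhds]; simp [evalFamily, hp]
        rw [this, div_zero]; simp
      · have e1 : dCoord 0 f (consPoint t w) = dCoord 0 u (consPoint t w) * (P w).eval t +
            u (consPoint t w) * (P w).derivative.eval t := by
          rw [(dCoord_congr h6).eq_of_nhds, dCoord_mul h3.differentiableAt h4.differentiableAt,
            dCoord_zero_evalFamily h4.differentiableAt]
          simp [evalFamily]
        have e2 : f (consPoint t w) = u (consPoint t w) * (P w).eval t := by
          rw [h6.self_of_nhds]; simp [evalFamily]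
        have e3 : dCoord 0 f (consPoint t w) / f (consPoint t w) =
            dCoord 0 u (consPoint t w) / u (consPoint t w) +
              (P w).derivative.eval t / (P w).eval t := by
          rw [e1, e2]; field_simp
        rw [e3, (IsAlgClosed.splits (P w)).eval_derivative_div_eval_of_ne_zero hp]
        refine (enorm_add_le _ _).trans (add_le_add ?_ ?_)
        · rw [← ofReal_norm]; exact ENNReal.ofReal_le_ofReal h1.le
        · have hm : ∀ s : Multiset ℂ, (∀ a ∈ s, t - a ≠ 0) → ‖(s.map fun a => 1 / (t - a)).sum‖ₑ ≤
              (s.map fun a => ‖t - a‖ₑ⁻¹).sum := by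
            intro s hs
            induction s using Multiset.induction_on with
            | empty => simp
            | cons a s ih =>
              simp only [Multiset.map_cons, Multiset.sum_cons]
              refine (enorm_add_le _ _).trans (add_le_add (le_of_eq ?_)
                (ih fun b hb => hs b (Multiset.mem_cons_of_mem hb)))
              rw [one_div, enorm_inv (hs a (Multiset.mem_cons_self a s))]
          refine hm _ fun a ha h => hp ?_
          rw [sub_eq_zero.1 h]
          exact isRoot_of_mem_roots ha
    · rw [Set.indicator_of_notMem hz]; exact bot_le
  calc _ ≤ ∫⁻ w : Fin k → ℂ, (Metric.ball (0 : Fin k → ℂ) 1).indicator (fun _ =>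
        ENNReal.ofReal c * volume (Metric.ball (0 : ℂ) 1) + N * C) w := by
        refine lintegral_mono fun w => ?_
        refine (lintegral_mono (hptw w)).trans ?_
        by_cases hw : w ∈ Metric.ball (0 : Fin k → ℂ) 1
        · simp only [Set.indicator_of_mem hw]
          rw [lintegral_indicator measurableSet_ball, lintegral_add_left measurable_const,
            setLIntegral_const]
          refine add_le_add le_rfl ?_
          have hm : ∀ s : Multiset ℂ, ∫⁻ t in Metric.ball (0 : ℂ) 1,
              (s.map fun a => ‖t - a‖ₑ⁻¹).sum ≤ Multiset.card s * C := by
            intro s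
            induction s using Multiset.induction_on with
            | empty => simp
            | cons a s ih =>
              simp only [Multiset.map_cons, Multiset.sum_cons, Multiset.card_cons]
              rw [lintegral_add_left (by fun_prop)]
              push_cast
              rw [add_mul, one_mul, add_comm]
              exact add_le_add ih (hCa a)
          refine (hm _).trans ?_
          gcongr
          exact ((P w).card_roots' ).trans (hW.natDegree w).le
        · simp [Set.indicator_of_notMem hw]
    _ < ⊤ := by
      rw [lintegral_indicator measurableSet_ball, setLIntegral_const]
      refine ENNReal.mul_lt_top (ENNReal.add_lt_top.2 ⟨?_, ?_⟩) measure_ball_lt_top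
      · exact ENNReal.mul_lt_top ENNReal.ofReal_lt_top measure_ball_lt_top
      · exact ENNReal.mul_lt_top (ENNReal.natCast_lt_top N) hC

end

/-! ### Null zero sets, and logarithmic derivatives in all directions -/

section

open MeasureTheory Polynomial

/-- The zero set of a family of monic polynomials has measure zero. -/
theorem ae_evalFamily_ne_zero {k : ℕ} {P : (Fin k → ℂ) → ℂ[X]} (hP : ∀ w, (P w).Monic)
    {V : Set (Fin (k + 1) → ℂ)} (hV : IsOpen V) (hc : ContinuousOn (evalFamily P) V) :
    ∀ᵐ z, z ∈ V → evalFamily P z ≠ 0 := by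
  have hS : MeasurableSet (V ∩ evalFamily P ⁻¹' {0}) := by
    obtain ⟨W, hW, hWe⟩ := (continuousOn_iff_isClosed.1 hc) {0} isClosed_singleton
    rw [Set.inter_comm, hWe]
    exact hW.measurableSet.inter hV.measurableSet
  have h0 : volume (V ∩ evalFamily P ⁻¹' {0}) = 0 := by
    -- By Fubini it suffices that the slices over `w` are null, and they consist of roots of a
    -- nonzero polynomial.
    rw [← lintegral_indicator_one hS, lintegral_cons
      ((measurable_one.indicator hS).aemeasurable)]
    rw [← lintegral_zero (μ := (volume : Measure (Fin k → ℂ)))]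
    congr 1
    funext w
    have hfin : ({t : ℂ | (P w).IsRoot t}).Finite :=
      finite_setOfPred_isRoot (hP w).ne_zero
    rw [← lintegral_zero (μ := (volume : Measure ℂ))]
    refine lintegral_congr_ae ?_
    have hae : ∀ᵐ t : ℂ, t ∉ {t : ℂ | (P w).IsRoot t} :=
      measure_eq_zero_iff_ae_notMem.1 (hfin.measure_zero volume)
    filter_upwards [hae] with t ht
    rw [Set.indicator_of_notMem]
    rintro ⟨-, h⟩
    exact ht (by simpa [evalFamily] using h)
  filter_upwards [measure_eq_zero_iff_ae_notMem.1 h0] with z hz hzV h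
  exact hz ⟨hzV, h⟩

/-- A null set condition pulled back along the projection `z ↦ z'`. -/
theorem ae_tail {k : ℕ} {p : (Fin k → ℂ) → Prop} (h : ∀ᵐ w, p w) :
    ∀ᵐ z : Fin (k + 1) → ℂ, p (Fin.tail z) := by
  have e1 : ∀ᵐ x : ℂ × (Fin k → ℂ), p x.2 := by
    rw [Measure.volume_eq_prod]
    exact Measure.quasiMeasurePreserving_snd.ae h
  have := (measurePreserving_cons k).map_eq
  rw [← this]
  refine ((measurableEmbedding_cons k).ae_map_iff).2 ?_
  filter_upwards [e1] with x hx
  simpa using hx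

/-- The shear `z ↦ z + c z₁ e_l`. -/
def shear {k : ℕ} (l : Fin k) (c : ℂ) (z : Fin (k + 1) → ℂ) : Fin (k + 1) → ℂ :=
  z + (c * z 0) • (Pi.single l.succ 1 : Fin (k + 1) → ℂ)

/-- The shear as a linear equivalence. -/
def shearEquiv {k : ℕ} (l : Fin k) (c : ℂ) : (Fin (k + 1) → ℂ) ≃L[ℂ] (Fin (k + 1) → ℂ) :=
  LinearEquiv.toContinuousLinearEquiv
    { toFun := shear l c
      invFun := shear l (-c)
      map_add' := fun x y => by
        simp only [shear, Pi.add_apply, mul_add, add_smul]; abel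
      map_smul' := fun a x => by
        simp only [shear, Pi.smul_apply, smul_eq_mul, RingHom.id_apply, smul_add, smul_smul]
        congr 2; ring
      left_inv := fun x => by
        simp [shear, (Fin.succ_ne_zero _).symm]
      right_inv := fun x => by
        simp [shear, (Fin.succ_ne_zero _).symm] }

theorem shearEquiv_apply {k : ℕ} (l : Fin k) (c : ℂ) (z : Fin (k + 1) → ℂ) :
    shearEquiv l c z = shear l c z := rfl

/-- All logarithmic derivatives of a function regular in the first variable are integrable. -/
theorem exists_integrableOn_logDeriv {k N : ℕ} {f : (Fin (k + 1) → ℂ) → ℂ}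
    {P : (Fin k → ℂ) → ℂ[X]} (hf : AnalyticAt ℂ f 0) (hP : IsWeierstrassPolyOf f P N)
    (l : Fin (k + 1)) :
    ∃ V : Set (Fin (k + 1) → ℂ), IsOpen V ∧ 0 ∈ V ∧
      IntegrableOn (fun z => dCoord l f z / f z) V := by
  obtain ⟨ε, hε, hInt⟩ := exists_integrableOn_logDeriv_zero hf hP
  refine Fin.cases ⟨_, Metric.isOpen_ball, Metric.mem_ball_self hε, hInt⟩ (fun l => ?_) l
  obtain ⟨ε₁, hε₁, hfa⟩ := Metric.eventually_nhds_iff_ball.1 hf.eventually_analyticAt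
  obtain ⟨hW, u, hu, hu0, hfu⟩ := hP
  -- a point of the first axis where `f` does not vanish
  have hcons : ∀ᶠ t in 𝓝 (0 : ℂ), u (consPoint t (0 : Fin k → ℂ)) ≠ 0 ∧
      f (consPoint t 0) = u (consPoint t 0) * t ^ N := by
    have ht : Filter.Tendsto (fun t : ℂ => consPoint t (0 : Fin k → ℂ)) (𝓝 0) (𝓝 0) := by
      have hc : Continuous fun t : ℂ => consPoint t (0 : Fin k → ℂ) := by
        refine continuous_pi fun i => ?_
        refine Fin.cases ?_ (fun i => ?_) i
        · exact continuous_id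
        · exact continuous_const
      have := hc.tendsto 0
      rwa [show consPoint (0 : ℂ) (0 : Fin k → ℂ) = 0 from
        funext fun i => Fin.cases rfl (fun _ => rfl) i] at this
    filter_upwards [ht.eventually (hu.continuousAt.eventually_ne hu0), ht.eventually hfu]
      with t h1 h2
    refine ⟨h1, ?_⟩
    rw [h2, hW.evalFamily_cons_zero]
  obtain ⟨ε₂, hε₂, hax⟩ := Metric.eventually_nhds_iff_ball.1 hcons
  set s : ℂ := ((min ε₁ ε₂ / 2 : ℝ) : ℂ) with hs
  have hm : 0 < min ε₁ ε₂ := lt_min hε₁ hε₂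
  have hsn : ‖s‖ = min ε₁ ε₂ / 2 := by
    rw [hs, Complex.norm_real, Real.norm_of_nonneg (by positivity)]
  have hs0 : s ≠ 0 := by rw [← norm_pos_iff, hsn]; positivity
  have hfs : f (consPoint s 0) ≠ 0 := by
    obtain ⟨h1, h2⟩ := hax s (by rw [mem_ball_zero_iff, hsn]; linarith [min_le_right ε₁ ε₂])
    rw [h2]; exact mul_ne_zero h1 (pow_ne_zero _ hs0)
  have hsball : consPoint s (0 : Fin k → ℂ) ∈ Metric.ball (0 : Fin (k + 1) → ℂ) ε₁ := by
    rw [mem_ball_zero_iff, pi_norm_lt_iff hε₁]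
    refine Fin.cases ?_ (fun i => ?_)
    · simp only [Fin.cons_zero]; rw [hsn]; linarith [min_le_left ε₁ ε₂]
    · simpa using hε₁
  -- a small shear keeps the first axis away from the zero set
  have hshear : Continuous fun c : ℂ => shear l c (consPoint s 0) := by
    unfold shear; fun_prop
  have hc0 : shear l 0 (consPoint s 0) = consPoint s 0 := by simp [shear]
  have hcont : ContinuousAt (fun c : ℂ => f (shear l c (consPoint s 0))) 0 := by
    refine ContinuousAt.comp (g := f) ?_ hshear.continuousAt
    rw [hc0]; exact (hfa _ hsball).continuousAt
  -- The bound `‖c‖ < 1` keeps the sheared axis in the ball where `f` is analytic. Later `c` is also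
  -- chosen nonzero, in order to solve for the derivative in the direction of `l.succ`.
  have hev : ∀ᶠ c in 𝓝 (0 : ℂ), f (shear l c (consPoint s 0)) ≠ 0 ∧ ‖c‖ < 1 := by
    refine (hcont.eventually_ne (by rw [hc0]; exact hfs)).and ?_
    filter_upwards [Metric.ball_mem_nhds (0 : ℂ) one_pos] with t ht using by simpa using ht
  obtain ⟨c, ⟨hc, hc1⟩, hcne⟩ := ((hev.filter_mono nhdsWithin_le_nhds).and
    (self_mem_nhdsWithin (s := {(0 : ℂ)}ᶜ))).exists
  have hcne : c ≠ 0 := hcne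
  set T := shearEquiv l c with hT
  have hT0 : T 0 = 0 := map_zero _
  have hF : AnalyticAt ℂ (f ∘ T) 0 :=
    AnalyticAt.comp (by rw [hT0]; exact hf) (ContinuousLinearEquiv.analyticAt T 0)
  -- If `f` vanished on the sheared axis near `0`, the identity theorem would propagate this to the
  -- parameter `s`, where `f` is nonzero.
  have hreg : ¬ ∀ᶠ t in 𝓝 (0 : ℂ), (f ∘ T) (consPoint t 0) = 0 := by
    intro h
    have hline : ∀ t : ℂ, T (consPoint t 0) = consPoint t ((c * t) • (Pi.single l 1 : Fin k → ℂ)) := by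
      intro t
      funext i
      refine Fin.cases ?_ (fun i => ?_) i
      · simp [hT, shearEquiv_apply, shear, (Fin.succ_ne_zero _).symm]
      · simp [hT, shearEquiv_apply, shear, Pi.single_apply]
    have hlin : ∀ t : ℂ, t ∈ Metric.ball (0 : ℂ) ε₁ → T (consPoint t 0) ∈
        Metric.ball (0 : Fin (k + 1) → ℂ) ε₁ := by
      intro t ht
      rw [mem_ball_zero_iff] at ht
      rw [hline, mem_ball_zero_iff, pi_norm_lt_iff hε₁]
      refine Fin.cases (by simpa using ht) (fun i => ?_)
      simp only [Fin.cons_succ, Pi.smul_apply, smul_eq_mul, norm_mul, Pi.single_apply]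
      by_cases hi : i = l
      · simp only [hi, if_true, norm_one, mul_one]
        nlinarith [norm_nonneg t, norm_nonneg c]
      · simpa [hi] using hε₁
    have hg : AnalyticOnNhd ℂ (fun t : ℂ => (f ∘ T) (consPoint t 0)) (Metric.ball 0 ε₁) := by
      intro t ht
      refine AnalyticAt.comp (g := f) (f := fun t : ℂ => T (consPoint t 0))
        (hfa _ (hlin t ht)) ?_
      refine AnalyticAt.comp (g := T) (f := fun t : ℂ => consPoint t 0)
        (ContinuousLinearEquiv.analyticAt T _) ?_
      refine AnalyticAt.pi (f := fun i (t : ℂ) => consPoint t (0 : Fin k → ℂ) i) fun i => ?_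
      refine Fin.cases ?_ (fun i => ?_) i
      · exact analyticAt_id
      · exact analyticAt_const
    have hz := hg.eqOn_zero_of_preconnected_of_eventuallyEq_zero
      (convex_ball (0 : ℂ) ε₁).isPreconnected (Metric.mem_ball_self hε₁) h
    exact hc (hz (by rw [mem_ball_zero_iff, hsn]; linarith [min_le_left ε₁ ε₂]))
  obtain ⟨P', N', hP'⟩ := weierstrass_preparation hF hreg
  obtain ⟨ε₃, hε₃, hInt'⟩ := exists_integrableOn_logDeriv_zero hF hP'
  -- pull back
  set V' : Set (Fin (k + 1) → ℂ) := Metric.ball 0 ε₃ ∩ T ⁻¹' (Metric.ball 0 ε₁) with hV'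
  have hV'o : IsOpen V' := Metric.isOpen_ball.inter (Metric.isOpen_ball.preimage T.continuous)
  have himg : IsOpen (T '' V') := T.toHomeomorph.isOpenMap _ hV'o
  have hInt2 : IntegrableOn (fun z => dCoord 0 (f ∘ T) (T.symm z) / f z) (T '' V') := by
    have hTR : ∀ x ∈ V', HasFDerivWithinAt T
        ((T : (Fin (k + 1) → ℂ) →L[ℂ] (Fin (k + 1) → ℂ)).restrictScalars ℝ) V' x := fun x _ =>
      (T.hasFDerivAt.restrictScalars ℝ).hasFDerivWithinAt
    rw [integrableOn_image_iff_integrableOn_abs_det_fderiv_smul volume hV'o.measurableSet hTR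
      T.injective.injOn]
    refine IntegrableOn.congr_fun ((hInt'.mono_set Set.inter_subset_left).smul
      (|((T : (Fin (k + 1) → ℂ) →L[ℂ] (Fin (k + 1) → ℂ)).restrictScalars ℝ).det|))
      (fun z hz => ?_) hV'o.measurableSet
    simp [Function.comp]
  refine ⟨(T '' V') ∩ Metric.ball 0 ε, himg.inter Metric.isOpen_ball,
    ⟨⟨0, ⟨Metric.mem_ball_self hε₃, by
      rw [Set.mem_preimage, hT0]; exact Metric.mem_ball_self hε₁⟩, hT0⟩,
      Metric.mem_ball_self hε⟩, ?_⟩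
  refine IntegrableOn.congr_fun (((hInt2.mono_set Set.inter_subset_left).sub
    (hInt.mono_set Set.inter_subset_right)).const_mul c⁻¹) (fun z hz => ?_)
    (himg.inter Metric.isOpen_ball).measurableSet
  obtain ⟨⟨y, ⟨hy3, hy1⟩, rfl⟩, -⟩ := hz
  have hfd : DifferentiableAt ℂ f (T y) := (hfa _ hy1).differentiableAt
  -- The first derivative of the sheared function mixes the two directions. The wanted logarithmic
  -- derivative is therefore `c⁻¹` times a difference of two integrable ones.
  have hd : dCoord 0 (f ∘ T) y = dCoord 0 f (T y) + c * dCoord l.succ f (T y) := by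
    have : HasFDerivAt (f ∘ T) ((fderiv ℂ f (T y)).comp
        (T : (Fin (k + 1) → ℂ) →L[ℂ] (Fin (k + 1) → ℂ))) y :=
      hfd.hasFDerivAt.comp y T.hasFDerivAt
    have e : T (Pi.single 0 1) = Pi.single 0 1 + c • Pi.single l.succ 1 := by
      simp [hT, shearEquiv_apply, shear]
    rw [dCoord, this.fderiv]
    simp only [ContinuousLinearMap.comp_apply, ContinuousLinearEquiv.coe_coe, e, map_add, map_smul,
      smul_eq_mul]
    rfl
  simp only [ContinuousLinearEquiv.symm_apply_apply, Pi.sub_apply, hd]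
  field_simp
  ring

end

section

open MeasureTheory

variable {n : ℕ}

/-! ### Integration by parts against `1 / p` -/

/-- Hypotheses on a holomorphic function `p` under which one can integrate by parts against
`1 / p`. -/
structure IsDivisor (U : Set (Fin n → ℂ)) (p : (Fin n → ℂ) → ℂ) : Prop where
  isOpen : IsOpen U
  analytic : AnalyticOnNhd ℂ p U
  ae_ne : ∀ᵐ z, z ∈ U → p z ≠ 0
  logDeriv : ∀ l, IntegrableOn (fun z => dCoord l p z / p z) U

theorem IsDivisor.mono {U V : Set (Fin n → ℂ)} {p : (Fin n → ℂ) → ℂ} (h : IsDivisor U p)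
    (hV : IsOpen V) (hVU : V ⊆ U) : IsDivisor V p :=
  ⟨hV, h.analytic.mono hVU, h.ae_ne.mono fun _ hz hzV => hz (hVU hzV),
    fun l => (h.logDeriv l).mono_set hVU⟩

theorem SmoothOn.div {U : Set (Fin n → ℂ)} {g h : (Fin n → ℂ) → ℂ} (hg : SmoothOn U g)
    (hh : SmoothOn U h) (h0 : ∀ z ∈ U, h z ≠ 0) : SmoothOn U (fun z => g z / h z) := by
  simp only [div_eq_mul_inv]
  exact ContDiffOn.mul hg (ContDiffOn.inv hh h0)

/-- A function vanishing off `U`, dominated on `U` by an integrable function times a test function,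
is integrable. -/
theorem integrable_mul_test {U : Set (Fin n → ℂ)} {g h χ : (Fin n → ℂ) → ℂ}
    (hχ : IsTest U χ) (hg : AEStronglyMeasurable g (volume.restrict U))
    (hh : IntegrableOn h (tsupport χ)) (hgh : ∀ᵐ z, z ∈ U → ‖g z‖ ≤ ‖h z‖) :
    Integrable (fun z => g z * χ z) := by
  have hK : MeasurableSet (tsupport χ) := (isClosed_tsupport χ).measurableSet
  have hsupp : Function.support (fun z => g z * χ z) ⊆ tsupport χ := fun z hz =>
    subset_tsupport _ (right_ne_zero_of_mul hz)
  rw [← integrableOn_iff_integrable_of_support_subset hsupp]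
  obtain ⟨B, hB⟩ := hχ.continuous.bounded_above_of_compact_support hχ.compact
  have hgK : AEStronglyMeasurable g (volume.restrict (tsupport χ)) :=
    hg.mono_measure (Measure.restrict_mono hχ.support le_rfl)
  refine Integrable.mono' (hh.norm.mul_const B) (hgK.mul
    hχ.continuous.aestronglyMeasurable) ?_
  rw [ae_restrict_iff' hK]
  filter_upwards [hgh] with z hz hzK
  rw [norm_mul]
  exact mul_le_mul (hz (hχ.support hzK)) (hB z) (norm_nonneg _) (norm_nonneg _)

theorem integrableOn_const_tsupport {U : Set (Fin n → ℂ)} {χ : (Fin n → ℂ) → ℂ}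
    (hχ : IsTest U χ) (c : ℂ) : IntegrableOn (fun _ : Fin n → ℂ => c) (tsupport χ) := by
  have : volume (tsupport χ) < ⊤ := hχ.compact.isCompact.measure_lt_top
  exact integrableOn_const this.ne

namespace IsDivisor

variable {U : Set (Fin n → ℂ)} {p : (Fin n → ℂ) → ℂ}

theorem aemeasurable (hD : IsDivisor U p) : AEMeasurable p (volume.restrict U) :=
  hD.analytic.continuousOn.aemeasurable hD.isOpen.measurableSet

theorem integrable_conj_div_mul (hD : IsDivisor U p) {χ : (Fin n → ℂ) → ℂ} (hχ : IsTest U χ) :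
    Integrable (fun z => conj (p z) / p z * χ z) := by
  refine integrable_mul_test hχ ?_ (integrableOn_const_tsupport hχ 1) ?_
  · exact ((Complex.continuous_conj.measurable.comp_aemeasurable hD.aemeasurable).div
      hD.aemeasurable).aestronglyMeasurable
  · refine Filter.Eventually.of_forall fun z _ => ?_
    rw [norm_div, RCLike.norm_conj, norm_one]
    exact div_self_le_one _

theorem integrable_conj_dCoord_div_mul (hD : IsDivisor U p) {χ : (Fin n → ℂ) → ℂ}
    (hχ : IsTest U χ) (l : Fin n) :
    Integrable (fun z => conj (dCoord l p z) / p z * χ z) := by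
  refine integrable_mul_test hχ ?_ ((hD.logDeriv l).mono_set hχ.support) ?_
  · exact ((Complex.continuous_conj.measurable.comp_aemeasurable
      ((analyticOnNhd_dCoord hD.analytic l).continuousOn.aemeasurable
        hD.isOpen.measurableSet)).div hD.aemeasurable).aestronglyMeasurable
  · refine Filter.Eventually.of_forall fun z _ => ?_
    rw [norm_div, RCLike.norm_conj, norm_div]

/-- The regularization of `conj p / p`. -/
def regularize (p : (Fin n → ℂ) → ℂ) (ε : ℝ) (z : Fin n → ℂ) : ℂ :=
  conj (p z) * conj (p z) / (p z * conj (p z) + ε)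

theorem norm_regularize_denom (a : ℂ) {ε : ℝ} (hε : 0 < ε) :
    ‖a * conj a + ε‖ = ‖a‖ ^ 2 + ε := by
  rw [Complex.mul_conj, Complex.normSq_eq_norm_sq, ← Complex.ofReal_add, Complex.norm_real,
    Real.norm_of_nonneg (by positivity)]

theorem regularize_denom_ne (a : ℂ) {ε : ℝ} (hε : 0 < ε) : a * conj a + ε ≠ 0 := by
  rw [← norm_pos_iff, norm_regularize_denom a hε]; positivity

theorem norm_regularize_le (p : (Fin n → ℂ) → ℂ) {ε : ℝ} (hε : 0 < ε) (z : Fin n → ℂ) :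
    ‖regularize p ε z‖ ≤ 1 := by
  rw [regularize, norm_div, norm_regularize_denom _ hε, norm_mul, RCLike.norm_conj,
    div_le_one (by positivity)]
  nlinarith

theorem smoothOn_regularize (hD : IsDivisor U p) {ε : ℝ} (hε : 0 < ε) :
    SmoothOn U (regularize p ε) := by
  have h1 : SmoothOn U p := hD.analytic.smoothOn
  exact SmoothOn.div (ContDiffOn.mul h1.conj h1.conj)
    (ContDiffOn.add (ContDiffOn.mul h1 h1.conj) contDiffOn_const)
    fun z _ => regularize_denom_ne (p z) hε

/-- Obtained by differentiating the product of the regularization with its denominator, which is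
`conj p ^ 2`, and solving for the unknown derivative. -/
theorem dbarCoord_regularize (hD : IsDivisor U p) {ε : ℝ} (hε : 0 < ε) (l : Fin n)
    {z : Fin n → ℂ} (hz : z ∈ U) :
    dbarCoord l (regularize p ε) z =
      (2 - p z * (conj (p z) / (p z * conj (p z) + ε))) *
        (conj (p z) * conj (dCoord l p z)) / (p z * conj (p z) + ε) := by
  have hp := (hD.analytic z hz).differentiableAt
  have hpR : DifferentiableAt ℝ p z := hp.restrictScalars ℝ
  have hcR : DifferentiableAt ℝ (fun z => conj (p z)) z :=
    hD.analytic.smoothOn.conj.differentiableAt hD.isOpen hz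
  have hpc : DifferentiableAt ℝ (fun z => p z * conj (p z)) z := hpR.mul hcR
  have hpce : DifferentiableAt ℝ (fun z => p z * conj (p z) + (ε : ℂ)) z :=
    hpc.add (differentiableAt_const _)
  have hrR : DifferentiableAt ℝ (regularize p ε) z :=
    (hD.smoothOn_regularize hε).differentiableAt hD.isOpen hz
  have hprod : (fun z => regularize p ε z * (p z * conj (p z) + ε)) =
      fun z => conj (p z) * conj (p z) := by
    funext z
    rw [regularize, div_mul_cancel₀ _ (regularize_denom_ne (p z) hε)]
  have h1 : dbarCoord l (fun z => p z * conj (p z) + ε) z = p z * conj (dCoord l p z) := by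
    rw [dbarCoord_add hpc (differentiableAt_const _), dbarCoord_holo_mul hp hcR,
      dbarCoord_conj hp, dbarCoord_of_differentiableAt (differentiableAt_const _), add_zero]
  have h2 : dbarCoord l (fun z => conj (p z) * conj (p z)) z =
      2 * (conj (p z) * conj (dCoord l p z)) := by
    rw [dbarCoord_mul hcR hcR, dbarCoord_conj hp]; ring
  rw [← hprod, dbarCoord_mul hrR hpce, h1] at h2
  rw [eq_div_iff (regularize_denom_ne (p z) hε)]
  have h3 : regularize p ε z = conj (p z) * (conj (p z) / (p z * conj (p z) + ε)) := by
    rw [regularize, mul_div_assoc]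
  rw [h3] at h2
  linear_combination h2

/-- The bound does not depend on `ε`, since `|p| ^ 2 ≤ |p| ^ 2 + ε`; this is the domination needed
for the limit `ε → 0`. -/
theorem norm_dbarCoord_regularize_le (hD : IsDivisor U p) {ε : ℝ} (hε : 0 < ε) (l : Fin n)
    {z : Fin n → ℂ} (hz : z ∈ U) (hpz : p z ≠ 0) :
    ‖dbarCoord l (regularize p ε) z‖ ≤ 3 * ‖dCoord l p z / p z‖ := by
  have hpn : 0 < ‖p z‖ := norm_pos_iff.2 hpz
  rw [hD.dbarCoord_regularize hε l hz, norm_div, norm_regularize_denom _ hε, norm_mul, norm_mul,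
    RCLike.norm_conj, RCLike.norm_conj, norm_div]
  have h1 : ‖2 - p z * (conj (p z) / (p z * conj (p z) + ε))‖ ≤ 3 := by
    refine (norm_sub_le _ _).trans ?_
    have : ‖p z * (conj (p z) / (p z * conj (p z) + ε))‖ ≤ 1 := by
      rw [norm_mul, norm_div, norm_regularize_denom _ hε, RCLike.norm_conj, ← mul_div_assoc,
        div_le_one (by positivity)]
      nlinarith
    rw [Complex.norm_ofNat]
    linarith
  rw [mul_div_assoc]
  refine mul_le_mul h1 ?_ (by positivity) (by norm_num)
  rw [div_le_div_iff₀ (by positivity) hpn]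
  nlinarith [norm_nonneg (dCoord l p z), mul_nonneg (norm_nonneg (dCoord l p z)) hε.le]

/-- Integration by parts: `conj p / p` has no residue. -/
theorem integral_conj_div (hD : IsDivisor U p) {ψ : (Fin n → ℂ) → ℂ} (hψ : IsTest U ψ)
    (l : Fin n) :
    ∫ z, (conj (dCoord l p z) / p z * ψ z + conj (p z) / p z * dbarCoord l ψ z) = 0 := by
  set e : ℕ → ℝ := fun k => 1 / ((k : ℝ) + 1) with he
  have hepos : ∀ k, 0 < e k := fun k => by positivity
  have helim : Filter.Tendsto e Filter.atTop (𝓝 0) := tendsto_one_div_add_atTop_nhds_zero_nat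
  have htest : ∀ k, IsTest U (fun z => regularize p (e k) z * ψ z) := fun k =>
    hψ.mul hD.isOpen (hD.smoothOn_regularize (hepos k))
  have hform : ∀ k, ∀ z ∈ U, dbarCoord l (fun z => regularize p (e k) z * ψ z) z =
      dbarCoord l (regularize p (e k)) z * ψ z + regularize p (e k) z * dbarCoord l ψ z :=
    fun k z hz => dbarCoord_mul ((hD.smoothOn_regularize (hepos k)).differentiableAt hD.isOpen hz)
      (hψ.differentiableAt z)
  -- For each `k` the integrand is the derivative of a genuine test function and integrates to zero.
  -- Dominated convergence, with the logarithmic derivative as majorant, passes this to the limit,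
  -- where `p` is nonzero almost everywhere on `U`.
  have hlim : Filter.Tendsto (fun k => ∫ z, dbarCoord l (fun z => regularize p (e k) z * ψ z) z)
      Filter.atTop (𝓝 (∫ z, (conj (dCoord l p z) / p z * ψ z +
        conj (p z) / p z * dbarCoord l ψ z))) := by
    refine tendsto_integral_of_dominated_convergence
      (fun z => 3 * ‖conj (dCoord l p z) / p z * ψ z‖ + ‖dbarCoord l ψ z‖) ?_ ?_ ?_ ?_
    · exact fun k => ((htest k).dbar l).continuous.aestronglyMeasurable
    · exact ((hD.integrable_conj_dCoord_div_mul hψ l).norm.const_mul 3).add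
        (hψ.dbar l).integrable.norm
    · intro k
      filter_upwards [hD.ae_ne] with z hz
      by_cases hzU : z ∈ U
      · rw [hform k z hzU]
        refine (norm_add_le _ _).trans (add_le_add ?_ ?_)
        · rw [norm_mul, norm_mul, ← mul_assoc]
          refine mul_le_mul_of_nonneg_right ?_ (norm_nonneg _)
          refine (hD.norm_dbarCoord_regularize_le (hepos k) l hzU (hz hzU)).trans (le_of_eq ?_)
          rw [norm_div, norm_div, RCLike.norm_conj]
        · rw [norm_mul]
          exact mul_le_of_le_one_left (norm_nonneg _) (norm_regularize_le p (hepos k) z)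
      · rw [((htest k).dbar l).eq_zero hzU, norm_zero]; positivity
    · filter_upwards [hD.ae_ne] with z hz
      by_cases hzU : z ∈ U
      · have hpz := hz hzU
        have hcz : conj (p z) ≠ 0 := (_root_.map_ne_zero _).2 hpz
        have hdl : Filter.Tendsto (fun k => p z * conj (p z) + (e k : ℂ)) Filter.atTop
            (𝓝 (p z * conj (p z))) := by
          have h1 : Filter.Tendsto (fun k => (e k : ℂ)) Filter.atTop (𝓝 ((0 : ℝ) : ℂ)) :=
            (Complex.continuous_ofReal.tendsto 0).comp helim
          simpa using tendsto_const_nhds.add h1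
        have hne : p z * conj (p z) ≠ 0 := mul_ne_zero hpz hcz
        have l1 : Filter.Tendsto (fun k => regularize p (e k) z) Filter.atTop
            (𝓝 (conj (p z) / p z)) := by
          have : conj (p z) / p z = conj (p z) * conj (p z) / (p z * conj (p z)) := by
            field_simp
          rw [this]
          exact tendsto_const_nhds.div hdl hne
        have l2 : Filter.Tendsto (fun k => dbarCoord l (regularize p (e k)) z) Filter.atTop
            (𝓝 (conj (dCoord l p z) / p z)) := by
          have : conj (dCoord l p z) / p z = (2 - p z * (conj (p z) / (p z * conj (p z)))) *
              (conj (p z) * conj (dCoord l p z)) / (p z * conj (p z)) := by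
            field_simp; ring
          rw [this]
          simp only [hD.dbarCoord_regularize (hepos _) l hzU]
          exact ((tendsto_const_nhds.sub (tendsto_const_nhds.mul
            (tendsto_const_nhds.div hdl hne))).mul tendsto_const_nhds).div hdl hne
        simp only [hform _ z hzU]
        exact (l2.mul_const _).add (l1.mul_const _)
      · simp only [((htest _).dbar l).eq_zero hzU, hψ.eq_zero hzU, (hψ.dbar l).eq_zero hzU,
          mul_zero, add_zero]
        exact tendsto_const_nhds
  have h0 : ∀ k, ∫ z, dbarCoord l (fun z => regularize p (e k) z * ψ z) z = 0 :=
    fun k => (htest k).integral_dbarCoord l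
  simp only [h0] at hlim
  exact (tendsto_nhds_unique hlim tendsto_const_nhds)

end IsDivisor

end

/-! ### Iterated integration by parts against `1 / p` -/

section

open MeasureTheory

variable {n : ℕ}

theorem SmoothOn.mul {U : Set (Fin n → ℂ)} {g h : (Fin n → ℂ) → ℂ} (hg : SmoothOn U g)
    (hh : SmoothOn U h) : SmoothOn U (fun z => g z * h z) := ContDiffOn.mul hg hh

theorem SmoothOn.pow {U : Set (Fin n → ℂ)} {g : (Fin n → ℂ) → ℂ} (hg : SmoothOn U g) (j : ℕ) :
    SmoothOn U (fun z => g z ^ j) := ContDiffOn.pow hg j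

theorem dbarCoord_conj_pow {U : Set (Fin n → ℂ)} {p : (Fin n → ℂ) → ℂ}
    (hp : AnalyticOnNhd ℂ p U) (l : Fin n) (j : ℕ) {z : Fin n → ℂ} (hz : z ∈ U) :
    dbarCoord l (fun z => conj (p z) ^ j) z =
      j * conj (p z) ^ (j - 1) * conj (dCoord l p z) := by
  have hd := (hp z hz).differentiableAt
  have h1 : (fun z => conj (p z) ^ j) = fun z => conj ((fun z => p z ^ j) z) := by
    funext z; simp
  have h2 : dCoord l (fun z => p z ^ j) z = j * p z ^ (j - 1) * dCoord l p z := by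
    simp only [dCoord]
    rw [fderiv_fun_pow j hd]
    simp
  rw [h1, dbarCoord_conj (h := fun z => p z ^ j) (hd.fun_pow j), h2]
  simp

namespace IsDivisor

variable {U : Set (Fin n → ℂ)} {p χ w : (Fin n → ℂ) → ℂ}

theorem smoothOn_conj_pow (hD : IsDivisor U p) (j : ℕ) : SmoothOn U (fun z => conj (p z) ^ j) :=
  hD.analytic.smoothOn.conj.pow j

theorem isTest_conj_pow_mul (hD : IsDivisor U p) (hχ : IsTest U χ) (j : ℕ) :
    IsTest U (fun z => conj (p z) ^ j * χ z) := hχ.mul hD.isOpen (hD.smoothOn_conj_pow j)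

theorem integrable_inv_mul (hD : IsDivisor U p) (hχ : IsTest U χ) (j : ℕ) :
    Integrable (fun z => (p z)⁻¹ * (conj (p z) ^ (j + 1) * χ z)) := by
  refine (hD.integrable_conj_div_mul (hD.isTest_conj_pow_mul hχ j)).congr
    (Filter.Eventually.of_forall fun z => ?_)
  simp only [pow_succ]
  ring

/-- Each derivative uses up at most one power of `conj p`; this bookkeeping decides how many
integrations by parts `Γ` allows. -/
theorem dbarCoord_conj_pow_mul (hD : IsDivisor U p) (hχ : IsTest U χ) (l : Fin n) (j : ℕ) :
    ∃ χ', IsTest U χ' ∧ dbarCoord l (fun z => conj (p z) ^ (j + 1) * χ z) =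
      fun z => conj (p z) ^ j * χ' z := by
  refine ⟨fun z => ((j + 1 : ℕ) : ℂ) * (conj (dCoord l p z) * χ z) + conj (p z) * dbarCoord l χ z,
    ?_, ?_⟩
  · exact ((hχ.mul hD.isOpen (analyticOnNhd_dCoord hD.analytic l).smoothOn.conj).const_mul _).add
      ((hχ.dbar l).mul hD.isOpen hD.analytic.smoothOn.conj)
  · funext z
    by_cases hz : z ∈ U
    · rw [dbarCoord_mul ((hD.smoothOn_conj_pow _).differentiableAt hD.isOpen hz)
        (hχ.differentiableAt z), dbarCoord_conj_pow hD.analytic l _ hz]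
      simp only [Nat.add_sub_cancel]
      ring
    · beta_reduce
      rw [((hD.isTest_conj_pow_mul hχ (j + 1)).dbar l).eq_zero hz, hχ.eq_zero hz,
        (hχ.dbar l).eq_zero hz]
      ring

theorem dbarCoord_iterate_conj_pow_mul (hD : IsDivisor U p) (l : Fin n) (j k : ℕ)
    {χ : (Fin n → ℂ) → ℂ} (hχ : IsTest U χ) :
    ∃ χ', IsTest U χ' ∧ (dbarCoord l)^[k] (fun z => conj (p z) ^ (j + k) * χ z) =
      fun z => conj (p z) ^ j * χ' z := by
  induction k generalizing χ with
  | zero => exact ⟨χ, hχ, rfl⟩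
  | succ k ih =>
    obtain ⟨χ₁, h₁, e₁⟩ := hD.dbarCoord_conj_pow_mul hχ l (j + k)
    obtain ⟨χ₂, h₂, e₂⟩ := ih h₁
    refine ⟨χ₂, h₂, ?_⟩
    rw [Function.iterate_succ_apply, ← add_assoc, e₁, e₂]

/-- One integration by parts against `w / p`. -/
theorem integral_by_parts (hD : IsDivisor U p) (hχ : IsTest U χ) (hw : SmoothOn U w) (l : Fin n)
    (j : ℕ) :
    Integrable (fun z => w z * ((p z)⁻¹ *
      dbarCoord l (fun z => conj (p z) ^ (j + 1) * χ z) z)) ∧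
    Integrable (fun z => dbarCoord l w z * ((p z)⁻¹ * (conj (p z) ^ (j + 1) * χ z))) ∧
    ∫ z, w z * ((p z)⁻¹ * dbarCoord l (fun z => conj (p z) ^ (j + 1) * χ z) z) =
      -∫ z, dbarCoord l w z * ((p z)⁻¹ * (conj (p z) ^ (j + 1) * χ z)) := by
  -- The smooth weight and `j` of the powers are absorbed into the test function; one power is left
  -- to form `conj p / p`.
  set ψ : (Fin n → ℂ) → ℂ := fun z => w z * (conj (p z) ^ j * χ z) with hψdef
  have hψ : IsTest U ψ := (hD.isTest_conj_pow_mul hχ j).mul hD.isOpen hw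
  have hI1 := hD.integrable_conj_dCoord_div_mul hψ l
  have hI2 := hD.integrable_conj_div_mul (hψ.dbar l)
  have h0 := hD.integral_conj_div hψ l
  have hI3 : Integrable (fun z => dbarCoord l w z * ((p z)⁻¹ * (conj (p z) ^ (j + 1) * χ z))) := by
    refine (hD.integrable_inv_mul (hχ.mul hD.isOpen (hw.dbarCoord hD.isOpen l)) j).congr
      (Filter.Eventually.of_forall fun z => ?_)
    ring
  have hpt : ∀ z, conj (dCoord l p z) / p z * ψ z + conj (p z) / p z * dbarCoord l ψ z =
      w z * ((p z)⁻¹ * dbarCoord l (fun z => conj (p z) ^ (j + 1) * χ z) z) +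
      dbarCoord l w z * ((p z)⁻¹ * (conj (p z) ^ (j + 1) * χ z)) := by
    intro z
    by_cases hz : z ∈ U
    · have hpd := (hD.analytic z hz).differentiableAt
      have hcd : DifferentiableAt ℝ (fun z => conj (p z)) z :=
        hD.analytic.smoothOn.conj.differentiableAt hD.isOpen hz
      have hjd : DifferentiableAt ℝ (fun z => conj (p z) ^ j * χ z) z :=
        (hD.isTest_conj_pow_mul hχ j).differentiableAt z
      have e1 : dbarCoord l ψ z = dbarCoord l w z * (conj (p z) ^ j * χ z) +
          w z * dbarCoord l (fun z => conj (p z) ^ j * χ z) z :=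
        dbarCoord_mul (hw.differentiableAt hD.isOpen hz) hjd
      have e2 : dbarCoord l (fun z => conj (p z) ^ (j + 1) * χ z) z =
          conj (dCoord l p z) * (conj (p z) ^ j * χ z) +
            conj (p z) * dbarCoord l (fun z => conj (p z) ^ j * χ z) z := by
        have : (fun z => conj (p z) ^ (j + 1) * χ z) =
            fun z => conj (p z) * (conj (p z) ^ j * χ z) := by
          funext z; rw [pow_succ]; ring
        rw [this, dbarCoord_mul hcd hjd, dbarCoord_conj hpd]
      rw [e1, e2, hψdef, pow_succ]
      ring
    · rw [hψ.eq_zero hz, (hψ.dbar l).eq_zero hz, hχ.eq_zero hz,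
        ((hD.isTest_conj_pow_mul hχ (j + 1)).dbar l).eq_zero hz]
      ring
  have hI : Integrable (fun z => w z * ((p z)⁻¹ *
      dbarCoord l (fun z => conj (p z) ^ (j + 1) * χ z) z)) := by
    refine ((hI1.add hI2).sub hI3).congr (Filter.Eventually.of_forall fun z => ?_)
    simp only [Pi.sub_apply, Pi.add_apply]
    rw [hpt z]; ring
  refine ⟨hI, hI3, ?_⟩
  simp only [hpt] at h0
  rw [integral_add hI hI3] at h0
  exact eq_neg_of_add_eq_zero_left h0

/-- Repeated integration by parts against `w / p`. -/
theorem integral_by_parts_iterate (hD : IsDivisor U p) (l : Fin n) (j k : ℕ)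
    {χ w : (Fin n → ℂ) → ℂ} (hχ : IsTest U χ) (hw : SmoothOn U w) :
    ∫ z, w z * ((p z)⁻¹ * (dbarCoord l)^[k] (fun z => conj (p z) ^ (j + k) * χ z) z) =
      (-1) ^ k * ∫ z, (dbarCoord l)^[k] w z * ((p z)⁻¹ * (conj (p z) ^ (j + k) * χ z)) := by
  induction k generalizing w j with
  | zero => simp
  | succ k ih =>
    -- The inner `k` derivatives leave `j + 1` powers of `conj p`, of which a single integration by
    -- parts needs at least one.
    obtain ⟨χ', hχ', e'⟩ := hD.dbarCoord_iterate_conj_pow_mul l (j + 1) k hχ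
    rw [add_assoc, add_comm 1 k] at e'
    have h1 := (hD.integral_by_parts hχ' hw l j).2.2
    rw [← e'] at h1
    have hL : ∀ z, (dbarCoord l)^[k + 1] (fun z => conj (p z) ^ (j + (k + 1)) * χ z) z =
        dbarCoord l ((dbarCoord l)^[k] fun z => conj (p z) ^ (j + (k + 1)) * χ z) z := fun z => by
      rw [Function.iterate_succ_apply']
    simp only [hL]
    rw [h1]
    have h2 := ih (j + 1) (hw.dbarCoord hD.isOpen l)
    rw [add_assoc, add_comm 1 k] at h2
    have e'' : ∀ z, conj (p z) ^ (j + 1) * χ' z =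
        (dbarCoord l)^[k] (fun z => conj (p z) ^ (j + (k + 1)) * χ z) z := fun z => by rw [e']
    simp only [e'']
    rw [h2, pow_succ]
    simp only [Function.iterate_succ_apply]
    ring

end IsDivisor

/-- One more derivative of `conj p ^ (e + 1) ∑ bᵢ ∂̄ⁱχ`. -/
theorem dbarCoord_conj_pow_mul_sum {U : Set (Fin n → ℂ)} {p χ : (Fin n → ℂ) → ℂ}
    (hU : IsOpen U) (hp : AnalyticOnNhd ℂ p U) (l : Fin n) (e K : ℕ) {b : ℕ → (Fin n → ℂ) → ℂ}
    (hb : ∀ i, SmoothOn U (b i)) (hχ : IsTest U χ) {z : Fin n → ℂ} (hz : z ∈ U) :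
    dbarCoord l (fun z => conj (p z) ^ (e + 1) * ∑ i ∈ Finset.range K,
        b i z * (dbarCoord l)^[i] χ z) z =
      conj (p z) ^ e * ∑ i ∈ Finset.range K,
        (((e + 1 : ℕ) * conj (dCoord l p z) * b i z + conj (p z) * dbarCoord l (b i) z) *
          (dbarCoord l)^[i] χ z + conj (p z) * b i z * (dbarCoord l)^[i + 1] χ z) := by
  have hs : ∀ i ∈ Finset.range K, DifferentiableAt ℝ
      (fun z => b i z * (dbarCoord l)^[i] χ z) z := fun i _ =>
    ((hb i).differentiableAt hU hz).mul ((hχ.dbar_iterate l i).differentiableAt z)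
  have hsum : DifferentiableAt ℝ (fun z => ∑ i ∈ Finset.range K,
      b i z * (dbarCoord l)^[i] χ z) z := DifferentiableAt.fun_sum hs
  rw [dbarCoord_mul ((hp.smoothOn.conj.pow _).differentiableAt hU hz) hsum,
    dbarCoord_conj_pow hp l _ hz, dbarCoord_sum _ hs, Nat.add_sub_cancel, pow_succ,
    Finset.mul_sum, Finset.mul_sum, Finset.mul_sum, ← Finset.sum_add_distrib]
  refine Finset.sum_congr rfl fun i _ => ?_
  rw [dbarCoord_mul ((hb i).differentiableAt hU hz) ((hχ.dbar_iterate l i).differentiableAt z),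
    Function.iterate_succ_apply']
  ring

/-- The iterated derivatives of `conj p ^ (e + k) a χ` as differential operators in `χ`. -/
theorem exists_dbarCoord_iterate_eq {U : Set (Fin n → ℂ)} {p a : (Fin n → ℂ) → ℂ}
    (hU : IsOpen U) (hp : AnalyticOnNhd ℂ p U) (l : Fin n) (ha : SmoothOn U a) (k : ℕ) :
    ∀ e : ℕ, ∃ b : ℕ → (Fin n → ℂ) → ℂ, (∀ i, SmoothOn U (b i)) ∧ ∀ χ, IsTest U χ → ∀ z ∈ U,
      (dbarCoord l)^[k] (fun z => conj (p z) ^ (e + k) * (a z * χ z)) z =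
        conj (p z) ^ e * ∑ i ∈ Finset.range (k + 1), b i z * (dbarCoord l)^[i] χ z := by
  induction k with
  | zero => exact fun e => ⟨fun _ => a, fun _ => ha, fun χ _ z _ => by simp⟩
  | succ k ih =>
    intro e
    obtain ⟨b, hb, h⟩ := ih (e + 1)
    -- By the Leibniz rule, `A i` collects the terms that keep the order of differentiation of `χ`,
    -- and `B i` those that raise it by one; the new coefficient of order `i` is `A i + B (i - 1)`.
    let A : ℕ → (Fin n → ℂ) → ℂ := fun i z =>
      (e + 1 : ℕ) * conj (dCoord l p z) * b i z + conj (p z) * dbarCoord l (b i) z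
    let B : ℕ → (Fin n → ℂ) → ℂ := fun i z => conj (p z) * b i z
    have hA : ∀ i, SmoothOn U (A i) := fun i =>
      ContDiffOn.add ((SmoothOn.mul contDiffOn_const
        (analyticOnNhd_dCoord hp l).smoothOn.conj).mul (hb i))
        (hp.smoothOn.conj.mul ((hb i).dbarCoord hU l))
    have hB : ∀ i, SmoothOn U (B i) := fun i => hp.smoothOn.conj.mul (hb i)
    refine ⟨fun i z => (if i < k + 1 then A i z else 0) + (if i = 0 then 0 else B (i - 1) z),
      fun i => ContDiffOn.add ?_ ?_, fun χ hχ z hz => ?_⟩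
    · by_cases hi : i < k + 1
      · simp only [hi, if_true]; exact hA i
      · simp only [hi, if_false]; exact contDiffOn_const
    · by_cases hi : i = 0
      · simp only [hi, if_true]; exact contDiffOn_const
      · simp only [hi, if_false]; exact hB _
    · rw [Function.iterate_succ_apply']
      have h' := h χ hχ
      rw [show e + 1 + k = e + (k + 1) by ring] at h'
      rw [(dbarCoord_eventuallyEq (Filter.eventuallyEq_of_mem (hU.mem_nhds hz) h')).eq_of_nhds,
        dbarCoord_conj_pow_mul_sum hU hp l e (k + 1) hb hχ hz]
      congr 1
      have hL : ∑ i ∈ Finset.range (k + 1), (A i z * (dbarCoord l)^[i] χ z +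
          B i z * (dbarCoord l)^[i + 1] χ z) =
          ∑ i ∈ Finset.range (k + 1), A i z * (dbarCoord l)^[i] χ z +
          ∑ i ∈ Finset.range (k + 1), B i z * (dbarCoord l)^[i + 1] χ z :=
        Finset.sum_add_distrib
      refine hL.trans ?_
      have hR : ∑ i ∈ Finset.range (k + 1 + 1), ((if i < k + 1 then A i z else 0) +
          (if i = 0 then 0 else B (i - 1) z)) * (dbarCoord l)^[i] χ z =
          ∑ i ∈ Finset.range (k + 1 + 1), (if i < k + 1 then A i z else 0) * (dbarCoord l)^[i] χ z +
          ∑ i ∈ Finset.range (k + 1 + 1), (if i = 0 then 0 else B (i - 1) z) *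
            (dbarCoord l)^[i] χ z := by
        rw [← Finset.sum_add_distrib]
        exact Finset.sum_congr rfl fun i _ => add_mul _ _ _
      rw [hR]
      congr 1
      · rw [Finset.sum_range_succ _ (k + 1), if_neg (lt_irrefl _), zero_mul, add_zero]
        exact Finset.sum_congr rfl fun i hi => by rw [if_pos (Finset.mem_range.1 hi)]
      · rw [Finset.sum_range_succ' _ (k + 1), if_pos rfl, zero_mul, add_zero]
        exact Finset.sum_congr rfl fun i _ => by
          rw [if_neg (Nat.succ_ne_zero i), Nat.add_sub_cancel]

/-- If `∂̄_l^N b = 0` then `b ∂̄_l^N χ` is `∂̄_l` of a test function, up to higher order terms. -/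
theorem exists_mul_dbarCoord_iterate_eq {U : Set (Fin n → ℂ)} (hU : IsOpen U) (l : Fin n)
    (N : ℕ) {b χ : (Fin n → ℂ) → ℂ} (hb : SmoothOn U b) (hχ : IsTest U χ) :
    ∃ Ψ, IsTest U Ψ ∧ ∀ z, b z * (dbarCoord l)^[N] χ z =
      dbarCoord l Ψ z + (-1) ^ N * ((dbarCoord l)^[N] b z * χ z) := by
  induction N generalizing b with
  | zero => exact ⟨_, IsTest.zero, fun z => by
      rw [show (fun _ => 0 : (Fin n → ℂ) → ℂ) = 0 from rfl, dbarCoord_zero]; simp⟩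
  | succ N ih =>
    obtain ⟨Ψ, hΨ, h⟩ := ih (hb.dbarCoord hU l)
    have ht := hχ.dbar_iterate l N
    -- One derivative is pulled out of `b ∂̄ᴺ⁺¹χ`; the correction `-∂̄b ∂̄ᴺχ` is treated by the
    -- induction hypothesis for `∂̄b`.
    refine ⟨fun z => b z * (dbarCoord l)^[N] χ z + (-1 : ℂ) * Ψ z,
      (ht.mul hU hb).add (hΨ.const_mul _), fun z => ?_⟩
    rw [dbarCoord_add ((ht.mul hU hb).differentiableAt z) ((hΨ.const_mul _).differentiableAt z),
      dbarCoord_const_mul _ (hΨ.differentiableAt z)]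
    by_cases hz : z ∈ U
    · rw [dbarCoord_mul (hb.differentiableAt hU hz) (ht.differentiableAt z), h z,
        Function.iterate_succ_apply', Function.iterate_succ_apply, pow_succ]
      ring
    · rw [((ht.mul hU hb).dbar l).eq_zero hz, (hΨ.dbar l).eq_zero hz, hχ.eq_zero hz,
        (hχ.dbar_iterate l (N + 1)).eq_zero hz]
      ring

end

section

open MeasureTheory Polynomial

/-! ### Iterated derivatives of polynomial families -/

theorem iterate_derivative_of_monic {T : ℂ[X]} {N : ℕ} (hT : T.Monic) (hN : T.natDegree = N) :
    derivative^[N] T = C (N.factorial : ℂ) := by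
  ext i
  rw [coeff_iterate_derivative, coeff_C]
  by_cases hi : i = 0
  · have : T.coeff N = 1 := by rw [← hN]; exact hT
    simp [hi, this, Nat.descFactorial_self]
  · rw [coeff_eq_zero_of_natDegree_lt (by omega), smul_zero, if_neg hi]

theorem dCoord_zero_iterate_evalFamily {k : ℕ} {T : (Fin k → ℂ) → ℂ[X]}
    {U : Set (Fin (k + 1) → ℂ)} (hU : IsOpen U) (hT : AnalyticOnNhd ℂ (evalFamily T) U) (j : ℕ) :
    ∀ z ∈ U, (dCoord 0)^[j] (evalFamily T) z = evalFamily (fun w => derivative^[j] (T w)) z := by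
  induction j with
  | zero => intro z _; rfl
  | succ j ih =>
    intro z hz
    have heq := Filter.eventuallyEq_of_mem (hU.mem_nhds hz) ih
    have han := (analyticOnNhd_dCoord_iterate hT 0 j z hz).congr heq
    rw [Function.iterate_succ_apply', (dCoord_congr heq).eq_of_nhds,
      dCoord_zero_evalFamily han.differentiableAt]
    simp only [Function.iterate_succ_apply']

theorem dCoord_one_evalFamily_tail {m : ℕ} {T : (Fin m → ℂ) → ℂ[X]} {z : Fin (m + 2) → ℂ}
    (hh : DifferentiableAt ℂ (fun z : Fin (m + 2) → ℂ => evalFamily T (Fin.tail z)) z) :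
    dCoord 1 (fun z : Fin (m + 2) → ℂ => evalFamily T (Fin.tail z)) z =
      evalFamily (fun w => (T w).derivative) (Fin.tail z) := by
  refine dCoord_of_eval (p := T (Fin.tail (Fin.tail z))) hh fun t => ?_
  have e : Fin.tail (Fin.tail (z + t • Pi.single 1 1)) = Fin.tail (Fin.tail z) := by
    funext i
    have : (i.succ.succ : Fin (m + 2)) ≠ 1 := by
      intro h
      have := congrArg Fin.val h
      simp at this
    simp [Fin.tail, this]
  rw [evalFamily, e]
  have : Fin.tail (z + t • Pi.single 1 1) 0 = z 1 + t := by
    simp [Fin.tail]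
  rw [this]

theorem dCoord_one_iterate_evalFamily_tail {m : ℕ} {T : (Fin m → ℂ) → ℂ[X]}
    {U : Set (Fin (m + 2) → ℂ)} (hU : IsOpen U)
    (hT : AnalyticOnNhd ℂ (fun z : Fin (m + 2) → ℂ => evalFamily T (Fin.tail z)) U) (j : ℕ) :
    ∀ z ∈ U, (dCoord 1)^[j] (fun z : Fin (m + 2) → ℂ => evalFamily T (Fin.tail z)) z =
      evalFamily (fun w => derivative^[j] (T w)) (Fin.tail z) := by
  induction j with
  | zero => intro z _; rfl
  | succ j ih =>
    intro z hz
    have heq := Filter.eventuallyEq_of_mem (hU.mem_nhds hz) ih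
    have han := (analyticOnNhd_dCoord_iterate hT 1 j z hz).congr heq
    rw [Function.iterate_succ_apply', (dCoord_congr heq).eq_of_nhds,
      dCoord_one_evalFamily_tail han.differentiableAt]
    simp only [Function.iterate_succ_apply']

/-! ### Test forms -/

section Forms

variable {n : ℕ} {U : Set (Fin n → ℂ)} {q : ℕ} {φ : Form n}

theorem IsTestForm.isTest (h : IsTestForm U q φ) (J : Finset (Fin n)) : IsTest U (φ J) :=
  ⟨h.smooth J, h.compact J, h.support J⟩

theorem isTestForm_of_isTest (h : ∀ J, IsTest U (φ J)) (h0 : ∀ J, J.card ≠ q → φ J = 0) :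
    IsTestForm U q φ :=
  ⟨h0, fun J => (h J).smooth, fun J => (h J).compact, fun J => (h J).support⟩

theorem IsTestForm.mono {V : Set (Fin n → ℂ)} (h : IsTestForm U q φ) (hUV : U ⊆ V) :
    IsTestForm V q φ :=
  isTestForm_of_isTest (fun J => (h.isTest J).mono hUV) h.degree

theorem IsTestForm.mulForm (h : IsTestForm U q φ) (hU : IsOpen U) {w : (Fin n → ℂ) → ℂ}
    (hw : SmoothOn U w) : IsTestForm U q (mulForm w φ) :=
  isTestForm_of_isTest (fun J => (h.isTest J).mul hU hw) fun J hJ => by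
    funext z; simp [ResidueCurrents.mulForm, h.degree J hJ]

theorem IsTestForm.dbar (h : IsTestForm U q φ) : IsTestForm U (q + 1) (dbar φ) := by
  refine isTestForm_of_isTest (fun J => IsTest.sum J fun l _ =>
    ((h.isTest _).dbar l).const_mul _) fun J hJ => ?_
  funext z
  refine Finset.sum_eq_zero fun l hl => ?_
  have hc := Finset.card_pos.2 ⟨l, hl⟩
  rw [h.degree (J.erase l) (by rw [Finset.card_erase_of_mem hl]; omega), dbarCoord_zero]
  simp

/-- For `k < l`, removing `k` lowers by one the number of indices before `l`, while removing `l`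
does not affect those before `k`. The products therefore differ by one sign. -/
theorem wedgeSign_comm {K : Finset (Fin n)} {k l : Fin n} (hk : k ∈ K) (hl : l ∈ K)
    (hkl : k ≠ l) :
    wedgeSign k K * wedgeSign l (K.erase k) = -(wedgeSign l K * wedgeSign k (K.erase l)) := by
  have key : ∀ {k l : Fin n}, k ∈ K → l ∈ K → k < l →
      wedgeSign k K * wedgeSign l (K.erase k) = -(wedgeSign l K * wedgeSign k (K.erase l)) := by
    intro k l hk hl h
    have h1 : (K.erase k).filter (· < l) = (K.filter (· < l)).erase k := by
      rw [Finset.filter_erase]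
    have h2 : (K.erase l).filter (· < k) = K.filter (· < k) := by
      rw [Finset.filter_erase, Finset.erase_eq_of_notMem]
      simp [h.le]
    have h3 : (K.filter (· < l)).card = ((K.filter (· < l)).erase k).card + 1 := by
      rw [Finset.card_erase_add_one]; simp [hk, h]
    simp only [wedgeSign, h1, h2, h3, pow_succ]
    ring
  rcases lt_or_gt_of_ne hkl with h | h
  · exact key hk hl h
  · rw [key hl hk h, neg_neg]

/-- The terms are indexed by ordered pairs of distinct indices. Exchanging the two preserves the
mixed derivative and reverses the sign, so they cancel in pairs. -/
theorem dbar_dbar (h : IsTestForm U q φ) : dbar (dbar φ) = 0 := by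
  funext K z
  have h1 : dbar (dbar φ) K z = ∑ x ∈ K ×ˢ K, if x.1 = x.2 then 0 else
      wedgeSign x.1 K * wedgeSign x.2 (K.erase x.1) *
        dbarCoord x.1 (dbarCoord x.2 (φ ((K.erase x.1).erase x.2))) z := by
    rw [Finset.sum_product]
    refine Finset.sum_congr rfl fun k hk => ?_
    have e : dbarCoord k (dbar φ (K.erase k)) z = ∑ l ∈ K.erase k,
        wedgeSign l (K.erase k) * dbarCoord k (dbarCoord l (φ ((K.erase k).erase l))) z := by
      have : dbar φ (K.erase k) = fun z => ∑ l ∈ K.erase k, wedgeSign l (K.erase k) *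
          dbarCoord l (φ ((K.erase k).erase l)) z := rfl
      rw [this, dbarCoord_sum _ fun l _ => (((h.isTest _).dbar l).const_mul _).differentiableAt z]
      exact Finset.sum_congr rfl fun l _ =>
        dbarCoord_const_mul _ (((h.isTest _).dbar l).differentiableAt z)
    rw [e, Finset.mul_sum]
    refine Eq.trans ?_ (Finset.sum_erase (a := k) K (by simp))
    refine Finset.sum_congr rfl fun l hl => ?_
    rw [if_neg (Finset.ne_of_mem_erase hl).symm, mul_assoc]
  rw [h1]
  refine Finset.sum_involution (fun x _ => (x.2, x.1)) ?_ ?_ ?_ ?_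
  · rintro ⟨k, l⟩ hx
    obtain ⟨hk, hl⟩ := Finset.mem_product.1 hx
    by_cases hkl : k = l
    · simp [hkl]
    · simp only [hkl, Ne.symm hkl, if_false]
      rw [wedgeSign_comm hk hl hkl, Finset.erase_right_comm,
        dbarCoord_comm ((h.isTest _).smooth.contDiffAt)]
      ring
  · rintro ⟨k, l⟩ hx hne heq
    apply hne
    have : k = l := (Prod.ext_iff.1 heq).2
    simp [this]
  · rintro ⟨k, l⟩ hx
    rw [Finset.mem_product] at hx ⊢
    exact hx.symm
  · rintro ⟨k, l⟩ _; rfl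

/-- `∂̄(h φ) = h ∂̄φ` for `h` holomorphic. -/
theorem dbar_mulForm (h : IsTestForm U q φ) {w : (Fin n → ℂ) → ℂ}
    (hw : ∀ z ∈ U, DifferentiableAt ℂ w z) : dbar (mulForm w φ) = mulForm w (dbar φ) := by
  funext K z
  simp only [dbar, mulForm, Finset.mul_sum]
  refine Finset.sum_congr rfl fun l _ => ?_
  change wedgeSign l K * dbarCoord l (fun z => w z * φ (K.erase l) z) z = _
  by_cases hz : z ∈ U
  · rw [dbarCoord_holo_mul (hw z hz) ((h.isTest _).differentiableAt z)]; ring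
  · have e1 : (fun z => w z * φ (K.erase l) z) =ᶠ[𝓝 z] fun _ => 0 := by
      filter_upwards [(h.isTest (K.erase l)).eventually_eq_zero hz] with y hy
      rw [hy, mul_zero]
    rw [(dbarCoord_eventuallyEq e1).eq_of_nhds, ((h.isTest _).dbar l).eq_zero hz,
      dbarCoord_of_differentiableAt (differentiableAt_const _)]
    ring

end Forms

end

/-! ### Charts, and bounds for iterated derivatives -/

section

open MeasureTheory Polynomial

/-- An open set on which `f₁ = u p` and `R = v q` with `u`, `v` holomorphic units and `p`, `q`
given by the families of monic polynomials `P₁` and `Q`. -/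
structure Chart {m : ℕ} (f₁ : (Fin (m + 2) → ℂ) → ℂ) (P₁ : (Fin (m + 1) → ℂ) → ℂ[X])
    (R : (Fin (m + 1) → ℂ) → ℂ) (Q : (Fin m → ℂ) → ℂ[X]) (N₁ N₂ : ℕ)
    (U : Set (Fin (m + 2) → ℂ)) (u : (Fin (m + 2) → ℂ) → ℂ) (v : (Fin (m + 1) → ℂ) → ℂ) :
    Prop where
  divisor : IsDivisor U (evalFamily P₁)
  monic₁ : ∀ w, (P₁ w).Monic
  natDegree₁ : ∀ w, (P₁ w).natDegree = N₁
  unit₁ : AnalyticOnNhd ℂ u U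
  unit₁_ne : ∀ z ∈ U, u z ≠ 0
  eq₁ : ∀ z ∈ U, f₁ z = u z * evalFamily P₁ z
  monic₂ : ∀ w, (Q w).Monic
  natDegree₂ : ∀ w, (Q w).natDegree = N₂
  analytic₂ : AnalyticOnNhd ℂ (fun z => evalFamily Q (Fin.tail z)) U
  ae_ne₂ : ∀ᵐ z, z ∈ U → evalFamily Q (Fin.tail z) ≠ 0
  unit₂ : AnalyticOnNhd ℂ (fun z => v (Fin.tail z)) U
  unit₂_ne : ∀ z ∈ U, v (Fin.tail z) ≠ 0
  eq₂ : ∀ z ∈ U, R (Fin.tail z) = v (Fin.tail z) * evalFamily Q (Fin.tail z)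

section

variable {n : ℕ} {U : Set (Fin n → ℂ)} {q : ℕ} {φ ψ : Form n}

theorem IsTestForm.iterate_add (hφ : IsTestForm U q φ) (hψ : IsTestForm U q ψ) (l : Fin n) (k : ℕ)
    (J : Finset (Fin n)) (z : Fin n → ℂ) :
    (dbarCoord l)^[k] ((φ + ψ) J) z = (dbarCoord l)^[k] (φ J) z + (dbarCoord l)^[k] (ψ J) z :=
  dbarCoord_iterate_add isOpen_univ ((hφ.isTest J).smoothOn _) ((hψ.isTest J).smoothOn _) k z trivial

theorem IsTestForm.iterate_smul (hφ : IsTestForm U q φ) (c : ℂ) (l : Fin n) (k : ℕ)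
    (J : Finset (Fin n)) (z : Fin n → ℂ) :
    (dbarCoord l)^[k] ((c • φ) J) z = c * (dbarCoord l)^[k] (φ J) z :=
  dbarCoord_iterate_holo_mul isOpen_univ (fun _ _ => differentiableAt_const c)
    ((hφ.isTest J).smoothOn _) k z trivial

theorem IsTestForm.iterate_mulForm (hφ : IsTestForm U q φ) (hU : IsOpen U) {w : (Fin n → ℂ) → ℂ}
    (hw : AnalyticOnNhd ℂ w U) (l : Fin n) (k : ℕ) (J : Finset (Fin n)) (z : Fin n → ℂ) :
    (dbarCoord l)^[k] (ResidueCurrents.mulForm w φ J) z = w z * (dbarCoord l)^[k] (φ J) z := by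
  by_cases hz : z ∈ U
  · exact dbarCoord_iterate_holo_mul hU (fun z hz => (hw z hz).differentiableAt)
      ((hφ.isTest J).smoothOn _) k z hz
  · rw [(((hφ.mulForm hU hw.smoothOn).isTest J).dbar_iterate l k).eq_zero hz,
      ((hφ.isTest J).dbar_iterate l k).eq_zero hz, mul_zero]

/-- A single constant, the sum over the orders up to `N`, serves for all of them; it bounds the
derivatives of `φ` inside `X₁` and `X₂` by its seminorms. -/
theorem exists_norm_dbarCoord_iterate_le (l k : Fin n) (M N : ℕ) : ∃ C : ℝ, 0 ≤ C ∧
    ∀ χ : (Fin n → ℂ) → ℂ, ContDiff ℝ ∞ χ → ∀ B : ℝ,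
      (∀ i ≤ N + M, ∀ z, ‖iteratedFDeriv ℝ i χ z‖ ≤ B) →
      ∀ i ≤ N, ∀ z, ‖(dbarCoord l)^[i] ((dbarCoord k)^[M] χ) z‖ ≤ C * B := by
  choose C hC hle using fun i => exists_norm_iteratedFDeriv_dbarCoord_le l i
  obtain ⟨D, hD, hleD⟩ := exists_norm_iteratedFDeriv_dbarCoord_le k M
  refine ⟨(∑ i ∈ Finset.range (N + 1), C i) * D,
    mul_nonneg (Finset.sum_nonneg fun i _ => hC i) hD, fun χ hχ B hB i hi z => ?_⟩
  have hB0 : 0 ≤ B := (norm_nonneg _).trans (hB 0 (Nat.zero_le _) z)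
  have hs : ContDiff ℝ ∞ ((dbarCoord k)^[M] χ) := by
    have : SmoothOn Set.univ χ := hχ.contDiffOn
    exact contDiffOn_univ.1 (this.dbarCoord_iterate isOpen_univ k M)
  have h1 := hle i _ hs 0 z
  rw [norm_iteratedFDeriv_zero, zero_add] at h1
  have h2 := hleD χ hχ i z
  calc _ ≤ C i * ‖iteratedFDeriv ℝ i ((dbarCoord k)^[M] χ) z‖ := h1
    _ ≤ C i * (D * B) := by
        refine mul_le_mul_of_nonneg_left (h2.trans ?_) (hC i)
        exact mul_le_mul_of_nonneg_left (hB _ (by omega) z) hD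
    _ ≤ (∑ i ∈ Finset.range (N + 1), C i) * (D * B) := by
        refine mul_le_mul_of_nonneg_right ?_ (mul_nonneg hD hB0)
        exact Finset.single_le_sum (f := C) (fun i _ => hC i) (Finset.mem_range.2 (by omega))
    _ = _ := by ring

end

/-- The Wirtinger derivative `∂χ/∂t̄` in one variable. -/
def dbarOne (χ : ℂ → ℂ) (t : ℂ) : ℂ := (1 / 2) * (fderiv ℝ χ t 1 + Complex.I * fderiv ℝ χ t Complex.I)

theorem integral_dbarOne {G : ℂ → ℂ} (hG : ContDiff ℝ ∞ G) (hc : HasCompactSupport G) :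
    ∫ t, dbarOne G t = 0 := by
  have hInt : ∀ v, Integrable fun t => fderiv ℝ G t v := fun v => by
    refine Continuous.integrable_of_hasCompactSupport ?_ ?_
    · exact (hG.continuous_fderiv (by simp)).clm_apply continuous_const
    · exact hc.fderiv_apply ℝ v
  have hz : ∀ v, ∫ t, fderiv ℝ G t v = 0 := fun v => by
    have := integral_mul_fderiv_eq_neg_fderiv_mul_of_integrable (𝕜 := ℂ) (μ := volume)
      (f := fun _ : ℂ => (1 : ℂ)) (g := G) (v := v) (by simp) (by simpa using hInt v)
      (by simpa using hG.continuous.integrable_of_hasCompactSupport hc)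
      (fun _ _ => differentiableAt_const _)
      (fun z _ => hG.differentiable (by simp) z)
    simpa using this
  simp only [dbarOne]
  rw [integral_const_mul, integral_add (hInt _) ((hInt _).const_mul _), integral_const_mul, hz, hz]
  simp

/-- `∂h/∂z̄₁` integrates to zero against a function that does not depend on `z₁`. -/
theorem integral_tail_mul_dbarCoord_zero {k : ℕ} {U : Set (Fin (k + 1) → ℂ)}
    {Ψ : (Fin (k + 1) → ℂ) → ℂ} (hΨ : IsTest U Ψ) {κ : (Fin k → ℂ) → ℂ}
    (hi : Integrable (fun z => κ (Fin.tail z) * dbarCoord 0 Ψ z)) :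
    ∫ z, κ (Fin.tail z) * dbarCoord 0 Ψ z = 0 := by
  -- Integrating in `z₁` first, `κ` is a constant factor, and what remains is the integral of a
  -- `∂̄`-derivative of a compactly supported function of one variable.
  rw [integral_cons hi]
  refine integral_eq_zero_of_ae (Filter.Eventually.of_forall fun w => ?_)
  simp only [consPoint, Fin.tail_cons, Pi.zero_apply]
  rw [integral_const_mul]
  suffices h : ∫ t : ℂ, dbarCoord 0 Ψ (Fin.cons t w) = 0 by rw [h, mul_zero]
  have hder : ∀ t : ℂ, HasFDerivAt (𝕜 := ℝ) (fun t : ℂ => (Fin.cons t w : Fin (k + 1) → ℂ))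
      (ContinuousLinearMap.single ℝ (fun _ : Fin (k + 1) => ℂ) 0) t := by
    intro t
    have e : (fun t : ℂ => (Fin.cons t w : Fin (k + 1) → ℂ)) = fun t =>
        ContinuousLinearMap.single ℝ (fun _ : Fin (k + 1) => ℂ) 0 t +
          (Fin.cons 0 w : Fin (k + 1) → ℂ) := by
      funext t i
      refine Fin.cases ?_ (fun i => ?_) i <;> simp
    rw [e]
    exact (ContinuousLinearMap.hasFDerivAt _).add_const _
  set G : ℂ → ℂ := fun t => Ψ (Fin.cons t w) with hG
  have hGs : ContDiff ℝ ∞ G := by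
    refine hΨ.smooth.comp ?_
    refine contDiff_pi.2 fun i => ?_
    refine Fin.cases ?_ (fun i => ?_) i
    · exact contDiff_id (𝕜 := ℝ) (E := ℂ)
    · simpa using contDiff_const
  have hGc : HasCompactSupport G := by
    refine HasCompactSupport.intro (hΨ.compact.isCompact.image (continuous_apply 0)) fun t ht => ?_
    by_contra h0
    exact ht ⟨Fin.cons t w, subset_tsupport _ h0, rfl⟩
  have hfd : ∀ t v, fderiv ℝ Ψ (Fin.cons t w) (Pi.single 0 v) = fderiv ℝ G t v := by
    intro t v
    have := (hΨ.differentiableAt (Fin.cons t w)).hasFDerivAt.comp t (hder t)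
    rw [show fderiv ℝ G t = _ from this.fderiv]
    rfl
  simp only [ResidueCurrents.dbarCoord, hfd]
  exact integral_dbarOne hGs hGc

/-! ### The current `X₁` -/

namespace Chart

variable {m : ℕ} {f₁ : (Fin (m + 2) → ℂ) → ℂ} {P₁ : (Fin (m + 1) → ℂ) → ℂ[X]}
  {R : (Fin (m + 1) → ℂ) → ℂ} {Q : (Fin m → ℂ) → ℂ[X]} {N₁ N₂ : ℕ}
  {U : Set (Fin (m + 2) → ℂ)} {u : (Fin (m + 2) → ℂ) → ℂ} {v : (Fin (m + 1) → ℂ) → ℂ}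
  {φ : Form (m + 2)} {q : ℕ}

theorem isOpen (h : Chart f₁ P₁ R Q N₁ N₂ U u v) : IsOpen U := h.divisor.isOpen

theorem analytic_inv (h : Chart f₁ P₁ R Q N₁ N₂ U u v) : AnalyticOnNhd ℂ (fun z => (u z)⁻¹) U :=
  fun z hz => (h.unit₁ z hz).fun_inv (h.unit₁_ne z hz)

theorem analytic_f (h : Chart f₁ P₁ R Q N₁ N₂ U u v) : AnalyticOnNhd ℂ f₁ U := fun z hz =>
  ((h.unit₁ z hz).fun_mul (h.divisor.analytic z hz)).congr
    (Filter.eventuallyEq_of_mem (h.isOpen.mem_nhds hz) fun y hy => (h.eq₁ y hy).symm)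

theorem analytic_R (h : Chart f₁ P₁ R Q N₁ N₂ U u v) :
    AnalyticOnNhd ℂ (fun z => R (Fin.tail z)) U := fun z hz =>
  ((h.unit₂ z hz).fun_mul (h.analytic₂ z hz)).congr
    (Filter.eventuallyEq_of_mem (h.isOpen.mem_nhds hz) fun y hy => (h.eq₂ y hy).symm)

theorem conjPow_eq (P₁ : (Fin (m + 1) → ℂ) → ℂ[X]) (Γ : ℕ) :
    conjPow P₁ Γ = fun z => conj (evalFamily (fun w => P₁ w ^ Γ) z) := by
  funext z; simp [conjPow, evalFamily]

theorem analytic_pow (h : Chart f₁ P₁ R Q N₁ N₂ U u v) (Γ : ℕ) :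
    AnalyticOnNhd ℂ (evalFamily (fun w => P₁ w ^ Γ)) U := fun z hz => by
  have := (h.divisor.analytic z hz).fun_pow Γ
  refine this.congr (Filter.Eventually.of_forall fun y => ?_)
  simp [evalFamily]

/-- The polynomial `P₁ ^ Γ` is monic of degree `Γ N₁`, so only its leading term survives this many
derivatives. This is the source of the factorial and of the order `Γ N₁` in the definition of `X₁`.
-/
theorem dCoord_iterate_pow (h : Chart f₁ P₁ R Q N₁ N₂ U u v) (Γ : ℕ) :
    ∀ z ∈ U, (dCoord 0)^[Γ * N₁] (evalFamily (fun w => P₁ w ^ Γ)) z = (Γ * N₁).factorial := by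
  intro z hz
  rw [dCoord_zero_iterate_evalFamily h.isOpen (h.analytic_pow Γ) _ z hz]
  simp only [evalFamily]
  rw [iterate_derivative_of_monic ((h.monic₁ _).pow Γ)
    (by rw [(h.monic₁ _).natDegree_pow, h.natDegree₁]), eval_C]

theorem dbarCoord_iterate_conjPow (h : Chart f₁ P₁ R Q N₁ N₂ U u v) (Γ : ℕ) :
    ∀ z ∈ U, (dbarCoord 0)^[Γ * N₁] (conjPow P₁ Γ) z = (Γ * N₁).factorial := by
  intro z hz
  rw [conjPow_eq, dbarCoord_iterate_conj h.isOpen (h.analytic_pow Γ) _ z hz,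
    h.dCoord_iterate_pow Γ z hz]
  simp

/-- The derivatives commute, and those in `z̄₁` already give a constant. This makes `f₁ X₂` vanish.
-/
theorem dbarCoord_iterate_dbarCoord_conjPow (h : Chart f₁ P₁ R Q N₁ N₂ U u v) (Γ : ℕ)
    (l : Fin (m + 2)) :
    ∀ z ∈ U, (dbarCoord 0)^[Γ * N₁] (dbarCoord l (conjPow P₁ Γ)) z = 0 := by
  intro z hz
  have e : ∀ z ∈ U, dbarCoord l (conjPow P₁ Γ) z =
      conj (dCoord l (evalFamily (fun w => P₁ w ^ Γ)) z) := fun z hz => by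
    rw [conjPow_eq, dbarCoord_conj (h.analytic_pow Γ z hz).differentiableAt]
  rw [dbarCoord_congr_on h.isOpen e _ z hz, dbarCoord_iterate_conj h.isOpen
    (analyticOnNhd_dCoord (h.analytic_pow Γ) l) _ z hz,
    dCoord_comm_iterate h.isOpen (h.analytic_pow Γ) _ z hz,
    (dCoord_congr (Filter.eventuallyEq_of_mem (h.isOpen.mem_nhds hz)
      (h.dCoord_iterate_pow Γ))).eq_of_nhds]
  simp [dCoord]

theorem smoothOn_conjPow (h : Chart f₁ P₁ R Q N₁ N₂ U u v) (Γ : ℕ) : SmoothOn U (conjPow P₁ Γ) :=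
  h.divisor.smoothOn_conj_pow Γ

theorem integrand₁_eq (h : Chart f₁ P₁ R Q N₁ N₂ U u v) (hφ : IsTestForm U q φ) (Γ : ℕ) :
    integrand₁ f₁ P₁ N₁ Γ φ Finset.univ = fun z => (u z)⁻¹ * ((evalFamily P₁ z)⁻¹ *
      (conj (evalFamily P₁ z) ^ Γ * (dbarCoord 0)^[Γ * N₁] (φ Finset.univ) z)) := by
  funext z
  change conj (evalFamily P₁ z) ^ Γ / f₁ z * (dbarCoord 0)^[Γ * N₁] (φ Finset.univ) z = _
  by_cases hz : z ∈ U
  · rw [h.eq₁ z hz, div_eq_mul_inv, mul_inv]; ring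
  · rw [((hφ.isTest _).dbar_iterate 0 _).eq_zero hz]; ring

/-- One power of `conj p` compensates `1 / p`, as `conj p / p` has modulus at most `1`; hence `Γ ≥
1` suffices. -/
theorem integrable_integrand₁ (h : Chart f₁ P₁ R Q N₁ N₂ U u v) (hφ : IsTestForm U q φ) (g : ℕ) :
    Integrable (integrand₁ f₁ P₁ N₁ (g + 1) φ Finset.univ) := by
  rw [h.integrand₁_eq hφ]
  have ht := ((hφ.isTest Finset.univ).dbar_iterate 0 ((g + 1) * N₁)).mul h.isOpen
    h.analytic_inv.smoothOn
  refine (h.divisor.integrable_inv_mul ht g).congr (Filter.Eventually.of_forall fun z => ?_)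
  ring

theorem isCurrent_X₁ (h : Chart f₁ P₁ R Q N₁ N₂ U u v) (q g : ℕ) :
    IsCurrent U q (X₁ f₁ P₁ N₁ (g + 1)) where
  map_add φ ψ hφ hψ := by
    simp only [X₁, formIntegral]
    rw [← mul_add, ← integral_add (h.integrable_integrand₁ hφ g) (h.integrable_integrand₁ hψ g)]
    congr 2
    funext z
    change _ * (dbarCoord 0)^[_] _ z = _ * (dbarCoord 0)^[_] _ z + _ * (dbarCoord 0)^[_] _ z
    rw [hφ.iterate_add hψ]; ring
  map_smul c φ hφ := by
    simp only [X₁, formIntegral]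
    rw [mul_left_comm c, ← integral_const_mul c]
    congr 2
    funext z
    change _ * (dbarCoord 0)^[_] _ z = _ * (_ * (dbarCoord 0)^[_] _ z)
    rw [hφ.iterate_smul]; ring
  bounded K hK hKU := by
    obtain ⟨C, hC, hle⟩ := exists_norm_dbarCoord_iterate_le (0 : Fin (m + 2)) 0 ((g + 1) * N₁) 0
    -- The quotient `|p| ^ (g + 1) / |p|` is at most `|p| ^ g`, so the majorant is continuous across
    -- the zeros of `p`.
    set H : (Fin (m + 2) → ℂ) → ℝ := fun z => ‖(u z)⁻¹‖ * ‖evalFamily P₁ z‖ ^ g with hH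
    have hHi : IntegrableOn H K := by
      refine ContinuousOn.integrableOn_compact hK ?_
      exact ((h.analytic_inv.continuousOn.mono hKU).norm).mul
        (((h.divisor.analytic.continuousOn.mono hKU).norm).pow g)
    set c : ℂ := (-1) ^ ((m + 2) * ((m + 2) - 1) / 2) * (-2 * Complex.I) ^ (m + 2) with hc
    refine ⟨‖c‖ * ((∫ z in K, H z) * C), 0 + (g + 1) * N₁, fun φ hφ hsupp B hB => ?_⟩
    have hb := hle _ (hφ.smooth Finset.univ) B (hB _) 0 le_rfl
    have key : ‖∫ z, integrand₁ f₁ P₁ N₁ (g + 1) φ Finset.univ z‖ ≤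
        ∫ z, K.indicator (fun z => H z * (C * B)) z := by
      refine norm_integral_le_of_norm_le ?_ (Filter.Eventually.of_forall fun z => ?_)
      · rw [integrable_indicator_iff hK.isClosed.measurableSet]
        exact hHi.mul_const _
      · rw [h.integrand₁_eq hφ]
        beta_reduce
        have hφK : IsTest K (φ Finset.univ) := ⟨hφ.smooth _, hφ.compact _, hsupp _⟩
        by_cases hz : z ∈ K
        · rw [Set.indicator_of_mem hz, norm_mul, norm_mul, norm_mul, norm_pow, RCLike.norm_conj,
            pow_succ, norm_inv (evalFamily P₁ z)]
          have h1 := hb z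
          simp only [Function.iterate_zero, id] at h1
          calc _ = (‖(u z)⁻¹‖ * ‖evalFamily P₁ z‖ ^ g) * (‖evalFamily P₁ z‖ / ‖evalFamily P₁ z‖) *
                ‖(dbarCoord 0)^[(g + 1) * N₁] (φ Finset.univ) z‖ := by ring
            _ ≤ (‖(u z)⁻¹‖ * ‖evalFamily P₁ z‖ ^ g) * 1 * (C * B) := by
                gcongr
                exact div_self_le_one _
            _ = _ := by rw [mul_one]
        · rw [Set.indicator_of_notMem hz, (hφK.dbar_iterate 0 _).eq_zero hz]; simp
    rw [integral_indicator hK.isClosed.measurableSet, integral_mul_const] at key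
    simp only [X₁, formIntegral]
    rw [norm_mul]
    calc _ ≤ ‖c‖ * ((∫ z in K, H z) * (C * B)) := mul_le_mul_of_nonneg_left key (norm_nonneg _)
      _ = _ := by ring

/-- Multiplication by `f₁` removes the denominator. Integrating by parts `Γ N₁` times moves all
derivatives onto `conj p ^ Γ`, where they produce the factorial, and the exact part integrates to
zero. -/
theorem mulCurrent_X₁ (h : Chart f₁ P₁ R Q N₁ N₂ U u v) (q g : ℕ) :
    CurrentEq U q (mulCurrent f₁ (X₁ f₁ P₁ N₁ (g + 1))) (fun φ =>
      (-1) ^ ((g + 1) * N₁) * (Nat.factorial ((g + 1) * N₁) : ℂ) * formIntegral φ) := by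
  intro φ hφ
  obtain ⟨Ψ, hΨ, hΨe⟩ := exists_mul_dbarCoord_iterate_eq h.isOpen 0 ((g + 1) * N₁)
    (h.smoothOn_conjPow (g + 1)) (hφ.isTest Finset.univ)
  have e : integrand₁ f₁ P₁ N₁ (g + 1) (mulForm f₁ φ) Finset.univ = fun z =>
      dbarCoord 0 Ψ z + (-1) ^ ((g + 1) * N₁) * (Nat.factorial ((g + 1) * N₁) : ℂ) *
        φ Finset.univ z := by
    funext z
    change conjPow P₁ (g + 1) z / f₁ z *
      (dbarCoord 0)^[(g + 1) * N₁] (mulForm f₁ φ Finset.univ) z = _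
    rw [hφ.iterate_mulForm h.isOpen h.analytic_f]
    have h1 := hΨe z
    by_cases hz : z ∈ U
    · rw [h.dbarCoord_iterate_conjPow _ z hz] at h1
      -- At zeros of `f₁` the cancellation `f₁ / f₁ = 1` fails, but `conj p ^ Γ` vanishes there too,
      -- so the identity holds at every point.
      by_cases hf : f₁ z = 0
      · have : conjPow P₁ (g + 1) z = 0 := by
          have : evalFamily P₁ z = 0 := by
            have h2 := h.eq₁ z hz
            rw [hf] at h2
            exact (mul_eq_zero.1 h2.symm).resolve_left (h.unit₁_ne z hz)
          simp [conjPow, this]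
        rw [this, zero_mul] at h1
        rw [this, zero_div, zero_mul, h1]; ring
      · rw [mul_assoc, ← h1]; field_simp
    · rw [hΨ.dbar 0 |>.eq_zero hz, (hφ.isTest _).eq_zero hz,
        ((hφ.isTest _).dbar_iterate 0 _).eq_zero hz]
      ring
  simp only [mulCurrent, X₁, formIntegral]
  rw [e, integral_add (hΨ.dbar 0).integrable ((hφ.isTest _).integrable.const_mul _),
    hΨ.integral_dbarCoord, integral_const_mul]
  ring

end Chart

end

section

open MeasureTheory Polynomial

/-! ### The current `X₂` -/

/-- The function `conj q / R`, seen on `ℂⁿ`. -/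
def kernel {m : ℕ} (R : (Fin (m + 1) → ℂ) → ℂ) (Q : (Fin m → ℂ) → ℂ[X])
    (z : Fin (m + 2) → ℂ) : ℂ :=
  conj (evalFamily Q (Fin.tail z)) / R (Fin.tail z)

/-- The factor of `conj p ^ (Γ - 1)` in `p u⁻¹ / p · ∂̄(conj p ^ Γ) ∧ ∂̄₁^M φ`. -/
def residueTest {m : ℕ} (P₁ : (Fin (m + 1) → ℂ) → ℂ[X]) (u : (Fin (m + 2) → ℂ) → ℂ) (M Γ : ℕ)
    (φ : Form (m + 2)) (z : Fin (m + 2) → ℂ) : ℂ :=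
  ∑ l, ((u z)⁻¹ * (Γ * (wedgeSign l Finset.univ * conj (dCoord l (evalFamily P₁) z)))) *
    (dbarCoord 0)^[M] (φ (Finset.univ.erase l)) z

theorem integrable_mul_of_norm_le_one {n : ℕ} {U : Set (Fin n → ℂ)}
    {θ F : (Fin n → ℂ) → ℂ} (hF : Integrable F)
    (hθ : AEStronglyMeasurable θ (volume.restrict U)) (hb : ∀ z, ‖θ z‖ ≤ 1)
    (h0 : ∀ z ∉ U, F z = 0) : Integrable (fun z => θ z * F z) := by
  have hs : Function.support (fun z => θ z * F z) ⊆ U := fun z hz => by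
    by_contra hzU
    exact hz (by simp [h0 z hzU])
  rw [← integrableOn_iff_integrable_of_support_subset hs]
  exact hF.integrableOn.bdd_mul hθ (Filter.Eventually.of_forall hb)

namespace Chart

variable {m : ℕ} {f₁ : (Fin (m + 2) → ℂ) → ℂ} {P₁ : (Fin (m + 1) → ℂ) → ℂ[X]}
  {R : (Fin (m + 1) → ℂ) → ℂ} {Q : (Fin m → ℂ) → ℂ[X]} {N₁ N₂ : ℕ}
  {U : Set (Fin (m + 2) → ℂ)} {u : (Fin (m + 2) → ℂ) → ℂ} {v : (Fin (m + 1) → ℂ) → ℂ}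
  {φ ψ : Form (m + 2)} {q : ℕ}

theorem smoothOn_factor (h : Chart f₁ P₁ R Q N₁ N₂ U u v) (c : ℂ) (l : Fin (m + 2)) (s : ℂ) :
    SmoothOn U (fun z => (u z)⁻¹ * (c * (s * conj (dCoord l (evalFamily P₁) z)))) :=
  h.analytic_inv.smoothOn.mul (SmoothOn.mul contDiffOn_const (SmoothOn.mul contDiffOn_const
    (analyticOnNhd_dCoord h.divisor.analytic l).smoothOn.conj))

theorem isTest_residueTest (h : Chart f₁ P₁ R Q N₁ N₂ U u v) (hφ : IsTestForm U q φ) (M Γ : ℕ) :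
    IsTest U (residueTest P₁ u M Γ φ) :=
  IsTest.sum _ fun l _ => ((hφ.isTest _).dbar_iterate 0 M).mul h.isOpen (h.smoothOn_factor Γ l _)

theorem residueTest_add (hφ : IsTestForm U q φ) (hψ : IsTestForm U q ψ) (M Γ : ℕ) :
    residueTest P₁ u M Γ (φ + ψ) = fun z => residueTest P₁ u M Γ φ z + residueTest P₁ u M Γ ψ z := by
  funext z
  simp only [residueTest]
  rw [← Finset.sum_add_distrib]
  exact Finset.sum_congr rfl fun l _ => by rw [hφ.iterate_add hψ]; ring

theorem residueTest_smul (hφ : IsTestForm U q φ) (c : ℂ) (M Γ : ℕ) :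
    residueTest P₁ u M Γ (c • φ) = fun z => c * residueTest P₁ u M Γ φ z := by
  funext z
  simp only [residueTest]
  rw [Finset.mul_sum]
  exact Finset.sum_congr rfl fun l _ => by rw [hφ.iterate_smul]; ring

theorem residueTest_mulForm (hφ : IsTestForm U q φ) (hU : IsOpen U) {w : (Fin (m + 2) → ℂ) → ℂ}
    (hw : AnalyticOnNhd ℂ w U) (M Γ : ℕ) :
    residueTest P₁ u M Γ (mulForm w φ) = fun z => w z * residueTest P₁ u M Γ φ z := by
  funext z
  simp only [residueTest]
  rw [Finset.mul_sum]
  exact Finset.sum_congr rfl fun l _ => by rw [hφ.iterate_mulForm hU hw]; ring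

/-- Differentiating `conj p ^ (g + 1)` leaves exactly `g` powers of `conj p`; everything else is
smooth and is collected in `residueTest`. -/
theorem conj_pow_mul_residueTest (h : Chart f₁ P₁ R Q N₁ N₂ U u v) (g M : ℕ)
    (φ : Form (m + 2)) {z : Fin (m + 2) → ℂ} (hz : z ∈ U) :
    conj (evalFamily P₁ z) ^ g * residueTest P₁ u M (g + 1) φ z =
      (u z)⁻¹ * dbarWedge (conjPow P₁ (g + 1)) (dbarIter 0 M φ) Finset.univ z := by
  simp only [residueTest, dbarWedge, Finset.mul_sum, dbarIter]
  refine Finset.sum_congr rfl fun l _ => ?_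
  rw [show conjPow P₁ (g + 1) = fun z => conj (evalFamily P₁ z) ^ (g + 1) from rfl,
    dbarCoord_conj_pow h.divisor.analytic l _ hz, Nat.add_sub_cancel]
  ring

/-- Off the zeros of `p` the factor `1 / p` is holomorphic, so it commutes with `∂̄₂ ^ N₂` and can
be taken outside. The zeros form a null set, on which the derivative of the original expression is
not controlled. -/
theorem integrand₂_ae (h : Chart f₁ P₁ R Q N₁ N₂ U u v) (hφ : IsTestForm U q φ) (g : ℕ) :
    integrand₂ f₁ P₁ R Q N₁ N₂ (g + 1) φ Finset.univ =ᵐ[volume] fun z => kernel R Q z *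
      ((evalFamily P₁ z)⁻¹ * (dbarCoord 1)^[N₂] (fun z => conj (evalFamily P₁ z) ^ g *
        residueTest P₁ u ((g + 1) * N₁) (g + 1) φ z) z) := by
  filter_upwards [h.divisor.ae_ne] with z hpz
  set F : (Fin (m + 2) → ℂ) → ℂ := fun z => (f₁ z)⁻¹ *
    dbarWedge (conjPow P₁ (g + 1)) (dbarIter 0 ((g + 1) * N₁) φ) Finset.univ z with hF
  change kernel R Q z * (dbarCoord 1)^[N₂] F z = _
  have hT := h.divisor.isTest_conj_pow_mul (h.isTest_residueTest hφ ((g + 1) * N₁) (g + 1)) g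
  by_cases hz : z ∈ U
  · set V : Set (Fin (m + 2) → ℂ) := U ∩ evalFamily P₁ ⁻¹' {0}ᶜ with hV
    have hVo : IsOpen V := h.divisor.analytic.continuousOn.isOpen_inter_preimage h.isOpen
      isOpen_compl_singleton
    have hzV : z ∈ V := ⟨hz, hpz hz⟩
    rw [← dbarCoord_iterate_holo_mul hVo (g := fun z => (evalFamily P₁ z)⁻¹)
      (fun y hy => ((h.divisor.analytic y hy.1).differentiableAt.fun_inv hy.2)) (hT.smoothOn V) N₂ z hzV]
    congr 1
    refine dbarCoord_congr_on hVo (fun y hy => ?_) N₂ z hzV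
    rw [h.conj_pow_mul_residueTest g _ φ hy.1, hF]
    beta_reduce
    rw [h.eq₁ y hy.1, mul_inv]
    ring
  · rw [(hT.dbar_iterate 1 N₂).eq_zero hz]
    have e : F =ᶠ[𝓝 z] 0 := by
      have : ∀ᶠ y in 𝓝 z, ∀ l : Fin (m + 2),
          (dbarCoord 0)^[(g + 1) * N₁] (φ (Finset.univ.erase l)) y = 0 :=
        Filter.eventually_all.2 fun l => ((hφ.isTest _).dbar_iterate 0 _).eventually_eq_zero hz
      filter_upwards [this] with y hy
      simp [hF, dbarWedge, dbarIter, hy]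
    rw [(dbarCoord_iterate_eventuallyEq e N₂).eq_of_nhds, dbarCoord_iterate_zero]
    simp

theorem kernel_eq (h : Chart f₁ P₁ R Q N₁ N₂ U u v) {z : Fin (m + 2) → ℂ} (hz : z ∈ U) :
    kernel R Q z = conj (evalFamily Q (Fin.tail z)) / evalFamily Q (Fin.tail z) *
      (v (Fin.tail z))⁻¹ := by
  rw [kernel, h.eq₂ z hz, div_eq_mul_inv, div_eq_mul_inv, mul_inv]; ring

theorem analytic_inv₂ (h : Chart f₁ P₁ R Q N₁ N₂ U u v) :
    AnalyticOnNhd ℂ (fun z => (v (Fin.tail z))⁻¹) U :=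
  fun z hz => (h.unit₂ z hz).fun_inv (h.unit₂_ne z hz)

theorem integrable_kernel_mul (h : Chart f₁ P₁ R Q N₁ N₂ U u v) {F : (Fin (m + 2) → ℂ) → ℂ}
    (hF : Integrable (fun z => (v (Fin.tail z))⁻¹ * F z)) (h0 : ∀ z ∉ U, F z = 0) :
    Integrable (fun z => kernel R Q z * F z) := by
  have hq := h.analytic₂.continuousOn.aemeasurable h.isOpen.measurableSet (μ := volume)
  have := integrable_mul_of_norm_le_one hF
    (θ := fun z => conj (evalFamily Q (Fin.tail z)) / evalFamily Q (Fin.tail z))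
    ((Complex.continuous_conj.measurable.comp_aemeasurable hq).div hq).aestronglyMeasurable
    (fun z => by rw [norm_div, RCLike.norm_conj]; exact div_self_le_one _)
    (fun z hz => by rw [h0 z hz, mul_zero])
  refine this.congr (Filter.Eventually.of_forall fun z => ?_)
  by_cases hz : z ∈ U
  · beta_reduce; rw [h.kernel_eq hz]; ring
  · simp [h0 z hz]

theorem integrable_kernel_mul_test (h : Chart f₁ P₁ R Q N₁ N₂ U u v) {χ : (Fin (m + 2) → ℂ) → ℂ}
    (hχ : IsTest U χ) : Integrable (fun z => kernel R Q z * χ z) :=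
  h.integrable_kernel_mul (hχ.mul h.isOpen h.analytic_inv₂.smoothOn).integrable
    fun _ hz => hχ.eq_zero hz

/-- After `k` of the `k + 1` derivatives, `j + 1` powers of `conj p` remain. The last derivative may
leave no power at all when `j = 0`, but it then yields `conj (∂₂ p) / p`, which has the modulus of
the logarithmic derivative and is integrable. Hence the threshold `Γ ≥ N₂ + 1`. -/
theorem integrable_kernel_mul_inv (h : Chart f₁ P₁ R Q N₁ N₂ U u v) (j k : ℕ)
    {χ : (Fin (m + 2) → ℂ) → ℂ} (hχ : IsTest U χ) :
    Integrable (fun z => kernel R Q z * ((evalFamily P₁ z)⁻¹ *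
      (dbarCoord 1)^[k + 1] (fun z => conj (evalFamily P₁ z) ^ (j + 1 + k) * χ z) z)) := by
  have hT := (h.divisor.isTest_conj_pow_mul hχ (j + 1 + k)).dbar_iterate 1 (k + 1)
  refine h.integrable_kernel_mul ?_ fun z hz => by rw [hT.eq_zero hz, mul_zero]
  obtain ⟨χ', hχ', e⟩ := h.divisor.dbarCoord_iterate_conj_pow_mul 1 (j + 1) k hχ
  rw [Function.iterate_succ_apply', e]
  exact (h.divisor.integral_by_parts hχ' h.analytic_inv₂.smoothOn 1 j).1

theorem integrable_integrand₂ {k : ℕ} (h : Chart f₁ P₁ R Q N₁ (k + 1) U u v) (hφ : IsTestForm U q φ)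
    (j : ℕ) : Integrable (integrand₂ f₁ P₁ R Q N₁ (k + 1) (j + 1 + k + 1) φ Finset.univ) :=
  (h.integrable_kernel_mul_inv j k (h.isTest_residueTest hφ _ _)).congr
    (h.integrand₂_ae hφ (j + 1 + k)).symm

/-- Quantitative form of the same integrability. The majorant is a continuous multiple of the
logarithmic derivative of `p` plus a continuous function, and it does not depend on the test
function. -/
theorem exists_bound (h : Chart f₁ P₁ R Q N₁ N₂ U u v) {a : (Fin (m + 2) → ℂ) → ℂ}
    (ha : SmoothOn U a) {K : Set (Fin (m + 2) → ℂ)} (hK : IsCompact K) (hKU : K ⊆ U) (k j : ℕ) :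
    ∃ H : (Fin (m + 2) → ℂ) → ℝ, IntegrableOn H K ∧ ∀ χ, IsTest U χ → ∀ B : ℝ,
      (∀ i ≤ k + 1, ∀ z, ‖(dbarCoord 1)^[i] χ z‖ ≤ B) → ∀ z ∈ K, evalFamily P₁ z ≠ 0 →
      ‖kernel R Q z * ((evalFamily P₁ z)⁻¹ * (dbarCoord 1)^[k + 1]
        (fun z => conj (evalFamily P₁ z) ^ (j + 1 + k) * (a z * χ z)) z)‖ ≤ H z * B := by
  obtain ⟨b, hb, hbe⟩ := exists_dbarCoord_iterate_eq h.isOpen h.divisor.analytic 1 ha k (j + 1)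
  set p := evalFamily P₁ with hp
  set A : (Fin (m + 2) → ℂ) → ℝ := fun z => ‖(v (Fin.tail z))⁻¹‖ * ‖p z‖ ^ j *
    ∑ i ∈ Finset.range (k + 1), (j + 1) * ‖b i z‖ with hA
  set D : (Fin (m + 2) → ℂ) → ℝ := fun z => ‖(v (Fin.tail z))⁻¹‖ * ‖p z‖ ^ j *
    ∑ i ∈ Finset.range (k + 1), (‖dbarCoord 1 (b i) z‖ + ‖b i z‖) with hD
  have hv : ContinuousOn (fun z => ‖(v (Fin.tail z))⁻¹‖ * ‖p z‖ ^ j) K :=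
    (h.analytic_inv₂.continuousOn.mono hKU).norm.mul
      ((h.divisor.analytic.continuousOn.mono hKU).norm.pow j)
  have hbc : ∀ i, ContinuousOn (b i) K := fun i => ContinuousOn.mono (hb i).continuousOn hKU
  have hbc' : ∀ i, ContinuousOn (dbarCoord 1 (b i)) K := fun i =>
    ContinuousOn.mono ((hb i).dbarCoord h.isOpen 1).continuousOn hKU
  have hAc : ContinuousOn A K := hv.mul (continuousOn_finsetSum _ fun i _ =>
    continuousOn_const.mul (hbc i).norm)
  have hDc : ContinuousOn D K := hv.mul (continuousOn_finsetSum _ fun i _ =>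
    (hbc' i).norm.add (hbc i).norm)
  refine ⟨fun z => A z * ‖dCoord 1 p z / p z‖ + D z, ?_, fun χ hχ B hB z hz hpz => ?_⟩
  · exact (IntegrableOn.continuousOn_mul hAc (((h.divisor.logDeriv 1).mono_set hKU).norm)
      hK).add (hDc.integrableOn_compact hK)
  have hB0 : 0 ≤ B := (norm_nonneg _).trans (hB 0 (Nat.zero_le _) z)
  have hzU := hKU hz
  have e1 : (dbarCoord 1)^[k + 1] (fun z => conj (p z) ^ (j + 1 + k) * (a z * χ z)) z =
      conj (p z) ^ j * ∑ i ∈ Finset.range (k + 1),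
        (((j + 1 : ℕ) * conj (dCoord 1 p z) * b i z + conj (p z) * dbarCoord 1 (b i) z) *
          (dbarCoord 1)^[i] χ z + conj (p z) * b i z * (dbarCoord 1)^[i + 1] χ z) := by
    rw [Function.iterate_succ_apply', ← dbarCoord_conj_pow_mul_sum h.isOpen h.divisor.analytic 1 j
      (k + 1) hb hχ hzU]
    exact (dbarCoord_eventuallyEq (Filter.eventuallyEq_of_mem (h.isOpen.mem_nhds hzU)
      (hbe χ hχ))).eq_of_nhds
  have hkn : ‖kernel R Q z‖ ≤ ‖(v (Fin.tail z))⁻¹‖ := by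
    rw [h.kernel_eq hzU, norm_mul, norm_div, RCLike.norm_conj]
    exact mul_le_of_le_one_left (norm_nonneg _) (div_self_le_one _)
  have hpn : ‖p z‖ ≠ 0 := norm_ne_zero_iff.2 hpz
  rw [e1, norm_mul, norm_mul, norm_mul, norm_pow, RCLike.norm_conj, norm_inv]
  have hterm : ∀ i ∈ Finset.range (k + 1),
      ‖((j + 1 : ℕ) * conj (dCoord 1 p z) * b i z + conj (p z) * dbarCoord 1 (b i) z) *
          (dbarCoord 1)^[i] χ z + conj (p z) * b i z * (dbarCoord 1)^[i + 1] χ z‖ ≤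
      ‖p z‖ * (((j + 1) * ‖b i z‖ * ‖dCoord 1 p z / p z‖ +
        (‖dbarCoord 1 (b i) z‖ + ‖b i z‖)) * B) := by
    intro i hi
    have hi' := Finset.mem_range.1 hi
    have hj : ‖((j + 1 : ℕ) : ℂ)‖ = j + 1 := by rw [Complex.norm_natCast]; push_cast; rfl
    calc _ ≤ ‖(j + 1 : ℕ) * conj (dCoord 1 p z) * b i z + conj (p z) * dbarCoord 1 (b i) z‖ *
          ‖(dbarCoord 1)^[i] χ z‖ + ‖conj (p z) * b i z‖ * ‖(dbarCoord 1)^[i + 1] χ z‖ := by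
            refine (norm_add_le _ _).trans ?_
            rw [norm_mul, norm_mul (conj (p z) * b i z)]
      _ ≤ (‖(j + 1 : ℕ) * conj (dCoord 1 p z) * b i z‖ + ‖conj (p z) * dbarCoord 1 (b i) z‖) * B +
          ‖conj (p z) * b i z‖ * B := by
            gcongr
            · exact norm_add_le _ _
            · exact hB i (by omega) z
            · exact hB (i + 1) (by omega) z
      _ = _ := by
            simp only [norm_mul, RCLike.norm_conj, norm_div, hj]
            field_simp
            ring
  calc _ ≤ ‖(v (Fin.tail z))⁻¹‖ * (‖p z‖⁻¹ * (‖p z‖ ^ j * ∑ i ∈ Finset.range (k + 1),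
        ‖p z‖ * (((j + 1) * ‖b i z‖ * ‖dCoord 1 p z / p z‖ +
        (‖dbarCoord 1 (b i) z‖ + ‖b i z‖)) * B))) := by
          gcongr
          exact (norm_sum_le _ _).trans (Finset.sum_le_sum hterm)
    _ = _ := by
        rw [← Finset.mul_sum, ← Finset.sum_mul, Finset.sum_add_distrib, ← Finset.sum_mul]
        simp only [hA, hD]
        field_simp

theorem isCurrent_X₂ {k : ℕ} (h : Chart f₁ P₁ R Q N₁ (k + 1) U u v) (q j : ℕ) :
    IsCurrent U q (X₂ f₁ P₁ R Q N₁ (k + 1) (j + 1 + k + 1)) where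
  map_add φ ψ hφ hψ := by
    have hi := h.integrable_integrand₂ hφ j
    have hi' := h.integrable_integrand₂ hψ j
    simp only [X₂, formIntegral]
    rw [← mul_add, ← integral_add hi hi']
    congr 1
    -- Additivity is checked on the almost everywhere formula, because the expression under the
    -- iterated derivative need not be differentiable at the zeros of `f₁`.
    refine integral_congr_ae ?_
    filter_upwards [h.integrand₂_ae hφ (j + 1 + k), h.integrand₂_ae hψ (j + 1 + k),
      h.integrand₂_ae (φ := φ + ψ) (q := q) (isTestForm_of_isTest
        (fun J => (hφ.isTest J).add (hψ.isTest J)) (fun J hJ => by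
          funext z; simp [hφ.degree J hJ, hψ.degree J hJ])) (j + 1 + k)] with z h1 h2 h3
    rw [h1, h2, h3, residueTest_add hφ hψ]
    simp only [mul_add]
    rw [dbarCoord_iterate_add isOpen_univ
      ((h.divisor.isTest_conj_pow_mul (h.isTest_residueTest hφ _ _) _).smoothOn _)
      ((h.divisor.isTest_conj_pow_mul (h.isTest_residueTest hψ _ _) _).smoothOn _) _ z trivial]
    ring
  map_smul c φ hφ := by
    simp only [X₂, formIntegral]
    rw [mul_left_comm c, ← integral_const_mul c]
    congr 1
    refine integral_congr_ae ?_
    filter_upwards [h.integrand₂_ae hφ (j + 1 + k),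
      h.integrand₂_ae (φ := c • φ) (q := q) (isTestForm_of_isTest
        (fun J => (hφ.isTest J).const_mul c) (fun J hJ => by
          funext z; simp [hφ.degree J hJ])) (j + 1 + k)] with z h1 h3
    rw [h1, h3, residueTest_smul hφ]
    simp only [mul_left_comm _ c]
    rw [dbarCoord_iterate_holo_mul isOpen_univ (fun _ _ => differentiableAt_const c)
      ((h.divisor.isTest_conj_pow_mul (h.isTest_residueTest hφ _ _) _).smoothOn _) _ z trivial]
    ring
  bounded K hK hKU := by
    set Γ := j + 1 + k + 1 with hΓ
    obtain ⟨C, hC, hle⟩ := exists_norm_dbarCoord_iterate_le (1 : Fin (m + 2)) 0 (Γ * N₁) (k + 1)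
    choose H hHi hH using fun l => h.exists_bound (h.smoothOn_factor Γ l
      (wedgeSign l Finset.univ)) hK hKU k j
    set c : ℂ := (-1) ^ ((m + 2) * ((m + 2) - 1) / 2) * (-2 * Complex.I) ^ (m + 2) with hc
    refine ⟨‖c‖ * ((∫ z in K, ∑ l, H l z) * C), k + 1 + Γ * N₁, fun φ hφ hsupp B hB => ?_⟩
    have key : ‖∫ z, integrand₂ f₁ P₁ R Q N₁ (k + 1) Γ φ Finset.univ z‖ ≤
        ∫ z, K.indicator (fun z => (∑ l, H l z) * (C * B)) z := by
      refine norm_integral_le_of_norm_le ?_ ?_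
      · rw [integrable_indicator_iff hK.isClosed.measurableSet]
        exact (integrable_finsetSum _ fun l _ => hHi l).mul_const _
      filter_upwards [h.integrand₂_ae hφ (j + 1 + k), h.divisor.ae_ne] with z hz hpz
      rw [hz]
      have hT := h.divisor.isTest_conj_pow_mul (h.isTest_residueTest hφ (Γ * N₁) Γ) (j + 1 + k)
      by_cases hzK : z ∈ K
      · rw [Set.indicator_of_mem hzK]
        have e : (fun z => conj (evalFamily P₁ z) ^ (j + 1 + k) * residueTest P₁ u (Γ * N₁) Γ φ z)
            = fun z => ∑ l, conj (evalFamily P₁ z) ^ (j + 1 + k) *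
            (((u z)⁻¹ * (Γ * (wedgeSign l Finset.univ * conj (dCoord l (evalFamily P₁) z)))) *
            (dbarCoord 0)^[Γ * N₁] (φ (Finset.univ.erase l)) z) := by
          funext z; rw [residueTest, Finset.mul_sum]
        have hts := fun l : Fin (m + 2) => (hφ.isTest (Finset.univ.erase l)).dbar_iterate 0 (Γ * N₁)
        rw [e, dbarCoord_iterate_sum _ isOpen_univ (fun l _ =>
          (h.divisor.isTest_conj_pow_mul ((hts l).mul h.isOpen (h.smoothOn_factor Γ l _)) _).smoothOn
            _) _ z trivial, Finset.mul_sum, Finset.mul_sum, Finset.sum_mul]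
        refine (norm_sum_le _ _).trans (Finset.sum_le_sum fun l _ => ?_)
        exact hH l _ (hts l) _ (hle _ (hφ.smooth _) B (hB _)) z hzK (hpz (hKU hzK))
      · rw [Set.indicator_of_notMem hzK]
        have hTK : IsTest K (fun z => conj (evalFamily P₁ z) ^ (j + 1 + k) *
            residueTest P₁ u (Γ * N₁) Γ φ z) := by
          refine ⟨hT.smooth, hT.compact, closure_minimal (fun y hy => ?_) hK.isClosed⟩
          by_contra hyK
          refine hy ?_
          have : ∀ l, (dbarCoord 0)^[Γ * N₁] (φ (Finset.univ.erase l)) y = 0 := fun l =>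
            (IsTest.dbar_iterate (U := K) ⟨hφ.smooth _, hφ.compact _, hsupp _⟩ 0 _).eq_zero hyK
          simp [residueTest, this]
        rw [(hTK.dbar_iterate 1 _).eq_zero hzK]
        simp
    rw [integral_indicator hK.isClosed.measurableSet, integral_mul_const] at key
    simp only [X₂, formIntegral]
    rw [norm_mul]
    calc _ ≤ ‖c‖ * ((∫ z in K, ∑ l, H l z) * (C * B)) :=
          mul_le_mul_of_nonneg_left key (norm_nonneg _)
      _ = _ := by ring

end Chart

end

/-! ### The identities for `R X₂` and `f₁ X₂` -/

section

open MeasureTheory Polynomial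

namespace Chart

variable {m : ℕ} {f₁ : (Fin (m + 2) → ℂ) → ℂ} {P₁ : (Fin (m + 1) → ℂ) → ℂ[X]}
  {R : (Fin (m + 1) → ℂ) → ℂ} {Q : (Fin m → ℂ) → ℂ[X]} {N₁ N₂ : ℕ}
  {U : Set (Fin (m + 2) → ℂ)} {u : (Fin (m + 2) → ℂ) → ℂ} {v : (Fin (m + 1) → ℂ) → ℂ}
  {φ ψ : Form (m + 2)} {q : ℕ}

theorem dbarCoord_iterate_conj_second (h : Chart f₁ P₁ R Q N₁ N₂ U u v) : ∀ z ∈ U,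
    (dbarCoord 1)^[N₂] (fun z => conj (evalFamily Q (Fin.tail z))) z = N₂.factorial := by
  intro z hz
  rw [dbarCoord_iterate_conj h.isOpen h.analytic₂ _ z hz,
    dCoord_one_iterate_evalFamily_tail h.isOpen h.analytic₂ _ z hz]
  simp only [evalFamily]
  rw [iterate_derivative_of_monic (h.monic₂ _) (h.natDegree₂ _), eval_C]
  simp

/-- Integration by parts turns `∂̄(conj p ^ Γ) ∧ φ` into `-conj p ^ Γ ∂̄φ`. -/
theorem integral_residueTest (h : Chart f₁ P₁ R Q N₁ N₂ U u v) (hφ : IsTestForm U q φ) (g : ℕ) :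
    ∫ z, (evalFamily P₁ z)⁻¹ * (conj (evalFamily P₁ z) ^ (g + 1) *
      residueTest P₁ u ((g + 2) * N₁) (g + 2) φ z) =
    -∫ z, integrand₁ f₁ P₁ N₁ (g + 2) (dbar φ) Finset.univ z := by
  set M := (g + 2) * N₁ with hM
  set p := evalFamily P₁ with hp
  set s : Fin (m + 2) → ℂ := fun l => wedgeSign l Finset.univ with hs
  set χ : Fin (m + 2) → (Fin (m + 2) → ℂ) → ℂ := fun l =>
    (dbarCoord 0)^[M] (φ (Finset.univ.erase l)) with hχdef
  have hχ : ∀ l, IsTest U (χ l) := fun l => (hφ.isTest _).dbar_iterate 0 M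
  have hcp : ∀ l, ∀ z ∈ U, dbarCoord l (fun z => conj (p z) ^ (g + 2) * χ l z) z =
      (((g + 2 : ℕ) : ℂ) * conj (p z) ^ (g + 1) * conj (dCoord l p z)) * χ l z +
        conj (p z) ^ (g + 2) * dbarCoord l (χ l) z := fun l z hz => by
    rw [dbarCoord_mul ((h.divisor.smoothOn_conj_pow _).differentiableAt h.isOpen hz)
      ((hχ l).differentiableAt z), dbarCoord_conj_pow h.divisor.analytic l _ hz]
    rfl
  have hInt := fun l => h.divisor.integral_by_parts (hχ l) h.analytic_inv.smoothOn l (g + 1)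
  -- The weight in this integration by parts is `1 / u`, which is holomorphic, so the right-hand
  -- side vanishes.
  have hzero : ∀ l, ∫ z, (u z)⁻¹ * ((p z)⁻¹ *
      dbarCoord l (fun z => conj (p z) ^ (g + 2) * χ l z) z) = 0 := fun l => by
    rw [(hInt l).2.2, neg_eq_zero]
    refine integral_eq_zero_of_ae (Filter.Eventually.of_forall fun z => ?_)
    by_cases hz : z ∈ U
    · beta_reduce
      rw [dbarCoord_of_differentiableAt (h.analytic_inv z hz).differentiableAt, zero_mul]
      rfl
    · beta_reduce
      rw [(hχ l).eq_zero hz]; simp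
  have hd : integrand₁ f₁ P₁ N₁ (g + 2) (dbar φ) Finset.univ = fun z => ∑ l,
      s l * ((u z)⁻¹ * ((p z)⁻¹ * (conj (p z) ^ (g + 2) * dbarCoord l (χ l) z))) := by
    rw [h.integrand₁_eq hφ.dbar]
    funext z
    have : (dbarCoord 0)^[M] (dbar φ Finset.univ) z = ∑ l, s l * dbarCoord l (χ l) z := by
      have e : dbar φ Finset.univ = fun z => ∑ l, s l * dbarCoord l (φ (Finset.univ.erase l)) z :=
        rfl
      rw [e, dbarCoord_iterate_sum _ isOpen_univ (fun l _ =>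
        (((hφ.isTest _).dbar l).const_mul _).smoothOn _) _ z trivial]
      refine Finset.sum_congr rfl fun l _ => ?_
      rw [dbarCoord_iterate_holo_mul isOpen_univ (fun _ _ => differentiableAt_const (s l))
        (((hφ.isTest _).dbar l).smoothOn _) _ z trivial,
        (hφ.isTest _).dbarCoord_comm_iterate l 0 M]
    rw [this, Finset.mul_sum, Finset.mul_sum, Finset.mul_sum]
    exact Finset.sum_congr rfl fun l _ => by ring
  rw [hd, eq_neg_iff_add_eq_zero, ← integral_add]
  · have e : (fun z => (p z)⁻¹ * (conj (p z) ^ (g + 1) * residueTest P₁ u M (g + 2) φ z) +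
        ∑ l, s l * ((u z)⁻¹ * ((p z)⁻¹ * (conj (p z) ^ (g + 2) * dbarCoord l (χ l) z)))) =
        fun z => ∑ l, s l * ((u z)⁻¹ * ((p z)⁻¹ *
          dbarCoord l (fun z => conj (p z) ^ (g + 2) * χ l z) z)) := by
      funext z
      rw [residueTest, Finset.mul_sum, Finset.mul_sum, ← Finset.sum_add_distrib]
      refine Finset.sum_congr rfl fun l _ => ?_
      by_cases hz : z ∈ U
      · rw [hcp l z hz]; ring
      · rw [((h.divisor.isTest_conj_pow_mul (hχ l) _).dbar l).eq_zero hz,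
          show (dbarCoord 0)^[M] (φ (Finset.univ.erase l)) z = χ l z from rfl,
          (hχ l).eq_zero hz, ((hχ l).dbar l).eq_zero hz]
        ring
    rw [e, integral_finsetSum _ fun l _ => (hInt l).1.const_mul _]
    refine Finset.sum_eq_zero fun l _ => ?_
    rw [integral_const_mul, hzero, mul_zero]
  · exact h.divisor.integrable_inv_mul (h.isTest_residueTest hφ _ _) g
  · rw [← hd]
    exact h.integrable_integrand₁ hφ.dbar (g + 1)

/-- The factor `R` cancels the denominator of the kernel and leaves `conj q`. As `q` is monic of
degree `N₂` in `z₂`, the `N₂` integrations by parts in `z̄₂` turn it into `N₂!`. What remains is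
`∂̄X₁` by `integral_residueTest`. -/
theorem mulCurrent_R_X₂ {k : ℕ} (h : Chart f₁ P₁ R Q N₁ (k + 1) U u v) (q j : ℕ) :
    CurrentEq U q (mulCurrent (fun z => R (Fin.tail z))
      (X₂ f₁ P₁ R Q N₁ (k + 1) (j + 1 + k + 1)))
      (fun φ => (-1) ^ (k + 1) * (Nat.factorial (k + 1) : ℂ) *
        dbarCurrent 0 (X₁ f₁ P₁ N₁ (j + 1 + k + 1)) φ) := by
  intro φ hφ
  set Γ := j + 1 + k + 1 with hΓ
  set p := evalFamily P₁ with hp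
  set χ := residueTest P₁ u (Γ * N₁) Γ φ with hχdef
  have hχ : IsTest U χ := h.isTest_residueTest hφ _ _
  have hT := h.divisor.isTest_conj_pow_mul hχ (j + 1 + k)
  have h1 : ∫ z, integrand₂ f₁ P₁ R Q N₁ (k + 1) Γ (mulForm (fun z => R (Fin.tail z)) φ)
      Finset.univ z = (-1) ^ (k + 1) * (Nat.factorial (k + 1) : ℂ) *
        ∫ z, (p z)⁻¹ * (conj (p z) ^ (j + 1 + k) * χ z) := by
    have h2 : ∫ z, integrand₂ f₁ P₁ R Q N₁ (k + 1) Γ (mulForm (fun z => R (Fin.tail z)) φ)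
        Finset.univ z = ∫ z, conj (evalFamily Q (Fin.tail z)) * ((p z)⁻¹ *
          (dbarCoord 1)^[k + 1] (fun z => conj (p z) ^ (j + (k + 1)) * χ z) z) := by
      refine integral_congr_ae ?_
      filter_upwards [h.integrand₂_ae (hφ.mulForm h.isOpen h.analytic_R.smoothOn) (j + 1 + k),
        h.ae_ne₂] with z hz hqz
      rw [hz, residueTest_mulForm hφ h.isOpen h.analytic_R]
      rw [show j + (k + 1) = j + 1 + k by ring]
      rw [show (fun z : Fin (m + 2) → ℂ => conj (evalFamily P₁ z) ^ (j + 1 + k) * (R (Fin.tail z) *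
          residueTest P₁ u ((j + 1 + k + 1) * N₁) (j + 1 + k + 1) φ z)) = fun z =>
          R (Fin.tail z) * (conj (evalFamily P₁ z) ^ (j + 1 + k) * χ z) from
        funext fun z => mul_left_comm _ _ _]
      by_cases hzU : z ∈ U
      · rw [dbarCoord_iterate_holo_mul h.isOpen (fun y hy => (h.analytic_R y hy).differentiableAt)
          (hT.smoothOn U) _ z hzU, kernel]
        have hR : R (Fin.tail z) ≠ 0 := by
          rw [h.eq₂ z hzU]; exact mul_ne_zero (h.unit₂_ne z hzU) (hqz hzU)
        field_simp
        rfl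
      · rw [(hT.dbar_iterate 1 _).eq_zero hzU,
          ((hT.mul h.isOpen h.analytic_R.smoothOn).dbar_iterate 1 _).eq_zero hzU]
        ring
    rw [h2, h.divisor.integral_by_parts_iterate 1 j (k + 1) hχ h.analytic₂.smoothOn.conj, mul_assoc,
      ← integral_const_mul ((k + 1).factorial : ℂ)]
    congr 2
    funext z
    by_cases hzU : z ∈ U
    · rw [h.dbarCoord_iterate_conj_second z hzU, show j + (k + 1) = j + 1 + k by ring]
    · rw [hχ.eq_zero hzU]; ring
  have h3 := h.integral_residueTest hφ (j + k)
  rw [show j + k + 2 = Γ by omega, show j + k + 1 = j + 1 + k by omega] at h3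
  simp only [mulCurrent, X₂, X₁, dbarCurrent, formIntegral]
  rw [h1, h3]
  ring

/-- Once `f₁` cancels, `∂̄(conj p ^ Γ) ∧ ∂̄₁ ^ (Γ N₁) φ` is `∂̄₁` of a test function, since `∂̄₁ ^
(Γ N₁)` annihilates each `∂̄_l (conj p ^ Γ)`. The kernel does not involve `z₁`, so integrating in
`z₁` first gives zero. -/
theorem mulCurrent_f_X₂ {k : ℕ} (h : Chart f₁ P₁ R Q N₁ (k + 1) U u v) (q j : ℕ) :
    CurrentEq U q (mulCurrent f₁ (X₂ f₁ P₁ R Q N₁ (k + 1) (j + 1 + k + 1))) (fun _ => 0) := by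
  intro φ hφ
  set Γ := j + 1 + k + 1 with hΓ
  set M := Γ * N₁ with hM
  have hcl : ∀ l, SmoothOn U (dbarCoord l (conjPow P₁ Γ)) := fun l =>
    (h.smoothOn_conjPow Γ).dbarCoord h.isOpen l
  choose Ψ hΨ hΨe using fun l => exists_mul_dbarCoord_iterate_eq h.isOpen 0 M (hcl l)
    (hφ.isTest (Finset.univ.erase l))
  set Θ : (Fin (m + 2) → ℂ) → ℂ := fun z => ∑ l, wedgeSign l Finset.univ * Ψ l z with hΘdef
  have hΘ : IsTest U Θ := IsTest.sum _ fun l _ => (hΨ l).const_mul _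
  have hT := h.divisor.isTest_conj_pow_mul (h.isTest_residueTest
    (hφ.mulForm h.isOpen h.analytic_f.smoothOn) M Γ) (j + 1 + k)
  -- The identity is kept multiplied by `p`, so that it holds everywhere and can be differentiated
  -- in `z̄₂` before dividing.
  have e : ∀ z, evalFamily P₁ z * dbarCoord 0 Θ z = conj (evalFamily P₁ z) ^ (j + 1 + k) *
      residueTest P₁ u M Γ (mulForm f₁ φ) z := by
    intro z
    by_cases hz : z ∈ U
    · rw [residueTest_mulForm hφ h.isOpen h.analytic_f, mul_left_comm,
        h.conj_pow_mul_residueTest _ _ φ hz, h.eq₁ z hz, hΘdef,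
        dbarCoord_sum _ fun l _ => ((hΨ l).const_mul _).differentiableAt z]
      have : ∀ l, dbarCoord l (conjPow P₁ Γ) z * (dbarCoord 0)^[M] (φ (Finset.univ.erase l)) z =
          dbarCoord 0 (Ψ l) z := fun l => by
        rw [hΨe l z, h.dbarCoord_iterate_dbarCoord_conjPow Γ l z hz]; ring
      simp only [dbarWedge, dbarIter, ← hΓ, this]
      rw [mul_mul_mul_comm, mul_inv_cancel₀ (h.unit₁_ne z hz), one_mul]
      congr 1
      exact Finset.sum_congr rfl fun l _ => dbarCoord_const_mul _ ((hΨ l).differentiableAt z)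
    · rw [(hΘ.dbar 0).eq_zero hz, mul_zero]
      exact (hT.eq_zero hz).symm
  have h1 : ∫ z, integrand₂ f₁ P₁ R Q N₁ (k + 1) Γ (mulForm f₁ φ) Finset.univ z =
      ∫ z, kernel R Q z * dbarCoord 0 ((dbarCoord 1)^[k + 1] Θ) z := by
    refine integral_congr_ae ?_
    filter_upwards [h.integrand₂_ae (hφ.mulForm h.isOpen h.analytic_f.smoothOn) (j + 1 + k),
      h.divisor.ae_ne] with z hz hpz
    rw [hz, ← hΓ, ← hM, ← funext e, ← hΘ.dbarCoord_comm_iterate 0 1 (k + 1)]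
    congr 1
    by_cases hzU : z ∈ U
    · rw [dbarCoord_iterate_holo_mul h.isOpen
        (fun y hy => (h.divisor.analytic y hy).differentiableAt) ((hΘ.dbar 0).smoothOn U) _ z hzU,
        inv_mul_cancel_left₀ (hpz hzU)]
    · rw [((hΘ.dbar 0).dbar_iterate 1 _).eq_zero hzU, funext e,
        (hT.dbar_iterate 1 _).eq_zero hzU, mul_zero]
  simp only [mulCurrent, X₂, formIntegral]
  rw [h1]
  have h2 := (hΘ.dbar_iterate 1 (k + 1))
  have h3 := integral_tail_mul_dbarCoord_zero h2
    (κ := fun w => conj (evalFamily Q w) / R w) (h.integrable_kernel_mul_test (h2.dbar 0))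
  rw [show ∫ z, kernel R Q z * dbarCoord 0 ((dbarCoord 1)^[k + 1] Θ) z = 0 from h3, mul_zero]

end Chart

end

section

open MeasureTheory Polynomial

/-! ### Existence of charts -/

theorem IsWeierstrassPolyOf.degree_pos {k N : ℕ} {f : (Fin (k + 1) → ℂ) → ℂ}
    {P : (Fin k → ℂ) → ℂ[X]} (h : IsWeierstrassPolyOf f P N) (h0 : f 0 = 0) : 0 < N := by
  obtain ⟨hP, u, -, hu0, he⟩ := h
  have := he.self_of_nhds
  rw [h0, evalFamily, tail_zero, hP.at_zero] at this
  rcases Nat.eq_zero_or_pos N with rfl | hN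
  · exact absurd (by simpa using this.symm) hu0
  · exact hN

/-- At the origin both polynomials are positive powers of the variable, so they share a root and the
resultant vanishes. -/
theorem IsAdapted.degree_pos {m : ℕ} {f₁ f₂ : (Fin (m + 2) → ℂ) → ℂ}
    {P₁ P₂ : (Fin (m + 1) → ℂ) → ℂ[X]} {Q : (Fin m → ℂ) → ℂ[X]} {N₁ M N₂ : ℕ}
    (h : IsAdapted f₁ f₂ P₁ P₂ Q N₁ M N₂) (h₁ : f₁ 0 = 0) (h₂ : f₂ 0 = 0) : 0 < N₂ := by
  refine h.resultant.degree_pos ?_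
  have hN := h.first.degree_pos h₁
  have hM := h.second.degree_pos h₂
  rw [res, h.first.1.at_zero, h.second.1.at_zero, resultant_eq_zero_iff]
  refine ⟨Or.inl (pow_ne_zero _ X_ne_zero), fun hc => ?_⟩
  rw [IsCoprime.pow_iff hN hM, isCoprime_self] at hc
  exact not_isUnit_X hc

theorem IsAdapted.exists_chart {m : ℕ} {f₁ f₂ : (Fin (m + 2) → ℂ) → ℂ}
    {P₁ P₂ : (Fin (m + 1) → ℂ) → ℂ[X]} {Q : (Fin m → ℂ) → ℂ[X]} {N₁ M N₂ : ℕ}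
    (h : IsAdapted f₁ f₂ P₁ P₂ Q N₁ M N₂) :
    ∃ U u v, 0 ∈ U ∧ Chart f₁ P₁ (res P₁ P₂) Q N₁ N₂ U u v := by
  obtain ⟨hP, u, hu, hu0, he⟩ := h.first
  obtain ⟨hQ, v, hv, hv0, he'⟩ := h.resultant
  have hpa := hP.analyticAt_evalFamily
  have hpW : IsWeierstrassPolyOf (evalFamily P₁) P₁ N₁ :=
    ⟨hP, fun _ => 1, analyticAt_const, one_ne_zero, Filter.Eventually.of_forall fun z => by simp⟩
  choose V hVo hV0 hVi using fun l => exists_integrableOn_logDeriv hpa hpW l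
  have hqa := hQ.analyticAt_evalFamily
  obtain ⟨W, hW, hWo, hW0⟩ := eventually_nhds_iff.1
    (((hqa.eventually_analyticAt.and hv.eventually_analyticAt).and
      (hv.continuousAt.eventually_ne hv0)).and he')
  obtain ⟨U₀, hU₀, hU₀o, hU₀0⟩ := eventually_nhds_iff.1
    (((hpa.eventually_analyticAt.and hu.eventually_analyticAt).and
      (hu.continuousAt.eventually_ne hu0)).and he)
  have htc : Continuous (Fin.tail : (Fin (m + 2) → ℂ) → Fin (m + 1) → ℂ) :=
    continuous_pi fun i => continuous_apply i.succ
  set U := U₀ ∩ Fin.tail ⁻¹' W ∩ ⋂ l, V l with hU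
  have hUo : IsOpen U := (hU₀o.inter (hWo.preimage htc)).inter (isOpen_iInter_of_finite hVo)
  have hU1 : ∀ z ∈ U, z ∈ U₀ := fun z hz => hz.1.1
  have hU2 : ∀ z ∈ U, Fin.tail z ∈ W := fun z hz => hz.1.2
  have hpU : AnalyticOnNhd ℂ (evalFamily P₁) U := fun z hz => (hU₀ z (hU1 z hz)).1.1.1
  refine ⟨U, u, v, ⟨⟨hU₀0, ?_⟩, Set.mem_iInter.2 hV0⟩, ?_⟩
  · rwa [Set.mem_preimage, tail_zero]
  refine ⟨⟨hUo, hpU, ae_evalFamily_ne_zero hP.monic hUo hpU.continuousOn, fun l =>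
    (hVi l).mono_set fun z hz => Set.mem_iInter.1 hz.2 l⟩, hP.monic, hP.natDegree,
    fun z hz => (hU₀ z (hU1 z hz)).1.1.2, fun z hz => (hU₀ z (hU1 z hz)).1.2,
    fun z hz => (hU₀ z (hU1 z hz)).2, hQ.monic, hQ.natDegree, fun z hz => ?_, ?_, fun z hz => ?_,
    fun z hz => (hW _ (hU2 z hz)).1.2, fun z hz => (hW _ (hU2 z hz)).2⟩
  · exact (hW _ (hU2 z hz)).1.1.1.comp (analyticAt_tail z)
  -- For `q` a null zero set is enough; integrability of logarithmic derivatives is only asked of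
  -- `p`.
  · have hc : ContinuousOn (evalFamily Q) W := fun w hw =>
      (hW w hw).1.1.1.continuousAt.continuousWithinAt
    filter_upwards [ae_tail (ae_evalFamily_ne_zero hQ.monic hWo hc)] with z hz hzU
    exact hz (hU2 z hzU)
  · exact (hW _ (hU2 z hz)).1.1.2.comp (analyticAt_tail z)

theorem Chart.mono {m : ℕ} {f₁ : (Fin (m + 2) → ℂ) → ℂ} {P₁ : (Fin (m + 1) → ℂ) → ℂ[X]}
    {R : (Fin (m + 1) → ℂ) → ℂ} {Q : (Fin m → ℂ) → ℂ[X]} {N₁ N₂ : ℕ}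
    {U V : Set (Fin (m + 2) → ℂ)} {u : (Fin (m + 2) → ℂ) → ℂ} {v : (Fin (m + 1) → ℂ) → ℂ}
    (h : Chart f₁ P₁ R Q N₁ N₂ U u v) (hV : IsOpen V) (hVU : V ⊆ U) :
    Chart f₁ P₁ R Q N₁ N₂ V u v :=
  ⟨h.divisor.mono hV hVU, h.monic₁, h.natDegree₁, h.unit₁.mono hVU,
    fun z hz => h.unit₁_ne z (hVU hz), fun z hz => h.eq₁ z (hVU hz), h.monic₂, h.natDegree₂,
    h.analytic₂.mono hVU, h.ae_ne₂.mono fun _ hz hzV => hz (hVU hzV), h.unit₂.mono hVU,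
    fun z hz => h.unit₂_ne z (hVU hz), fun z hz => h.eq₂ z (hVU hz)⟩

theorem IsTestForm.add {n : ℕ} {U : Set (Fin n → ℂ)} {q : ℕ} {φ ψ : Form n}
    (hφ : IsTestForm U q φ) (hψ : IsTestForm U q ψ) : IsTestForm U q (φ + ψ) :=
  isTestForm_of_isTest (fun J => (hφ.isTest J).add (hψ.isTest J)) fun J hJ => by
    funext z; simp [hφ.degree J hJ, hψ.degree J hJ]

theorem dbar_add {n : ℕ} {U : Set (Fin n → ℂ)} {q : ℕ} {φ ψ : Form n}
    (hφ : IsTestForm U q φ) (hψ : IsTestForm U q ψ) : dbar (φ + ψ) = dbar φ + dbar ψ := by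
  funext K z
  change _ = dbar φ K z + dbar ψ K z
  simp only [dbar]
  rw [← Finset.sum_add_distrib]
  refine Finset.sum_congr rfl fun l _ => ?_
  rw [← mul_add, ← dbarCoord_add ((hφ.isTest _).differentiableAt z)
    ((hψ.isTest _).differentiableAt z)]
  rfl

/-- The ideal generated by `f₁` and `R` annihilates `∂̄X₂`. -/
theorem Chart.annihilates {m : ℕ} {f₁ : (Fin (m + 2) → ℂ) → ℂ} {P₁ : (Fin (m + 1) → ℂ) → ℂ[X]}
    {R : (Fin (m + 1) → ℂ) → ℂ} {Q : (Fin m → ℂ) → ℂ[X]} {N₁ k : ℕ}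
    {U : Set (Fin (m + 2) → ℂ)} {u : (Fin (m + 2) → ℂ) → ℂ} {v : (Fin (m + 1) → ℂ) → ℂ}
    (h : Chart f₁ P₁ R Q N₁ (k + 1) U u v) (q j : ℕ) {G α β r : (Fin (m + 2) → ℂ) → ℂ}
    (hα : AnalyticOnNhd ℂ α U) (hβ : AnalyticOnNhd ℂ β U) (hr : AnalyticOnNhd ℂ r U)
    (hG : ∀ z ∈ U, G z = α z * f₁ z + β z * R (Fin.tail z) + r z) :
    CurrentEq U q (mulCurrent G (dbarCurrent 1 (X₂ f₁ P₁ R Q N₁ (k + 1) (j + 1 + k + 1))))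
      (mulCurrent r (dbarCurrent 1 (X₂ f₁ P₁ R Q N₁ (k + 1) (j + 1 + k + 1)))) := by
  intro φ hφ
  have hcur := h.isCurrent_X₂ (q + 1) j
  have hαφ := hφ.mulForm h.isOpen hα.smoothOn
  have hβφ := hφ.mulForm h.isOpen hβ.smoothOn
  have hrφ := hφ.mulForm h.isOpen hr.smoothOn
  have h1 := hαφ.mulForm h.isOpen h.analytic_f.smoothOn
  have h2 := hβφ.mulForm h.isOpen h.analytic_R.smoothOn
  have e : mulForm G φ = mulForm f₁ (mulForm α φ) +
      mulForm (fun z => R (Fin.tail z)) (mulForm β φ) + mulForm r φ := by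
    funext J z
    change G z * φ J z = f₁ z * (α z * φ J z) + R (Fin.tail z) * (β z * φ J z) + r z * φ J z
    by_cases hz : z ∈ U
    · rw [hG z hz]; ring
    · rw [(hφ.isTest J).eq_zero hz]; ring
  have e1 := h.mulCurrent_f_X₂ (q + 1) j _ hαφ.dbar
  have e2 := h.mulCurrent_R_X₂ (q + 1) j _ hβφ.dbar
  -- Multiplying `X₂` by `R` leaves `X₁` evaluated at `∂̄∂̄` of a test form, that is, at the zero
  -- form.
  have e3 : X₁ f₁ P₁ N₁ (j + 1 + k + 1) 0 = 0 := by
    have := (h.isCurrent_X₁ 0 (j + 1 + k)).map_smul 0 0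
      ⟨fun _ _ => rfl, fun _ => contDiff_const, fun _ => HasCompactSupport.zero, fun _ => by
        rw [show tsupport ((0 : Form (m + 2)) _) = ∅ from tsupport_eq_empty_iff.2 rfl]
        exact Set.empty_subset _⟩
    simpa using this
  simp only [mulCurrent, dbarCurrent] at e1 e2 ⊢
  rw [e, dbar_add (h1.add h2) hrφ, dbar_add h1 h2, hcur.map_add _ _ (h1.dbar.add h2.dbar) hrφ.dbar,
    hcur.map_add _ _ h1.dbar h2.dbar,
    dbar_mulForm hαφ fun z hz => (h.analytic_f z hz).differentiableAt,
    dbar_mulForm hβφ fun z hz => (h.analytic_R z hz).differentiableAt, e1, e2,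
    dbar_dbar hβφ, e3]
  simp

end

section

open MeasureTheory Polynomial

/-! ### One-dimensional residues -/

theorem dbarOne_eventuallyEq {g h : ℂ → ℂ} {t : ℂ} (hgh : g =ᶠ[𝓝 t] h) :
    dbarOne g t = dbarOne h t := by
  rw [dbarOne, dbarOne, hgh.fderiv_eq]

theorem dbarOne_sub {g h : ℂ → ℂ} {t : ℂ} (hg : DifferentiableAt ℝ g t)
    (hh : DifferentiableAt ℝ h t) :
    dbarOne (fun t => g t - h t) t = dbarOne g t - dbarOne h t := by
  rw [dbarOne, dbarOne, dbarOne, fderiv_fun_sub hg hh]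
  simp only [_root_.sub_apply]
  ring

theorem dbarOne_holo_mul {F χ : ℂ → ℂ} {t : ℂ} (hF : DifferentiableAt ℂ F t)
    (hχ : DifferentiableAt ℝ χ t) : dbarOne (fun t => F t * χ t) t = F t * dbarOne χ t := by
  have hd : HasFDerivAt (𝕜 := ℝ) F ((fderiv ℂ F t).restrictScalars ℝ) t :=
    hF.hasFDerivAt.restrictScalars ℝ
  rw [dbarOne, dbarOne, (hd.fun_mul hχ.hasFDerivAt).fderiv]
  have hI : fderiv ℂ F t Complex.I = Complex.I * fderiv ℂ F t 1 := by
    rw [show (Complex.I : ℂ) = Complex.I • (1 : ℂ) by simp, map_smul]; simp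
  simp only [_root_.add_apply, _root_.smul_apply, ContinuousLinearMap.coe_restrictScalars', hI, smul_eq_mul]
  linear_combination (1 / 2) * χ t * fderiv ℂ F t 1 * Complex.I_mul_I

/-- A radial cutoff function, equal to `1` for `‖t‖ ≤ ε` and to `0` for `‖t‖ ≥ 2 ε`. -/
def cutoff (ε : ℝ) (t : ℂ) : ℂ := (Real.smoothTransition (2 - ‖t‖ ^ 2 / ε ^ 2) : ℝ)

/-- The radial density of `∂̄(cutoff 1)`. -/
def cutoffWeight (t : ℂ) : ℝ := deriv Real.smoothTransition (2 - ‖t‖ ^ 2)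

theorem contDiff_cutoff (ε : ℝ) : ContDiff ℝ ∞ (cutoff ε) := by
  refine Complex.ofRealCLM.contDiff.comp (Real.smoothTransition.contDiff.comp ?_)
  exact contDiff_const.sub ((contDiff_norm_sq ℝ).div_const _)

theorem cutoff_eq_one {ε : ℝ} (hε : 0 < ε) {t : ℂ} (ht : ‖t‖ ≤ ε) : cutoff ε t = 1 := by
  rw [cutoff, Real.smoothTransition.one_of_one_le, Complex.ofReal_one]
  have : ‖t‖ ^ 2 / ε ^ 2 ≤ 1 := by
    rw [div_le_one (by positivity)]
    exact pow_le_pow_left₀ (norm_nonneg _) ht 2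
  linarith

theorem cutoff_eq_zero {ε : ℝ} (hε : 0 < ε) {t : ℂ} (ht : 2 * ε ≤ ‖t‖) : cutoff ε t = 0 := by
  rw [cutoff, Real.smoothTransition.zero_of_nonpos, Complex.ofReal_zero]
  have : 2 ≤ ‖t‖ ^ 2 / ε ^ 2 := by
    rw [le_div_iff₀ (by positivity)]
    nlinarith
  linarith

theorem tsupport_cutoff_subset {ε : ℝ} (hε : 0 < ε) :
    tsupport (cutoff ε) ⊆ Metric.closedBall 0 (2 * ε) := by
  refine closure_minimal (fun t ht => ?_) Metric.isClosed_closedBall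
  rw [mem_closedBall_zero_iff]
  by_contra h
  exact ht (cutoff_eq_zero hε (not_le.1 h).le)

theorem hasCompactSupport_cutoff {ε : ℝ} (hε : 0 < ε) : HasCompactSupport (cutoff ε) :=
  (isCompact_closedBall (0 : ℂ) (2 * ε)).of_isClosed_subset (isClosed_tsupport _)
    (tsupport_cutoff_subset hε)

/-- Chain rule with `∂|t|² / ∂t̄ = t`; the factor `t` later raises the exponent in the residue
integral by one. -/
theorem dbarOne_cutoff (ε : ℝ) (t : ℂ) :
    dbarOne (cutoff ε) t = -((cutoffWeight (t / ε) : ℝ) / ε ^ 2 : ℂ) * t := by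
  have h1 : HasFDerivAt (fun t : ℂ => 2 - ‖t‖ ^ 2 / ε ^ 2)
      (-((ε ^ 2)⁻¹ • (2 • innerSL ℝ t))) t := by
    have := ((hasStrictFDerivAt_norm_sq t).hasFDerivAt.const_mul ((ε ^ 2)⁻¹)).const_sub 2
    refine this.congr_of_eventuallyEq (Filter.Eventually.of_forall fun y => ?_)
    simp [div_eq_inv_mul]
  have h2 : HasDerivAt Real.smoothTransition (deriv Real.smoothTransition (2 - ‖t‖ ^ 2 / ε ^ 2))
      (2 - ‖t‖ ^ 2 / ε ^ 2) :=
    (Real.smoothTransition.contDiff (n := 1)).differentiable (by simp) _ |>.hasDerivAt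
  have h3 := Complex.ofRealCLM.hasFDerivAt.comp t (h2.comp_hasFDerivAt t h1)
  have hw : cutoffWeight (t / ε) = deriv Real.smoothTransition (2 - ‖t‖ ^ 2 / ε ^ 2) := by
    rw [cutoffWeight, norm_div, Complex.norm_real, div_pow, Real.norm_eq_abs, sq_abs]
  rw [dbarOne, show fderiv ℝ (cutoff ε) t = _ from h3.fderiv, hw]
  simp only [ContinuousLinearMap.comp_apply, _root_.smul_apply, _root_.neg_apply,
    Complex.ofRealCLM_apply, innerSL_apply_apply, Complex.inner]
  generalize deriv Real.smoothTransition (2 - ‖t‖ ^ 2 / ε ^ 2) = D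
  simp
  linear_combination (-(D : ℂ) / (ε : ℂ) ^ 2) * Complex.re_add_im t

theorem cutoffWeight_nonneg (t : ℂ) : 0 ≤ cutoffWeight t :=
  Real.smoothTransition.monotone.deriv_nonneg

theorem continuous_cutoffWeight : Continuous cutoffWeight := by
  have : Continuous (deriv Real.smoothTransition) :=
    (Real.smoothTransition.contDiff (n := 1)).continuous_deriv le_rfl
  exact this.comp (by fun_prop)

theorem cutoffWeight_eq_zero {t : ℂ} (ht : ‖t‖ < 1 ∨ 2 ≤ ‖t‖) : cutoffWeight t = 0 := by
  rcases ht with ht | ht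
  · have : Real.smoothTransition =ᶠ[𝓝 (2 - ‖t‖ ^ 2)] fun _ => 1 := by
      have : (1 : ℝ) < 2 - ‖t‖ ^ 2 := by nlinarith [norm_nonneg t]
      filter_upwards [lt_mem_nhds this] with x hx
      exact Real.smoothTransition.one_of_one_le hx.le
    rw [cutoffWeight, this.deriv_eq, deriv_const]
  · have : Real.smoothTransition =ᶠ[𝓝 (2 - ‖t‖ ^ 2)] fun _ => 0 := by
      have : 2 - ‖t‖ ^ 2 < 0 := by nlinarith [norm_nonneg t]
      filter_upwards [gt_mem_nhds this] with x hx
      exact Real.smoothTransition.zero_of_nonpos hx.le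
    rw [cutoffWeight, this.deriv_eq, deriv_const]

theorem hasCompactSupport_cutoffWeight : HasCompactSupport cutoffWeight :=
  HasCompactSupport.intro (isCompact_closedBall (0 : ℂ) 2) fun t ht => by
    rw [mem_closedBall_zero_iff, not_le] at ht
    exact cutoffWeight_eq_zero (Or.inr ht.le)

/-- The residue constant of the cutoff functions. -/
def cutoffConst : ℂ := -∫ t : ℂ, (cutoffWeight t : ℂ)

/-- The weight is continuous, nonnegative and not identically zero, because the transition function
climbs from `0` to `1`. Only nonvanishing matters, not the value. -/
theorem cutoffConst_ne_zero : cutoffConst ≠ 0 := by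
  have h : 0 < ∫ t : ℂ, cutoffWeight t := by
    obtain ⟨x, hx⟩ : ∃ x : ℂ, cutoffWeight x ≠ 0 := by
      by_contra! h0
      have hd : ∀ x ∈ Set.Ioo (0 : ℝ) 1, deriv Real.smoothTransition x = 0 := fun x hx => by
        have := h0 (Real.sqrt (2 - x) : ℝ)
        rw [cutoffWeight, Complex.norm_real, Real.norm_eq_abs, sq_abs,
          Real.sq_sqrt (by linarith [hx.2])] at this
        simpa using this
      obtain ⟨c, hc, hc'⟩ := exists_deriv_eq_slope Real.smoothTransition one_pos
        Real.smoothTransition.continuous.continuousOn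
        ((Real.smoothTransition.contDiff (n := 1)).differentiable (by simp)).differentiableOn
      rw [hd c hc] at hc'
      simp at hc'
    exact continuous_cutoffWeight.integral_pos_of_hasCompactSupport_nonneg_nonzero
      hasCompactSupport_cutoffWeight cutoffWeight_nonneg hx
  rw [cutoffConst, integral_complex_ofReal]
  simpa using h.ne'

/-- All poles lie in the disc where the cutoff is constant, so the derivative of the cutoff removes
them. -/
theorem continuous_div_mul_dbarOne_cutoff {ε : ℝ} (hε : 0 < ε) {T : ℂ[X]} (s : ℕ)
    (hT : ∀ a, T.IsRoot a → ‖a‖ < ε) :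
    Continuous (fun t => t ^ s / T.eval t * dbarOne (cutoff ε) t) := by
  have hd : Continuous (dbarOne (cutoff ε)) := by
    rw [funext (dbarOne_cutoff ε)]
    have := continuous_cutoffWeight
    fun_prop
  rw [continuous_iff_continuousAt]
  intro t
  by_cases ht : T.eval t = 0
  · have : (fun t => t ^ s / T.eval t * dbarOne (cutoff ε) t) =ᶠ[𝓝 t] fun _ => 0 := by
      filter_upwards [continuous_norm.continuousAt.eventually_lt continuousAt_const (hT t ht)]
        with y hy
      rw [dbarOne_cutoff ε, cutoffWeight_eq_zero (Or.inl ?_)]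
      · simp
      · rwa [norm_div, Complex.norm_real, Real.norm_of_nonneg hε.le, div_lt_one hε]
    exact continuousAt_const.congr this.symm
  · exact ((continuousAt_id.pow s).div T.continuous.continuousAt ht).mul hd.continuousAt

theorem hasCompactSupport_div_mul_dbarOne_cutoff {ε : ℝ} (hε : 0 < ε) (F : ℂ → ℂ) :
    HasCompactSupport (fun t => F t * dbarOne (cutoff ε) t) :=
  HasCompactSupport.intro (isCompact_closedBall (0 : ℂ) (2 * ε)) fun t ht => by
    rw [mem_closedBall_zero_iff, not_le] at ht
    rw [dbarOne_cutoff ε, cutoffWeight_eq_zero (Or.inr ?_)]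
    · simp
    · rw [norm_div, Complex.norm_real, Real.norm_of_nonneg hε.le, le_div_iff₀ hε]
      exact ht.le

/-- The difference of the two cutoffs vanishes near every root, so times the meromorphic factor it
is a test function, and its `∂̄`-derivative integrates to zero. -/
theorem integral_cutoff_eq {ε δ : ℝ} (hε : 0 < ε) (hδ : ε ≤ δ) {T : ℂ[X]} (s : ℕ)
    (hT : ∀ a, T.IsRoot a → ‖a‖ < ε) :
    ∫ t, t ^ s / T.eval t * dbarOne (cutoff ε) t = ∫ t, t ^ s / T.eval t * dbarOne (cutoff δ) t := by
  have hδ0 : 0 < δ := hε.trans_le hδ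
  have hInt : ∀ {η : ℝ}, 0 < η → ε ≤ η →
      Integrable (fun t => t ^ s / T.eval t * dbarOne (cutoff η) t) := fun hη hle =>
    (continuous_div_mul_dbarOne_cutoff hη s fun a ha => (hT a ha).trans_le hle)
      |>.integrable_of_hasCompactSupport (hasCompactSupport_div_mul_dbarOne_cutoff hη _)
  rw [← sub_eq_zero, ← integral_sub (hInt hε le_rfl) (hInt hδ0 hδ)]
  set χ : ℂ → ℂ := fun t => cutoff ε t - cutoff δ t with hχ
  have hχs : ContDiff ℝ ∞ χ := (contDiff_cutoff ε).sub (contDiff_cutoff δ)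
  have hzero : ∀ t, T.eval t = 0 → χ =ᶠ[𝓝 t] fun _ => 0 := fun t ht => by
    filter_upwards [continuous_norm.continuousAt.eventually_lt continuousAt_const (hT t ht)]
      with y hy
    rw [hχ]
    beta_reduce
    rw [cutoff_eq_one hε hy.le, cutoff_eq_one hδ0 (hy.le.trans hδ), sub_self]
  have hF : ∀ t, T.eval t ≠ 0 → ContDiffAt ℂ ∞ (fun t => t ^ s / T.eval t) t := fun t ht =>
    (contDiffAt_id.pow s).div (T.contDiff_aeval (𝕜 := ℂ) ∞).contDiffAt ht
  have key : ∀ t, dbarOne (fun t => t ^ s / T.eval t * χ t) t =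
      t ^ s / T.eval t * dbarOne (cutoff ε) t - t ^ s / T.eval t * dbarOne (cutoff δ) t := by
    intro t
    have hsub : dbarOne χ t = dbarOne (cutoff ε) t - dbarOne (cutoff δ) t := dbarOne_sub
      ((contDiff_cutoff ε).differentiable (by simp) t)
      ((contDiff_cutoff δ).differentiable (by simp) t)
    rw [← mul_sub, ← hsub]
    by_cases ht : T.eval t = 0
    · have e : (fun t => t ^ s / T.eval t * χ t) =ᶠ[𝓝 t] fun _ => 0 := by
        filter_upwards [hzero t ht] with y hy
        rw [hy, mul_zero]
      rw [dbarOne_eventuallyEq e, ht]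
      simp [dbarOne]
    · exact dbarOne_holo_mul ((hF t ht).differentiableAt (by simp))
        (hχs.differentiable (by simp) t)
  rw [← integral_dbarOne (G := fun t => t ^ s / T.eval t * χ t)]
  · exact integral_congr_ae (Filter.Eventually.of_forall fun t => (key t).symm)
  · rw [contDiff_iff_contDiffAt]
    intro t
    by_cases ht : T.eval t = 0
    · refine (contDiffAt_const (c := (0 : ℂ))).congr_of_eventuallyEq ?_
      filter_upwards [hzero t ht] with y hy
      rw [hy, mul_zero]
    · exact ((hF t ht).restrict_scalars ℝ).mul hχs.contDiffAt
  · exact ((hasCompactSupport_cutoff hε).sub (hasCompactSupport_cutoff hδ0)).mul_left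

/-- The residue at infinity of `t ^ s / T`, for `s < deg T`. -/
theorem integral_pow_div_cutoff {ε : ℝ} (hε : 0 < ε) {T : ℂ[X]} (hT : T.Monic) {N s : ℕ}
    (hN : T.natDegree = N) (hs : s < N) (hroot : ∀ a, T.IsRoot a → ‖a‖ < ε) :
    ∫ t, t ^ s / T.eval t * dbarOne (cutoff ε) t = if s + 1 = N then cutoffConst else 0 := by
  -- Substitute `t = δ y`: the Jacobian `δ ^ 2` cancels the one in `dbarOne_cutoff`, and its factor
  -- `t` gives the exponent `s + 1`.
  have hscale : ∀ δ : ℝ, 0 < δ → ∫ t, t ^ s / T.eval t * dbarOne (cutoff δ) t =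
      -∫ y : ℂ, (δ * y) ^ (s + 1) / T.eval (δ * y) * (cutoffWeight y : ℂ) := fun δ hδ => by
    have h1 := Measure.integral_comp_smul (μ := (volume : Measure ℂ))
      (fun t => t ^ s / T.eval t * dbarOne (cutoff δ) t) δ
    rw [Complex.finrank_real_complex] at h1
    have hδ' : (δ : ℂ) ≠ 0 := by exact_mod_cast hδ.ne'
    have h2 : ∫ t, t ^ s / T.eval t * dbarOne (cutoff δ) t = (δ ^ 2 : ℝ) •
        ∫ y : ℂ, ((δ • y) ^ s / T.eval (δ • y) * dbarOne (cutoff δ) (δ • y)) := by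
      rw [h1, smul_smul, abs_of_pos (by positivity), mul_inv_cancel₀ (by positivity), one_smul]
    rw [h2, ← integral_smul, ← integral_neg]
    congr 1
    funext y
    rw [dbarOne_cutoff δ]
    simp only [Complex.real_smul, mul_div_cancel_left₀ _ hδ']
    push_cast
    field_simp
    ring
  have hlim : Filter.Tendsto (fun δ : ℝ => -∫ y : ℂ, (δ * y) ^ (s + 1) / T.eval (δ * y) *
      (cutoffWeight y : ℂ)) Filter.atTop (𝓝 (if s + 1 = N then cutoffConst else 0)) := by
    -- The integral does not depend on `δ`, so it may be computed as `δ → ∞`. In the coordinate `1 /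
    -- x` the integrand is `Φ`, regular at `0` because the reversed monic polynomial has value `1`
    -- there; `Φ 0` is `1` if `s + 1 = N` and `0` otherwise.
    set Φ : ℂ → ℂ := fun ξ => ξ ^ (N - (s + 1)) / T.reverse.eval ξ with hΦ
    have hrev : ∀ x : ℂ, x ≠ 0 → x ^ (s + 1) / T.eval x = Φ x⁻¹ := fun x hx => by
      let _ := invertibleOfNonzero hx
      have h1 := eval₂_reverse_mul_pow (RingHom.id ℂ) x T
      rw [invOf_eq_inv, hN, eval₂_id, eval₂_id] at h1
      rw [hΦ, ← h1, show N = N - (s + 1) + (s + 1) by omega]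
      simp only [pow_add, Nat.add_sub_cancel]
      rw [inv_pow, div_mul_eq_div_div, div_div, mul_comm (_ ^ _) (_ ^ _)]
      field_simp
    have hr0 : T.reverse.eval 0 = 1 := by
      rw [← coeff_zero_eq_eval_zero, coeff_zero_reverse, hT.leadingCoeff]
    have hΦc : ContinuousAt Φ 0 :=
      (continuousAt_id.pow _).div T.reverse.continuous.continuousAt (by rw [hr0]; exact one_ne_zero)
    obtain ⟨η, hη, hηb⟩ := Metric.eventually_nhds_iff.1
      (hΦc.norm.eventually_lt (continuousAt_const (y := ‖Φ 0‖ + 1)) (by simp))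
    have hval : -∫ y : ℂ, Φ 0 * (cutoffWeight y : ℂ) = if s + 1 = N then cutoffConst else 0 := by
      rw [integral_const_mul, ← mul_neg, hΦ]
      beta_reduce
      rw [hr0, div_one, ← cutoffConst]
      split_ifs with hc
      · rw [show N - (s + 1) = 0 by omega, pow_zero, one_mul]
      · rw [zero_pow (by omega), zero_mul]
    rw [← hval]
    refine Filter.Tendsto.neg ?_
    have hwi : Integrable (fun y : ℂ => (‖Φ 0‖ + 1) * cutoffWeight y) :=
      (continuous_cutoffWeight.integrable_of_hasCompactSupport
        hasCompactSupport_cutoffWeight).const_mul _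
    have hwne : ∀ y : ℂ, cutoffWeight y ≠ 0 → 1 ≤ ‖y‖ := fun y hy => by
      by_contra h
      exact hy (cutoffWeight_eq_zero (Or.inl (not_le.1 h)))
    refine tendsto_integral_filter_of_dominated_convergence _ (Filter.Eventually.of_forall fun δ => ?_)
      ?_ hwi (Filter.Eventually.of_forall fun y => ?_)
    · have h1 : Measurable fun y : ℂ => T.eval (δ * y) :=
        (T.continuous.comp (continuous_const.mul continuous_id)).measurable
      have h2 : Measurable fun y : ℂ => (cutoffWeight y : ℂ) :=
        (Complex.continuous_ofReal.comp continuous_cutoffWeight).measurable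
      exact ((((measurable_const.mul measurable_id).pow_const _).div h1).mul
        h2).aestronglyMeasurable
    · filter_upwards [Filter.eventually_gt_atTop (max 0 η⁻¹)] with δ hδ
      have hδ0 : 0 < δ := (le_max_left _ _).trans_lt hδ
      have hδη : η⁻¹ < δ := (le_max_right _ _).trans_lt hδ
      refine Filter.Eventually.of_forall fun y => ?_
      rw [norm_mul, Complex.norm_real, Real.norm_of_nonneg (cutoffWeight_nonneg y)]
      by_cases hy : cutoffWeight y = 0
      · simp [hy]
      · have hy1 := hwne y hy
        have hne : (δ : ℂ) * y ≠ 0 :=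
          mul_ne_zero (by exact_mod_cast hδ0.ne') (norm_pos_iff.1 (one_pos.trans_le hy1))
        rw [hrev _ hne]
        refine mul_le_mul_of_nonneg_right (hηb ?_).le (cutoffWeight_nonneg y)
        rw [dist_zero_right, norm_inv, norm_mul, Complex.norm_real, Real.norm_of_nonneg hδ0.le]
        refine inv_lt_of_inv_lt₀ hη (hδη.trans_le ?_)
        nlinarith
    · by_cases hy : cutoffWeight y = 0
      · simp [hy]
      · have hy0 : y ≠ 0 := norm_pos_iff.1 (one_pos.trans_le (hwne y hy))
        refine Filter.Tendsto.mul_const _ ?_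
        have h0 : Filter.Tendsto (fun δ : ℝ => ((δ : ℂ) * y)⁻¹) Filter.atTop (𝓝 0) := by
          have := (Complex.continuous_ofReal.tendsto 0).comp tendsto_inv_atTop_zero
          have := this.mul_const y⁻¹
          simpa [mul_comm, Function.comp_def] using this
        refine (hΦc.tendsto.comp h0).congr' ?_
        filter_upwards [Filter.eventually_gt_atTop 0] with δ hδ
        rw [hrev _ (mul_ne_zero (by exact_mod_cast hδ.ne') hy0)]
        rfl
  refine tendsto_nhds_unique (tendsto_const_nhds.congr' ?_) hlim
  filter_upwards [Filter.eventually_ge_atTop ε] with δ hδ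
  rw [integral_cutoff_eq hε hδ s hroot, hscale δ (hε.trans_le hδ)]

end

section

open MeasureTheory Polynomial

/-! ### The residue formula for `∂̄X₂` -/

theorem IsTest.dbarCoord_iterate_mul {n : ℕ} {U : Set (Fin n → ℂ)} {χ w : (Fin n → ℂ) → ℂ}
    (hχ : IsTest U χ) (hU : IsOpen U) (hw : AnalyticOnNhd ℂ w U) (l : Fin n) (k : ℕ) :
    (dbarCoord l)^[k] (fun z => w z * χ z) = fun z => w z * (dbarCoord l)^[k] χ z := by
  funext z
  by_cases hz : z ∈ U
  · exact dbarCoord_iterate_holo_mul hU (fun z hz => (hw z hz).differentiableAt)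
      (hχ.smoothOn _) k z hz
  · rw [((hχ.mul hU hw.smoothOn).dbar_iterate l k).eq_zero hz, (hχ.dbar_iterate l k).eq_zero hz,
      mul_zero]

/-- The form `η dz ∧ dz̄₃ ∧ ⋯ ∧ dz̄ₙ`. -/
def topForm {m : ℕ} (η : (Fin (m + 2) → ℂ) → ℂ) : Form (m + 2) := fun J =>
  if J = (Finset.univ.erase 0).erase 1 then η else 0

theorem IsTest.topForm {m : ℕ} {U : Set (Fin (m + 2) → ℂ)} {η : (Fin (m + 2) → ℂ) → ℂ}
    (hη : IsTest U η) : IsTestForm U m (topForm η) := by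
  refine isTestForm_of_isTest (fun J => ?_) fun J hJ => if_neg ?_
  · rw [ResidueCurrents.topForm]
    split_ifs
    · exact hη
    · exact IsTest.zero
  · rintro rfl
    apply hJ
    rw [Finset.card_erase_of_mem (by simp), Finset.card_erase_of_mem (by simp)]
    simp

theorem mulForm_topForm {m : ℕ} (w η : (Fin (m + 2) → ℂ) → ℂ) :
    mulForm w (topForm η) = topForm (fun z => w z * η z) := by
  funext J z
  rw [mulForm, topForm, topForm]
  split_ifs <;> simp

theorem dbar_topForm_zero {m : ℕ} (η : (Fin (m + 2) → ℂ) → ℂ) :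
    dbar (topForm η) (Finset.univ.erase 0) = fun z =>
      wedgeSign 1 (Finset.univ.erase (0 : Fin (m + 2))) * dbarCoord 1 η z := by
  funext z
  rw [dbar, Finset.sum_eq_single (1 : Fin (m + 2))]
  · rw [topForm, if_pos rfl]
  · intro l hl hl1
    rw [topForm, if_neg, dbarCoord_zero]
    · simp
    · intro h
      have : (1 : Fin (m + 2)) ∈ (Finset.univ.erase 0).erase l := by simp [hl1.symm]
      rw [h] at this
      simp at this
  · simp

theorem dbar_topForm_one {m : ℕ} (η : (Fin (m + 2) → ℂ) → ℂ) :
    dbar (topForm η) (Finset.univ.erase 1) = fun z =>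
      wedgeSign 0 (Finset.univ.erase (1 : Fin (m + 2))) * dbarCoord 0 η z := by
  funext z
  rw [dbar, Finset.sum_eq_single (0 : Fin (m + 2))]
  · rw [topForm, if_pos (Finset.erase_right_comm)]
  · intro l hl hl1
    rw [topForm, if_neg, dbarCoord_zero]
    · simp
    · intro h
      have : (0 : Fin (m + 2)) ∈ (Finset.univ.erase 1).erase l := by simp [hl1.symm]
      rw [h] at this
      simp at this
  · simp

theorem dbar_topForm_of_ne {m : ℕ} (η : (Fin (m + 2) → ℂ) → ℂ) {l : Fin (m + 2)} (h0 : l ≠ 0)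
    (h1 : l ≠ 1) : dbar (topForm η) (Finset.univ.erase l) = 0 := by
  funext z
  refine Finset.sum_eq_zero fun k hk => ?_
  rw [topForm, if_neg, dbarCoord_zero]
  · simp
  · intro h
    have : l ∈ (Finset.univ.erase (0 : Fin (m + 2))).erase 1 := by simp [h0, h1]
    rw [← h] at this
    simp at this

theorem wedgeSign_ne_zero {n : ℕ} (l : Fin n) (K : Finset (Fin n)) : wedgeSign l K ≠ 0 := by
  rw [wedgeSign]
  exact mul_ne_zero (pow_ne_zero _ (by norm_num)) (pow_ne_zero _ (by norm_num))

namespace Chart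

variable {m : ℕ} {f₁ : (Fin (m + 2) → ℂ) → ℂ} {P₁ : (Fin (m + 1) → ℂ) → ℂ[X]}
  {R : (Fin (m + 1) → ℂ) → ℂ} {Q : (Fin m → ℂ) → ℂ[X]} {N₁ N₂ : ℕ}
  {U : Set (Fin (m + 2) → ℂ)} {u : (Fin (m + 2) → ℂ) → ℂ} {v : (Fin (m + 1) → ℂ) → ℂ}
  {θ : (Fin (m + 2) → ℂ) → ℂ}

/-- The part of the chart where the first divisor is invertible. -/
theorem isOpen_ne₁ (h : Chart f₁ P₁ R Q N₁ N₂ U u v) :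
    IsOpen (U ∩ {z | evalFamily P₁ z ≠ 0}) :=
  h.divisor.analytic.continuousOn.isOpen_inter_preimage h.isOpen isOpen_compl_singleton

theorem isOpen_ne₂ (h : Chart f₁ P₁ R Q N₁ N₂ U u v) :
    IsOpen (U ∩ {z | R (Fin.tail z) ≠ 0}) :=
  h.analytic_R.continuousOn.isOpen_inter_preimage h.isOpen isOpen_compl_singleton

theorem analytic_inv_ne₁ (h : Chart f₁ P₁ R Q N₁ N₂ U u v) :
    AnalyticOnNhd ℂ (fun z => (evalFamily P₁ z)⁻¹) (U ∩ {z | evalFamily P₁ z ≠ 0}) :=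
  fun z hz => (h.divisor.analytic z hz.1).fun_inv hz.2

theorem analytic_inv_ne₂ (h : Chart f₁ P₁ R Q N₁ N₂ U u v) :
    AnalyticOnNhd ℂ (fun z => (R (Fin.tail z))⁻¹) (U ∩ {z | R (Fin.tail z) ≠ 0}) :=
  fun z hz => (h.analytic_R z hz.1).fun_inv hz.2

/-- The form lacks only `dz̄₁` and `dz̄₂`, so just two components of its `∂̄` survive; they enter
with opposite signs by `wedgeSign_comm`. -/
theorem residueTest_topForm (h : Chart f₁ P₁ R Q N₁ N₂ U u v) (hθ : IsTest U θ) (g M : ℕ)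
    {z : Fin (m + 2) → ℂ} (hz : z ∈ U) :
    conj (evalFamily P₁ z) ^ g *
      residueTest P₁ u M (g + 1) (dbar (topForm fun z => u z * θ z)) z =
    wedgeSign (0 : Fin (m + 2)) Finset.univ * wedgeSign 1 (Finset.univ.erase (0 : Fin (m + 2))) *
      (dbarCoord 0 (conjPow P₁ (g + 1)) z * (dbarCoord 0)^[M] (dbarCoord 1 θ) z -
        dbarCoord 1 (conjPow P₁ (g + 1)) z * (dbarCoord 0)^[M + 1] θ z) := by
  rw [h.conj_pow_mul_residueTest g M _ hz]
  have e1 : ∀ l, dbarCoord l (fun z => u z * θ z) = fun z => u z * dbarCoord l θ z := fun l =>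
    hθ.dbarCoord_iterate_mul h.isOpen h.unit₁ l 1
  have h01 : (0 : Fin (m + 2)) ≠ 1 := by simp
  have hs : ∀ l (c : ℂ) {χ : (Fin (m + 2) → ℂ) → ℂ}, IsTest U χ →
      (dbarCoord l)^[M] (fun z => c * (u z * χ z)) z = c * (u z * (dbarCoord l)^[M] χ z) := by
    intro l c χ hχ
    rw [(hχ.mul h.isOpen h.unit₁.smoothOn).dbarCoord_iterate_mul h.isOpen
      (fun _ _ => analyticAt_const), hχ.dbarCoord_iterate_mul h.isOpen h.unit₁]
  simp only [dbarWedge, dbarIter]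
  rw [Finset.sum_eq_add (0 : Fin (m + 2)) 1 h01 (fun l _ hl => by
      rw [dbar_topForm_of_ne _ hl.1 hl.2, dbarCoord_iterate_zero]; simp) (by simp) (by simp),
    dbar_topForm_zero, dbar_topForm_one, e1, e1, hs 0 _ (hθ.dbar 1), hs 0 _ (hθ.dbar 0),
    ← Function.iterate_succ_apply]
  have hw := wedgeSign_comm (K := Finset.univ) (Finset.mem_univ (0 : Fin (m + 2)))
    (Finset.mem_univ 1) h01
  have hu := h.unit₁_ne z hz
  field_simp
  linear_combination (dbarCoord 1 (conjPow P₁ (g + 1)) z * (dbarCoord 0)^[M + 1] θ z) * hw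

/-- Where `θ` depends on `z̄₁` (resp. `z̄₂`) only off the zeros of `f₁` (resp. `R`), the action of
`∂̄X₂` on `u θ` is an absolutely convergent residue integral. -/
theorem exists_residue_formula {k M : ℕ} (h : Chart f₁ P₁ R Q N₁ (k + 1) U u v) (j : ℕ)
    (hM : (j + 1 + k + 1) * N₁ = M + 1) :
    ∃ C : ℂ, C ≠ 0 ∧ ∀ θ, IsTest U θ →
      IsTest (U ∩ {z | evalFamily P₁ z ≠ 0}) (dbarCoord 0 θ) →
      IsTest (U ∩ {z | R (Fin.tail z) ≠ 0}) (dbarCoord 1 θ) →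
      Integrable (fun z => (R (Fin.tail z))⁻¹ *
        ((evalFamily P₁ z)⁻¹ * dbarCoord 0 (dbarCoord 1 θ) z)) ∧
      X₂ f₁ P₁ R Q N₁ (k + 1) (j + 1 + k + 1) (dbar (topForm fun z => u z * θ z)) =
        C * ∫ z, (R (Fin.tail z))⁻¹ * ((evalFamily P₁ z)⁻¹ * dbarCoord 0 (dbarCoord 1 θ) z) := by
  set Γ := j + 1 + k + 1 with hΓ
  set σ : ℂ := wedgeSign (0 : Fin (m + 2)) Finset.univ * wedgeSign 1 (Finset.univ.erase (0 : Fin (m + 2))) with hσ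
  set c : ℂ := (-1) ^ ((m + 2) * ((m + 2) - 1) / 2) * (-2 * Complex.I) ^ (m + 2) with hc
  set τ : ℂ := (-1) ^ M * (M + 1).factorial with hτ
  set ρ : ℂ := (-1) ^ (k + 1) * (k + 1).factorial with hρ
  refine ⟨c * (σ * τ * ρ), ?_, fun θ hθ h0 h1 => ?_⟩
  · have h2 : ∀ n : ℕ, ((-1 : ℂ)) ^ n ≠ 0 := fun n => pow_ne_zero _ (by norm_num)
    have h3 : ∀ n : ℕ, (n.factorial : ℂ) ≠ 0 := fun n => by exact_mod_cast n.factorial_ne_zero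
    refine mul_ne_zero (mul_ne_zero (h2 _) (pow_ne_zero _ (by simp))) (mul_ne_zero (mul_ne_zero
      (mul_ne_zero (wedgeSign_ne_zero _ _) (wedgeSign_ne_zero _ _)) (mul_ne_zero (h2 _) (h3 _)))
      (mul_ne_zero (h2 _) (h3 _)))
  set p := evalFamily P₁ with hp
  have hcomm : dbarCoord 0 (dbarCoord 1 θ) = dbarCoord 1 (dbarCoord 0 θ) := funext fun z =>
    dbarCoord_comm hθ.smooth.contDiffAt
  have h01 : IsTest (U ∩ {z | p z ≠ 0}) (dbarCoord 0 (dbarCoord 1 θ)) := by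
    rw [hcomm]; exact h0.dbar 1
  -- Because `∂̄₁θ` vanishes near the zeros of `p`, division by `p` produces smooth test functions.
  -- One of the `∂̄₁` derivatives falling on `θ` is spent on this.
  set Θ₁ : (Fin (m + 2) → ℂ) → ℂ := fun z => (p z)⁻¹ * dbarCoord 0 (dbarCoord 1 θ) z with hΘ₁
  set Θ₂ : (Fin (m + 2) → ℂ) → ℂ := fun z => (p z)⁻¹ * dbarCoord 0 θ z with hΘ₂
  have hΘ₁t : IsTest (U ∩ {z | p z ≠ 0}) Θ₁ := h01.mul h.isOpen_ne₁ h.analytic_inv_ne₁.smoothOn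
  have hΘ₂t : IsTest (U ∩ {z | p z ≠ 0}) Θ₂ := h0.mul h.isOpen_ne₁ h.analytic_inv_ne₁.smoothOn
  have hΘ₁R : IsTest (U ∩ {z | R (Fin.tail z) ≠ 0}) Θ₁ := by
    refine ⟨hΘ₁t.smooth, hΘ₁t.compact, ?_⟩
    refine Set.Subset.trans ?_ (h1.dbar 0).support
    exact tsupport_mul_subset_right
  have hb : ∀ l, SmoothOn U (dbarCoord l (conjPow P₁ Γ)) := fun l =>
    (h.smoothOn_conjPow Γ).dbarCoord h.isOpen l
  obtain ⟨Ψ₁, hΨ₁, hΨ₁e⟩ := exists_mul_dbarCoord_iterate_eq h.isOpen 0 M (hb 0)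
    (hΘ₁t.mono Set.inter_subset_left)
  obtain ⟨Ψ₂, hΨ₂, hΨ₂e⟩ := exists_mul_dbarCoord_iterate_eq h.isOpen 0 (M + 1) (hb 1)
    (hΘ₂t.mono Set.inter_subset_left)
  set Ψ : (Fin (m + 2) → ℂ) → ℂ := fun z => Ψ₁ z + (-1) * Ψ₂ z with hΨdef
  have hΨ : IsTest U Ψ := hΨ₁.add (hΨ₂.const_mul _)
  have hΘU := hΘ₁t.mono (Set.inter_subset_left (s := U))
  set W : (Fin (m + 2) → ℂ) → ℂ := fun z => σ * (dbarCoord 0 Ψ z + τ * Θ₁ z) with hW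
  have hWt : IsTest U W := ((hΨ.dbar 0).add (hΘU.const_mul τ)).const_mul σ
  have hTT := hθ.mul h.isOpen h.unit₁.smoothOn
  have hT := h.divisor.isTest_conj_pow_mul (h.isTest_residueTest hTT.topForm.dbar
    ((j + 1 + k + 1) * N₁) (j + 1 + k + 1)) (j + 1 + k)
  -- The first term integrates by parts to `τ Θ₁`, since `M` more derivatives of `∂̄₁(conj p ^ Γ)`
  -- give `(M + 1)!`. The second is purely exact, since `M + 1` derivatives kill `∂̄₂(conj p ^ Γ)`.
  have hWe : (fun z => conj (p z) ^ (j + 1 + k) *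
      residueTest P₁ u ((j + 1 + k + 1) * N₁) (j + 1 + k + 1)
        (dbar (topForm fun z => u z * θ z)) z) = fun z => p z * W z := by
    funext z
    by_cases hz : z ∈ U
    · by_cases hpz : p z = 0
      · rw [hpz, map_zero, zero_pow (by omega), zero_mul, zero_mul]
      rw [h.residueTest_topForm hθ (j + 1 + k) _ hz, hM]
      have e1 : (dbarCoord 0)^[M + 1] (dbarCoord 1 θ) z = p z * (dbarCoord 0)^[M] Θ₁ z := by
        rw [Function.iterate_succ_apply, hΘ₁,
          h01.dbarCoord_iterate_mul h.isOpen_ne₁ h.analytic_inv_ne₁, mul_inv_cancel_left₀ hpz]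
      have e2 : (dbarCoord 0)^[M + 1 + 1] θ z = p z * (dbarCoord 0)^[M + 1] Θ₂ z := by
        rw [Function.iterate_succ_apply, hΘ₂,
          h0.dbarCoord_iterate_mul h.isOpen_ne₁ h.analytic_inv_ne₁, mul_inv_cancel_left₀ hpz]
      have e3 := hΨ₁e z
      rw [← Function.iterate_succ_apply, Nat.succ_eq_add_one, ← hM,
        h.dbarCoord_iterate_conjPow Γ z hz, hM] at e3
      have e4 := hΨ₂e z
      rw [← hM, h.dbarCoord_iterate_dbarCoord_conjPow Γ 1 z hz, hM] at e4
      have e5 : dbarCoord 0 Ψ z = dbarCoord 0 Ψ₁ z - dbarCoord 0 Ψ₂ z := by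
        rw [hΨdef, dbarCoord_add (hΨ₁.differentiableAt z) ((hΨ₂.const_mul _).differentiableAt z),
          dbarCoord_const_mul _ (hΨ₂.differentiableAt z)]
        ring
      rw [e1, e2, hW]
      beta_reduce
      rw [e5, hτ]
      linear_combination σ * p z * e3 - σ * p z * e4
    · rw [hWt.eq_zero hz, mul_zero]
      exact hT.eq_zero hz
  -- The same reduction in `z̄₂` with `conj q`: since `Θ₁` vanishes near the zeros of `R`, the
  -- quotient by `R` is again a test function.
  obtain ⟨Ψ₃, hΨ₃, hΨ₃e⟩ := exists_mul_dbarCoord_iterate_eq h.isOpen 1 (k + 1)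
    h.analytic₂.smoothOn.conj ((hΘ₁R.mul h.isOpen_ne₂ h.analytic_inv_ne₂.smoothOn).mono
      Set.inter_subset_left)
  have hΩ := (hΘ₁R.mul h.isOpen_ne₂ h.analytic_inv_ne₂.smoothOn)
  have hk : ∀ z, kernel R Q z * (dbarCoord 1)^[k + 1] Θ₁ z =
      dbarCoord 1 Ψ₃ z + ρ * ((R (Fin.tail z))⁻¹ * Θ₁ z) := fun z => by
    have e1 := hΨ₃e z
    rw [hΘ₁R.dbarCoord_iterate_mul h.isOpen_ne₂ h.analytic_inv_ne₂] at e1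
    rw [kernel, div_eq_mul_inv, mul_assoc, e1, hρ]
    by_cases hz : z ∈ U
    · rw [h.dbarCoord_iterate_conj_second z hz]; ring
    · rw [hΘU.eq_zero hz]; ring
  have hInt : ∫ z, integrand₂ f₁ P₁ R Q N₁ (k + 1) Γ (dbar (topForm fun z => u z * θ z))
      Finset.univ z = σ * τ * ρ * ∫ z, (R (Fin.tail z))⁻¹ * Θ₁ z := by
    have e1 : ∫ z, integrand₂ f₁ P₁ R Q N₁ (k + 1) Γ (dbar (topForm fun z => u z * θ z))
        Finset.univ z = ∫ z, (σ * (kernel R Q z * dbarCoord 0 ((dbarCoord 1)^[k + 1] Ψ) z) +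
          σ * τ * (dbarCoord 1 Ψ₃ z + ρ * ((R (Fin.tail z))⁻¹ * Θ₁ z))) := by
      refine integral_congr_ae ?_
      filter_upwards [h.integrand₂_ae hTT.topForm.dbar (j + 1 + k), h.divisor.ae_ne] with z hz hpz
      rw [hz, hWe, hWt.dbarCoord_iterate_mul h.isOpen h.divisor.analytic, ← hk,
        ← hΨ.dbarCoord_comm_iterate 0 1 (k + 1)]
      have e2 : (dbarCoord 1)^[k + 1] W z = σ * ((dbarCoord 1)^[k + 1] (dbarCoord 0 Ψ) z +
          τ * (dbarCoord 1)^[k + 1] Θ₁ z) := by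
        rw [hW, ((hΨ.dbar 0).add (hΘU.const_mul τ)).dbarCoord_iterate_mul h.isOpen
          (fun _ _ => analyticAt_const)]
        beta_reduce
        rw [dbarCoord_iterate_add isOpen_univ
          ((hΨ.dbar 0).smoothOn _) ((hΘU.const_mul τ).smoothOn _) _ z trivial,
          hΘU.dbarCoord_iterate_mul h.isOpen (fun _ _ => analyticAt_const)]
      beta_reduce
      by_cases hzU : z ∈ U
      · rw [← mul_assoc (evalFamily P₁ z)⁻¹, inv_mul_cancel₀ (hpz hzU), one_mul, e2]; ring
      · rw [(hWt.dbar_iterate 1 _).eq_zero hzU, ((hΨ.dbar 0).dbar_iterate 1 _).eq_zero hzU,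
          (hΘU.dbar_iterate 1 _).eq_zero hzU]
        ring
    have hi1 := h.integrable_kernel_mul_test ((hΨ.dbar_iterate 1 (k + 1)).dbar 0)
    -- The part exact in `z̄₁` drops out, because the kernel does not depend on `z₁`.
    have h3 := integral_tail_mul_dbarCoord_zero (hΨ.dbar_iterate 1 (k + 1))
      (κ := fun w => conj (evalFamily Q w) / R w) hi1
    have h3' : ∫ z, kernel R Q z * dbarCoord 0 ((dbarCoord 1)^[k + 1] Ψ) z = 0 := h3
    have hi2 : Integrable (fun z => dbarCoord 1 Ψ₃ z + ρ * ((R (Fin.tail z))⁻¹ * Θ₁ z)) :=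
      (hΨ₃.dbar 1).integrable.add (hΩ.integrable.const_mul ρ)
    rw [e1, integral_add (hi1.const_mul σ) (hi2.const_mul _), integral_const_mul, integral_const_mul, h3',
      integral_add (hΨ₃.dbar 1).integrable (hΩ.integrable.const_mul ρ), hΨ₃.integral_dbarCoord,
      integral_const_mul]
    ring
  refine ⟨hΩ.integrable, ?_⟩
  simp only [X₂, formIntegral]
  rw [hInt]
  ring

end Chart

end

section

open MeasureTheory Polynomial

/-! ### Product test functions -/

theorem dbarCoord_comp_apply {n : ℕ} (l : Fin n) {A : ℂ → ℂ} {z : Fin n → ℂ}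
    (hA : DifferentiableAt ℝ A (z l)) :
    dbarCoord l (fun z => A (z l)) z = dbarOne A (z l) := by
  have h := hA.hasFDerivAt.comp z
    (ContinuousLinearMap.proj (R := ℝ) (φ := fun _ : Fin n => ℂ) l).hasFDerivAt
  rw [dbarCoord, dbarOne, show fderiv ℝ (fun z : Fin n → ℂ => A (z l)) z = _ from h.fderiv]
  simp

theorem dbarCoord_eq_zero_of_forall {n : ℕ} {l : Fin n} {h : (Fin n → ℂ) → ℂ} {z : Fin n → ℂ}
    (hd : DifferentiableAt ℝ h z) (hc : ∀ t : ℂ, h (z + Pi.single l t) = h z) :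
    dbarCoord l h z = 0 := by
  have key : ∀ t : ℂ, fderiv ℝ h z (Pi.single l t) = 0 := fun t => by
    have h1 := hd.hasFDerivAt.hasLineDerivAt (Pi.single l t)
    have h2 : HasLineDerivAt ℝ h 0 z (Pi.single l t) := by
      have e : (fun s : ℝ => h (z + s • (Pi.single l t : Fin n → ℂ))) = fun _ => h z := by
        funext s
        rw [← Pi.single_smul, hc]
      rw [HasLineDerivAt, e]
      exact hasDerivAt_const _ _
    exact h1.unique h2
  simp [dbarCoord, key]

/-- The test function `χ₁(z₁) χ₂(z₂) χ₃(z'')`. -/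
def prodTest {m : ℕ} (χ₁ χ₂ : ℂ → ℂ) (χ₃ : (Fin m → ℂ) → ℂ) (z : Fin (m + 2) → ℂ) : ℂ :=
  χ₁ (z 0) * (χ₂ (z 1) * χ₃ (Fin.tail (Fin.tail z)))

theorem contDiff_prodTest {m : ℕ} {χ₁ χ₂ : ℂ → ℂ} {χ₃ : (Fin m → ℂ) → ℂ}
    (h₁ : ContDiff ℝ ∞ χ₁) (h₂ : ContDiff ℝ ∞ χ₂) (h₃ : ContDiff ℝ ∞ χ₃) :
    ContDiff ℝ ∞ (prodTest χ₁ χ₂ χ₃) :=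
  (h₁.comp (contDiff_apply ℝ ℂ 0)).mul ((h₂.comp (contDiff_apply ℝ ℂ 1)).mul
    (h₃.comp (contDiff_pi.2 fun i => contDiff_apply ℝ ℂ i.succ.succ)))

theorem dbarCoord_zero_prodTest {m : ℕ} {χ₁ χ₂ : ℂ → ℂ} {χ₃ : (Fin m → ℂ) → ℂ}
    (h₁ : ContDiff ℝ ∞ χ₁) (h₂ : ContDiff ℝ ∞ χ₂) (h₃ : ContDiff ℝ ∞ χ₃) :
    dbarCoord 0 (prodTest χ₁ χ₂ χ₃) = prodTest (dbarOne χ₁) χ₂ χ₃ := by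
  funext z
  have hA : ContDiff ℝ ∞ (fun z : Fin (m + 2) → ℂ => χ₁ (z 0)) :=
    h₁.comp (contDiff_apply ℝ ℂ 0)
  have hB : ContDiff ℝ ∞ (fun z : Fin (m + 2) → ℂ => χ₂ (z 1) * χ₃ (Fin.tail (Fin.tail z))) :=
    (h₂.comp (contDiff_apply ℝ ℂ 1)).mul
    (h₃.comp (contDiff_pi.2 fun i => contDiff_apply ℝ ℂ i.succ.succ))
  have e := dbarCoord_mul (l := 0) (hA.differentiable (by simp) z) (hB.differentiable (by simp) z)
  rw [dbarCoord_comp_apply 0 (h₁.differentiable (by simp) _),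
    dbarCoord_eq_zero_of_forall (l := 0) (hB.differentiable (by simp) z) (fun t => by
      have : Fin.tail (Fin.tail (z + Pi.single 0 t)) = Fin.tail (Fin.tail z) := by
        funext i; simp [Fin.tail]
      rw [this]; simp), mul_zero, add_zero] at e
  exact e

theorem dbarCoord_one_prodTest {m : ℕ} {χ₁ χ₂ : ℂ → ℂ} {χ₃ : (Fin m → ℂ) → ℂ}
    (h₁ : ContDiff ℝ ∞ χ₁) (h₂ : ContDiff ℝ ∞ χ₂) (h₃ : ContDiff ℝ ∞ χ₃) :
    dbarCoord 1 (prodTest χ₁ χ₂ χ₃) = prodTest χ₁ (dbarOne χ₂) χ₃ := by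
  funext z
  have hA : ContDiff ℝ ∞ (fun z : Fin (m + 2) → ℂ => χ₂ (z 1)) :=
    h₂.comp (contDiff_apply ℝ ℂ 1)
  have hB : ContDiff ℝ ∞ (fun z : Fin (m + 2) → ℂ => χ₁ (z 0) * χ₃ (Fin.tail (Fin.tail z))) :=
    (h₁.comp (contDiff_apply ℝ ℂ 0)).mul
    (h₃.comp (contDiff_pi.2 fun i => contDiff_apply ℝ ℂ i.succ.succ))
  have e := dbarCoord_mul (l := 1) (hA.differentiable (by simp) z) (hB.differentiable (by simp) z)
  rw [dbarCoord_comp_apply 1 (h₂.differentiable (by simp) _),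
    dbarCoord_eq_zero_of_forall (l := 1) (hB.differentiable (by simp) z) (fun t => by
      have : Fin.tail (Fin.tail (z + Pi.single 1 t)) = Fin.tail (Fin.tail z) := by
        funext i
        have : (i.succ.succ : Fin (m + 2)) ≠ 1 := by
          intro h
          have := congrArg Fin.val h
          simp at this
        simp [Fin.tail, this]
      rw [this]; simp), mul_zero, add_zero] at e
  have e2 : prodTest χ₁ χ₂ χ₃ = fun z => χ₂ (z 1) * (χ₁ (z 0) * χ₃ (Fin.tail (Fin.tail z))) :=
    funext fun z => mul_left_comm _ _ _
  rw [e2, e, prodTest]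
  ring

theorem contDiff_dbarOne {χ : ℂ → ℂ} (h : ContDiff ℝ ∞ χ) : ContDiff ℝ ∞ (dbarOne χ) := by
  have : ContDiff ℝ ∞ (fderiv ℝ χ) := h.fderiv_right le_rfl
  exact contDiff_const.mul ((this.clm_apply contDiff_const).add
    (contDiff_const.mul (this.clm_apply contDiff_const)))

theorem cons_cons_tail_tail {m : ℕ} (z : Fin (m + 2) → ℂ) :
    (Fin.cons (z 0) (Fin.cons (z 1) (Fin.tail (Fin.tail z)) : Fin (m + 1) → ℂ) :
      Fin (m + 2) → ℂ) = z := by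
  have : (Fin.cons (z 1) (Fin.tail (Fin.tail z)) : Fin (m + 1) → ℂ) = Fin.tail z :=
    Fin.cons_self_tail (Fin.tail z)
  rw [this, Fin.cons_self_tail]

/-- A product test function supported in a closed set `S` is a test function on any set that
contains the part of `S` lying over the supports of the factors. -/
theorem isTest_prodTest {m : ℕ} {χ₁ χ₂ : ℂ → ℂ} {χ₃ : (Fin m → ℂ) → ℂ} {V : Set (Fin (m + 2) → ℂ)}
    (h₁ : ContDiff ℝ ∞ χ₁) (h₂ : ContDiff ℝ ∞ χ₂) (h₃ : ContDiff ℝ ∞ χ₃)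
    {S₁ S₂ : Set ℂ} (hS₁ : IsCompact S₁) (hS₂ : IsCompact S₂) (h₁S : ∀ t ∉ S₁, χ₁ t = 0)
    (h₂S : ∀ t ∉ S₂, χ₂ t = 0) (h₃c : HasCompactSupport χ₃)
    (hV : ∀ z : Fin (m + 2) → ℂ, z 0 ∈ S₁ → z 1 ∈ S₂ → Fin.tail (Fin.tail z) ∈ tsupport χ₃ →
      z ∈ V) : IsTest V (prodTest χ₁ χ₂ χ₃) := by
  set f : ℂ × ℂ × (Fin m → ℂ) → (Fin (m + 2) → ℂ) := fun x =>
    Fin.cons x.1 (Fin.cons x.2.1 x.2.2 : Fin (m + 1) → ℂ) with hf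
  have hfc : Continuous f := by
    refine continuous_pi fun i => ?_
    refine Fin.cases ?_ (fun i => ?_) i
    · exact continuous_fst
    · refine Fin.cases ?_ (fun i => ?_) i
      · exact continuous_fst.comp continuous_snd
      · exact (continuous_apply i).comp (continuous_snd.comp continuous_snd)
  set K := f '' (S₁ ×ˢ S₂ ×ˢ tsupport χ₃) with hK
  have hKc : IsCompact K := (hS₁.prod (hS₂.prod h₃c)).image hfc
  have hsupp : tsupport (prodTest χ₁ χ₂ χ₃) ⊆ K := by
    refine closure_minimal (fun z hz => ?_) hKc.isClosed
    have hz' : prodTest χ₁ χ₂ χ₃ z ≠ 0 := hz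
    rw [prodTest] at hz'
    refine ⟨(z 0, z 1, Fin.tail (Fin.tail z)), ⟨?_, ?_, ?_⟩, cons_cons_tail_tail z⟩
    · by_contra hc
      exact hz' (by rw [h₁S _ hc, zero_mul])
    · by_contra hc
      exact hz' (by rw [h₂S _ hc, zero_mul, mul_zero])
    · exact subset_tsupport _ (right_ne_zero_of_mul (right_ne_zero_of_mul hz'))
  refine ⟨contDiff_prodTest h₁ h₂ h₃, hKc.of_isClosed_subset (isClosed_tsupport _) hsupp,
    hsupp.trans ?_⟩
  rintro _ ⟨⟨a, b, c⟩, ⟨ha, hb, hc⟩, rfl⟩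
  exact hV _ ha hb hc

theorem integrable_integral_cons {k : ℕ} {F : (Fin (k + 1) → ℂ) → ℂ} (hF : Integrable F) :
    Integrable (fun w : Fin k → ℂ => ∫ t : ℂ, F (consPoint t w)) := by
  have h := (measurePreserving_cons k).integrable_comp_of_integrable hF
  rw [Measure.volume_eq_prod] at h
  exact h.integral_prod_right

/-- The shift by `N - 1 - i₀` puts index `i₀` at exponent `N - 1`, the only one below `N` with
nonzero residue. Smaller indices land below it, and larger ones have coefficient zero. -/
theorem integral_sum_pow_div_cutoff {ε : ℝ} (hε : 0 < ε) {T : ℂ[X]} {N : ℕ} (hTm : T.Monic)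
    (hTd : T.natDegree = N) (hT : ∀ a, T.IsRoot a → ‖a‖ < ε) (c : Fin N → ℂ) (i₀ : Fin N)
    (hc : ∀ i, i₀ < i → c i = 0) :
    ∫ t, (∑ i, c i * t ^ ((i : ℕ) + (N - 1 - i₀))) / T.eval t * dbarOne (cutoff ε) t =
      cutoffConst * c i₀ := by
  have hi : ∀ i, Integrable (fun t => c i * (t ^ ((i : ℕ) + (N - 1 - i₀)) / T.eval t *
      dbarOne (cutoff ε) t)) := fun i =>
    ((continuous_div_mul_dbarOne_cutoff hε _ hT).integrable_of_hasCompactSupport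
      (hasCompactSupport_div_mul_dbarOne_cutoff hε _)).const_mul _
  have e : (fun t => (∑ i, c i * t ^ ((i : ℕ) + (N - 1 - i₀))) / T.eval t *
      dbarOne (cutoff ε) t) = fun t => ∑ i, c i * (t ^ ((i : ℕ) + (N - 1 - i₀)) / T.eval t *
      dbarOne (cutoff ε) t) := by
    funext t
    rw [Finset.sum_div, Finset.sum_mul]
    exact Finset.sum_congr rfl fun i _ => by ring
  rw [e, integral_finsetSum _ fun i _ => hi i, Finset.sum_eq_single i₀]
  · have := i₀.2
    rw [integral_const_mul, integral_pow_div_cutoff hε hTm hTd (by omega) hT, if_pos (by omega),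
      mul_comm]
  · intro i _ hne
    rw [integral_const_mul]
    rcases lt_or_gt_of_ne hne with h | h
    · have h1 : (i : ℕ) < i₀ := h
      have h2 := i₀.2
      rw [integral_pow_div_cutoff hε hTm hTd (by omega) hT, if_neg (by omega), mul_zero]
    · rw [hc i h, zero_mul]
  · simp

/-- Evaluation of an iterated residue integral of a polynomial. -/
theorem integral_prodTest {m N₁ N₂ : ℕ} {P : (Fin (m + 1) → ℂ) → ℂ[X]} {Q : (Fin m → ℂ) → ℂ[X]}
    (hPm : ∀ w, (P w).Monic) (hPd : ∀ w, (P w).natDegree = N₁) (hQm : ∀ w, (Q w).Monic)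
    (hQd : ∀ w, (Q w).natDegree = N₂) {D : Set (Fin m → ℂ)} {ε₀ ε₁ : ℝ} (hε₀ : 0 < ε₀)
    (hε₁ : 0 < ε₁) (hP : ∀ w : Fin (m + 1) → ℂ, ‖w 0‖ ≤ 2 * ε₁ → Fin.tail w ∈ D →
      ∀ a, (P w).IsRoot a → ‖a‖ < ε₀) (hQ : ∀ w ∈ D, ∀ a, (Q w).IsRoot a → ‖a‖ < ε₁)
    {r : Fin N₁ → Fin N₂ → (Fin m → ℂ) → ℂ} (i₀ : Fin N₁) (l₀ : Fin N₂)
    (hi : ∀ i, i₀ < i → ∀ l, ∀ w ∈ D, r i l w = 0) (hl : ∀ l, l₀ < l → ∀ w ∈ D, r i₀ l w = 0)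
    {χ : (Fin m → ℂ) → ℂ} (hχ : ∀ w ∉ D, χ w = 0)
    (hInt : Integrable (fun z : Fin (m + 2) → ℂ => (∑ i, ∑ l, r i l (Fin.tail (Fin.tail z)) *
      (z 0 ^ ((i : ℕ) + (N₁ - 1 - i₀)) * z 1 ^ ((l : ℕ) + (N₂ - 1 - l₀)))) /
      (evalFamily P z * evalFamily Q (Fin.tail z)) *
        prodTest (dbarOne (cutoff ε₀)) (dbarOne (cutoff ε₁)) χ z)) :
    ∫ z : Fin (m + 2) → ℂ, (∑ i, ∑ l, r i l (Fin.tail (Fin.tail z)) *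
      (z 0 ^ ((i : ℕ) + (N₁ - 1 - i₀)) * z 1 ^ ((l : ℕ) + (N₂ - 1 - l₀)))) /
      (evalFamily P z * evalFamily Q (Fin.tail z)) *
        prodTest (dbarOne (cutoff ε₀)) (dbarOne (cutoff ε₁)) χ z =
      cutoffConst * cutoffConst * ∫ w, χ w * r i₀ l₀ w := by
  have hcut0 : ∀ t : ℂ, 2 * ε₁ < ‖t‖ → dbarOne (cutoff ε₁) t = 0 := fun t ht => by
    rw [dbarOne_cutoff ε₁, cutoffWeight_eq_zero (Or.inr ?_)]
    · simp
    · rw [norm_div, Complex.norm_real, Real.norm_of_nonneg hε₁.le, le_div_iff₀ hε₁]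
      exact ht.le
  -- The `z₁`-integral selects the row `i₀` and leaves the same kind of integral in `z₂`. Where the
  -- parameters lie outside the root bounds, the remaining factors vanish.
  have hinner : ∀ w : Fin (m + 1) → ℂ, ∫ t : ℂ, (∑ i, ∑ l,
      r i l (Fin.tail (Fin.tail (consPoint t w))) *
      (consPoint t w 0 ^ ((i : ℕ) + (N₁ - 1 - i₀)) *
        consPoint t w 1 ^ ((l : ℕ) + (N₂ - 1 - l₀)))) /
      (evalFamily P (consPoint t w) * evalFamily Q (Fin.tail (consPoint t w))) *
        prodTest (dbarOne (cutoff ε₀)) (dbarOne (cutoff ε₁)) χ (consPoint t w) =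
      cutoffConst * ((∑ l, r i₀ l (Fin.tail w) * w 0 ^ ((l : ℕ) + (N₂ - 1 - l₀))) / evalFamily Q w *
        (dbarOne (cutoff ε₁) (w 0) * χ (Fin.tail w))) := by
    intro w
    have e1 : ∀ t, (consPoint t w : Fin (m + 2) → ℂ) 1 = w 0 := fun t => rfl
    by_cases hw : ‖w 0‖ ≤ 2 * ε₁ ∧ Fin.tail w ∈ D
    · set c : Fin N₁ → ℂ := fun i => (∑ l, r i l (Fin.tail w) * w 0 ^ ((l : ℕ) + (N₂ - 1 - l₀))) /
        evalFamily Q w * (dbarOne (cutoff ε₁) (w 0) * χ (Fin.tail w)) with hc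
      refine Eq.trans (integral_congr_ae (Filter.Eventually.of_forall fun t => ?_))
        (integral_sum_pow_div_cutoff hε₀ (hPm w) (hPd w) (hP w hw.1 hw.2) c i₀ fun i hii => ?_)
      · change (∑ i, ∑ l, r i l (Fin.tail w) * (t ^ ((i : ℕ) + (N₁ - 1 - i₀)) *
          w 0 ^ ((l : ℕ) + (N₂ - 1 - l₀)))) / ((P w).eval t * evalFamily Q w) *
          (dbarOne (cutoff ε₀) t * (dbarOne (cutoff ε₁) (w 0) * χ (Fin.tail w))) = _
        have : ∑ i, c i * t ^ ((i : ℕ) + (N₁ - 1 - i₀)) = (∑ i, ∑ l, r i l (Fin.tail w) *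
            (t ^ ((i : ℕ) + (N₁ - 1 - i₀)) * w 0 ^ ((l : ℕ) + (N₂ - 1 - l₀)))) / evalFamily Q w *
            (dbarOne (cutoff ε₁) (w 0) * χ (Fin.tail w)) := by
          rw [Finset.sum_div, Finset.sum_mul]
          refine Finset.sum_congr rfl fun i _ => ?_
          rw [hc]
          beta_reduce
          rw [mul_right_comm, div_mul_eq_mul_div, Finset.sum_mul]
          congr 2
          exact Finset.sum_congr rfl fun l _ => by ring
        rw [this, div_mul_eq_div_div_swap]
        ring
      · rw [hc]
        beta_reduce
        rw [Finset.sum_eq_zero fun l _ => by rw [hi i hii l _ hw.2, zero_mul], zero_div, zero_mul]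
    · have h0 : dbarOne (cutoff ε₁) (w 0) * χ (Fin.tail w) = 0 := by
        rw [not_and_or, not_le] at hw
        rcases hw with hw | hw
        · rw [hcut0 _ hw, zero_mul]
        · rw [hχ _ hw, mul_zero]
      rw [h0, mul_zero, mul_zero]
      refine integral_eq_zero_of_ae (Filter.Eventually.of_forall fun t => ?_)
      change _ * (dbarOne (cutoff ε₀) t * (dbarOne (cutoff ε₁) (w 0) * χ (Fin.tail w))) = 0
      rw [h0, mul_zero, mul_zero]
  have hInt' := integrable_integral_cons hInt
  simp only [hinner] at hInt'
  rw [integral_cons hInt]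
  simp only [hinner]
  rw [integral_cons hInt', mul_assoc, ← integral_const_mul, ← integral_const_mul]
  refine integral_congr_ae (Filter.Eventually.of_forall fun y => ?_)
  beta_reduce
  rw [integral_const_mul]
  congr 1
  by_cases hy : y ∈ D
  · refine Eq.trans (integral_congr_ae (Filter.Eventually.of_forall fun t => ?_))
      (integral_sum_pow_div_cutoff hε₁ (hQm y) (hQd y) (hQ y hy) (fun l => χ y * r i₀ l y) l₀
        fun l hll => ?_)
    · change (∑ l, r i₀ l y * t ^ ((l : ℕ) + (N₂ - 1 - l₀))) / (Q y).eval t *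
        (dbarOne (cutoff ε₁) t * χ y) = _
      simp only [mul_assoc (χ y)]
      rw [← Finset.mul_sum]
      ring
    · rw [hl l hll y hy, mul_zero]
  · rw [hχ y hy, zero_mul, mul_zero]
    refine integral_eq_zero_of_ae (Filter.Eventually.of_forall fun t => ?_)
    change _ * (dbarOne (cutoff ε₁) t * χ y) = 0
    rw [hχ y hy, mul_zero, mul_zero]

end

/-! ### Vanishing of the coefficients of the remainder -/

section

open MeasureTheory Polynomial

theorem dbarOne_cutoff_eq_zero {ε : ℝ} (hε : 0 < ε) {t : ℂ}
    (ht : t ∉ Metric.closedBall (0 : ℂ) (2 * ε) \ Metric.ball 0 ε) : dbarOne (cutoff ε) t = 0 := by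
  rw [dbarOne_cutoff ε, cutoffWeight_eq_zero ?_]
  · simp
  · rw [norm_div, Complex.norm_real, Real.norm_of_nonneg hε.le, le_div_iff₀ hε, div_lt_one hε]
    by_contra! hc
    exact ht ⟨mem_closedBall_zero_iff.2 hc.2.le, fun h => (mem_ball_zero_iff.1 h).not_ge hc.1⟩

theorem isCompact_closedBall_diff_ball (ε δ : ℝ) :
    IsCompact (Metric.closedBall (0 : ℂ) ε \ Metric.ball 0 δ) :=
  (isCompact_closedBall _ _).diff Metric.isOpen_ball

theorem forall_fin_succ_succ {m : ℕ} {p : Fin (m + 2) → Prop} (h0 : p 0) (h1 : p 1)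
    (h : ∀ i : Fin m, p i.succ.succ) (i : Fin (m + 2)) : p i := by
  refine Fin.cases h0 (fun i => ?_) i
  exact Fin.cases (motive := fun i => p i.succ) h1 h i

namespace Chart

variable {m : ℕ} {f₁ : (Fin (m + 2) → ℂ) → ℂ} {P₁ : (Fin (m + 1) → ℂ) → ℂ[X]}
  {R : (Fin (m + 1) → ℂ) → ℂ} {Q : (Fin m → ℂ) → ℂ[X]} {N₁ k : ℕ}
  {U : Set (Fin (m + 2) → ℂ)} {u : (Fin (m + 2) → ℂ) → ℂ} {v : (Fin (m + 1) → ℂ) → ℂ}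

/-- The current is tested on the remainder times suitable monomials and product cutoffs. The residue
formula turns the vanishing into that of an iterated residue, which is a nonzero multiple of the
integral of the selected coefficient against `χ`. -/
theorem integral_coeff_eq_zero (h : Chart f₁ P₁ R Q N₁ (k + 1) U u v) (j : ℕ)
    {D : Set (Fin m → ℂ)} {ε₀ ε₁ : ℝ} (hε₀ : 0 < ε₀) (hε₁ : 0 < ε₁)
    (hU : ∀ z : Fin (m + 2) → ℂ, ‖z 0‖ ≤ 2 * ε₀ → ‖z 1‖ ≤ 2 * ε₁ → Fin.tail (Fin.tail z) ∈ D →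
      z ∈ U)
    (hP : ∀ w : Fin (m + 1) → ℂ, ‖w 0‖ ≤ 2 * ε₁ → Fin.tail w ∈ D →
      ∀ a, (P₁ w).IsRoot a → ‖a‖ < ε₀) (hQ : ∀ w ∈ D, ∀ a, (Q w).IsRoot a → ‖a‖ < ε₁)
    {r : Fin N₁ → Fin (k + 1) → (Fin m → ℂ) → ℂ}
    (hr : ∀ i l, ∀ z ∈ U, AnalyticAt ℂ (r i l) (Fin.tail (Fin.tail z)))
    (hT : CurrentEq U m (mulCurrent (fun z => ∑ i, ∑ l, r i l (Fin.tail (Fin.tail z)) *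
      (z 0 ^ (i : ℕ) * z 1 ^ (l : ℕ)))
      (dbarCurrent 1 (X₂ f₁ P₁ R Q N₁ (k + 1) (j + 1 + k + 1)))) (fun _ => 0))
    (i₀ : Fin N₁) (l₀ : Fin (k + 1))
    (hi : ∀ i, i₀ < i → ∀ l, ∀ w ∈ D, r i l w = 0) (hl : ∀ l, l₀ < l → ∀ w ∈ D, r i₀ l w = 0)
    {χ : (Fin m → ℂ) → ℂ} (hχ : IsTest D χ) : ∫ w, χ w * r i₀ l₀ w = 0 := by
  set rr : (Fin (m + 2) → ℂ) → ℂ := fun z => ∑ i, ∑ l, r i l (Fin.tail (Fin.tail z)) *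
      (z 0 ^ (i : ℕ) * z 1 ^ (l : ℕ)) with hrr
  have hrra : AnalyticOnNhd ℂ rr U := fun z hz => by
    refine Finset.analyticAt_fun_sum _ fun i _ => Finset.analyticAt_fun_sum _ fun l _ => ?_
    have h1 : AnalyticAt ℂ (fun z : Fin (m + 2) → ℂ => r i l (Fin.tail (Fin.tail z))) z :=
      ((hr i l z hz).comp (analyticAt_tail (Fin.tail z))).comp (analyticAt_tail z)
    exact h1.fun_mul (((analyticAt_coord 0 z).fun_pow _).fun_mul ((analyticAt_coord 1 z).fun_pow _))
  set a := N₁ - 1 - i₀ with ha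
  set b := k + 1 - 1 - l₀ with hb
  -- The factor `v` replaces `1 / R` by `1 / q`, and the monomial moves the indices `i₀`, `l₀` to
  -- the top exponents `N₁ - 1` and `k`.
  set w : (Fin (m + 2) → ℂ) → ℂ := fun z => v (Fin.tail z) * (z 0 ^ a * z 1 ^ b) with hw
  have hwa : AnalyticOnNhd ℂ w U := fun z hz => (h.unit₂ z hz).fun_mul
    (((analyticAt_coord 0 z).fun_pow _).fun_mul ((analyticAt_coord 1 z).fun_pow _))
  have hrw : AnalyticOnNhd ℂ (fun z => rr z * w z) U := fun z hz =>
    (hrra z hz).fun_mul (hwa z hz)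
  have hc0 := contDiff_cutoff ε₀
  have hc1 := contDiff_cutoff ε₁
  have hS : ∀ {ε : ℝ}, 0 < ε → ∀ t ∉ Metric.closedBall (0 : ℂ) (2 * ε), cutoff ε t = 0 :=
    fun hε t ht => cutoff_eq_zero hε (by
      rw [mem_closedBall_zero_iff, not_le] at ht; exact ht.le)
  have hroot₁ : ∀ z : Fin (m + 2) → ℂ, z 0 ∈ Metric.closedBall (0 : ℂ) (2 * ε₀) \ Metric.ball 0 ε₀ →
      z 1 ∈ Metric.closedBall (0 : ℂ) (2 * ε₁) → Fin.tail (Fin.tail z) ∈ tsupport χ →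
      z ∈ U ∩ {z | evalFamily P₁ z ≠ 0} := fun z h0 h1 h2 => by
    refine ⟨hU z (mem_closedBall_zero_iff.1 h0.1) (mem_closedBall_zero_iff.1 h1) (hχ.support h2),
      fun hz => h0.2 (mem_ball_zero_iff.2 ?_)⟩
    exact hP (Fin.tail z) (mem_closedBall_zero_iff.1 h1) (hχ.support h2) _ hz
  have hroot₂ : ∀ z : Fin (m + 2) → ℂ, z 0 ∈ Metric.closedBall (0 : ℂ) (2 * ε₀) →
      z 1 ∈ Metric.closedBall (0 : ℂ) (2 * ε₁) \ Metric.ball 0 ε₁ →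
      Fin.tail (Fin.tail z) ∈ tsupport χ → z ∈ U ∩ {z | R (Fin.tail z) ≠ 0} := fun z h0 h1 h2 => by
    have hzU := hU z (mem_closedBall_zero_iff.1 h0) (mem_closedBall_zero_iff.1 h1.1) (hχ.support h2)
    refine ⟨hzU, fun hz => h1.2 (mem_ball_zero_iff.2 ?_)⟩
    rw [h.eq₂ z hzU] at hz
    exact hQ _ (hχ.support h2) _ ((mul_eq_zero.1 hz).resolve_left (h.unit₂_ne z hzU))
  have hX : IsTest U (prodTest (cutoff ε₀) (cutoff ε₁) χ) :=
    isTest_prodTest hc0 hc1 hχ.smooth (isCompact_closedBall _ _) (isCompact_closedBall _ _)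
      (hS hε₀) (hS hε₁) hχ.compact fun z h0 h1 h2 =>
        hU z (mem_closedBall_zero_iff.1 h0) (mem_closedBall_zero_iff.1 h1) (hχ.support h2)
  have hX0 : IsTest (U ∩ {z | evalFamily P₁ z ≠ 0})
      (prodTest (dbarOne (cutoff ε₀)) (cutoff ε₁) χ) :=
    isTest_prodTest (contDiff_dbarOne hc0) hc1 hχ.smooth (isCompact_closedBall_diff_ball _ _)
      (isCompact_closedBall _ _) (fun t ht => dbarOne_cutoff_eq_zero hε₀ ht) (hS hε₁) hχ.compact
      hroot₁
  have hX1 : IsTest (U ∩ {z | R (Fin.tail z) ≠ 0})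
      (prodTest (cutoff ε₀) (dbarOne (cutoff ε₁)) χ) :=
    isTest_prodTest hc0 (contDiff_dbarOne hc1) hχ.smooth (isCompact_closedBall _ _)
      (isCompact_closedBall_diff_ball _ _) (hS hε₀) (fun t ht => dbarOne_cutoff_eq_zero hε₁ ht)
      hχ.compact hroot₂
  set X := prodTest (cutoff ε₀) (cutoff ε₁) χ with hXdef
  set θ : (Fin (m + 2) → ℂ) → ℂ := fun z => rr z * w z * X z with hθ
  have hθt : IsTest U θ := hX.mul h.isOpen hrw.smoothOn
  have e0 : dbarCoord 0 θ = fun z => rr z * w z *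
      prodTest (dbarOne (cutoff ε₀)) (cutoff ε₁) χ z := by
    rw [← dbarCoord_zero_prodTest hc0 hc1 hχ.smooth]
    exact hX.dbarCoord_iterate_mul h.isOpen hrw 0 1
  have e1 : dbarCoord 1 θ = fun z => rr z * w z *
      prodTest (cutoff ε₀) (dbarOne (cutoff ε₁)) χ z := by
    rw [← dbarCoord_one_prodTest hc0 hc1 hχ.smooth]
    exact hX.dbarCoord_iterate_mul h.isOpen hrw 1 1
  have e01 : dbarCoord 0 (dbarCoord 1 θ) = fun z => rr z * w z *
      prodTest (dbarOne (cutoff ε₀)) (dbarOne (cutoff ε₁)) χ z := by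
    rw [e1, ← dbarCoord_zero_prodTest hc0 (contDiff_dbarOne hc1) hχ.smooth]
    exact (hX1.mono Set.inter_subset_left).dbarCoord_iterate_mul h.isOpen hrw 0 1
  obtain ⟨M, hM⟩ : ∃ M, (j + 1 + k + 1) * N₁ = M + 1 :=
    Nat.exists_eq_succ_of_ne_zero (Nat.mul_ne_zero (by omega) (by have := i₀.2; omega))
  obtain ⟨C, hC, hform⟩ := h.exists_residue_formula j hM
  obtain ⟨hInt, hres⟩ := hform θ hθt
    (by rw [e0]; exact hX0.mul h.isOpen_ne₁ (hrw.smoothOn.mono Set.inter_subset_left))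
    (by rw [e1]; exact hX1.mul h.isOpen_ne₂ (hrw.smoothOn.mono Set.inter_subset_left))
  have hzero : X₂ f₁ P₁ R Q N₁ (k + 1) (j + 1 + k + 1) (dbar (topForm fun z => u z * θ z)) = 0 := by
    have hη := (hX.mul h.isOpen hwa.smoothOn).mul h.isOpen h.unit₁.smoothOn
    have := hT _ hη.topForm
    simp only [mulCurrent, dbarCurrent, mulForm_topForm] at this
    rw [show (fun z => u z * θ z) = fun z => rr z * (u z * (w z * X z)) from
      funext fun z => by rw [hθ]; ring]
    simpa using this
  have hF : (fun z => (R (Fin.tail z))⁻¹ * ((evalFamily P₁ z)⁻¹ * dbarCoord 0 (dbarCoord 1 θ) z)) =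
      fun z : Fin (m + 2) → ℂ => (∑ i, ∑ l, r i l (Fin.tail (Fin.tail z)) *
      (z 0 ^ ((i : ℕ) + (N₁ - 1 - i₀)) * z 1 ^ ((l : ℕ) + (k + 1 - 1 - l₀)))) /
      (evalFamily P₁ z * evalFamily Q (Fin.tail z)) *
        prodTest (dbarOne (cutoff ε₀)) (dbarOne (cutoff ε₁)) χ z := by
    funext z
    rw [e01]
    beta_reduce
    by_cases hz : z ∈ U
    · have hs : (∑ i, ∑ l, r i l (Fin.tail (Fin.tail z)) *
          (z 0 ^ ((i : ℕ) + (N₁ - 1 - i₀)) * z 1 ^ ((l : ℕ) + (k + 1 - 1 - l₀)))) =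
          rr z * (z 0 ^ a * z 1 ^ b) := by
        rw [hrr]
        beta_reduce
        rw [Finset.sum_mul]
        refine Finset.sum_congr rfl fun i _ => ?_
        rw [Finset.sum_mul]
        exact Finset.sum_congr rfl fun l _ => by rw [← ha, ← hb, pow_add, pow_add]; ring
      rw [hs, h.eq₂ z hz, hw]
      have := h.unit₂_ne z hz
      rw [div_eq_mul_inv, mul_inv, mul_inv]
      field_simp
    · rw [← dbarCoord_zero_prodTest hc0 (contDiff_dbarOne hc1) hχ.smooth,
        ((hX1.mono Set.inter_subset_left).dbar 0).eq_zero hz]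
      ring
  rw [hF] at hInt hres
  rw [hzero, integral_prodTest h.monic₁ h.natDegree₁ h.monic₂ h.natDegree₂ hε₀ hε₁ hP hQ i₀ l₀ hi hl
    (fun w hw => hχ.eq_zero hw) hInt] at hres
  have hcc := cutoffConst_ne_zero
  simpa [hC, hcc] using hres.symm

/-- Residues isolate a coefficient only once the higher ones are known to vanish, so the
coefficients are treated in descending order, first in `i` and then in `l`. -/
theorem coeff_eq_zero (h : Chart f₁ P₁ R Q N₁ (k + 1) U u v) (h0 : (0 : Fin (m + 2) → ℂ) ∈ U)
    (hP : IsWeierstrassPoly P₁ N₁) (hQ : IsWeierstrassPoly Q (k + 1)) (j : ℕ)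
    {r : Fin N₁ → Fin (k + 1) → (Fin m → ℂ) → ℂ}
    (hr : ∀ i l, ∀ z ∈ U, AnalyticAt ℂ (r i l) (Fin.tail (Fin.tail z)))
    (hT : CurrentEq U m (mulCurrent (fun z => ∑ i, ∑ l, r i l (Fin.tail (Fin.tail z)) *
      (z 0 ^ (i : ℕ) * z 1 ^ (l : ℕ)))
      (dbarCurrent 1 (X₂ f₁ P₁ R Q N₁ (k + 1) (j + 1 + k + 1)))) (fun _ => 0)) :
    ∀ᶠ w in 𝓝 (0 : Fin m → ℂ), ∀ i l, r i l w = 0 := by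
  obtain ⟨ρ, hρ, hρU⟩ := Metric.nhds_basis_closedBall.mem_iff.1 (h.isOpen.mem_nhds h0)
  obtain ⟨δ₁, hδ₁, hδP⟩ := Metric.eventually_nhds_iff_ball.1
    (hP.eventually_roots_small (half_pos hρ))
  -- The second cutoff lives on `‖z 1‖ ≤ 2 ε₁`. This must stay inside the chart, `2 ε₁ ≤ ρ`, and
  -- inside the ball of radius `δ₁` over which the roots of `P₁` are smaller than `ρ / 2`.
  set ε₁ := min (ρ / 2) (δ₁ / 4) with hε₁
  have hε₁0 : 0 < ε₁ := lt_min (half_pos hρ) (by positivity)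
  have hε₁ρ : ε₁ ≤ ρ / 2 := min_le_left _ _
  have hε₁δ : ε₁ ≤ δ₁ / 4 := min_le_right _ _
  obtain ⟨δ₂, hδ₂, hδQ⟩ := Metric.eventually_nhds_iff_ball.1 (hQ.eventually_roots_small hε₁0)
  set δ := min (min δ₁ δ₂) ρ with hδ
  have hδ0 : 0 < δ := lt_min (lt_min hδ₁ hδ₂) hρ
  have hδρ : δ ≤ ρ := min_le_right _ _
  have hδδ₁ : δ ≤ δ₁ := (min_le_left _ _).trans (min_le_left _ _)
  have hδδ₂ : δ ≤ δ₂ := (min_le_left _ _).trans (min_le_right _ _)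
  set D : Set (Fin m → ℂ) := Metric.ball 0 δ with hD
  have hUD : ∀ z : Fin (m + 2) → ℂ, ‖z 0‖ ≤ 2 * (ρ / 2) → ‖z 1‖ ≤ 2 * ε₁ →
      Fin.tail (Fin.tail z) ∈ D → z ∈ U := fun z hz0 hz1 hz2 => by
    refine hρU (mem_closedBall_zero_iff.2 ((pi_norm_le_iff_of_nonneg hρ.le).2 ?_))
    refine forall_fin_succ_succ (by linarith) (by linarith) fun i => ?_
    have := norm_le_pi_norm (Fin.tail (Fin.tail z)) i
    exact this.trans ((mem_ball_zero_iff.1 hz2).le.trans hδρ)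
  have hPD : ∀ w : Fin (m + 1) → ℂ, ‖w 0‖ ≤ 2 * ε₁ → Fin.tail w ∈ D →
      ∀ a, (P₁ w).IsRoot a → ‖a‖ < ρ / 2 := fun w hw0 hw1 => by
    refine hδP w (mem_ball_zero_iff.2 ((pi_norm_lt_iff hδ₁).2 ?_))
    refine Fin.cases (by linarith) fun i => ?_
    have := norm_le_pi_norm (Fin.tail w) i
    exact this.trans_lt ((mem_ball_zero_iff.1 hw1).trans_le hδδ₁)
  have hQD : ∀ w ∈ D, ∀ a, (Q w).IsRoot a → ‖a‖ < ε₁ := fun w hw =>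
    hδQ w (Metric.ball_subset_ball hδδ₂ hw)
  have hrc : ∀ i l, ContinuousOn (r i l) D := fun i l w hw => by
    have hz : (Fin.cons 0 (Fin.cons 0 w : Fin (m + 1) → ℂ) : Fin (m + 2) → ℂ) ∈ U :=
      hUD _ (by simpa using (half_pos hρ).le) (by
        change ‖(0 : ℂ)‖ ≤ _
        simp [hε₁0.le]) hw
    exact (hr i l _ hz).continuousAt.continuousWithinAt
  have key : ∀ i₀ l₀, (∀ i, i₀ < i → ∀ l, ∀ w ∈ D, r i l w = 0) →
      (∀ l, l₀ < l → ∀ w ∈ D, r i₀ l w = 0) → ∀ w ∈ D, r i₀ l₀ w = 0 := by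
    intro i₀ l₀ hi hl
    -- Orthogonality to all test functions gives vanishing almost everywhere, and continuity
    -- upgrades it to the whole ball.
    have hae := Metric.isOpen_ball.ae_eq_zero_of_integral_contDiff_smul_eq_zero (U := D)
      ((hrc i₀ l₀).locallyIntegrableOn (μ := volume) Metric.isOpen_ball.measurableSet)
      fun g hg hgc hgs => by
        have ht : IsTest D (fun w => (g w : ℂ)) := by
          refine ⟨Complex.ofRealCLM.contDiff.comp hg, hgc.comp_left Complex.ofReal_zero, ?_⟩
          refine Set.Subset.trans (closure_mono fun w hw => ?_) hgs
          intro h0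
          exact hw (by simp [h0])
        have := h.integral_coeff_eq_zero j (half_pos hρ) hε₁0 hUD hPD hQD hr hT i₀ l₀ hi hl ht
        simpa [Complex.real_smul] using this
    exact Measure.eqOn_open_of_ae_eq (g := fun _ => 0)
      ((ae_restrict_iff' Metric.isOpen_ball.measurableSet).2 hae) Metric.isOpen_ball (hrc i₀ l₀)
      continuousOn_const
  have hall : ∀ i l, ∀ w ∈ D, r i l w = 0 := by
    intro i
    induction i using WellFoundedGT.induction with
    | ind i ih =>
      intro l
      induction l using WellFoundedGT.induction with
      | ind l ihl => exact key i l ih ihl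
  filter_upwards [Metric.ball_mem_nhds 0 hδ0] with w hw i l
  exact hall i l w hw

end Chart

end

section

open MeasureTheory Polynomial

/-! ### The local ideal -/

theorem eventually_eq_zero_of_ae {n : ℕ} {y : (Fin n → ℂ) → ℂ} (hy : AnalyticAt ℂ y 0)
    {V : Set (Fin n → ℂ)} (hV : V ∈ 𝓝 0) (h : ∀ᵐ z, z ∈ V → y z = 0) : ∀ᶠ z in 𝓝 0, y z = 0 := by
  obtain ⟨W, hW, hWo, hW0⟩ := eventually_nhds_iff.1 (hy.eventually_analyticAt.and hV)
  have := Measure.eqOn_open_of_ae_eq (μ := volume) (f := y) (g := fun _ => 0)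
    ((ae_restrict_iff' hWo.measurableSet).2 (h.mono fun z hz hzW => hz (hW z hzW).2)) hWo
    (fun z hz => (hW z hz).1.continuousAt.continuousWithinAt) continuousOn_const
  exact Filter.eventually_of_mem (hWo.mem_nhds hW0) this

theorem IsWeierstrassPolyOf.ae_ne_zero {k N : ℕ} {f : (Fin (k + 1) → ℂ) → ℂ}
    {P : (Fin k → ℂ) → ℂ[X]} (h : IsWeierstrassPolyOf f P N) :
    ∃ V ∈ 𝓝 (0 : Fin (k + 1) → ℂ), ∀ᵐ z, z ∈ V → f z ≠ 0 := by
  obtain ⟨hP, u, hu, hu0, he⟩ := h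
  obtain ⟨W, hW, hWo, hW0⟩ := eventually_nhds_iff.1
    ((hP.analyticAt_evalFamily.eventually_analyticAt.and (hu.continuousAt.eventually_ne hu0)).and he)
  refine ⟨W, hWo.mem_nhds hW0, ?_⟩
  filter_upwards [ae_evalFamily_ne_zero hP.monic hWo fun z hz =>
    (hW z hz).1.1.continuousAt.continuousWithinAt] with z hz hzW
  rw [(hW z hzW).2]
  exact mul_ne_zero (hW z hzW).1.2 (hz hzW)

/-- Germs of functions with a Weierstrass polynomial are not zero divisors. -/
theorem IsWeierstrassPolyOf.mul_right_cancel {k N : ℕ} {f x y : (Fin (k + 1) → ℂ) → ℂ}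
    {P : (Fin k → ℂ) → ℂ[X]} (h : IsWeierstrassPolyOf f P N) (hx : AnalyticAt ℂ x 0)
    (hy : AnalyticAt ℂ y 0) (hxy : ∀ᶠ z in 𝓝 0, x z * f z = y z * f z) :
    ∀ᶠ z in 𝓝 0, x z = y z := by
  obtain ⟨V, hV, hVne⟩ := h.ae_ne_zero
  have := eventually_eq_zero_of_ae (hx.fun_sub hy) (Filter.inter_mem hV hxy) (by
    filter_upwards [hVne] with z hz hzV
    have h1 : x z * f z = y z * f z := hzV.2
    exact sub_eq_zero.2 (mul_right_cancel₀ (hz hzV.1) h1))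
  filter_upwards [this] with z hz
  exact sub_eq_zero.1 hz

/-- A function of `z'` with a Weierstrass polynomial is not a zero divisor modulo a function with
a Weierstrass polynomial in `z₁`. -/
theorem IsWeierstrassPolyOf.exists_eq_mul {m N₁ N₂ : ℕ} {f : (Fin (m + 2) → ℂ) → ℂ}
    {P : (Fin (m + 1) → ℂ) → ℂ[X]} {R : (Fin (m + 1) → ℂ) → ℂ} {Q : (Fin m → ℂ) → ℂ[X]}
    (hf : IsWeierstrassPolyOf f P N₁) (hR : IsWeierstrassPolyOf R Q N₂)
    {x s : (Fin (m + 2) → ℂ) → ℂ} (hx : AnalyticAt ℂ x 0) (hs : AnalyticAt ℂ s 0)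
    (hxs : ∀ᶠ z in 𝓝 0, x z * R (Fin.tail z) = s z * f z) :
    ∃ t, AnalyticAt ℂ t 0 ∧ ∀ᶠ z in 𝓝 0, x z = t z * f z := by
  obtain ⟨hP, u, hu, hu0, he⟩ := id hf
  obtain ⟨-, v, hv, hv0, heR⟩ := id hR
  obtain ⟨a, r, ha, hr, hdiv⟩ := hP.division hx
  have htail : Filter.Tendsto (Fin.tail : (Fin (m + 2) → ℂ) → Fin (m + 1) → ℂ) (𝓝 0) (𝓝 0) := by
    have := (analyticAt_tail (0 : Fin (m + 2) → ℂ)).continuousAt.tendsto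
    rwa [show Fin.tail (0 : Fin (m + 2) → ℂ) = 0 from tail_zero] at this
  obtain ⟨ε, hε, hball⟩ := Metric.eventually_nhds_iff_ball.1 ((((he.and hdiv).and hxs).and
    (ha.eventually_continuousAt.and hs.eventually_continuousAt)).and
    (hu.eventually_continuousAt))
  obtain ⟨V, hV, hVne⟩ := hR.ae_ne_zero
  have hsmall := hP.eventually_roots_small hε
  have hr0 : ∀ i, ∀ᶠ w in 𝓝 0, r i w = 0 := fun i => by
    refine eventually_eq_zero_of_ae (hr i) (Filter.inter_mem hV (Filter.inter_mem hsmall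
      (Metric.ball_mem_nhds 0 hε))) ?_
    filter_upwards [hVne] with w hw hwV
    have hRw := hw hwV.1
    have hwr : ∀ b, (P w).IsRoot b → ‖b‖ < ε := hwV.2.1
    have hwε : ‖w‖ < ε := mem_ball_zero_iff.1 hwV.2.2
    have hcons : ∀ t : ℂ, ‖t‖ < ε → (consPoint t w) ∈ Metric.ball (0 : Fin (m + 2) → ℂ) ε :=
      fun t ht => by
        rw [mem_ball_zero_iff, pi_norm_lt_iff hε]
        refine Fin.cases (by simpa using ht) fun i => ?_
        simpa using (norm_le_pi_norm w i).trans_lt hwε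
    have hcc : ∀ t : ℂ, ContinuousAt (fun t : ℂ => (consPoint t w : Fin (m + 2) → ℂ)) t := fun t => by
      refine continuousAt_pi.2 fun i => ?_
      refine Fin.cases ?_ (fun i => ?_) i
      · exact continuous_id.continuousAt
      · simpa using continuousAt_const
    -- The hypothesis shows that `R w` times the remainder of `x` is a continuous multiple of `P w`
    -- near all roots of `P w`. Its degree is smaller, so it is zero; and `R w ≠ 0` for almost every
    -- `w`.
    set A : ℂ[X] := C (R w) * lowPoly (fun i => r i w) with hA
    have hA0 : A = 0 := by
      refine eq_zero_of_eval_eq_mul (D := Metric.ball 0 ε) Metric.isOpen_ball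
        (k := fun t => s (consPoint t w) * u (consPoint t w) - R w * a (consPoint t w)) ?_ N₁ (P w) A
        (hP.monic w) (hP.natDegree w) ?_ (fun b hb => mem_ball_zero_iff.2 (hwr b hb)) fun t ht => ?_
      · intro t ht
        have hb := hball _ (hcons t (mem_ball_zero_iff.1 ht))
        refine ContinuousAt.continuousWithinAt ?_
        have h1 := hb.1.2.2.comp (f := fun t : ℂ => (consPoint t w : Fin (m + 2) → ℂ)) (hcc t)
        have h2 := hb.2.comp (f := fun t : ℂ => (consPoint t w : Fin (m + 2) → ℂ)) (hcc t)
        have h3 := hb.1.2.1.comp (f := fun t : ℂ => (consPoint t w : Fin (m + 2) → ℂ)) (hcc t)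
        exact (h1.mul h2).sub (continuousAt_const.mul h3)
      · rw [hA, degree_C_mul hRw, degree_eq_natDegree (hP.monic w).ne_zero, hP.natDegree]
        exact degree_lowPoly_lt _
      · have hb := (hball _ (hcons t (mem_ball_zero_iff.1 ht))).1.1
        have e1 := hb.1.1
        have e2 := hb.1.2
        have e3 := hb.2
        simp only [evalFamily, consPoint, Fin.tail_cons, Fin.cons_zero] at e1 e2 e3
        rw [hA, eval_mul, eval_C, eval_lowPoly]
        simp only [consPoint]
        linear_combination e3 - R w * e2 + s (Fin.cons t w) * e1
    have hlow : lowPoly (fun i => r i w) = 0 :=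
      (mul_eq_zero.1 hA0).resolve_left (C_ne_zero.2 hRw)
    exact lowPoly_eq_zero hlow i
  refine ⟨fun z => a z / u z, ha.fun_div hu hu0, ?_⟩
  filter_upwards [hdiv, he, hu.continuousAt.eventually_ne hu0,
    htail.eventually (Filter.eventually_all.2 hr0)] with z h1 h2 h3 h4
  rw [h1, h2, Finset.sum_eq_zero fun i _ => by rw [h4 i, zero_mul]]
  field_simp
  ring

theorem IsTransitionMatrix.eqs {n : ℕ} {f₁ f₂ R : (Fin n → ℂ) → ℂ}
    {A : (Fin n → ℂ) → Matrix (Fin 2) (Fin 2) ℂ} (h : IsTransitionMatrix f₁ f₂ R A) :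
    ∀ᶠ z in 𝓝 0, A z 0 0 * f₁ z + A z 0 1 * f₂ z = f₁ z ∧
      A z 1 0 * f₁ z + A z 1 1 * f₂ z = R z := by
  filter_upwards [h.2] with z hz
  have h0 := congrFun hz 0
  have h1 := congrFun hz 1
  simp only [Matrix.mulVec, dotProduct, Fin.sum_univ_two, Matrix.cons_val_zero,
    Matrix.cons_val_one] at h0 h1
  exact ⟨h0, h1⟩

theorem IsTransitionMatrix.analyticAt_det {n : ℕ} {f₁ f₂ R : (Fin n → ℂ) → ℂ}
    {A : (Fin n → ℂ) → Matrix (Fin 2) (Fin 2) ℂ} (h : IsTransitionMatrix f₁ f₂ R A) :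
    AnalyticAt ℂ (fun z => (A z).det) 0 := by
  simp only [Matrix.det_fin_two]
  exact ((h.1 0 0).fun_mul (h.1 1 1)).fun_sub ((h.1 0 1).fun_mul (h.1 1 0))

/-- Cramer's rule: the row `(h₁, h₂)` times the adjugate of `A` gives the new coefficients. -/
theorem MemLocalIdeal.mul_det {n : ℕ} {f₁ f₂ R g : (Fin n → ℂ) → ℂ}
    {A : (Fin n → ℂ) → Matrix (Fin 2) (Fin 2) ℂ} (hA : IsTransitionMatrix f₁ f₂ R A)
    (hg : MemLocalIdeal f₁ f₂ g) : MemLocalIdeal f₁ R (fun z => g z * (A z).det) := by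
  obtain ⟨h₁, h₂, hh₁, hh₂, he⟩ := hg
  refine ⟨fun z => h₁ z * A z 1 1 - h₂ z * A z 1 0, fun z => h₂ z * A z 0 0 - h₁ z * A z 0 1,
    (hh₁.fun_mul (hA.1 1 1)).fun_sub (hh₂.fun_mul (hA.1 1 0)),
    (hh₂.fun_mul (hA.1 0 0)).fun_sub (hh₁.fun_mul (hA.1 0 1)), ?_⟩
  filter_upwards [he, hA.eqs] with z h1 h2
  rw [h1, Matrix.det_fin_two]
  linear_combination (h₁ z * A z 1 1 - h₂ z * A z 1 0) * h2.1 +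
    (h₂ z * A z 0 0 - h₁ z * A z 0 1) * h2.2

/-- Wiebe's theorem for the regular sequences `(f₁, f₂)` and `(f₁, R)`. -/
theorem memLocalIdeal_of_mul_det {m N₁ N₂ : ℕ} {f₁ f₂ g : (Fin (m + 2) → ℂ) → ℂ}
    {P : (Fin (m + 1) → ℂ) → ℂ[X]} {R : (Fin (m + 1) → ℂ) → ℂ} {Q : (Fin m → ℂ) → ℂ[X]}
    (hf : IsWeierstrassPolyOf f₁ P N₁) (hR : IsWeierstrassPolyOf R Q N₂)
    (hf₂ : AnalyticAt ℂ f₂ 0) (hg : AnalyticAt ℂ g 0)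
    {A : (Fin (m + 2) → ℂ) → Matrix (Fin 2) (Fin 2) ℂ}
    (hA : IsTransitionMatrix f₁ f₂ (fun z => R (Fin.tail z)) A)
    (h : MemLocalIdeal f₁ (fun z => R (Fin.tail z)) (fun z => g z * (A z).det)) :
    MemLocalIdeal f₁ f₂ g := by
  obtain ⟨h₁, h₂, hh₁, hh₂, he⟩ := h
  have h00 := hA.1 0 0
  have h01 := hA.1 0 1
  have h10 := hA.1 1 0
  have h11 := hA.1 1 1
  -- The two rows of the matrix equation show that `f₁` divides `A₀₁ R`, hence `A₀₁ = t f₁`.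
  obtain ⟨t, ht, hte⟩ := hf.exists_eq_mul hR h01 (s := fun z => A z 0 1 * A z 1 0 +
    A z 1 1 * (1 - A z 0 0)) ((h01.fun_mul h10).fun_add (h11.fun_mul (analyticAt_const.fun_sub h00)))
    (by
      filter_upwards [hA.eqs] with z hz
      linear_combination A z 1 1 * hz.1 - A z 0 1 * hz.2)
  -- The first row now gives `1 - A₀₀ = t f₂` after cancelling `f₁`, and therefore `det A = A₁₁ - t
  -- R`.
  have hta := hf.mul_right_cancel (ht.fun_mul hf₂) (analyticAt_const.fun_sub h00 (f := fun _ => 1))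
    (by
      filter_upwards [hA.eqs, hte] with z hz hz'
      linear_combination hz.1 - f₂ z * hz')
  -- With this `k` the hypothesis reads `g A₁₁ = h₁ f₁ + k R`. Multiplying by `f₂` and using `A₁₁ f₂
  -- = R - A₁₀ f₁`, one finds `(g - k f₂) R ∈ (f₁)`; as `R` is regular modulo `f₁`, the first factor
  -- lies in `(f₁)`.
  have hk : AnalyticAt ℂ (fun z => g z * t z + h₂ z) 0 := (hg.fun_mul ht).fun_add hh₂
  have hy : AnalyticAt ℂ (fun z => g z - (g z * t z + h₂ z) * f₂ z) 0 :=
    hg.fun_sub (hk.fun_mul hf₂)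
  obtain ⟨s, hs, hse⟩ := hf.exists_eq_mul hR hy (s := fun z =>
    (g z - (g z * t z + h₂ z) * f₂ z) * A z 1 0 +
      f₂ z * (h₁ z + (g z * t z + h₂ z) * A z 1 0))
    ((hy.fun_mul h10).fun_add (hf₂.fun_mul (hh₁.fun_add (hk.fun_mul h10)))) (by
      filter_upwards [hA.eqs, he, hta, hte] with z h1 h2 h3 h4
      rw [Matrix.det_fin_two] at h2
      have hdet : A z 0 0 * A z 1 1 - A z 0 1 * A z 1 0 = A z 1 1 - t z * R (Fin.tail z) := by
        linear_combination A z 1 1 * h3 - A z 1 0 * h4 - t z * h1.2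
      rw [hdet] at h2
      linear_combination f₂ z * h2 - (g z - (g z * t z + h₂ z) * f₂ z) * h1.2 -
        f₂ z * (g z * t z + h₂ z) * h1.2)
  refine ⟨s, fun z => g z * t z + h₂ z, hs, hk, ?_⟩
  filter_upwards [hse] with z hz
  linear_combination hz

namespace Chart

variable {m : ℕ} {f₁ : (Fin (m + 2) → ℂ) → ℂ} {P₁ : (Fin (m + 1) → ℂ) → ℂ[X]}
  {R : (Fin (m + 1) → ℂ) → ℂ} {Q : (Fin m → ℂ) → ℂ[X]} {N₁ k : ℕ}
  {U : Set (Fin (m + 2) → ℂ)} {u : (Fin (m + 2) → ℂ) → ℂ} {v : (Fin (m + 1) → ℂ) → ℂ}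

/-- The duality theorem for `(f₁, R)`. -/
theorem memLocalIdeal_iff (h : Chart f₁ P₁ R Q N₁ (k + 1) U u v)
    (h0 : (0 : Fin (m + 2) → ℂ) ∈ U) (hP : IsWeierstrassPoly P₁ N₁)
    (hQ : IsWeierstrassPoly Q (k + 1)) (j : ℕ) {G : (Fin (m + 2) → ℂ) → ℂ}
    (hG : AnalyticAt ℂ G 0) :
    MemLocalIdeal f₁ (fun z => R (Fin.tail z)) G ↔
      ∃ V : Set (Fin (m + 2) → ℂ), IsOpen V ∧ 0 ∈ V ∧ V ⊆ U ∧ CurrentEq V m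
        (mulCurrent G (dbarCurrent 1 (X₂ f₁ P₁ R Q N₁ (k + 1) (j + 1 + k + 1)))) (fun _ => 0) := by
  constructor
  · rintro ⟨α, β, hα, hβ, he⟩
    obtain ⟨V, hV, hVo, hV0⟩ := eventually_nhds_iff.1
      (((hα.eventually_analyticAt.and hβ.eventually_analyticAt).and he).and (h.isOpen.mem_nhds h0))
    have hVU : V ⊆ U := fun z hz => (hV z hz).2
    refine ⟨V, hVo, hV0, hVU, fun φ hφ => ?_⟩
    rw [(h.mono hVo hVU).annihilates m j (fun z hz => (hV z hz).1.1.1)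
      (fun z hz => (hV z hz).1.1.2) (r := fun _ => 0) (fun z _ => analyticAt_const)
      (fun z hz => by rw [(hV z hz).1.2, add_zero]) φ hφ]
    have h1 := ((h.mono hVo hVU).isCurrent_X₂ (m + 1) j).map_smul 0 _ hφ.dbar
    have e : dbar (mulForm (fun _ => 0) φ) = (0 : ℂ) • dbar φ := by
      rw [dbar_mulForm hφ fun z _ => differentiableAt_const 0]
      rfl
    simp only [mulCurrent, dbarCurrent]
    rw [e, h1]
    simp
  · rintro ⟨V, hVo, hV0, hVU, hT⟩
    -- Dividing by `P₁`, and then each coefficient of the remainder by `Q`, reduces `G` modulo `(f₁,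
    -- R)` to a polynomial in `z₁`, `z₂` of small degrees. Since `f₁` and `R` annihilate the
    -- current, this remainder satisfies the same vanishing as `G`.
    obtain ⟨a, g, ha, hg, hdiv⟩ := hP.division hG
    choose b r hb hr hdiv' using fun i => hQ.division (hg i)
    have htail : Filter.Tendsto (Fin.tail : (Fin (m + 2) → ℂ) → Fin (m + 1) → ℂ) (𝓝 0) (𝓝 0) := by
      have := (analyticAt_tail (0 : Fin (m + 2) → ℂ)).continuousAt.tendsto
      rwa [show Fin.tail (0 : Fin (m + 2) → ℂ) = 0 from tail_zero] at this
    have htail' : Filter.Tendsto (Fin.tail : (Fin (m + 1) → ℂ) → Fin m → ℂ) (𝓝 0) (𝓝 0) := by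
      have := (analyticAt_tail (0 : Fin (m + 1) → ℂ)).continuousAt.tendsto
      rwa [show Fin.tail (0 : Fin (m + 1) → ℂ) = 0 from tail_zero] at this
    have hu := h.unit₁ 0 h0
    have hu0 := h.unit₁_ne 0 h0
    have hvt := h.unit₂ 0 h0
    have hbt : ∀ i, AnalyticAt ℂ (fun z : Fin (m + 2) → ℂ => b i (Fin.tail z)) 0 := fun i => by
      refine AnalyticAt.comp ?_ (analyticAt_tail (0 : Fin (m + 2) → ℂ))
      rw [show Fin.tail (0 : Fin (m + 2) → ℂ) = 0 from tail_zero]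
      exact hb i
    set α : (Fin (m + 2) → ℂ) → ℂ := fun z => a z / u z with hα
    set β : (Fin (m + 2) → ℂ) → ℂ := fun z => (∑ i : Fin N₁, b i (Fin.tail z) * z 0 ^ (i : ℕ)) /
      v (Fin.tail z) with hβ
    have hαa : AnalyticAt ℂ α 0 := ha.fun_div hu hu0
    have hβa : AnalyticAt ℂ β 0 := (Finset.analyticAt_fun_sum _ fun i _ =>
      (hbt i).fun_mul ((analyticAt_coord 0 _).fun_pow _)).fun_div hvt (h.unit₂_ne 0 h0)
    set rr : (Fin (m + 2) → ℂ) → ℂ := fun z => ∑ i, ∑ l, r i l (Fin.tail (Fin.tail z)) *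
      (z 0 ^ (i : ℕ) * z 1 ^ (l : ℕ)) with hrr
    have hra : ∀ᶠ z : Fin (m + 2) → ℂ in 𝓝 0, ∀ i l, AnalyticAt ℂ (r i l) (Fin.tail (Fin.tail z)) :=
      (htail'.comp htail).eventually (Filter.eventually_all.2 fun i => Filter.eventually_all.2
        fun l => (hr i l).eventually_analyticAt)
    have hGe : ∀ᶠ z in 𝓝 0, G z = α z * f₁ z + β z * R (Fin.tail z) + rr z := by
      filter_upwards [hdiv, htail.eventually (Filter.eventually_all.2 hdiv'),
        h.isOpen.mem_nhds h0] with z h1 h2 h3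
      have e1 : ∑ i : Fin N₁, g i (Fin.tail z) * z 0 ^ (i : ℕ) =
          (∑ i : Fin N₁, b i (Fin.tail z) * z 0 ^ (i : ℕ)) * evalFamily Q (Fin.tail z) + rr z := by
        rw [hrr]
        beta_reduce
        rw [Finset.sum_mul, ← Finset.sum_add_distrib]
        refine Finset.sum_congr rfl fun i _ => ?_
        rw [h2 i, add_mul, Finset.sum_mul]
        congr 1
        · ring
        · refine Finset.sum_congr rfl fun l _ => ?_
          rw [show Fin.tail z 0 = z 1 from rfl]
          ring
      rw [h1, e1, h.eq₁ z h3, h.eq₂ z h3, hα, hβ]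
      have hz1 := h.unit₁_ne z h3
      have hz2 := h.unit₂_ne z h3
      field_simp
      ring
    obtain ⟨W, hW, hWo, hW0⟩ := eventually_nhds_iff.1
      ((((hαa.eventually_analyticAt.and hβa.eventually_analyticAt).and hra).and hGe).and
        (hVo.mem_nhds hV0))
    have hWV : W ⊆ V := fun z hz => (hW z hz).2
    have hrra : AnalyticOnNhd ℂ rr W := fun z hz => by
      refine Finset.analyticAt_fun_sum _ fun i _ => Finset.analyticAt_fun_sum _ fun l _ => ?_
      have h1 : AnalyticAt ℂ (fun z : Fin (m + 2) → ℂ => r i l (Fin.tail (Fin.tail z))) z :=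
        (((hW z hz).1.1.2 i l).comp (analyticAt_tail (Fin.tail z))).comp (analyticAt_tail z)
      exact h1.fun_mul (((analyticAt_coord 0 z).fun_pow _).fun_mul
        ((analyticAt_coord 1 z).fun_pow _))
    have hWc := h.mono hWo (hWV.trans hVU)
    have hTW : CurrentEq W m (mulCurrent rr
        (dbarCurrent 1 (X₂ f₁ P₁ R Q N₁ (k + 1) (j + 1 + k + 1)))) (fun _ => 0) := fun φ hφ => by
      rw [← hWc.annihilates m j (fun z hz => (hW z hz).1.1.1.1) (fun z hz => (hW z hz).1.1.1.2) hrra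
        (fun z hz => (hW z hz).1.2) φ hφ]
      exact hT φ (hφ.mono hWV)
    have hzero := hWc.coeff_eq_zero hW0 hP hQ j (fun i l z hz => (hW z hz).1.1.2 i l) hTW
    refine ⟨α, β, hαa, hβa, ?_⟩
    filter_upwards [hGe, (htail'.comp htail).eventually hzero] with z h1 h2
    rw [h1, hrr]
    beta_reduce
    rw [Finset.sum_eq_zero fun i _ => Finset.sum_eq_zero fun l _ => by
      rw [show r i l (Fin.tail (Fin.tail z)) = 0 from h2 i l, zero_mul], add_zero]

end Chart

end

section

open MeasureTheory Polynomial

/-! ### The resultant of two families and the transition matrix -/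

/-- The ring of functions on `ℂᵏ` that are analytic at `0`. -/
def analyticSubring (k : ℕ) : Subring ((Fin k → ℂ) → ℂ) where
  carrier := {f | AnalyticAt ℂ f 0}
  mul_mem' hf hg := AnalyticAt.mul hf hg
  one_mem' := analyticAt_const
  add_mem' hf hg := AnalyticAt.add hf hg
  zero_mem' := analyticAt_const
  neg_mem' hf := AnalyticAt.neg hf

/-- Evaluation at `w`, on the ring of functions analytic at `0`. -/
def analyticEval {k : ℕ} (w : Fin k → ℂ) : analyticSubring k →+* ℂ :=
  (Pi.evalRingHom (fun _ => ℂ) w).comp (analyticSubring k).subtype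

theorem analyticEval_apply {k : ℕ} (w : Fin k → ℂ) (f : analyticSubring k) :
    analyticEval w f = (f : (Fin k → ℂ) → ℂ) w := rfl

/-- With coefficients in a ring of functions, the resultant and its Bézout identity can be formed
once and evaluated afterwards, so analyticity is automatic. -/
theorem IsWeierstrassPoly.exists_lift {k N : ℕ} {P : (Fin k → ℂ) → ℂ[X]}
    (hP : IsWeierstrassPoly P N) :
    ∃ p : (analyticSubring k)[X], p.natDegree ≤ N ∧ ∀ w, p.map (analyticEval w) = P w := by
  refine ⟨∑ i ∈ Finset.range (N + 1), C ⟨fun w => (P w).coeff i, hP.analytic i⟩ * X ^ i, ?_,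
    fun w => ?_⟩
  · refine natDegree_sum_le_of_forall_le _ _ fun i hi => ?_
    exact (natDegree_C_mul_X_pow_le _ _).trans (Nat.lt_succ_iff.1 (Finset.mem_range.1 hi))
  · rw [Polynomial.map_sum]
    simp only [Polynomial.map_mul, map_C, Polynomial.map_pow, map_X, analyticEval_apply]
    conv_rhs => rw [(P w).as_sum_range_C_mul_X_pow, hP.natDegree]

theorem analyticAt_eval_map {k : ℕ} (p : (analyticSubring k)[X]) :
    AnalyticAt ℂ (fun z : Fin (k + 1) → ℂ => (p.map (analyticEval (Fin.tail z))).eval (z 0)) 0 := by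
  simp only [eval_map, eval₂_eq_sum_range]
  refine Finset.analyticAt_fun_sum _ fun i _ => AnalyticAt.fun_mul ?_
    ((analyticAt_coord 0 _).fun_pow _)
  refine AnalyticAt.comp (g := ((p.coeff i : analyticSubring k) : (Fin k → ℂ) → ℂ)) ?_
    (analyticAt_tail 0)
  rw [tail_zero]
  exact (p.coeff i).2

/-- The resultant of fixed formal degrees commutes with ring homomorphisms; the pointwise degrees
are constant, so they may be taken as those formal degrees. -/
theorem res_eq {k N M : ℕ} {P₁ P₂ : (Fin k → ℂ) → ℂ[X]} (h₁ : IsWeierstrassPoly P₁ N)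
    (h₂ : IsWeierstrassPoly P₂ M) {p q : (analyticSubring k)[X]}
    (hp : ∀ w, p.map (analyticEval w) = P₁ w) (hq : ∀ w, q.map (analyticEval w) = P₂ w)
    (w : Fin k → ℂ) : res P₁ P₂ w = analyticEval w (resultant p q N M) := by
  rw [res, h₁.natDegree, h₂.natDegree, ← resultant_map_map, hp, hq]

theorem analyticAt_res {k N M : ℕ} {P₁ P₂ : (Fin k → ℂ) → ℂ[X]} (h₁ : IsWeierstrassPoly P₁ N)
    (h₂ : IsWeierstrassPoly P₂ M) : AnalyticAt ℂ (res P₁ P₂) 0 := by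
  obtain ⟨p, -, hp⟩ := h₁.exists_lift
  obtain ⟨q, -, hq⟩ := h₂.exists_lift
  rw [show res P₁ P₂ = (resultant p q N M : analyticSubring k) from
    funext fun w => res_eq h₁ h₂ hp hq w]
  exact (resultant p q N M).2

/-- The resultant lies in the ideal generated by the two polynomials. -/
theorem exists_eq_resLift {k N M : ℕ} {P₁ P₂ : (Fin k → ℂ) → ℂ[X]} (h₁ : IsWeierstrassPoly P₁ N)
    (h₂ : IsWeierstrassPoly P₂ M) (hN : 0 < N) :
    ∃ a b : (Fin (k + 1) → ℂ) → ℂ, AnalyticAt ℂ a 0 ∧ AnalyticAt ℂ b 0 ∧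
      ∀ z, evalFamily P₁ z * a z + evalFamily P₂ z * b z = resLift P₁ P₂ z := by
  obtain ⟨p, hpN, hp⟩ := h₁.exists_lift
  obtain ⟨q, hqM, hq⟩ := h₂.exists_lift
  obtain ⟨a, b, -, -, e⟩ := exists_mul_add_mul_eq_C_resultant p q hpN hqM (Or.inl hN.ne')
  refine ⟨_, _, analyticAt_eval_map a, analyticAt_eval_map b, fun z => ?_⟩
  have := congrArg (fun r => (r.map (analyticEval (Fin.tail z))).eval (z 0)) e
  simp only [Polynomial.map_add, Polynomial.map_mul, hp, hq, eval_add, eval_mul, map_C,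
    eval_C] at this
  rw [resLift, res_eq h₁ h₂ hp hq, ← this]
  rfl

/-- The second row consists of the Bézout coefficients of the resultant divided by the units
relating `f₁` and `f₂` to their Weierstrass polynomials. -/
theorem IsAdapted.exists_transitionMatrix {m : ℕ} {f₁ f₂ : (Fin (m + 2) → ℂ) → ℂ}
    {P₁ P₂ : (Fin (m + 1) → ℂ) → ℂ[X]} {Q : (Fin m → ℂ) → ℂ[X]} {N₁ M N₂ : ℕ}
    (h : IsAdapted f₁ f₂ P₁ P₂ Q N₁ M N₂) (h0 : f₁ 0 = 0) :
    ∃ A, IsTransitionMatrix f₁ f₂ (resLift P₁ P₂) A ∧ ∀ z, A z 0 = ![1, 0] := by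
  obtain ⟨a, b, ha, hb, he⟩ := exists_eq_resLift h.first.1 h.second.1 (h.first.degree_pos h0)
  obtain ⟨-, u₁, hu₁, hu₁0, he₁⟩ := h.first
  obtain ⟨-, u₂, hu₂, hu₂0, he₂⟩ := h.second
  refine ⟨fun z => !![1, 0; a z / u₁ z, b z / u₂ z], ⟨fun i j => ?_, ?_⟩, fun z => rfl⟩
  · fin_cases i <;> fin_cases j
    exacts [analyticAt_const, analyticAt_const, ha.fun_div hu₁ hu₁0, hb.fun_div hu₂ hu₂0]
  · filter_upwards [he₁, he₂, hu₁.continuousAt.eventually_ne hu₁0,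
      hu₂.continuousAt.eventually_ne hu₂0] with z h1 h2 h3 h4
    ext i
    fin_cases i
    · simp [Matrix.mulVec, dotProduct]
    · simp only [Matrix.mulVec, dotProduct, Fin.sum_univ_two]
      simp only [Fin.mk_one, Matrix.of_apply, Matrix.cons_val', Matrix.cons_val_zero,
        Matrix.cons_val_one, Matrix.cons_val_fin_one]
      rw [← he z, h1, h2]
      field_simp

end

section

open MeasureTheory Polynomial

/-! ### Immersed manifolds in the zero set of a Weierstrass polynomial -/

/-- If the image of a compact set has interior points, so do the images of all neighbourhoods of
one of its points. -/
theorem exists_forall_nhds_interior_image_nonempty {X Y : Type*} [TopologicalSpace X]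
    [RegularSpace X] [TopologicalSpace Y] [T2Space Y] {K : Set X} (hK : IsCompact K)
    {π : X → Y} (hπ : Continuous π) (h : (interior (π '' K)).Nonempty) :
    ∃ z ∈ K, ∀ V ∈ 𝓝 z, (interior (π '' (K ∩ V))).Nonempty := by
  by_contra! hcon
  -- Compactness induction: if every point had a neighbourhood with thin image, `K` would be a
  -- finite union of pieces whose images have closure without interior, and finite unions of closed
  -- sets without interior have none.
  have key : interior (closure (π '' (K ∩ K))) = ∅ := by
    refine hK.induction_on (p := fun s => interior (closure (π '' (K ∩ s))) = ∅) (by simp)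
      (fun s t hst ht => ?_) (fun s t hs ht => ?_) fun z hz => ?_
    · refine Set.subset_empty_iff.1 (ht ▸ interior_mono (closure_mono (Set.image_mono ?_)))
      exact Set.inter_subset_inter_right _ hst
    · rw [Set.inter_union_distrib_left, Set.image_union, closure_union,
        interior_union_isClosed_of_interior_empty isClosed_closure ht, hs]
    · obtain ⟨V, hV, hVe⟩ := hcon z hz
      obtain ⟨C, hC, hCc, hCV⟩ := exists_mem_nhds_isClosed_subset hV
      refine ⟨C, mem_nhdsWithin_of_mem_nhds hC, ?_⟩
      rw [((hK.inter_right hCc).image hπ).isClosed.closure_eq]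
      exact Set.subset_empty_iff.1
        (hVe ▸ interior_mono (Set.image_mono (Set.inter_subset_inter_right _ hCV)))
  rw [Set.inter_self, (hK.image hπ).isClosed.closure_eq] at key
  exact h.ne_empty key

/-- A family of polynomials of bounded degree whose coefficients are analytic at `w`. -/
def IsAnalyticFamily {k : ℕ} (P : (Fin k → ℂ) → ℂ[X]) (N : ℕ) (w : Fin k → ℂ) : Prop :=
  (∀ w, (P w).natDegree ≤ N) ∧ ∀ i, AnalyticAt ℂ (fun w => (P w).coeff i) w

namespace IsAnalyticFamily

variable {k N : ℕ} {P : (Fin k → ℂ) → ℂ[X]}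

theorem derivative {w : Fin k → ℂ} (h : IsAnalyticFamily P N w) :
    IsAnalyticFamily (fun w => Polynomial.derivative (P w)) N w := by
  refine ⟨fun w => (natDegree_derivative_le _).trans ((Nat.sub_le _ _).trans (h.1 w)), fun i => ?_⟩
  simp only [coeff_derivative]
  exact (h.2 _).fun_mul analyticAt_const

theorem iterate_derivative {w : Fin k → ℂ} (h : IsAnalyticFamily P N w) (j : ℕ) :
    IsAnalyticFamily (fun w => Polynomial.derivative^[j] (P w)) N w := by
  induction j with
  | zero => exact h
  | succ j ih =>
    simp only [Function.iterate_succ_apply']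
    exact ih.derivative

theorem analyticAt {z : Fin (k + 1) → ℂ} (h : IsAnalyticFamily P N (Fin.tail z)) :
    AnalyticAt ℂ (evalFamily P) z := by
  have e : evalFamily P = fun z => ∑ i ∈ Finset.range (N + 1),
      (P (Fin.tail z)).coeff i * z 0 ^ i := funext fun z =>
    eval_eq_sum_range' (Nat.lt_succ_of_le (h.1 _)) _
  rw [e]
  exact Finset.analyticAt_fun_sum _ fun i _ => AnalyticAt.fun_mul
    (AnalyticAt.comp (g := fun w => (P w).coeff i) (h.2 i) (analyticAt_tail z))
    ((analyticAt_coord 0 _).fun_pow _)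

theorem fderiv_single {z : Fin (k + 1) → ℂ} (h : IsAnalyticFamily P N (Fin.tail z)) :
    fderiv ℂ (evalFamily P) z (Pi.single 0 1) =
      evalFamily (fun w => Polynomial.derivative (P w)) z := by
  have hl : HasDerivAt (fun t : ℂ => (consPoint t (Fin.tail z) : Fin (k + 1) → ℂ))
      (Pi.single 0 1) (z 0) := by
    refine hasDerivAt_pi.2 fun i => ?_
    refine Fin.cases ?_ (fun i => ?_) i
    · simpa using hasDerivAt_id' (z 0)
    · simpa using hasDerivAt_const (z 0) (Fin.tail z i)
  have hz : (consPoint (z 0) (Fin.tail z) : Fin (k + 1) → ℂ) = z := Fin.cons_self_tail z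
  have h1 : HasFDerivAt (evalFamily P) (fderiv ℂ (evalFamily P) z) (consPoint (z 0) (Fin.tail z)) := by
    rw [hz]
    exact h.analyticAt.differentiableAt.hasFDerivAt
  have h2 := h1.comp_hasDerivAt (z 0) hl
  have e : evalFamily P ∘ (fun t : ℂ => (consPoint t (Fin.tail z) : Fin (k + 1) → ℂ)) =
      fun t => (P (Fin.tail z)).eval t := by
    funext t
    simp [evalFamily, consPoint]
  rw [e] at h2
  exact h2.unique ((P (Fin.tail z)).hasDerivAt (z 0))

end IsAnalyticFamily

/-- The zero set of a function with a nonzero derivative in the direction of the first axis is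
parametrized by the other coordinates. -/
theorem exists_parametrization {k : ℕ} {D : (Fin (k + 1) → ℂ) → ℂ} {z₀ : Fin (k + 1) → ℂ}
    (hD : AnalyticAt ℂ D z₀) (h0 : fderiv ℂ D z₀ (Pi.single 0 1) ≠ 0) :
    ∃ (V : Set (Fin (k + 1) → ℂ)) (ψ : (Fin k → ℂ) → Fin (k + 1) → ℂ), V ∈ 𝓝 z₀ ∧
      ∀ z ∈ V, D z = 0 → ψ (Fin.tail z) = z ∧ DifferentiableAt ℂ ψ (Fin.tail z) := by
  -- Replacing the first coordinate by `D` is a local biholomorphism at `z₀`; its inverse restricted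
  -- to first coordinate `0` parametrizes the zero set.
  set Φ : (Fin (k + 1) → ℂ) → Fin (k + 1) → ℂ := fun z => consPoint (D z) (Fin.tail z) with hΦ
  have htail : ∀ i : Fin k, ∀ z : Fin (k + 1) → ℂ, HasFDerivAt
      (fun z : Fin (k + 1) → ℂ => Fin.tail z i) (ContinuousLinearMap.proj (R := ℂ) i.succ) z :=
    fun i z => (ContinuousLinearMap.proj (R := ℂ) (φ := fun _ => ℂ) i.succ).hasFDerivAt
  set T : (Fin (k + 1) → ℂ) →L[ℂ] (Fin (k + 1) → ℂ) := ContinuousLinearMap.pi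
    (Fin.cons (fderiv ℂ D z₀) fun i => ContinuousLinearMap.proj (R := ℂ) i.succ) with hT
  have hT0 : ∀ v, T v 0 = fderiv ℂ D z₀ v := fun v => rfl
  have hTs : ∀ v (i : Fin k), T v i.succ = v i.succ := fun v i => rfl
  have hTi : Function.Injective T := by
    refine (injective_iff_map_eq_zero T).2 fun v hv => ?_
    have hvs : ∀ i : Fin k, v i.succ = 0 := fun i => by rw [← hTs v i, hv]; rfl
    have hv' : v = v 0 • Pi.single 0 1 := by
      funext i
      refine Fin.cases (by simp) (fun i => ?_) i
      simp [hvs]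
    have h1 : fderiv ℂ D z₀ v = 0 := by rw [← hT0, hv]; rfl
    rw [hv', map_smul, smul_eq_mul] at h1
    rw [hv', (mul_eq_zero.1 h1).resolve_right h0, zero_smul]
  set T' : (Fin (k + 1) → ℂ) ≃L[ℂ] (Fin (k + 1) → ℂ) :=
    (LinearEquiv.ofInjectiveEndo (T : (Fin (k + 1) → ℂ) →ₗ[ℂ] (Fin (k + 1) → ℂ))
      hTi).toContinuousLinearEquiv
  have hT' : (T' : (Fin (k + 1) → ℂ) →L[ℂ] (Fin (k + 1) → ℂ)) = T :=
    ContinuousLinearMap.ext fun v => rfl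
  have hΦd : HasFDerivAt Φ (T' : (Fin (k + 1) → ℂ) →L[ℂ] (Fin (k + 1) → ℂ)) z₀ := by
    rw [hT']
    refine hasFDerivAt_pi.2 fun i => ?_
    refine Fin.cases ?_ (fun i => ?_) i
    · exact hD.differentiableAt.hasFDerivAt
    · exact htail i z₀
  have hΦa : ContDiffAt ℂ 1 Φ z₀ := by
    refine contDiffAt_pi.2 fun i => ?_
    refine Fin.cases ?_ (fun i => ?_) i
    · exact hD.contDiffAt
    · exact (analyticAt_coord i.succ z₀).contDiffAt
  set e := hΦa.localInverse hΦd one_ne_zero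
  have h1 : ∀ᶠ z in 𝓝 z₀, e (Φ z) = z :=
    (hΦa.hasStrictFDerivAt' hΦd one_ne_zero).eventually_left_inverse
  have h2 : ∀ᶠ y in 𝓝 (Φ z₀), ContDiffAt ℂ 1 e y :=
    (hΦa.to_localInverse hΦd one_ne_zero).eventually (by simp)
  refine ⟨_, fun w => e (consPoint 0 w), h1.and (hΦa.continuousAt.eventually h2), ?_⟩
  rintro z ⟨hz1, hz2⟩ hz
  have hΦz : Φ z = consPoint 0 (Fin.tail z) := by rw [hΦ]; beta_reduce; rw [hz]
  rw [hΦz] at hz1 hz2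
  refine ⟨hz1, (hz2.differentiableAt one_ne_zero).comp (Fin.tail z)
    (f := fun w => (consPoint 0 w : Fin (k + 1) → ℂ)) ?_⟩
  refine differentiableAt_pi.2 fun i => ?_
  refine Fin.cases ?_ (fun i => ?_) i
  · exact differentiableAt_const 0
  · exact (analyticAt_coord i _).differentiableAt

/-- A function with analytic left inverse `Fin.tail` is an immersion. -/
theorem injective_fderiv_of_tail {k : ℕ} {W : Set (Fin k → ℂ)} (hW : IsOpen W)
    {ψ : (Fin k → ℂ) → Fin (k + 1) → ℂ} (h : ∀ w ∈ W, Fin.tail (ψ w) = w) {w : Fin k → ℂ}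
    (hw : w ∈ W) (hψ : DifferentiableAt ℂ ψ w) : Function.Injective (fderiv ℂ ψ w) := by
  have h1 : HasFDerivAt (fun w => Fin.tail (ψ w))
      ((fderiv ℂ (Fin.tail : (Fin (k + 1) → ℂ) → Fin k → ℂ) (ψ w)).comp (fderiv ℂ ψ w)) w :=
    (analyticAt_tail (ψ w)).differentiableAt.hasFDerivAt.comp w hψ.hasFDerivAt
  have h2 : HasFDerivAt (fun w => Fin.tail (ψ w)) (ContinuousLinearMap.id ℂ (Fin k → ℂ)) w :=
    (hasFDerivAt_id w).congr_of_eventuallyEq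
      (Filter.eventuallyEq_of_mem (hW.mem_nhds hw) fun y hy => h y hy)
  have h3 := h1.unique h2
  refine Function.LeftInverse.injective
    (g := fderiv ℂ (Fin.tail : (Fin (k + 1) → ℂ) → Fin k → ℂ) (ψ w)) fun v => ?_
  exact congrArg (fun T : (Fin k → ℂ) →L[ℂ] (Fin k → ℂ) => T v) h3

theorem iterate_derivative_eval_ne_zero {p : ℂ[X]} (hp : p.Monic) (t : ℂ) :
    (derivative^[p.natDegree] p).eval t ≠ 0 := by
  have h1 : (derivative^[p.natDegree] p).natDegree ≤ 0 :=
    (natDegree_iterate_derivative p _).trans (by simp)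
  rw [eq_C_of_natDegree_le_zero h1, eval_C, coeff_iterate_derivative, zero_add,
    coeff_natDegree, hp.leadingCoeff, Nat.descFactorial_self]
  simp [Nat.factorial_ne_zero]

/-- If a Weierstrass polynomial and an analytic function have a common zero over each point of the
parameter space, then their common zero set contains an immersed hypersurface. -/
theorem IsWeierstrassPoly.exists_immersion {k N : ℕ} {P : (Fin k → ℂ) → ℂ[X]}
    (hP : IsWeierstrassPoly P N) {G : (Fin (k + 1) → ℂ) → ℂ} (hG : AnalyticAt ℂ G 0)
    (h : ∀ᶠ w in 𝓝 0, ∃ a, (P w).IsRoot a ∧ G (consPoint a w) = 0)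
    {U : Set (Fin (k + 1) → ℂ)} (hU : U ∈ 𝓝 0) :
    ∃ (W : Set (Fin k → ℂ)) (ψ : (Fin k → ℂ) → (Fin (k + 1) → ℂ)),
      IsOpen W ∧ W.Nonempty ∧ DifferentiableOn ℂ ψ W ∧
      (∀ w ∈ W, Function.Injective (fderiv ℂ ψ w)) ∧
      Set.MapsTo ψ W ({z | evalFamily P z = 0 ∧ G z = 0} ∩ U) := by
  obtain ⟨ρ, hρ, hball⟩ := Metric.nhds_basis_closedBall.eventually_iff.1
    (hG.eventually_analyticAt.and hU)
  obtain ⟨δ, hδ, hδb⟩ := Metric.nhds_basis_closedBall.eventually_iff.1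
    ((h.and (hP.eventually_roots_small hρ)).and
      (hP.eventually_analyticAt.and (Metric.closedBall_mem_nhds 0 hρ)))
  have hfam : ∀ w ∈ Metric.closedBall (0 : Fin k → ℂ) δ, IsAnalyticFamily P N w := fun w hw =>
    ⟨fun w => (hP.natDegree w).le, (hδb hw).2.1⟩
  have htc : Continuous (Fin.tail : (Fin (k + 1) → ℂ) → Fin k → ℂ) :=
    continuous_pi fun i => continuous_apply i.succ
  set D : ℕ → (Fin (k + 1) → ℂ) → ℂ := fun j => evalFamily fun w => derivative^[j] (P w) with hD
  set K : Set (Fin (k + 1) → ℂ) :=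
    Metric.closedBall 0 ρ ∩ Fin.tail ⁻¹' Metric.closedBall 0 δ with hK
  have hKc : IsCompact K :=
    (isCompact_closedBall _ _).inter_right (Metric.isClosed_closedBall.preimage htc)
  have hDc : ∀ j, ContinuousOn (D j) K := fun j z hz =>
    ((hfam _ hz.2).iterate_derivative j).analyticAt.continuousAt.continuousWithinAt
  have hGc : ContinuousOn G K := fun z hz => (hball hz.1).1.continuousAt.continuousWithinAt
  -- `E j` collects the zeros of `G` that are roots of `P` of multiplicity at least `j`. It is empty
  -- for `j = N + 1`, and for `j = 1` its projection contains a neighbourhood of the origin.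
  set E : ℕ → Set (Fin (k + 1) → ℂ) := fun j => {z ∈ K | G z = 0 ∧ ∀ i < j, D i z = 0} with hE
  have hEc : ∀ j, IsCompact (E j) := fun j => by
    have h1 : E j = (K ∩ G ⁻¹' {0}) ∩ ⋂ i : Fin j, (K ∩ D i ⁻¹' {0}) := by
      ext z
      simp only [hE, Set.mem_ofPred_eq, Set.mem_inter_iff, Set.mem_iInter, Set.mem_preimage,
        Set.mem_singleton_iff]
      exact ⟨fun ⟨h1, h2, h3⟩ => ⟨⟨h1, h2⟩, fun i => ⟨h1, h3 i i.2⟩⟩,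
        fun ⟨⟨h1, h2⟩, h3⟩ => ⟨h1, h2, fun i hi => (h3 ⟨i, hi⟩).2⟩⟩
    rw [h1]
    have hcl : ∀ F : (Fin (k + 1) → ℂ) → ℂ, ContinuousOn F K → IsClosed (K ∩ F ⁻¹' {0}) :=
      fun F hF => hF.preimage_isClosed_of_isClosed hKc.isClosed isClosed_singleton
    exact (hKc.of_isClosed_subset (hcl G hGc) Set.inter_subset_left).inter_right
      (isClosed_iInter fun i => hcl _ (hDc i))
  have hEN : E (N + 1) = ∅ := by
    refine Set.eq_empty_iff_forall_notMem.2 fun z hz => ?_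
    have h1 := hz.2.2 N (Nat.lt_succ_self N)
    rw [hD] at h1
    have h2 := iterate_derivative_eval_ne_zero (hP.monic (Fin.tail z)) (z 0)
    rw [hP.natDegree] at h2
    exact h2 h1
  set p : ℕ → Prop := fun j => 1 ≤ j ∧ (interior (Fin.tail '' E j)).Nonempty with hp
  have hp1 : p 1 := by
    refine ⟨le_rfl, 0, mem_interior.2 ⟨Metric.ball 0 δ, fun w hw => ?_, Metric.isOpen_ball,
      Metric.mem_ball_self hδ⟩⟩
    have hb := hδb (Metric.ball_subset_closedBall hw)
    obtain ⟨a, ha, haG⟩ := hb.1.1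
    have hat : Fin.tail (consPoint a w : Fin (k + 1) → ℂ) = w := by simp [consPoint]
    refine ⟨consPoint a w, ⟨⟨?_, ?_⟩, haG, fun i hi => ?_⟩, hat⟩
    · rw [mem_closedBall_zero_iff, pi_norm_le_iff_of_nonneg hρ.le]
      refine Fin.cases (by simpa [consPoint] using (hb.1.2 a ha).le) fun i => ?_
      simpa [consPoint] using (norm_le_pi_norm w i).trans (mem_closedBall_zero_iff.1 hb.2.2)
    · rw [Set.mem_preimage, hat]
      exact Metric.ball_subset_closedBall hw
    · obtain rfl : i = 0 := by omega
      simp only [hD, evalFamily, hat, Function.iterate_zero, id]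
      simpa [consPoint] using ha.eq_zero
  classical
  -- The largest multiplicity whose locus still projects onto a set with interior. The locus of
  -- multiplicity `j + 1` then has thin closed projection and can be avoided over a smaller ball.
  set j := Nat.findGreatest p (N + 1) with hj
  have hpj : p j := Nat.findGreatest_spec (P := p) (Nat.le_add_left 1 N) hp1
  have hjN : j < N + 1 := by
    refine lt_of_le_of_ne (Nat.findGreatest_le _) fun he => ?_
    have h1 := hpj.2
    rw [he, hEN] at h1
    simp at h1
  have hj1 : interior (Fin.tail '' E (j + 1)) = ∅ := by
    by_contra hne
    exact Nat.findGreatest_is_greatest (P := p) (Nat.lt_succ_self j) hjN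
      ⟨Nat.le_add_left 1 j, Set.nonempty_iff_ne_empty.2 hne⟩
  obtain ⟨w₁, hw₁, hw₁'⟩ : ∃ w ∈ interior (Fin.tail '' E j), w ∉ Fin.tail '' E (j + 1) := by
    by_contra! hsub
    have h1 : interior (Fin.tail '' E j) ⊆ interior (Fin.tail '' E (j + 1)) :=
      interior_maximal hsub isOpen_interior
    rw [hj1, Set.subset_empty_iff] at h1
    exact hpj.2.ne_empty h1
  obtain ⟨r, hr, hrb⟩ := Metric.nhds_basis_closedBall.mem_iff.1
    ((isOpen_interior.sdiff ((hEc (j + 1)).image htc).isClosed).mem_nhds ⟨hw₁, hw₁'⟩)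
  have himg : Metric.closedBall w₁ r ⊆
      Fin.tail '' (E j ∩ Fin.tail ⁻¹' Metric.closedBall w₁ r) := fun w hw => by
    obtain ⟨z, hz, rfl⟩ := interior_subset (hrb hw).1
    exact ⟨z, ⟨hz, hw⟩, rfl⟩
  obtain ⟨z₀, hz₀, hz₀V⟩ := exists_forall_nhds_interior_image_nonempty
    ((hEc j).inter_right (Metric.isClosed_closedBall.preimage htc)) htc
    ⟨w₁, mem_interior.2 ⟨Metric.ball w₁ r, Metric.ball_subset_closedBall.trans himg,
      Metric.isOpen_ball, Metric.mem_ball_self hr⟩⟩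
  -- Write `j = i + 1`. On `E j` the derivative of order `i` vanishes, while its own
  -- `z₁`-derivative, of order `j`, does not vanish at `z₀`. So `E j` lies locally on a graph over
  -- the parameters.
  obtain ⟨i, hi⟩ := Nat.exists_eq_add_of_le' hpj.1
  have hz₀D : D j z₀ ≠ 0 := fun h0 => (hrb hz₀.2).2 ⟨z₀, ⟨hz₀.1.1, hz₀.1.2.1, fun l hl => by
    rcases Nat.lt_succ_iff_lt_or_eq.1 hl with hl | rfl
    · exact hz₀.1.2.2 l hl
    · exact h0⟩, rfl⟩
  have hfi := (hfam _ hz₀.1.1.2).iterate_derivative i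
  have hder : fderiv ℂ (D i) z₀ (Pi.single 0 1) ≠ 0 := by
    have h1 := hfi.fderiv_single
    simp only [← Function.iterate_succ_apply' (f := (derivative : ℂ[X] → ℂ[X]))] at h1
    rw [hi] at hz₀D
    rw [hD]
    beta_reduce
    rw [h1]
    exact hz₀D
  obtain ⟨V, ψ, hV, hψ⟩ := exists_parametrization hfi.analyticAt hder
  have hmain : ∀ w ∈ interior (Fin.tail '' (E j ∩ Fin.tail ⁻¹' Metric.closedBall w₁ r ∩ V)),
      ψ w ∈ E j ∧ Fin.tail (ψ w) = w ∧ DifferentiableAt ℂ ψ w := fun w hw => by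
    obtain ⟨z, ⟨⟨hz, -⟩, hzV⟩, rfl⟩ := interior_subset hw
    obtain ⟨h1, h2⟩ := hψ z hzV (hz.2.2 i (by omega))
    rw [h1]
    exact ⟨hz, rfl, h2⟩
  refine ⟨_, ψ, isOpen_interior, hz₀V V hV, fun w hw => (hmain w hw).2.2.differentiableWithinAt,
    fun w hw => injective_fderiv_of_tail isOpen_interior (fun y hy => (hmain y hy).2.1) hw
      (hmain w hw).2.2, fun w hw => ?_⟩
  have hw' := (hmain w hw).1
  exact ⟨⟨hw'.2.2 0 (by omega), hw'.2.1⟩, (hball hw'.1.1).2⟩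

end

section

open MeasureTheory Polynomial

/-! ### Existence of adapted coordinates -/

/-- Some neighbourhood of `0` contains no immersed `(m + 1)`-dimensional manifold on which both
functions vanish. -/
def HasSmallZeroSet {m : ℕ} (f₁ f₂ : (Fin (m + 2) → ℂ) → ℂ) : Prop :=
  ∃ U ∈ 𝓝 (0 : Fin (m + 2) → ℂ), ∀ (W : Set (Fin (m + 1) → ℂ))
    (ψ : (Fin (m + 1) → ℂ) → (Fin (m + 2) → ℂ)), IsOpen W → W.Nonempty →
    DifferentiableOn ℂ ψ W → (∀ w ∈ W, Function.Injective (fderiv ℂ ψ w)) →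
    ¬ Set.MapsTo ψ W ({z | f₁ z = 0 ∧ f₂ z = 0} ∩ U)

namespace HasSmallZeroSet

variable {m : ℕ} {f₁ f₂ : (Fin (m + 2) → ℂ) → ℂ}

/-- Maximality of the dimension `m` excludes `m + 1`. -/
theorem of_isCompleteIntersection (hf : IsCompleteIntersection f₁ f₂) : HasSmallZeroSet f₁ f₂ := by
  have h : ¬ ∀ U ∈ 𝓝 (0 : Fin (m + 2) → ℂ), ∃ (W : Set (Fin (m + 1) → ℂ))
      (ψ : (Fin (m + 1) → ℂ) → (Fin (m + 2) → ℂ)), IsOpen W ∧ W.Nonempty ∧ DifferentiableOn ℂ ψ W ∧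
      (∀ w ∈ W, Function.Injective (fderiv ℂ ψ w)) ∧
      Set.MapsTo ψ W ({z | f₁ z = 0 ∧ f₂ z = 0} ∩ U) := fun h =>
    absurd (hf.dim.2 h) (by simp)
  push Not at h
  exact h

theorem symm (h : HasSmallZeroSet f₁ f₂) : HasSmallZeroSet f₂ f₁ := by
  obtain ⟨U, hU, h⟩ := h
  exact ⟨U, hU, fun W ψ h1 h2 h3 h4 h5 => h W ψ h1 h2 h3 h4 fun w hw =>
    ⟨(h5 hw).1.symm, (h5 hw).2⟩⟩

theorem comp (h : HasSmallZeroSet f₁ f₂) (L : (Fin (m + 2) → ℂ) ≃L[ℂ] (Fin (m + 2) → ℂ)) :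
    HasSmallZeroSet (f₁ ∘ L) (f₂ ∘ L) := by
  obtain ⟨U, hU, h⟩ := h
  refine ⟨L ⁻¹' U, L.continuous.continuousAt.preimage_mem_nhds (by rwa [map_zero]),
    fun W ψ h1 h2 h3 h4 h5 => h W (L ∘ ψ) h1 h2
      (L.differentiable.comp_differentiableOn h3) (fun w hw => ?_) fun w hw => h5 hw⟩
  rw [L.comp_fderiv]
  exact L.injective.comp (h4 w hw)

/-- A Weierstrass polynomial of the first function and the second one have no common zero over
some parameters near `0`. -/
theorem not_eventually_common_root (h : HasSmallZeroSet f₁ f₂) {P : (Fin (m + 1) → ℂ) → ℂ[X]}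
    {N : ℕ} (hP : IsWeierstrassPoly P N) (h₁ : ∀ᶠ z in 𝓝 0, evalFamily P z = 0 → f₁ z = 0)
    {G : (Fin (m + 2) → ℂ) → ℂ} (hG : AnalyticAt ℂ G 0) (h₂ : ∀ᶠ z in 𝓝 0, G z = 0 → f₂ z = 0) :
    ¬ ∀ᶠ w in 𝓝 0, ∃ a, (P w).IsRoot a ∧ G (consPoint a w) = 0 := fun hw => by
  obtain ⟨U, hU, h⟩ := h
  obtain ⟨W, ψ, hW, hne, hd, hi, hm⟩ :=
    hP.exists_immersion hG hw (Filter.inter_mem hU (h₁.and h₂))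
  exact h W ψ hW hne hd hi fun w hw => ⟨⟨(hm hw).2.2.1 (hm hw).1.1, (hm hw).2.2.2 (hm hw).1.2⟩,
    (hm hw).2.1⟩

end HasSmallZeroSet

/-- An analytic function that vanishes near `0` on every line vanishes near `0`. -/
theorem exists_line_of_not_eventually_zero {n : ℕ} {f : (Fin n → ℂ) → ℂ} (hf : AnalyticAt ℂ f 0)
    (h : ¬ ∀ᶠ z in 𝓝 0, f z = 0) : ∃ v, ¬ ∀ᶠ t : ℂ in 𝓝 0, f (t • v) = 0 := by
  by_contra! hv
  obtain ⟨ε, hε, hball⟩ := Metric.nhds_basis_ball.eventually_iff.1 hf.eventually_analyticAt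
  refine h (Metric.nhds_basis_ball.eventually_iff.2 ⟨ε, hε, fun z hz => ?_⟩)
  -- The part of the complex line through `z` inside the ball is convex, so the identity theorem
  -- carries vanishing from near the parameter `0` to the parameter `1`.
  set T : ℂ →L[ℂ] (Fin n → ℂ) := ContinuousLinearMap.toSpanSingleton ℂ z with hT
  have hS : IsPreconnected (T ⁻¹' Metric.ball 0 ε) :=
    ((convex_ball (0 : Fin n → ℂ) ε).is_linear_preimage
      (T.restrictScalars ℝ).isBoundedLinearMap.toIsLinearMap).isPreconnected
  have h1 : AnalyticOnNhd ℂ (fun t => f (T t)) (T ⁻¹' Metric.ball 0 ε) := fun t ht =>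
    AnalyticAt.comp (hball ht) (T.analyticAt t)
  have h2 := h1.eqOn_zero_of_preconnected_of_eventuallyEq_zero hS (z₀ := 0)
    (by rw [Set.mem_preimage, map_zero]; exact Metric.mem_ball_self hε) (hv z)
  have h3 := h2 (x := 1) (by rw [Set.mem_preimage, hT]; simpa using hz)
  simpa [hT] using h3

/-- Germs of analytic functions form an integral domain: near a point where `g` is nonzero `f`
vanishes, and the identity theorem on a ball does the rest. -/
theorem eventually_zero_or_of_mul {n : ℕ} {f g : (Fin n → ℂ) → ℂ} (hf : AnalyticAt ℂ f 0)
    (hg : AnalyticAt ℂ g 0) (h : ∀ᶠ z in 𝓝 0, f z * g z = 0) :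
    (∀ᶠ z in 𝓝 0, f z = 0) ∨ ∀ᶠ z in 𝓝 0, g z = 0 := by
  obtain ⟨ε, hε, hball⟩ := Metric.nhds_basis_ball.eventually_iff.1
    ((hf.eventually_analyticAt.and hg.eventually_analyticAt).and h)
  by_cases hz : ∃ z ∈ Metric.ball (0 : Fin n → ℂ) ε, g z ≠ 0
  · obtain ⟨z, hz, hgz⟩ := hz
    have h1 : f =ᶠ[𝓝 z] 0 := by
      filter_upwards [(hball hz).1.2.continuousAt.eventually_ne hgz,
        Metric.isOpen_ball.mem_nhds hz] with y hy hyb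
      exact (mul_eq_zero.1 (hball hyb).2).resolve_right hy
    exact Or.inl (Metric.nhds_basis_ball.eventually_iff.2 ⟨ε, hε, fun y hy =>
      (show AnalyticOnNhd ℂ f (Metric.ball 0 ε) from
        fun y hy => (hball hy).1.1).eqOn_zero_of_preconnected_of_eventuallyEq_zero
        (convex_ball _ _).isPreconnected hz h1 hy⟩)
  · push Not at hz
    exact Or.inr (Metric.nhds_basis_ball.eventually_iff.2 ⟨ε, hε, fun y hy => hz y hy⟩)

/-- After a linear change of coordinates, an analytic function that vanishes at `0` but not
identically near `0` does not vanish identically on the first axis. -/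
theorem exists_equiv_not_eventually_zero {n : ℕ} {f : (Fin (n + 1) → ℂ) → ℂ}
    (hf : AnalyticAt ℂ f 0) (h0 : f 0 = 0) (h : ¬ ∀ᶠ z in 𝓝 0, f z = 0) :
    ∃ L : (Fin (n + 1) → ℂ) ≃L[ℂ] (Fin (n + 1) → ℂ),
      ¬ ∀ᶠ t in 𝓝 (0 : ℂ), f (L (consPoint t 0)) = 0 := by
  obtain ⟨v, hv⟩ := exists_line_of_not_eventually_zero hf h
  have hv0 : v ≠ 0 := by
    rintro rfl
    exact hv (Filter.Eventually.of_forall fun t => by rw [smul_zero, h0])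
  obtain ⟨L, hL⟩ := SeparatingDual.exists_continuousLinearEquiv_apply_eq (R := ℂ)
    (x := (Pi.single 0 1 : Fin (n + 1) → ℂ)) (y := v) (by simp) hv0
  refine ⟨L, fun hc => hv ?_⟩
  filter_upwards [hc] with t ht
  have e : (consPoint t 0 : Fin (n + 1) → ℂ) = t • Pi.single 0 1 := by
    funext i
    refine Fin.cases (by simp [consPoint]) (fun i => ?_) i
    simp [consPoint]
  rwa [e, map_smul, hL] at ht

theorem analyticAt_comp_equiv {n : ℕ} {f : (Fin n → ℂ) → ℂ} (hf : AnalyticAt ℂ f 0)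
    (L : (Fin n → ℂ) ≃L[ℂ] (Fin n → ℂ)) : AnalyticAt ℂ (f ∘ L) 0 := by
  refine AnalyticAt.comp ?_ (L.analyticAt 0)
  rwa [map_zero]

theorem IsWeierstrassPolyOf.eventually_eq_zero {k N : ℕ} {f : (Fin (k + 1) → ℂ) → ℂ}
    {P : (Fin k → ℂ) → ℂ[X]} (h : IsWeierstrassPolyOf f P N) :
    ∀ᶠ z in 𝓝 0, evalFamily P z = 0 → f z = 0 := by
  obtain ⟨-, u, -, -, he⟩ := h
  filter_upwards [he] with z hz h0
  rw [hz, h0, mul_zero]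

theorem IsWeierstrassPoly.exists_root {k N : ℕ} {P : (Fin k → ℂ) → ℂ[X]}
    (hP : IsWeierstrassPoly P N) (hN : 0 < N) (w : Fin k → ℂ) : ∃ a, (P w).IsRoot a := by
  refine Complex.exists_root (natDegree_pos_iff_degree_pos.1 ?_)
  rwa [hP.natDegree]

/-- If `f₁` vanished identically, the common zero set would be that of `f₂` alone, which contains a
hypersurface because `f₂ 0 = 0`. -/
theorem HasSmallZeroSet.not_eventually_zero {m : ℕ} {f₁ f₂ : (Fin (m + 2) → ℂ) → ℂ}
    (h : HasSmallZeroSet f₁ f₂) (h₂ : AnalyticAt ℂ f₂ 0) (h0 : f₂ 0 = 0) :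
    ¬ ∀ᶠ z in 𝓝 0, f₁ z = 0 := fun hz => by
  by_cases hz₂ : ∀ᶠ z in 𝓝 0, f₂ z = 0
  -- When both functions vanish identically any hypersurface will do; the polynomial `X` gives `z₁ =
  -- 0`.
  · have hX : IsWeierstrassPoly (fun _ : Fin (m + 1) → ℂ => (X : ℂ[X])) 1 :=
      ⟨fun _ => monic_X, fun _ => natDegree_X, fun i => analyticAt_const, (pow_one X).symm⟩
    refine h.not_eventually_common_root hX (hz.mono fun z hz _ => hz) (G := fun _ => 0)
      analyticAt_const (hz₂.mono fun z hz _ => hz) (Filter.Eventually.of_forall fun w => ?_)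
    exact ⟨0, by simp [IsRoot], rfl⟩
  · obtain ⟨L, hL⟩ := exists_equiv_not_eventually_zero h₂ h0 hz₂
    obtain ⟨P, N, hP⟩ := weierstrass_preparation (analyticAt_comp_equiv h₂ L) hL
    have hN := hP.degree_pos (by simpa using h0)
    have hz' : ∀ᶠ z in 𝓝 0, (f₁ ∘ L) z = 0 :=
      L.continuous.continuousAt.eventually (p := fun z => f₁ z = 0) (by rwa [map_zero])
    refine (h.comp L).symm.not_eventually_common_root hP.1 hP.eventually_eq_zero (G := fun _ => 0)
      analyticAt_const (hz'.mono fun z hz _ => hz) (Filter.Eventually.of_forall fun w => ?_)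
    obtain ⟨a, ha⟩ := hP.1.exists_root hN w
    exact ⟨a, ha, rfl⟩

/-- The linear change of coordinates that extends one of the last variables. -/
def consEquiv {k : ℕ} (L : (Fin k → ℂ) ≃L[ℂ] (Fin k → ℂ)) :
    (Fin (k + 1) → ℂ) ≃L[ℂ] (Fin (k + 1) → ℂ) :=
  (((Fin.consLinearEquiv ℂ fun _ : Fin (k + 1) => ℂ).symm.trans
    ((LinearEquiv.refl ℂ ℂ).prodCongr L.toLinearEquiv)).trans
    (Fin.consLinearEquiv ℂ fun _ : Fin (k + 1) => ℂ)).toContinuousLinearEquiv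

theorem consEquiv_apply {k : ℕ} (L : (Fin k → ℂ) ≃L[ℂ] (Fin k → ℂ)) (z : Fin (k + 1) → ℂ) :
    consEquiv L z = consPoint (z 0) (L (Fin.tail z)) := rfl

/-- A linear change of the remaining variables preserves Weierstrass form in `z₁`, so the resultant
can be normalized afterwards without undoing the first normalization. -/
theorem IsWeierstrassPolyOf.comp_consEquiv {k N : ℕ} {f : (Fin (k + 1) → ℂ) → ℂ}
    {P : (Fin k → ℂ) → ℂ[X]} (h : IsWeierstrassPolyOf f P N)
    (L : (Fin k → ℂ) ≃L[ℂ] (Fin k → ℂ)) : IsWeierstrassPolyOf (f ∘ consEquiv L) (P ∘ L) N := by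
  obtain ⟨hP, u, hu, hu0, he⟩ := h
  refine ⟨⟨fun w => hP.monic _, fun w => hP.natDegree _, fun i =>
    analyticAt_comp_equiv (hP.analytic i) L, ?_⟩, u ∘ consEquiv L,
    analyticAt_comp_equiv hu _, by simpa using hu0, ?_⟩
  · rw [Function.comp_apply, map_zero, hP.at_zero]
  · have h1 : Filter.Tendsto (consEquiv L) (𝓝 0) (𝓝 0) := by
      have := (consEquiv L).continuous.tendsto 0
      rwa [map_zero] at this
    filter_upwards [h1.eventually he] with z hz
    rw [Function.comp_apply, Function.comp_apply, hz]
    simp [evalFamily, consEquiv_apply, consPoint]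

theorem exists_common_root_of_not_isCoprime {p q : ℂ[X]} (hp : p ≠ 0) (h : ¬ IsCoprime p q) :
    ∃ a, p.IsRoot a ∧ q.IsRoot a := by
  by_contra! hc
  refine h (isCoprime_of_dvd p q (fun h0 => hp h0.1) fun r hr hr0 hrp hrq => ?_)
  obtain ⟨a, ha⟩ := Complex.exists_root (degree_pos_of_ne_zero_of_nonunit hr0 hr)
  exact hc a (ha.dvd hrp) (ha.dvd hrq)

/-- Adapted coordinates exist. -/
theorem exists_isAdapted {m : ℕ} {f₁ f₂ : (Fin (m + 2) → ℂ) → ℂ}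
    (hf : IsCompleteIntersection f₁ f₂) :
    ∃ (L : (Fin (m + 2) → ℂ) ≃ₗ[ℂ] (Fin (m + 2) → ℂ))
      (P₁ P₂ : (Fin (m + 1) → ℂ) → ℂ[X]) (Q : (Fin m → ℂ) → ℂ[X])
      (N₁ M N₂ : ℕ), IsAdapted (f₁ ∘ L) (f₂ ∘ L) P₁ P₂ Q N₁ M N₂ := by
  have hsmall := HasSmallZeroSet.of_isCompleteIntersection hf
  -- Working with the product yields one direction in which both functions are regular.
  have hprod : ¬ ∀ᶠ z in 𝓝 0, f₁ z * f₂ z = 0 := fun hz => by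
    rcases eventually_zero_or_of_mul hf.analytic₁ hf.analytic₂ hz with h | h
    · exact hsmall.not_eventually_zero hf.analytic₂ hf.zero₂ h
    · exact hsmall.symm.not_eventually_zero hf.analytic₁ hf.zero₁ h
  obtain ⟨L, hL⟩ := exists_equiv_not_eventually_zero (hf.analytic₁.fun_mul hf.analytic₂)
    (by rw [hf.zero₁, zero_mul]) hprod
  obtain ⟨P₁, N₁, hP₁⟩ := weierstrass_preparation (analyticAt_comp_equiv hf.analytic₁ L)
    fun hz => hL (hz.mono fun t ht => mul_eq_zero_of_left ht _)
  obtain ⟨P₂, M, hP₂⟩ := weierstrass_preparation (analyticAt_comp_equiv hf.analytic₂ L)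
    fun hz => hL (hz.mono fun t ht => mul_eq_zero_of_right _ ht)
  have hN₁ := hP₁.degree_pos (by simpa using hf.zero₁)
  have hM := hP₂.degree_pos (by simpa using hf.zero₂)
  -- A vanishing resultant means a common root over every nearby parameter, hence an immersed
  -- hypersurface in the common zero set.
  have hR : ¬ ∀ᶠ w in 𝓝 0, res P₁ P₂ w = 0 := fun hz => by
    refine (hsmall.comp L).not_eventually_common_root hP₁.1 hP₁.eventually_eq_zero
      hP₂.1.analyticAt_evalFamily hP₂.eventually_eq_zero (hz.mono fun w hw => ?_)
    rw [res, resultant_eq_zero_iff] at hw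
    obtain ⟨a, ha₁, ha₂⟩ := exists_common_root_of_not_isCoprime (hP₁.1.monic w).ne_zero hw.2
    exact ⟨a, ha₁, by simpa [evalFamily, consPoint] using ha₂⟩
  have hR0 : res P₁ P₂ 0 = 0 := by
    rw [res, hP₁.1.at_zero, hP₂.1.at_zero, resultant_eq_zero_iff]
    refine ⟨Or.inl (pow_ne_zero _ X_ne_zero), fun hc => ?_⟩
    rw [IsCoprime.pow_iff hN₁ hM, isCoprime_self] at hc
    exact not_isUnit_X hc
  -- The second change of variables acts on `z'` only. Resultants are taken pointwise, so composing
  -- the families with `L'` composes their resultant with `L'`.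
  obtain ⟨L', hL'⟩ := exists_equiv_not_eventually_zero (analyticAt_res hP₁.1 hP₂.1) hR0 hR
  obtain ⟨Q, N₂, hQ⟩ := weierstrass_preparation (analyticAt_comp_equiv
    (analyticAt_res hP₁.1 hP₂.1) L') hL'
  exact ⟨((consEquiv L').trans L).toLinearEquiv, P₁ ∘ L', P₂ ∘ L', Q, N₁, M, N₂,
    hP₁.comp_consEquiv L', hP₂.comp_consEquiv L', hQ⟩

end

end ResidueCurrents

end

/-! ### The main theorem -/

open ResidueCurrents in
theorem mainTheorem1 {m : ℕ} (f₁ f₂ : (Fin (m + 2) → ℂ) → ℂ)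
    (hf : IsCompleteIntersection f₁ f₂) :
    -- after a linear change of coordinates, the coordinates are adapted
    (∃ (L : (Fin (m + 2) → ℂ) ≃ₗ[ℂ] (Fin (m + 2) → ℂ))
      (P₁ P₂ : (Fin (m + 1) → ℂ) → Polynomial ℂ) (Q : (Fin m → ℂ) → Polynomial ℂ)
      (N₁ M N₂ : ℕ), IsAdapted (f₁ ∘ L) (f₂ ∘ L) P₁ P₂ Q N₁ M N₂) ∧
    -- in adapted coordinates
    (∀ (P₁ P₂ : (Fin (m + 1) → ℂ) → Polynomial ℂ) (Q : (Fin m → ℂ) → Polynomial ℂ)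
      (N₁ M N₂ : ℕ), IsAdapted f₁ f₂ P₁ P₂ Q N₁ M N₂ →
      -- a transition matrix with first row `(1, 0)` exists
      (∃ A, IsTransitionMatrix f₁ f₂ (resLift P₁ P₂) A ∧ ∀ z, A z 0 = ![1, 0]) ∧
      ∃ U : Set (Fin (m + 2) → ℂ), IsOpen U ∧ 0 ∈ U ∧
        -- the current `X₁`
        (∀ Γ : ℕ, 1 ≤ Γ →
          (∀ φ, IsTestForm U (m + 2) φ →
            MeasureTheory.Integrable (integrand₁ f₁ P₁ N₁ Γ φ Finset.univ)) ∧
          IsCurrent U (m + 2) (X₁ f₁ P₁ N₁ Γ) ∧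
          CurrentEq U (m + 2) (mulCurrent f₁ (X₁ f₁ P₁ N₁ Γ))
            (fun φ => (-1) ^ (Γ * N₁) * (Nat.factorial (Γ * N₁) : ℂ) * formIntegral φ)) ∧
        -- the current `X₂` and the description of the local ideal
        (∀ Γ : ℕ, N₂ + 1 ≤ Γ →
          (∀ φ, IsTestForm U (m + 1) φ →
            MeasureTheory.Integrable
              (integrand₂ f₁ P₁ (res P₁ P₂) Q N₁ N₂ Γ φ Finset.univ)) ∧
          IsCurrent U (m + 1) (X₂ f₁ P₁ (res P₁ P₂) Q N₁ N₂ Γ) ∧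
          CurrentEq U (m + 1) (mulCurrent (resLift P₁ P₂) (X₂ f₁ P₁ (res P₁ P₂) Q N₁ N₂ Γ))
            (fun φ => (-1) ^ N₂ * (Nat.factorial N₂ : ℂ) *
              dbarCurrent 0 (X₁ f₁ P₁ N₁ Γ) φ) ∧
          CurrentEq U (m + 1) (mulCurrent f₁ (X₂ f₁ P₁ (res P₁ P₂) Q N₁ N₂ Γ)) (fun _ => 0) ∧
          ∀ A, IsTransitionMatrix f₁ f₂ (resLift P₁ P₂) A → ∀ g : (Fin (m + 2) → ℂ) → ℂ, AnalyticAt ℂ g 0 →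
            (MemLocalIdeal f₁ f₂ g ↔
              ∃ V : Set (Fin (m + 2) → ℂ), IsOpen V ∧ 0 ∈ V ∧ V ⊆ U ∧
                CurrentEq V m
                  (mulCurrent (fun z => g z * (A z).det)
                    (dbarCurrent 1 (X₂ f₁ P₁ (res P₁ P₂) Q N₁ N₂ Γ)))
                  (fun _ => 0)))) := by
  refine ⟨exists_isAdapted hf, fun P₁ P₂ Q N₁ M N₂ h => ⟨h.exists_transitionMatrix hf.zero₁, ?_⟩⟩
  obtain ⟨U, u, v, h0, hU⟩ := h.exists_chart
  -- The lemmas on `X₂` are stated for `N₂ = k + 1`, which is legitimate because the resultant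
  -- vanishes at `0`.
  obtain ⟨k, rfl⟩ := Nat.exists_eq_succ_of_ne_zero (h.degree_pos hf.zero₁ hf.zero₂).ne'
  refine ⟨U, hU.isOpen, h0, fun Γ hΓ => ?_, fun Γ hΓ => ?_⟩
  · obtain ⟨g, rfl⟩ := Nat.exists_eq_add_of_le' hΓ
    exact ⟨fun φ hφ => hU.integrable_integrand₁ hφ g, hU.isCurrent_X₁ _ g, hU.mulCurrent_X₁ _ g⟩
  · obtain ⟨j, rfl⟩ := Nat.exists_eq_add_of_le' hΓ
    rw [show j + (k.succ + 1) = j + 1 + k + 1 by omega]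
    refine ⟨fun φ hφ => hU.integrable_integrand₂ hφ j, hU.isCurrent_X₂ _ j, hU.mulCurrent_R_X₂ _ j,
      hU.mulCurrent_f_X₂ _ j, fun A hA g hg => ?_⟩
    rw [← hU.memLocalIdeal_iff h0 h.first.1 h.resultant.1 j (hg.fun_mul hA.analyticAt_det)]
    exact ⟨MemLocalIdeal.mul_det hA, memLocalIdeal_of_mul_det h.first h.resultant hf.analytic₂ hg hA⟩
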